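/- Let $0<\beta<1$, let $\Omega\subset\mathbb C$ be a bounded simply connected domain of class $C^{1,\beta}$, let $\mathbb D$ be the unit disc, and let $f:\mathbb D\to\Omega$ be a conformal representation (a biholomorphic map of $\mathbb D$ onto $\Omega$), extended by continuity to $\overline{\mathbb D}$. Let $d_1,\dots,d_k\in\mathbb Z$ and $d=\sum_j d_j$. For a domain $G\in\{\Omega,\mathbb D\}$, pairwise distinct points $a=(a_1,\dots,a_k)$ of $G$, and $g\in H^{1/2}(\partial G;\mathbb S^1)$ of degree $\frac1{2\pi}\int_{\partial G}g\wedge\frac{\partial g}{\partial\tau}=d$, let $\Phi^G_{a,g}$ be the solution of $$\Delta\Phi=2\pi\sum_j d_j\delta_{a_j}\ \text{in }G,\qquad \frac{\partial\Phi}{\partial\nu}=g\wedge\frac{\partial g}{\partial\tau}\ \text{on }\partial G,\qquad \int_{\partial G}\Phi=0,$$ let $\widehat\Phi^G_a$ be the solution of $$\Delta\Phi=2\pi\sum_j d_j\delta_{a_j}\ \text{in }G,\qquad \Phi=0\ \text{on }\partial G,$$ let $R^G_{a,g}=\Phi^G_{a,g}-\sum_j d_j\log|\cdot-a_j|$ and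 $\widehat R^G_a=\widehat\Phi^G_a-\sum_j d_j\log|\cdot-a_j|$ be their regular parts (smooth in $G$), and let $$W^G(a,g)=-\pi\sum_{j\ne l}d_jd_l\log|a_j-a_l|+\frac12\int_{\partial G}\Phi^G_{a,g}\Big(g\wedge\frac{\partial g}{\partial\tau}\Big)-\pi\sum_j d_jR^G_{a,g}(a_j),$$ $$\widehat W^G(a)=-\pi\sum_{j\ne l}d_jd_l\log|a_j-a_l|-\pi\sum_j d_j\widehat R^G_a(a_j).$$ Here $\nu$ and $\tau$ are the outward unit normal and the direct unit tangent, $u\wedge v=u_1v_2-u_2v_1$, sums over $j\neq l$ run over ordered pairs, $g\wedge\partial g/\partial\tau$ is taken as a distribution in $H^{-1/2}(\partial G)$, and boundary integrals of it are duality brackets. Let $\alpha_1,\dots,\alpha_k\in\mathbb D$ be pairwise distinct and put $a=f(\alpha)=(f(\alpha_1),\dots,f(\alpha_k))$. Then, for every $g\in H^{1/2}(\partial\Omega;\mathbb S^1)$ of degree $d$, the numbers $W^\Omega(a,g)$ and $W^{\mathbb D}(\alpha,g\circ f)$ are well defined and $$W^\Omega(a,g)=W^{\mathbb D}(\alpha,g\circ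 f)+\pi\sum_{j=1}^k d_j^2\log|f'(\alpha_j)|.$$ Likewise $\widehat W^\Omega(a)$ and $\widehat W^{\mathbb D}(\alpha)$ are well defined and $$\widehat W^\Omega(a)=\widehat W^{\mathbb D}(\alpha)+\pi\sum_{j=1}^k d_j^2\log|f'(\alpha_j)|.$$ -/

import Mathlib

open MeasureTheory Set Filter Topology
open scoped ContDiff

/-! ### The domains -/

/-- The local boundary condition at `p`: in the orthonormal frame `(c, i c)` centred at `p`, the set
`Ω` is, near `p`, the strict epigraph of a `C^1` function whose derivative is `β`-Hölder. -/
def IsLocalHolderEpigraph (β : ℝ) (Ω : Set ℂ) (p : ℂ) : Prop :=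
  ∃ (c : ℂ) (r C : ℝ) (h : ℝ → ℝ), ‖c‖ = 1 ∧ 0 < r ∧ ContDiff ℝ 1 h ∧
    (∀ s t : ℝ, |deriv h s - deriv h t| ≤ C * |s - t| ^ β) ∧
    ∀ s t : ℝ, |s| < r → |t| < r →
      (p + c * ((s : ℂ) + (t : ℂ) * Complex.I) ∈ Ω ↔ h s < t)

/-- Bounded open sets of class `C^{1,β}`. -/
structure IsHolderDomain (β : ℝ) (Ω : Set ℂ) : Prop where
  isOpen : IsOpen Ω
  isBounded : Bornology.IsBounded Ω
  boundary : ∀ p ∈ frontier Ω, IsLocalHolderEpigraph β Ω p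

/-- `f` is a conformal representation of `Ω`: a biholomorphic map from the unit disc onto `Ω`. -/
structure IsConformalRep (f : ℂ → ℂ) (Ω : Set ℂ) : Prop where
  holomorphic : DifferentiableOn ℂ f (Metric.ball 0 1)
  injective : InjOn f (Metric.ball 0 1)
  image_eq : f '' Metric.ball 0 1 = Ω

/-- The extension by continuity, to the closed disc, of a map defined on the open unit disc. -/
noncomputable def discExtension (f : ℂ → ℂ) : ℂ → ℂ := extendFrom (Metric.ball 0 1) f

/-! ### Calculus in the plane -/

/-- Partial derivative in the direction of the first coordinate. -/
noncomputable def partialX {E : Type*} [NormedAddCommGroup E] [NormedSpace ℝ E]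
    (u : ℂ → E) (z : ℂ) : E := fderiv ℝ u z 1

/-- Partial derivative in the direction of the second coordinate. -/
noncomputable def partialY {E : Type*} [NormedAddCommGroup E] [NormedSpace ℝ E]
    (u : ℂ → E) (z : ℂ) : E := fderiv ℝ u z Complex.I

/-- The vector product of two complex numbers. -/
def wedge (u v : ℂ) : ℝ := u.re * v.im - u.im * v.re

/-- The Dirichlet integrand `∇u · ∇v`. -/
noncomputable def gradDot (u v : ℂ → ℝ) (z : ℂ) : ℝ :=
  partialX u z * partialX v z + partialY u z * partialY v z

/-- `u` is smooth on the open set `U` and its gradient is square integrable on `U`. When `U` is a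
bounded set of class `C^{1,β}`, these functions are exactly the smooth elements of the Sobolev space
`H^1(U)`, and they are dense in it. -/
structure IsSmoothFiniteEnergy {E : Type*} [NormedAddCommGroup E] [NormedSpace ℝ E]
    (U : Set ℂ) (u : ℂ → E) : Prop where
  smooth : ContDiffOn ℝ ∞ u U
  finite_energy : MemLp (fderiv ℝ u) 2 (volume.restrict U)

/-! ### Boundary values -/

/-- Arclength on the boundary of `Ω`. -/
noncomputable def boundaryMeasure (Ω : Set ℂ) : Measure ℂ :=
  (μH[1] : Measure ℂ).restrict (frontier Ω)

/-- `t` is the trace of `u` on the boundary of `Ω`: at almost every boundary point `x`, the mean of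
`‖u - t x‖` over `B(x, r) ∩ Ω` tends to `0` with `r`. Only the values of `u` in `Ω` near the boundary
and the values of `t` almost everywhere on the boundary matter. -/
def HasTrace {E : Type*} [NormedAddCommGroup E] (Ω : Set ℂ) (u t : ℂ → E) : Prop :=
  ∀ᵐ x ∂(boundaryMeasure Ω),
    Tendsto (fun r : ℝ => ⨍⁻ y in Metric.ball x r ∩ Ω, ‖u y - t x‖ₑ ∂volume)
      (𝓝[>] 0) (𝓝 0)

/-- `g ∈ H^{1/2}(∂Ω; 𝕊¹)`: `g` is measurable, circle valued, and its Gagliardo seminorm of order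
`1/2` on the boundary is finite. -/
structure IsHalfSobolevCircle (Ω : Set ℂ) (g : ℂ → ℂ) : Prop where
  measurable : AEStronglyMeasurable g (boundaryMeasure Ω)
  norm_eq_one : ∀ᵐ x ∂(boundaryMeasure Ω), ‖g x‖ = 1
  gagliardo : ∫⁻ x, ∫⁻ y, ‖g x - g y‖ₑ ^ 2 / ‖x - y‖ₑ ^ 2 ∂(boundaryMeasure Ω)
    ∂(boundaryMeasure Ω) < ⊤

/-- `v` is a circle valued finite energy map on `Ω \ K` (with `K` a compact subset of `Ω`) with trace
`g` on the boundary of `Ω`. -/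
structure IsCircleExtension (Ω : Set ℂ) (g : ℂ → ℂ) (K : Set ℂ) (v : ℂ → ℂ) : Prop where
  isCompact : IsCompact K
  subset : K ⊆ Ω
  norm_eq_one : ∀ z ∈ Ω \ K, ‖v z‖ = 1
  energy : IsSmoothFiniteEnergy (Ω \ K) v
  trace : HasTrace Ω v g

/-- `t` is the duality bracket `∫_{∂Ω} φ (g ∧ ∂g/∂τ)`, where `φ` is a function on `Ω` which is smooth
with finite energy near the boundary, `g` is a circle valued boundary datum of class `H^{1/2}`, and
`τ` is the direct unit tangent.

By definition of the distribution `g ∧ ∂g/∂τ` of class `H^{-1/2}`, this bracket is given by Stokes'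
formula: if `v` is a circle valued extension of `g` to a neighbourhood `Ω \ K` of the boundary in `Ω`,
then `v ∧ ∇v` is curl free there, and the bracket is `∫_Ω curl (ψ v ∧ ∇v)`, where `ψ` is any
function equal to `φ` near the boundary and to `0` near `K`. For `g` and `φ` of class `C^1` it is the
usual integral. -/
def IsAngularPairing (Ω : Set ℂ) (g : ℂ → ℂ) (φ : ℂ → ℝ) (t : ℝ) : Prop :=
  ∃ (K L : Set ℂ) (v : ℂ → ℂ) (ψ : ℂ → ℝ),
    IsCircleExtension Ω g K v ∧
    IsCompact L ∧ L ⊆ Ω ∧ EqOn ψ φ (Ω \ L) ∧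
    ContDiffOn ℝ ∞ ψ Ω ∧ Disjoint (tsupport ψ) K ∧
    t = ∫ z in Ω,
      (partialX ψ z * wedge (v z) (partialY v z) - partialY ψ z * wedge (v z) (partialX v z))

/-- The degree of `g` on the boundary of `Ω` is `n`: that is, `∫_{∂Ω} g ∧ ∂g/∂τ = 2 π n`. -/
def HasBoundaryDegree (Ω : Set ℂ) (g : ℂ → ℂ) (n : ℤ) : Prop :=
  IsAngularPairing Ω g (fun _ => 1) (2 * Real.pi * n)

/-! ### The renormalized energies -/

section Energies

variable {k : ℕ}

/-- The singular potential `∑ d_j log |z - a_j|` plus the regular part `R`. -/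
noncomputable def withLogs (d : Fin k → ℤ) (a : Fin k → ℂ) (R : ℂ → ℝ) (z : ℂ) : ℝ :=
  R z + ∑ j, (d j : ℝ) * Real.log ‖z - a j‖

/-- `R` is the regular part of the solution `Φ = R + ∑ d_j log |· - a_j|` of the Neumann problem
`ΔΦ = 2π ∑ d_j δ_{a_j}` in `Ω`, `∂Φ/∂ν = g ∧ ∂g/∂τ` on `∂Ω`, `∫_{∂Ω} Φ = 0`.
The first two equations are taken in the weak sense, against all smooth test functions on `Ω` which
have finite energy (their values on the boundary are not restricted). -/
structure IsNeumannRegularPart (Ω : Set ℂ) (d : Fin k → ℤ) (a : Fin k → ℂ) (g : ℂ → ℂ)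
    (R : ℂ → ℝ) : Prop where
  energy : IsSmoothFiniteEnergy Ω R
  weak_equation : ∀ φ : ℂ → ℝ, IsSmoothFiniteEnergy Ω φ →
    IsAngularPairing Ω g φ
      ((∫ z in Ω, gradDot (withLogs d a R) φ z) + 2 * Real.pi * ∑ j, (d j : ℝ) * φ (a j))
  normalized : ∃ t : ℂ → ℝ, HasTrace Ω (withLogs d a R) t ∧
    Integrable t (boundaryMeasure Ω) ∧ ∫ x, t x ∂(boundaryMeasure Ω) = 0

/-- `R` is the regular part of the solution `Φ = R + ∑ d_j log |· - a_j|` of the Dirichlet problem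
`ΔΦ = 2π ∑ d_j δ_{a_j}` in `Ω` (in the sense of distributions), `Φ = 0` on `∂Ω`. -/
structure IsDirichletRegularPart (Ω : Set ℂ) (d : Fin k → ℤ) (a : Fin k → ℂ)
    (R : ℂ → ℝ) : Prop where
  smooth : ContDiffOn ℝ ∞ R Ω
  distribution_equation : ∀ φ : ℂ → ℝ, ContDiff ℝ ∞ φ → HasCompactSupport φ → tsupport φ ⊆ Ω →
    ∫ z in Ω, gradDot (withLogs d a R) φ z = -(2 * Real.pi * ∑ j, (d j : ℝ) * φ (a j))
  boundary_value : ∀ p ∈ frontier Ω, Tendsto (withLogs d a R) (𝓝[Ω] p) (𝓝 0)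

/-- The interaction sum `∑_{j ≠ l} d_j d_l log |a_j - a_l|` over ordered pairs of distinct indices. -/
noncomputable def interaction (d : Fin k → ℤ) (a : Fin k → ℂ) : ℝ :=
  ∑ j, ∑ l ∈ Finset.univ.erase j, (d j : ℝ) * (d l : ℝ) * Real.log ‖a j - a l‖

/-- `w` is a value of `-π ∑_{j≠l} d_j d_l log |a_j - a_l| + 1/2 ∫_{∂Ω} Φ (g ∧ ∂g/∂τ) - π ∑ d_j R(a_j)`
for a solution `Φ` of the Neumann problem with regular part `R`. -/
def IsRenormalizedEnergy (Ω : Set ℂ) (d : Fin k → ℤ) (a : Fin k → ℂ) (g : ℂ → ℂ) (w : ℝ) : Prop :=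
  ∃ (R : ℂ → ℝ) (t : ℝ), IsNeumannRegularPart Ω d a g R ∧
    IsAngularPairing Ω g (withLogs d a R) t ∧
    w = -Real.pi * interaction d a + 1 / 2 * t - Real.pi * ∑ j, (d j : ℝ) * R (a j)

/-- `w` is a value of `-π ∑_{j≠l} d_j d_l log |a_j - a_l| - π ∑ d_j R(a_j)` for a solution of the
Dirichlet problem with regular part `R`. -/
def IsRenormalizedEnergyHat (Ω : Set ℂ) (d : Fin k → ℤ) (a : Fin k → ℂ) (w : ℝ) : Prop :=
  ∃ R : ℂ → ℝ, IsDirichletRegularPart Ω d a R ∧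
    w = -Real.pi * interaction d a - Real.pi * ∑ j, (d j : ℝ) * R (a j)

/-- The renormalized energy `W^Ω(a, g)` with prescribed Dirichlet datum `g`. -/
noncomputable def renormalizedEnergy (Ω : Set ℂ) (d : Fin k → ℤ) (a : Fin k → ℂ) (g : ℂ → ℂ) : ℝ :=
  Classical.epsilon (IsRenormalizedEnergy Ω d a g)

/-- The renormalized energy `Ŵ^Ω(a)` with prescribed degree. -/
noncomputable def renormalizedEnergyHat (Ω : Set ℂ) (d : Fin k → ℤ) (a : Fin k → ℂ) : ℝ :=
  Classical.epsilon (IsRenormalizedEnergyHat Ω d a)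

end Energies

/-! The identity is conformal invariance plus bookkeeping of logarithms. The differential of `f` is
a rotation times `|f'|`, so the densities `∇u · ∇φ` and `∇^⊥ψ · (v ∧ ∇v)` pull back with the factor
`|f'|²`, which is the Jacobian. Hence, if `Φ` solves the Dirichlet or Neumann problem on `Ω`, then
`Φ ∘ f` solves it on the disc, up to a constant `c` in the Neumann case: arclength is not
conformally invariant, so the mean over the boundary has to be corrected. The regular part becomes
`R ∘ f + ∑ d_j log |(f - f(α_j)) / (· - α_j)| + c`. At `α_j` the `j`-th quotient is `f'(α_j)`, which
produces `d_j² log |f'(α_j)|`, and the other quotients convert one interaction sum into the other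
(`sum_transport`). The constant adds `π c d` through half the bracket and `-π c d` through the
regular part, so it disappears (`isRenormalizedEnergy_transport`).

Transport of traces, boundary null sets and brackets requires `f` to be bi-Lipschitz up to the
boundary (`IsConformalRep.exists_isBilipschitzPair`), a weak form of the Kellogg–Warschawski
theorem. A `C^{1,β}` boundary lies between two cusps `Re w = ± C |w|^{1+β}` at each of its points.
The barriers `Re (w ∓ A w^{1+β})`, used as exponents of holomorphic functions in the maximum
principle, show that `1 - |F|`, with `F` the inverse of `f`, is comparable to the distance to the
boundary. Schwarz–Pick and Cauchy estimates then bound `F'` and `f'`.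

Transport works in both directions, so unique existence of the four energies only has to be proved
on the disc (`eq_add_of_existsUnique`). The Dirichlet problem has an explicit Green function, and
uniqueness follows by testing a weakly harmonic function with a smooth truncation of itself. For the
Neumann problem the bracket must first be shown independent of the extensions
(`IsAngularPairing.unique`): the quotient `w` of two circle valued extensions has trace `1`, and a
Hardy inequality for `w - 1` near the circle makes the boundary term of a cutoff tend to zero.
Uniqueness up to constants is then the energy identity for the difference of two solutions.

Existence for the Neumann problem is the Riesz representation theorem in the closure of gradients in
`L²`. The functional is bounded because the total flux vanishes, which is exactly the condition that
`g` has degree `∑ d_j`, together with a Poincaré inequality on an annulus. The representing field is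
weakly free of curl and divergence, so its conjugate is holomorphic by Weyl's lemma and the field is
the gradient of a smooth function. Its trace is given by radial limits (`hasTrace_radialLimit`). -/

/-! ### Geometry of `C^{1,β}` boundaries -/

/-- Taylor estimate for a function with Hölder continuous derivative. -/
lemma abs_sub_sub_deriv_mul_le {β C : ℝ} {h : ℝ → ℝ} (hβ : 0 < β) (hh : ContDiff ℝ 1 h)
    (hC : ∀ s t : ℝ, |deriv h s - deriv h t| ≤ C * |s - t| ^ β) (s₀ σ : ℝ) :
    |h (s₀ + σ) - h s₀ - deriv h s₀ * σ| ≤ C * |σ| ^ (1 + β) := by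
  have hC0 : 0 ≤ C := by
    have := (abs_nonneg _).trans (hC 1 0)
    simpa using this
  have hd : Differentiable ℝ h := hh.differentiable (by simp)
  have key := (convex_uIcc s₀ (s₀ + σ)).norm_image_sub_le_of_norm_deriv_le
    (f := fun s => h s - deriv h s₀ * s) (C := C * |σ| ^ β) (x := s₀) (y := s₀ + σ)
    (fun x _ => by fun_prop) (fun x hx => by
      have : deriv (fun s => h s - deriv h s₀ * s) x = deriv h x - deriv h s₀ := by
        rw [deriv_fun_sub (hd x) (by fun_prop)]
        simp
      rw [this]
      refine (hC x s₀).trans ?_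
      have h1 := abs_sub_left_of_mem_uIcc hx
      have : |x - s₀| ≤ |σ| := by simpa using h1
      gcongr) left_mem_uIcc right_mem_uIcc
  have e : (|σ| : ℝ) ^ (1 + β) = |σ| ^ β * |σ| := by
    rcases eq_or_ne σ 0 with rfl | h0
    · simp [Real.zero_rpow (by positivity : (1 + β) ≠ 0)]
    · rw [Real.rpow_add (abs_pos.2 h0), Real.rpow_one, mul_comm]
  rw [e, ← mul_assoc]
  simp only [Real.norm_eq_abs, add_sub_cancel_left] at key
  convert key using 2
  ring

/-- A boundary point in the frame of an epigraph lies on the graph. -/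
lemma eq_of_mem_frontier_of_epigraph {Ω : Set ℂ} (hΩ : IsOpen Ω) {p c : ℂ} {r : ℝ} {h : ℝ → ℝ}
    (hc : ‖c‖ = 1) (hh : Continuous h)
    (H : ∀ s t : ℝ, |s| < r → |t| < r →
      (p + c * ((s : ℂ) + (t : ℂ) * Complex.I) ∈ Ω ↔ h s < t))
    {s t : ℝ} (hs : |s| < r) (ht : |t| < r)
    (hq : p + c * ((s : ℂ) + (t : ℂ) * Complex.I) ∈ frontier Ω) : h s = t := by
  have hc0 : c ≠ 0 := by rintro rfl; simp at hc
  rcases lt_trichotomy (h s) t with hlt | heq | hgt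
  · have := (H s t hs ht).2 hlt
    rw [hΩ.frontier_eq] at hq
    exact absurd this hq.2
  · exact heq
  · exfalso
    have hcl : p + c * ((s : ℂ) + (t : ℂ) * Complex.I) ∈ closure Ω := frontier_subset_closure hq
    set q := p + c * ((s : ℂ) + (t : ℂ) * Complex.I) with hqdef
    have hqe : (q - p) / c = (s : ℂ) + (t : ℂ) * Complex.I := by
      rw [hqdef]; field_simp; ring
    have ev : ∀ᶠ z in 𝓝 q, |((z - p) / c).re| < r ∧ |((z - p) / c).im| < r ∧
        ((z - p) / c).im < h ((z - p) / c).re := by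
      have c1 : Continuous fun z : ℂ => |((z - p) / c).re| := by fun_prop
      have c2 : Continuous fun z : ℂ => |((z - p) / c).im| := by fun_prop
      have c3 : Continuous fun z : ℂ => ((z - p) / c).im := by fun_prop
      have c4 : Continuous fun z : ℂ => h ((z - p) / c).re := by fun_prop
      refine (c1.continuousAt.eventually_lt_const ?_).and
        ((c2.continuousAt.eventually_lt_const ?_).and
          (c3.continuousAt.eventually_lt c4.continuousAt ?_))
      · dsimp only; rw [hqe]; simpa using hs
      · dsimp only; rw [hqe]; simpa using ht
      · rw [hqe]; simpa using hgt
    obtain ⟨z, ⟨h1, h2, h3⟩, hz⟩ := mem_closure_iff_nhds.1 hcl _ ev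
    have := (H _ _ h1 h2).1 (by
      rw [Complex.re_add_im, mul_div_cancel₀ _ hc0]; simpa using hz)
    exact absurd h3 this.not_gt

/-- Near a boundary point of a `C^{1,β}` domain, the domain lies between two cusps with uniform
constants. -/
def IsBetweenCusps (β : ℝ) (Ω : Set ℂ) (C ρ : ℝ) (q : ℂ) : Prop :=
  ∃ n : ℂ, ‖n‖ = 1 ∧ ∀ w : ℂ, ‖w‖ < ρ →
    (C * ‖w‖ ^ (1 + β) < w.re → q + n * w ∈ Ω) ∧ (q + n * w ∈ Ω → -(C * ‖w‖ ^ (1 + β)) < w.re)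

lemma IsBetweenCusps.mono {β : ℝ} {Ω : Set ℂ} {C ρ C' ρ' : ℝ} {q : ℂ}
    (h : IsBetweenCusps β Ω C ρ q) (hC : C ≤ C') (hρ : ρ' ≤ ρ) : IsBetweenCusps β Ω C' ρ' q := by
  obtain ⟨n, hn, H⟩ := h
  refine ⟨n, hn, fun w hw => ?_⟩
  have hle : C * ‖w‖ ^ (1 + β) ≤ C' * ‖w‖ ^ (1 + β) := by gcongr
  obtain ⟨h1, h2⟩ := H w (hw.trans_le hρ)
  exact ⟨fun h => h1 (hle.trans_lt h), fun h => (neg_le_neg hle).trans_lt (h2 h)⟩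

/-- In the frame of the epigraph the inner normal at a graph point with slope `m` is `(-m, 1) / N`,
`N = √(1 + m²)`. The inward coordinate of a displacement `(σ, τ)` is therefore `(τ - m σ) / N`,
while the Taylor estimate says that the graph deviates from its tangent by at most `C |σ|^{1+β}`.
Since `N ≥ 1`, the factor `N` can be dropped in both implications. -/
lemma IsLocalHolderEpigraph.isBetweenCusps {β : ℝ} (hβ : 0 < β) {Ω : Set ℂ} (hΩ : IsOpen Ω) {p : ℂ}
    (hp : IsLocalHolderEpigraph β Ω p) :
    ∃ C ρ : ℝ, 0 < C ∧ 0 < ρ ∧ ∀ q ∈ frontier Ω, dist q p < ρ → IsBetweenCusps β Ω C ρ q := by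
  obtain ⟨c, r, C, h, hc, hr, hh, hC, H⟩ := hp
  have hc0 : c ≠ 0 := by rintro rfl; simp at hc
  have hC0 : 0 ≤ C := by
    have := (abs_nonneg _).trans (hC 1 0)
    simpa using this
  -- The added `1` only makes the constant positive. With radius `r / 2`, the sum of the coordinates
  -- of `q` and of a displacement `w` stays below `r`.
  refine ⟨C + 1, r / 2, by positivity, by positivity, fun q hq hqp => ?_⟩
  set u := (q - p) / c with hu
  have hqu : q = p + c * ((u.re : ℂ) + (u.im : ℂ) * Complex.I) := by
    rw [Complex.re_add_im, hu, mul_div_cancel₀ _ hc0]; ring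
  have hun : ‖u‖ < r / 2 := by rw [hu, norm_div, hc, div_one, ← dist_eq_norm]; exact hqp
  have hs0 : |u.re| < r / 2 := (Complex.abs_re_le_norm u).trans_lt hun
  have ht0 : |u.im| < r / 2 := (Complex.abs_im_le_norm u).trans_lt hun
  have hgraph : h u.re = u.im := eq_of_mem_frontier_of_epigraph hΩ hc hh.continuous H
    (by linarith) (by linarith) (hqu ▸ hq)
  set m := deriv h u.re with hm
  set N := √(1 + m ^ 2) with hN
  have hNpos : 0 < N := Real.sqrt_pos.2 (by positivity)
  have hN1 : 1 ≤ N := by rw [hN, Real.one_le_sqrt]; nlinarith [sq_nonneg m]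
  have hNsq : N ^ 2 = 1 + m ^ 2 := Real.sq_sqrt (by positivity)
  set e : ℂ := ⟨-m / N, 1 / N⟩ with he
  have hen : ‖e‖ = 1 := by
    have : ‖e‖ ^ 2 = 1 := by
      rw [← Complex.normSq_eq_norm_sq, Complex.normSq_apply, he]
      field_simp
      linarith [hNsq]
    nlinarith [norm_nonneg e]
  refine ⟨c * e, by rw [norm_mul, hc, hen, one_mul], fun w hw => ?_⟩
  have hew : ‖e * w‖ = ‖w‖ := by rw [norm_mul, hen, one_mul]
  set σ := (e * w).re with hσ
  set τ := (e * w).im with hτ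
  have hσw : |σ| ≤ ‖w‖ := hew ▸ Complex.abs_re_le_norm (e * w)
  have hτw : |τ| ≤ ‖w‖ := hew ▸ Complex.abs_im_le_norm (e * w)
  have hpt : q + c * e * w =
      p + c * (((u.re + σ : ℝ) : ℂ) + ((u.im + τ : ℝ) : ℂ) * Complex.I) := by
    have : ((u.re + σ : ℝ) : ℂ) + ((u.im + τ : ℝ) : ℂ) * Complex.I
        = ((u.re : ℂ) + (u.im : ℂ) * Complex.I) + e * w := by
      rw [← Complex.re_add_im (e * w)]; push_cast; ring
    rw [this, hqu]
    simp only [Complex.re_add_im]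
    ring
  have hid : τ - m * σ = w.re * N := by
    have e1 : σ = -m / N * w.re - 1 / N * w.im := by simp [hσ, he, Complex.mul_re]
    have e2 : τ = -m / N * w.im + 1 / N * w.re := by simp [hτ, he, Complex.mul_im]
    rw [e1, e2]
    field_simp
    rw [hNsq]; ring
  have hT := abs_sub_sub_deriv_mul_le hβ hh hC u.re σ
  rw [← hm] at hT
  have hT' : |h (u.re + σ) - h u.re - m * σ| ≤ (C + 1) * ‖w‖ ^ (1 + β) := by
    refine hT.trans ?_
    gcongr
    linarith
  have hiff := H (u.re + σ) (u.im + τ)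
    ((abs_add_le _ _).trans_lt (by linarith)) ((abs_add_le _ _).trans_lt (by linarith))
  rw [← hpt] at hiff
  obtain ⟨a1, a2⟩ := abs_le.1 hT'
  have hwn : 0 ≤ (C + 1) * ‖w‖ ^ (1 + β) := by positivity
  refine ⟨fun hlt => hiff.2 ?_, fun hmem => ?_⟩
  · have : w.re ≤ w.re * N := le_mul_of_one_le_right (hwn.trans hlt.le) hN1
    linarith
  · have h3 := hiff.1 hmem
    by_contra hcon
    push Not at hcon
    have : w.re * N ≤ w.re := by nlinarith
    linarith

/-- Compactness of the boundary makes the local constants uniform, since lying between cusps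
survives enlarging the constant and shrinking the radius. -/
lemma IsHolderDomain.exists_isBetweenCusps {β : ℝ} (hβ : 0 < β) {Ω : Set ℂ}
    (hΩ : IsHolderDomain β Ω) :
    ∃ C ρ : ℝ, 0 < C ∧ 0 < ρ ∧ ∀ q ∈ frontier Ω, IsBetweenCusps β Ω C ρ q := by
  have hcpt : IsCompact (frontier Ω) :=
    Metric.isCompact_of_isClosed_isBounded isClosed_frontier
      (hΩ.isBounded.closure.subset frontier_subset_closure)
  refine hcpt.induction_on
    (p := fun S => ∃ C ρ : ℝ, 0 < C ∧ 0 < ρ ∧ ∀ q ∈ S, IsBetweenCusps β Ω C ρ q) ?_ ?_ ?_ ?_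
  · exact ⟨1, 1, one_pos, one_pos, by simp⟩
  · rintro S T hST ⟨C, ρ, hC, hρ, H⟩
    exact ⟨C, ρ, hC, hρ, fun q hq => H q (hST hq)⟩
  · rintro S T ⟨C, ρ, hC, hρ, H⟩ ⟨C', ρ', hC', hρ', H'⟩
    refine ⟨max C C', min ρ ρ', by positivity, by positivity, ?_⟩
    rintro q (hq | hq)
    · exact (H q hq).mono (le_max_left _ _) (min_le_left _ _)
    · exact (H' q hq).mono (le_max_right _ _) (min_le_right _ _)
  · intro p hp
    obtain ⟨C, ρ, hC, hρ, H⟩ := (hΩ.boundary p hp).isBetweenCusps hβ hΩ.isOpen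
    refine ⟨frontier Ω ∩ Metric.ball p ρ,
      inter_mem self_mem_nhdsWithin (mem_nhdsWithin_of_mem_nhds (Metric.ball_mem_nhds p hρ)),
      C, ρ, hC, hρ, fun q hq => H q hq.1 hq.2⟩

/-- Functions with bounded derivative on an epigraph are locally Lipschitz at the boundary. -/
lemma IsLocalHolderEpigraph.exists_lipschitz {β : ℝ} {Ω : Set ℂ} (hΩ : IsOpen Ω)
    {p : ℂ} (hp : IsLocalHolderEpigraph β Ω p) {G : ℂ → ℂ} {M : ℝ} (hM : 0 ≤ M)
    (hG : DifferentiableOn ℂ G Ω) (hG' : ∀ z ∈ Ω, ‖deriv G z‖ ≤ M) :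
    ∃ ρ K : ℝ, 0 < ρ ∧ 0 < K ∧ ∀ z₁ ∈ Ω, ∀ z₂ ∈ Ω, dist z₁ p < ρ → dist z₂ p < ρ →
      ‖G z₁ - G z₂‖ ≤ K * ‖z₁ - z₂‖ := by
  obtain ⟨c, r, C, h, hc, hr, hh, hC, H⟩ := hp
  have hc0 : c ≠ 0 := by rintro rfl; simp at hc
  obtain ⟨L, hL⟩ := (isCompact_Icc (a := -r) (b := r)).exists_bound_of_continuousOn
    (hh.continuous_deriv le_rfl).continuousOn
  have hL0 : 0 ≤ L := (norm_nonneg _).trans (hL 0 ⟨by linarith, hr.le⟩)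
  have hlip : ∀ s t : ℝ, |s| < r → |t| < r → |h s - h t| ≤ L * |s - t| := by
    intro s t hs ht
    refine (convex_Icc (-r) r).norm_image_sub_le_of_norm_deriv_le (f := h) (C := L)
      (fun x _ => (hh.differentiable (by simp)) x) hL ?_ ?_
    · exact ⟨(abs_lt.1 ht).1.le, (abs_lt.1 ht).2.le⟩
    · exact ⟨(abs_lt.1 hs).1.le, (abs_lt.1 hs).2.le⟩
  have hseg : ∀ a b : ℂ, segment ℝ a b ⊆ Ω → ‖G a - G b‖ ≤ M * ‖a - b‖ := fun a b hab =>
    (convex_segment a b).norm_image_sub_le_of_norm_deriv_le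
      (fun x hx => (hG x (hab hx)).differentiableAt (hΩ.mem_nhds (hab hx)))
      (fun x hx => hG' x (hab hx)) (right_mem_segment ℝ a b) (left_mem_segment ℝ a b)
  let E : ℝ → ℝ → ℂ := fun s t => p + c * ((s : ℂ) + (t : ℂ) * Complex.I)
  have hvert : ∀ s t T : ℝ, |s| < r → |t| < r → |T| < r → h s < t → t ≤ T →
      ‖G (E s t) - G (E s T)‖ ≤ M * (T - t) := by
    intro s t T hs ht hT h1 h2
    have := hseg (E s t) (E s T) (by
      rw [segment_eq_image]
      rintro _ ⟨θ, hθ, rfl⟩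
      have : (1 - θ) • E s t + θ • E s T = E s ((1 - θ) * t + θ * T) := by
        simp only [E, Complex.real_smul]; push_cast; ring
      dsimp only
      rw [this]
      refine (H _ _ hs ?_).2 ?_
      · rw [abs_lt] at *
        constructor <;> nlinarith [hθ.1, hθ.2]
      · nlinarith [hθ.1, hθ.2])
    have e : ‖E s t - E s T‖ = T - t := by
      have : E s t - E s T = c * (((t - T : ℝ) : ℂ) * Complex.I) := by
        simp only [E]; push_cast; ring
      rw [this, norm_mul, hc, norm_mul, Complex.norm_I, Complex.norm_real, Real.norm_eq_abs,
        abs_of_nonpos (by linarith)]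
      ring
    rwa [e] at this
  have hL2 : (0 : ℝ) < 2 + 2 * L := by positivity
  -- The radius `r' = r / (2 + 2L)` ensures `r' + L · 2r' ≤ r`, so the detour used below stays in
  -- the chart. The two points are joined by three segments, of lengths at most `(1 + L) D`, `D` and
  -- `(1 + L) D`, where `D` is their distance.
  refine ⟨r / (2 + 2 * L), M * (2 * (1 + L) + 1) + 1, by positivity, by positivity, ?_⟩
  intro z₁ hz₁ z₂ hz₂ hd₁ hd₂
  have hρr : r / (2 + 2 * L) < r := by
    rw [div_lt_iff₀ hL2]; nlinarith
  have coord : ∀ z : ℂ, dist z p < r / (2 + 2 * L) → ∃ s t : ℝ, z = E s t ∧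
      |s| < r / (2 + 2 * L) ∧ |t| < r / (2 + 2 * L) := by
    intro z hz
    have hun : ‖(z - p) / c‖ < r / (2 + 2 * L) := by
      rw [norm_div, hc, div_one, ← dist_eq_norm]; exact hz
    refine ⟨((z - p) / c).re, ((z - p) / c).im, ?_, (Complex.abs_re_le_norm _).trans_lt hun,
      (Complex.abs_im_le_norm _).trans_lt hun⟩
    simp only [E]
    rw [Complex.re_add_im, mul_div_cancel₀ _ hc0]; ring
  obtain ⟨s₁, t₁, rfl, hs₁, ht₁⟩ := coord z₁ hd₁
  obtain ⟨s₂, t₂, rfl, hs₂, ht₂⟩ := coord z₂ hd₂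
  have hg₁ : h s₁ < t₁ := (H _ _ (hs₁.trans hρr) (ht₁.trans hρr)).1 hz₁
  have hg₂ : h s₂ < t₂ := (H _ _ (hs₂.trans hρr) (ht₂.trans hρr)).1 hz₂
  have hz12 : E s₁ t₁ - E s₂ t₂ = c * (((s₁ - s₂ : ℝ) : ℂ) + ((t₁ - t₂ : ℝ) : ℂ) * Complex.I) := by
    simp only [E]; push_cast; ring
  set D := ‖E s₁ t₁ - E s₂ t₂‖ with hD
  have hsD : |s₁ - s₂| ≤ D := by
    rw [hD, hz12, norm_mul, hc, one_mul]
    simpa using Complex.abs_re_le_norm (((s₁ - s₂ : ℝ) : ℂ) + ((t₁ - t₂ : ℝ) : ℂ) * Complex.I)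
  have htD : |t₁ - t₂| ≤ D := by
    rw [hD, hz12, norm_mul, hc, one_mul]
    simpa using Complex.abs_im_le_norm (((s₁ - s₂ : ℝ) : ℂ) + ((t₁ - t₂ : ℝ) : ℂ) * Complex.I)
  -- Both points are raised to the common height `T`. Since `h` is `L`-Lipschitz on the chart, the
  -- horizontal segment at height `T` lies above the graph.
  set T := max t₁ t₂ + L * |s₁ - s₂| with hT
  have hs12 : |s₁ - s₂| < 2 * (r / (2 + 2 * L)) := (abs_sub _ _).trans_lt (by linarith)
  have hrr : r / (2 + 2 * L) + L * (2 * (r / (2 + 2 * L))) ≤ r := by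
    have : r / (2 + 2 * L) * (2 + 2 * L) = r := by field_simp
    have : 0 < r / (2 + 2 * L) := by positivity
    nlinarith
  have hmaxle : max t₁ t₂ ≤ t₁ + |t₁ - t₂| := by
    rcases abs_cases (t₁ - t₂) with h | h <;> rcases max_cases t₁ t₂ with h' | h' <;> linarith
  have hmaxle' : max t₁ t₂ ≤ t₂ + |t₁ - t₂| := by
    rcases abs_cases (t₁ - t₂) with h | h <;> rcases max_cases t₁ t₂ with h' | h' <;> linarith
  have hLs : 0 ≤ L * |s₁ - s₂| := by positivity
  have hT1 : t₁ ≤ T := (le_max_left _ _).trans (by linarith)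
  have hT2 : t₂ ≤ T := (le_max_right _ _).trans (by linarith)
  have hTr : |T| < r := by
    rw [abs_lt]
    constructor
    · linarith [(abs_lt.1 ht₁).1]
    · have : max t₁ t₂ < r / (2 + 2 * L) := max_lt (abs_lt.1 ht₁).2 (abs_lt.1 ht₂).2
      have : L * |s₁ - s₂| ≤ L * (2 * (r / (2 + 2 * L))) := by gcongr
      linarith
  have v1 := hvert s₁ t₁ T (hs₁.trans hρr) (ht₁.trans hρr) hTr hg₁ hT1
  have v2 := hvert s₂ t₂ T (hs₂.trans hρr) (ht₂.trans hρr) hTr hg₂ hT2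
  have v3 := hseg (E s₁ T) (E s₂ T) (by
      rw [segment_eq_image]
      rintro _ ⟨θ, hθ, rfl⟩
      have : (1 - θ) • E s₁ T + θ • E s₂ T = E ((1 - θ) * s₁ + θ * s₂) T := by
        simp only [E, Complex.real_smul]; push_cast; ring
      dsimp only
      rw [this]
      have hsr : |(1 - θ) * s₁ + θ * s₂| < r := by
        have h1 := hs₁.trans hρr
        have h2 := hs₂.trans hρr
        rw [abs_lt] at *
        constructor <;> nlinarith [hθ.1, hθ.2]
      refine (H _ _ hsr hTr).2 ?_
      have h1 := hlip _ s₁ hsr (hs₁.trans hρr)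
      have h2 : |(1 - θ) * s₁ + θ * s₂ - s₁| ≤ |s₁ - s₂| := by
        have : (1 - θ) * s₁ + θ * s₂ - s₁ = -(θ * (s₁ - s₂)) := by ring
        rw [this, abs_neg, abs_mul, abs_of_nonneg hθ.1]
        exact mul_le_of_le_one_left (abs_nonneg _) hθ.2
      have h3 := (abs_le.1 h1).2
      have h4 : L * |(1 - θ) * s₁ + θ * s₂ - s₁| ≤ L * |s₁ - s₂| := by gcongr
      have := le_max_left t₁ t₂
      linarith)
  have e3 : ‖E s₁ T - E s₂ T‖ = |s₁ - s₂| := by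
    have : E s₁ T - E s₂ T = c * ((s₁ - s₂ : ℝ) : ℂ) := by
      simp only [E]; push_cast; ring
    rw [this, norm_mul, hc, Complex.norm_real, Real.norm_eq_abs, one_mul]
  rw [e3] at v3
  have tri : ‖G (E s₁ t₁) - G (E s₂ t₂)‖ ≤ ‖G (E s₁ t₁) - G (E s₁ T)‖
      + ‖G (E s₁ T) - G (E s₂ T)‖ + ‖G (E s₂ t₂) - G (E s₂ T)‖ := by
    have : G (E s₁ t₁) - G (E s₂ t₂) = (G (E s₁ t₁) - G (E s₁ T))
      + (G (E s₁ T) - G (E s₂ T)) - (G (E s₂ t₂) - G (E s₂ T)) := by ring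
    rw [this]
    exact (norm_sub_le _ _).trans (by gcongr; exact norm_add_le _ _)
  have hLD : L * |s₁ - s₂| ≤ L * D := by gcongr
  have b1 : M * (T - t₁) ≤ M * ((1 + L) * D) := by gcongr; linarith
  have b2 : M * (T - t₂) ≤ M * ((1 + L) * D) := by gcongr; linarith
  have b3 : M * |s₁ - s₂| ≤ M * D := by gcongr
  have hD0 : 0 ≤ D := norm_nonneg _
  nlinarith

/-! ### Biholomorphic maps -/

/-- `f : U → V` and `F : V → U` are mutually inverse holomorphic maps between open sets. -/
structure IsBiholomorphicPair (U V : Set ℂ) (f F : ℂ → ℂ) : Prop where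
  isOpen_left : IsOpen U
  isOpen_right : IsOpen V
  holomorphic_left : DifferentiableOn ℂ f U
  holomorphic_right : DifferentiableOn ℂ F V
  mapsTo_left : MapsTo f U V
  mapsTo_right : MapsTo F V U
  left_inv : ∀ z ∈ U, F (f z) = z
  right_inv : ∀ z ∈ V, f (F z) = z

namespace IsBiholomorphicPair

variable {U V : Set ℂ} {f F : ℂ → ℂ}

lemma symm (h : IsBiholomorphicPair U V f F) : IsBiholomorphicPair V U F f :=
  ⟨h.2, h.1, h.4, h.3, h.6, h.5, h.8, h.7⟩

lemma differentiableAt (h : IsBiholomorphicPair U V f F) {z : ℂ} (hz : z ∈ U) :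
    DifferentiableAt ℂ f z := (h.holomorphic_left z hz).differentiableAt (h.isOpen_left.mem_nhds hz)

lemma injOn (h : IsBiholomorphicPair U V f F) : InjOn f U := fun a ha b hb hab => by
  rw [← h.left_inv a ha, ← h.left_inv b hb, hab]

lemma image_eq (h : IsBiholomorphicPair U V f F) : f '' U = V :=
  Subset.antisymm h.mapsTo_left.image_subset fun z hz => ⟨F z, h.mapsTo_right hz, h.right_inv z hz⟩

lemma deriv_mul_deriv (h : IsBiholomorphicPair U V f F) {z : ℂ} (hz : z ∈ U) :
    deriv F (f z) * deriv f z = 1 := by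
  have h1 := (h.symm.differentiableAt (h.mapsTo_left hz)).hasDerivAt.comp z
    (h.differentiableAt hz).hasDerivAt
  have h2 : HasDerivAt (F ∘ f) 1 z := (hasDerivAt_id z).congr_of_eventuallyEq (by
    filter_upwards [h.isOpen_left.mem_nhds hz] with y hy using h.left_inv y hy)
  exact h1.unique h2

lemma deriv_ne_zero (h : IsBiholomorphicPair U V f F) {z : ℂ} (hz : z ∈ U) : deriv f z ≠ 0 :=
  fun h0 => by simpa [h0] using h.deriv_mul_deriv hz

end IsBiholomorphicPair

/-- An analytic function is either locally constant or locally open, and injectivity excludes the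
first alternative. -/
lemma nhds_le_map_of_injOn {U : Set ℂ} (hU : IsOpen U) {f : ℂ → ℂ} (hf : DifferentiableOn ℂ f U)
    (hinj : InjOn f U) {z : ℂ} (hz : z ∈ U) : 𝓝 (f z) ≤ map f (𝓝 z) := by
  refine ((hf.analyticAt (hU.mem_nhds hz)).eventually_constant_or_nhds_le_map_nhds).resolve_left ?_
  intro h
  have h2 : ∀ᶠ y in 𝓝[≠] z, False := by
    filter_upwards [nhdsWithin_le_nhds h, nhdsWithin_le_nhds (hU.mem_nhds hz), self_mem_nhdsWithin]
      with y hy hyU hne using hne (hinj hyU hz hy)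
  exact h2.exists.elim fun _ h => h

/-- The inverse is continuous by openness of `f`, hence differentiable at the images of points where
`f' ≠ 0`. The zeros of `f'` are isolated, because `f` is nowhere locally constant, and at their
images a continuous function holomorphic on a punctured neighbourhood is holomorphic. That `f'` has
no zero at all then follows from the chain rule. -/
lemma exists_isBiholomorphicPair {U : Set ℂ} (hU : IsOpen U) {f : ℂ → ℂ}
    (hf : DifferentiableOn ℂ f U) (hinj : InjOn f U) :
    ∃ F, IsBiholomorphicPair U (f '' U) f F := by
  set F := Function.invFunOn f U with hF
  have hleft : ∀ z ∈ U, F (f z) = z := fun z hz => hinj.leftInvOn_invFunOn hz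
  have hV : IsOpen (f '' U) := by
    rw [isOpen_iff_mem_nhds]
    rintro _ ⟨z, hz, rfl⟩
    exact nhds_le_map_of_injOn hU hf hinj hz (image_mem_map (hU.mem_nhds hz))
  have hFc : ∀ z ∈ U, ContinuousAt F (f z) := by
    intro z hz
    rw [ContinuousAt, hleft z hz]
    intro W hW
    have := nhds_le_map_of_injOn hU hf hinj hz (image_mem_map (inter_mem hW (hU.mem_nhds hz)))
    rw [Filter.mem_map]
    refine mem_of_superset this ?_
    rintro _ ⟨y, ⟨hyW, hyU⟩, rfl⟩
    simpa [hleft y hyU] using hyW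
  have hright : ∀ w ∈ f '' U, f (F w) = w := by
    rintro _ ⟨z, hz, rfl⟩; rw [hleft z hz]
  have hFd : ∀ z ∈ U, deriv f z ≠ 0 → DifferentiableAt ℂ F (f z) := fun z hz h0 => by
    refine (HasDerivAt.of_local_left_inverse (f := f) (f' := deriv f z) (hFc z hz) ?_ h0 ?_
      ).differentiableAt
    · rw [hleft z hz]
      exact ((hf z hz).differentiableAt (hU.mem_nhds hz)).hasDerivAt
    · filter_upwards [hV.mem_nhds (mem_image_of_mem f hz)] with w hw using hright w hw
  refine ⟨F, hU, hV, hf, ?_, mapsTo_image f U, ?_, hleft, hright⟩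
  · rintro _ ⟨z, hz, rfl⟩
    refine DifferentiableAt.differentiableWithinAt (AnalyticAt.differentiableAt (𝕜 := ℂ)
      (Complex.analyticAt_of_differentiable_on_punctured_nhds_of_continuousAt ?_ (hFc z hz)))
    have han := (hf.analyticAt (hU.mem_nhds hz)).deriv
    have hne : ∀ᶠ y in 𝓝[≠] z, deriv f y ≠ 0 := by
      refine han.eventually_eq_zero_or_eventually_ne_zero.resolve_left fun h0 => ?_
      obtain ⟨ε, hε, hball⟩ := Metric.eventually_nhds_iff_ball.1 (h0.and (hU.eventually_mem hz))
      have hconst : ∀ y ∈ Metric.ball z ε, f y = f z := fun y hy =>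
        (convex_ball z ε).is_const_of_fderivWithin_eq_zero (𝕜 := ℂ)
          (hf.mono fun y hy => (hball y hy).2) (fun y hy => by
            rw [fderivWithin_of_isOpen Metric.isOpen_ball hy]
            ext; simpa using (hball y hy).1) hy (Metric.mem_ball_self hε)
      have h2 : ∀ᶠ y in 𝓝[≠] z, False := by
        filter_upwards [nhdsWithin_le_nhds (Metric.ball_mem_nhds z hε), self_mem_nhdsWithin]
          with y hy hne using hne (hinj (hball y hy).2 hz (hconst y hy))
      exact h2.exists.elim fun _ h => h
    have hFne : Tendsto F (𝓝[≠] (f z)) (𝓝[≠] z) := by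
      refine tendsto_nhdsWithin_iff.2 ⟨?_, ?_⟩
      · have := (hFc z hz).tendsto
        rw [hleft z hz] at this
        exact this.mono_left nhdsWithin_le_nhds
      · filter_upwards [nhdsWithin_le_nhds (hV.mem_nhds (mem_image_of_mem f hz)),
          self_mem_nhdsWithin] with w hw hne hc
        exact hne (by rw [← hright w hw, hc]; rfl)
    filter_upwards [hFne.eventually hne, nhdsWithin_le_nhds (hV.mem_nhds (mem_image_of_mem f hz))]
      with w hw hwV
    obtain ⟨y, hy, rfl⟩ := hwV
    rw [hleft y hy] at hw
    exact hFd y hy hw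
  · rintro _ ⟨z, hz, rfl⟩
    rwa [hleft z hz]

/-- The image of a compact set by the inverse stays away from the boundary. -/
lemma IsBiholomorphicPair.tendsto_norm_frontier {Ω : Set ℂ} {f F : ℂ → ℂ}
    (h : IsBiholomorphicPair (Metric.ball 0 1) Ω f F) {p : ℂ} (hp : p ∈ frontier Ω) :
    Tendsto (fun z => ‖F z‖) (𝓝[Ω] p) (𝓝 1) := by
  have hlt : ∀ z ∈ Ω, ‖F z‖ < 1 := fun z hz => by simpa using h.mapsTo_right hz
  rw [tendsto_order]
  refine ⟨fun a ha => ?_, fun a ha => ?_⟩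
  -- A point of `Ω` with `‖F z‖ ≤ a < 1` lies in the compact image of a smaller closed disc, which
  -- does not contain the boundary point `p`.
  · have hcpt : IsCompact (f '' Metric.closedBall 0 a) :=
      (isCompact_closedBall _ _).image_of_continuousOn
        (h.holomorphic_left.continuousOn.mono (Metric.closedBall_subset_ball ha))
    have hpn : p ∉ f '' Metric.closedBall 0 a := by
      rintro ⟨y, hy, rfl⟩
      rw [h.isOpen_right.frontier_eq] at hp
      exact hp.2 (h.mapsTo_left (Metric.closedBall_subset_ball ha hy))
    filter_upwards [nhdsWithin_le_nhds (hcpt.isClosed.isOpen_compl.mem_nhds hpn),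
      self_mem_nhdsWithin] with z hz hzΩ
    by_contra hcon
    exact hz ⟨F z, by simpa using hcon, h.right_inv z hzΩ⟩
  · filter_upwards [self_mem_nhdsWithin] with z hz using (hlt z hz).trans ha

/-- Maximum principle for a holomorphic function with boundary upper limits at most `1`. -/
lemma norm_le_one_of_eventually_frontier {U : Set ℂ} (hU : IsOpen U) (hb : Bornology.IsBounded U)
    {G : ℂ → ℂ} (hG : DifferentiableOn ℂ G U)
    (hfr : ∀ p ∈ frontier U, ∀ M > 1, ∀ᶠ z in 𝓝[U] p, ‖G z‖ ≤ M) {z : ℂ} (hz : z ∈ U) :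
    ‖G z‖ ≤ 1 := by
  by_contra! hcon
  obtain ⟨c, hc1, hcz⟩ := exists_between hcon
  -- The closure of the superlevel set stays inside `U` by the boundary hypothesis. The usual
  -- maximum principle on `W`, on whose frontier `‖G‖ ≤ c`, contradicts `z ∈ W`.
  set W := {z ∈ U | c < ‖G z‖} with hW
  have hWo : IsOpen W := hG.continuousOn.norm.isOpen_inter_preimage hU isOpen_Ioi
  have hWU : closure W ⊆ U := by
    intro y hy
    by_contra hyU
    have hyf : y ∈ frontier U := by
      rw [hU.frontier_eq]
      exact ⟨closure_mono (fun _ h => h.1) hy, hyU⟩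
    obtain ⟨w, hw1, hw2⟩ := ((mem_closure_iff_frequently.1 hy).and_eventually
      (eventually_nhdsWithin_iff.1 (hfr y hyf c hc1))).exists
    exact absurd (hw2 hw1.1) hw1.2.not_ge
  have := Complex.norm_le_of_forall_mem_frontier_norm_le (hb.subset fun _ (h : _ ∈ W) => h.1)
    ((hG.mono hWU).diffContOnCl) (C := c) (fun y hy => by
      have hyW : y ∉ W := by rw [hWo.frontier_eq] at hy; exact hy.2
      have hyU := hWU (frontier_subset_closure hy)
      by_contra! h
      exact hyW ⟨hyU, h⟩) (subset_closure (show z ∈ W from ⟨hz, hcz⟩))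
  linarith

/-- Schwarz–Pick at the centre of a disc. -/
lemma norm_deriv_le_of_mapsTo_unit_ball {F : ℂ → ℂ} {z : ℂ} {δ : ℝ} (hδ : 0 < δ)
    (hF : DifferentiableOn ℂ F (Metric.ball z δ))
    (hmaps : MapsTo F (Metric.ball z δ) (Metric.ball 0 1)) :
    ‖deriv F z‖ ≤ 2 * (1 - ‖F z‖) / δ := by
  have hzb : z ∈ Metric.ball z δ := Metric.mem_ball_self hδ
  set a := F z with ha
  have ha1 : ‖a‖ < 1 := by simpa using hmaps hzb
  have hden : ∀ u : ℂ, ‖u‖ < 1 → 1 - (starRingEnd ℂ) a * u ≠ 0 := by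
    intro u hu h0
    have : ‖(starRingEnd ℂ) a * u‖ = 1 := by rw [← sub_eq_zero.1 h0, norm_one]
    rw [norm_mul, Complex.norm_conj] at this
    nlinarith [norm_nonneg a, norm_nonneg u]
  have hle : ∀ u : ℂ, ‖u‖ < 1 → ‖(u - a) / (1 - (starRingEnd ℂ) a * u)‖ ≤ 1 := by
    intro u hu
    rw [norm_div, div_le_one (norm_pos_iff.2 (hden u hu))]
    refine le_of_sq_le_sq ?_ (norm_nonneg _)
    rw [← Complex.normSq_eq_norm_sq, ← Complex.normSq_eq_norm_sq]
    have h1 : Complex.normSq a ≤ 1 := by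
      rw [Complex.normSq_eq_norm_sq]; nlinarith [norm_nonneg a]
    have h2 : Complex.normSq u ≤ 1 := by
      rw [Complex.normSq_eq_norm_sq]; nlinarith [norm_nonneg u]
    simp only [Complex.normSq_apply, Complex.sub_re, Complex.sub_im, Complex.mul_re, Complex.mul_im,
      Complex.conj_re, Complex.conj_im, Complex.one_re, Complex.one_im] at *
    nlinarith
  -- Composition with the disc automorphism sending `a` to `0`. The Cauchy estimate for `G` gives
  -- `‖F'(z)‖ ≤ (1 - ‖a‖²) / δ`, and `1 - ‖a‖² ≤ 2 (1 - ‖a‖)`.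
  set G : ℂ → ℂ := fun y => (F y - a) / (1 - (starRingEnd ℂ) a * F y) with hG
  have hu : ∀ y ∈ Metric.ball z δ, ‖F y‖ < 1 := fun y hy => by simpa using hmaps hy
  have hGz : G z = 0 := by simp [hG, ← ha]
  have key := Complex.norm_deriv_le_div_of_mapsTo_ball (f := G) (c := z) (R₁ := δ) (R₂ := 1)
    ((hF.sub_const _).div ((hF.const_mul _).const_sub _) fun y hy => hden _ (hu y hy))
    (fun y hy => by rw [hGz, mem_closedBall_zero_iff]; exact hle _ (hu y hy)) hδ
  have hFz := (hF.differentiableAt (Metric.ball_mem_nhds z hδ)).hasDerivAt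
  have hnz : (1 : ℂ) - (starRingEnd ℂ) a * a ≠ 0 := hden a ha1
  have hder : deriv G z = deriv F z / (1 - (starRingEnd ℂ) a * a) := by
    have := ((hFz.sub_const a).div ((hFz.const_mul ((starRingEnd ℂ) a)).const_sub 1) hnz).deriv
    rw [hG]
    refine this.trans ?_
    rw [← ha]
    field_simp
    ring
  have hval : (1 : ℂ) - (starRingEnd ℂ) a * a = ((1 - ‖a‖ ^ 2 : ℝ) : ℂ) := by
    rw [mul_comm, Complex.mul_conj, Complex.normSq_eq_norm_sq]; push_cast; ring
  have hpos : 0 < 1 - ‖a‖ ^ 2 := by nlinarith [norm_nonneg a]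
  rw [hder, hval, norm_div, Complex.norm_real, Real.norm_eq_abs, abs_of_pos hpos,
    div_le_div_iff₀ hpos hδ] at key
  rw [le_div_iff₀ hδ]
  nlinarith [norm_nonneg a]

/-! ### Barriers -/

/-- The power `w ^ (1 + β)` of a complex number. -/
noncomputable def cuspPow (β : ℝ) (w : ℂ) : ℂ := w ^ ((1 + β : ℝ) : ℂ)

lemma cuspPow_re (β : ℝ) (w : ℂ) :
    (cuspPow β w).re = ‖w‖ ^ (1 + β) * Real.cos (w.arg * (1 + β)) := Complex.cpow_ofReal_re w _

lemma abs_cuspPow_re_le (β : ℝ) (w : ℂ) : |(cuspPow β w).re| ≤ ‖w‖ ^ (1 + β) := by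
  rw [cuspPow_re, abs_mul, abs_of_nonneg (by positivity : 0 ≤ ‖w‖ ^ (1 + β))]
  exact mul_le_of_le_one_right (by positivity) (Real.abs_cos_le_one _)

/-- Near the imaginary directions the real part of `w ^ (1 + β)` is negative. -/
lemma exists_cuspPow_re_le {β : ℝ} (hβ0 : 0 < β) (hβ1 : β < 1) :
    ∃ ε σ : ℝ, 0 < ε ∧ 0 < σ ∧ ∀ w : ℂ, w ≠ 0 → |w.re| ≤ ε * ‖w‖ →
      (cuspPow β w).re ≤ -(σ * ‖w‖ ^ (1 + β)) := by
  -- `g` expresses `cos ((1 + β) arg w)` as a continuous function of `Re w / ‖w‖`. At `0` the angle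
  -- is `(1 + β) π / 2`, which lies strictly between `π / 2` and `π` because `0 < β < 1`.
  set g : ℝ → ℝ := fun x => Real.cos (Real.arccos x * (1 + β)) with hg
  have hgc : Continuous g := by fun_prop
  have hg0 : g 0 < 0 := by
    simp only [hg, Real.arccos_zero]
    have := Real.pi_pos
    exact Real.cos_neg_of_pi_div_two_lt_of_lt (by nlinarith) (by nlinarith)
  have hev : ∀ᶠ x in 𝓝 (0 : ℝ), g x < g 0 / 2 :=
    hgc.continuousAt.eventually_lt_const (by linarith)
  obtain ⟨ε, hε, hball⟩ := Metric.eventually_nhds_iff.1 hev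
  refine ⟨ε / 2, -(g 0) / 2, by positivity, by linarith, fun w hw hre => ?_⟩
  have hwn : 0 < ‖w‖ := norm_pos_iff.2 hw
  have hx : |w.re / ‖w‖| ≤ ε / 2 := by
    rw [abs_div, abs_norm, div_le_iff₀ hwn]; exact hre
  have h1 : g (w.re / ‖w‖) < g 0 / 2 := hball (by
    rw [Real.dist_eq, sub_zero]; linarith)
  have h2 : g (w.re / ‖w‖) = Real.cos (w.arg * (1 + β)) := by
    simp only [hg]
    rw [← Complex.cos_arg hw, ← Real.cos_abs w.arg, Real.arccos_cos (abs_nonneg _)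
      (Complex.abs_arg_le_pi w), ← Real.cos_abs (w.arg * (1 + β)), abs_mul,
      abs_of_pos (by linarith : 0 < 1 + β)]
  rw [cuspPow_re, ← h2]
  have : 0 < ‖w‖ ^ (1 + β) := by positivity
  nlinarith

lemma rpow_one_add_eq {β x : ℝ} (hβ : 0 < β) (hx : 0 ≤ x) : x ^ (1 + β) = x * x ^ β := by
  rw [Real.rpow_add_of_nonneg hx zero_le_one hβ.le, Real.rpow_one]

lemma exists_rpow_le {β : ℝ} (hβ : 0 < β) {η : ℝ} (hη : 0 < η) :
    ∃ ρ : ℝ, 0 < ρ ∧ ρ ≤ 1 ∧ ∀ x : ℝ, 0 ≤ x → x ≤ ρ → x ^ (1 + β) ≤ η * x := by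
  refine ⟨min 1 (η ^ (1 / β)), by positivity, min_le_left _ _, fun x hx hxρ => ?_⟩
  have : x ^ β ≤ η := by
    calc x ^ β ≤ (η ^ (1 / β)) ^ β := by gcongr; exact hxρ.trans (min_le_right _ _)
      _ = η := by rw [← Real.rpow_mul hη.le]; field_simp; simp
  rw [rpow_one_add_eq hβ hx, mul_comm]
  gcongr

/-- The barriers `Re (w ∓ A w ^ (1 + β))` adapted to a cusp of size `C`. -/
lemma exists_barriers {β : ℝ} (hβ0 : 0 < β) (hβ1 : β < 1) {C : ℝ} (hC : 0 < C) :
    ∃ A ρ : ℝ, 0 < A ∧ 0 < ρ ∧ ρ ≤ 1 ∧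
      (∀ w : ℂ, w ≠ 0 → ‖w‖ ≤ ρ → -(C * ‖w‖ ^ (1 + β)) ≤ w.re →
        w ∈ Complex.slitPlane ∧ ‖w‖ ^ (1 + β) ≤ (w - A * cuspPow β w).re) ∧
      (∀ w : ℂ, w ≠ 0 → ‖w‖ ≤ ρ → w.re = 2 * C * ‖w‖ ^ (1 + β) →
        (w + A * cuspPow β w).re ≤ 0) := by
  obtain ⟨ε, σ, hε, hσ, H⟩ := exists_cuspPow_re_le hβ0 hβ1
  -- With this choice `A Re (w^{1+β}) ≤ -(2C + 1) ‖w‖^{1+β}` near the imaginary directions. This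
  -- beats both `Re w ≥ -C ‖w‖^{1+β}` in the first barrier and `Re w = 2C ‖w‖^{1+β}` in the second.
  set A := (2 * C + 1) / σ with hA
  have hA0 : 0 < A := by positivity
  have hAσ : A * σ = 2 * C + 1 := by rw [hA]; field_simp
  -- The three smallness conditions serve different purposes: the first controls the barrier away
  -- from the imaginary directions, the second places the cusp boundary `Re w = 2C ‖w‖^{1+β}` among
  -- those directions, and the third keeps `w` off the negative real axis.
  obtain ⟨ρ, hρ, hρ1, hpow⟩ := exists_rpow_le hβ0
    (η := min (ε / (A + 1)) (min (ε / (2 * C)) (1 / (2 * C)))) (by positivity)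
  have mulre : ∀ w : ℂ, (A * cuspPow β w).re = A * (cuspPow β w).re := fun w => by simp
  refine ⟨A, ρ, hA0, hρ, hρ1, fun w hw hwρ hre => ?_, fun w hw hwρ hre => ?_⟩
  all_goals
    have hwn : 0 < ‖w‖ := norm_pos_iff.2 hw
    have hp := hpow _ hwn.le hwρ
    have hp0 : 0 < ‖w‖ ^ (1 + β) := by positivity
    have hp1 : (A + 1) * ‖w‖ ^ (1 + β) ≤ ε * ‖w‖ := by
      have : ‖w‖ ^ (1 + β) ≤ ε / (A + 1) * ‖w‖ := hp.trans (by gcongr; exact min_le_left _ _)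
      calc (A + 1) * ‖w‖ ^ (1 + β) ≤ (A + 1) * (ε / (A + 1) * ‖w‖) := by gcongr
        _ = ε * ‖w‖ := by field_simp
    have hp2 : 2 * C * ‖w‖ ^ (1 + β) ≤ ε * ‖w‖ := by
      have : ‖w‖ ^ (1 + β) ≤ ε / (2 * C) * ‖w‖ := hp.trans (by
        gcongr; exact (min_le_right _ _).trans (min_le_left _ _))
      calc 2 * C * ‖w‖ ^ (1 + β) ≤ 2 * C * (ε / (2 * C) * ‖w‖) := by gcongr
        _ = ε * ‖w‖ := by field_simp
    have hp3 : 2 * C * ‖w‖ ^ (1 + β) ≤ ‖w‖ := by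
      have : ‖w‖ ^ (1 + β) ≤ 1 / (2 * C) * ‖w‖ := hp.trans (by
        gcongr; exact (min_le_right _ _).trans (min_le_right _ _))
      calc 2 * C * ‖w‖ ^ (1 + β) ≤ 2 * C * (1 / (2 * C) * ‖w‖) := by gcongr
        _ = ‖w‖ := by field_simp
    have hQ := abs_le.1 (abs_cuspPow_re_le β w)
  · constructor
    · rw [Complex.mem_slitPlane_iff]
      by_contra! hcon
      have hwe : ‖w‖ = -w.re := by
        have : w = (w.re : ℂ) := by apply Complex.ext <;> simp [hcon.2]
        rw [this, Complex.norm_real, Real.norm_eq_abs, abs_of_nonpos hcon.1]; simp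
      nlinarith
    · rw [Complex.sub_re, mulre]
      by_cases hx : |w.re| ≤ ε * ‖w‖
      · have := H w hw hx
        have : A * (cuspPow β w).re ≤ A * (-(σ * ‖w‖ ^ (1 + β))) := by gcongr
        have : A * (-(σ * ‖w‖ ^ (1 + β))) = -((2 * C + 1) * ‖w‖ ^ (1 + β)) := by
          rw [← hAσ]; ring
        nlinarith
      · have hpos : ε * ‖w‖ < w.re := by
          rcases abs_cases w.re with h | h <;> nlinarith
        have : A * (cuspPow β w).re ≤ A * ‖w‖ ^ (1 + β) := by gcongr; exact hQ.2
        linarith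
  · rw [Complex.add_re, mulre]
    have hx : |w.re| ≤ ε * ‖w‖ := by
      rw [hre, abs_of_nonneg (by positivity)]; exact hp2
    have : A * (cuspPow β w).re ≤ A * (-(σ * ‖w‖ ^ (1 + β))) := by gcongr; exact H w hw hx
    have : A * (-(σ * ‖w‖ ^ (1 + β))) = -((2 * C + 1) * ‖w‖ ^ (1 + β)) := by
      rw [← hAσ]; ring
    rw [hre]; nlinarith

/-! ### Comparison of `1 - |F|` with the distance to the boundary -/

section GreenBounds

variable {β : ℝ} {Ω : Set ℂ} {f F : ℂ → ℂ} {C ρ : ℝ}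

/-- Upper barrier: `1 - |F|` is at most proportional to the distance to a boundary point. -/
lemma IsBiholomorphicPair.exists_one_sub_norm_le (hβ0 : 0 < β) (hβ1 : β < 1)
    (hb : Bornology.IsBounded Ω) (h : IsBiholomorphicPair (Metric.ball 0 1) Ω f F)
    (hC : 0 < C) (hρ : 0 < ρ) (hcusp : ∀ q ∈ frontier Ω, IsBetweenCusps β Ω C ρ q) :
    ∃ K ρ₁ : ℝ, 0 < K ∧ 0 < ρ₁ ∧ ∀ q ∈ frontier Ω, ∀ z ∈ Ω, dist z q < ρ₁ →
      1 - ‖F z‖ ≤ K * dist z q := by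
  obtain ⟨A, ρ₀, hA, hρ₀, hρ₀1, hup, -⟩ := exists_barriers hβ0 hβ1 hC
  have h0Ω : f 0 ∈ Ω := h.mapsTo_left (by simp)
  obtain ⟨d₀, hd₀, hd₀Ω⟩ := Metric.isOpen_iff.1 h.isOpen_right _ h0Ω
  -- `F` vanishes only at `f 0`, which is at distance at least `d₀` from the boundary. Hence `‖F‖`
  -- is bounded below by `m` near the boundary and division by `F` is allowed there.
  obtain ⟨m, hm, hm1⟩ : ∃ m : ℝ, 0 < m ∧ ∀ z ∈ Ω, ‖F z‖ < m → dist z (f 0) < d₀ / 2 := by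
    have hc : ContinuousAt f 0 := (h.differentiableAt (by simp)).continuousAt
    obtain ⟨m, hm, H⟩ := Metric.continuousAt_iff.1 hc (d₀ / 2) (by positivity)
    refine ⟨m, hm, fun z hz hzm => ?_⟩
    simpa [h.right_inv z hz] using H (x := F z) (by simpa using hzm)
  set ρ₁ := min (min ρ₀ (ρ / 2)) (d₀ / 4) with hρ₁
  have hρ₁0 : 0 < ρ₁ := by positivity
  have hρ₁a : ρ₁ ≤ ρ₀ := (min_le_left _ _).trans (min_le_left _ _)
  have hρ₁b : ρ₁ < ρ := ((min_le_left _ _).trans (min_le_right _ _)).trans_lt (by linarith)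
  have hρ₁c : ρ₁ ≤ d₀ / 4 := min_le_right _ _
  set R := ρ₁ ^ (1 + β) with hR
  have hR0 : 0 < R := by positivity
  -- The factor `lam` is such that `exp (-lam R) ≤ m`, where `R` is the lower bound of the barrier
  -- on the circle of radius `ρ₁`.
  set lam := |Real.log m| / R with hlam
  have hlam0 : 0 ≤ lam := by positivity
  refine ⟨lam * (1 + A) + 1, ρ₁, by positivity, hρ₁0, fun q hq z hz hzq => ?_⟩
  obtain ⟨n, hn, hcq⟩ := hcusp q hq
  have hn0 : n ≠ 0 := by rintro rfl; simp at hn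
  have hqd : d₀ ≤ dist q (f 0) := by
    by_contra! hcon
    have : q ∈ Ω := hd₀Ω hcon
    rw [h.isOpen_right.frontier_eq] at hq
    exact hq.2 this
  have hFm : ∀ y ∈ Ω, dist y q ≤ ρ₁ → m ≤ ‖F y‖ := by
    intro y hy hyq
    by_contra! hcon
    have h1 := hm1 y hy hcon
    have h2 := dist_triangle_left q (f 0) y
    linarith
  set om : ℂ → ℂ := fun y => (y - q) / n with hom
  have homn : ∀ y, ‖om y‖ = dist y q := fun y => by
    simp only [hom]; rw [norm_div, hn, div_one, dist_eq_norm]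
  have homq : ∀ y, q + n * om y = y := fun y => by
    simp only [hom]; rw [mul_div_cancel₀ _ hn0]; ring
  have hom0 : ∀ y ∈ Ω, om y ≠ 0 := fun y hy h0 => by
    have : y = q := by simpa [h0] using (homq y).symm
    rw [h.isOpen_right.frontier_eq, ← this] at hq
    exact hq.2 hy
  have hbar : ∀ y ∈ Ω, dist y q ≤ ρ₁ → om y ∈ Complex.slitPlane ∧
      ‖om y‖ ^ (1 + β) ≤ (om y - A * cuspPow β (om y)).re := fun y hy hyq => by
    refine hup _ (hom0 y hy) ((homn y).le.trans (hyq.trans hρ₁a)) ?_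
    have := (hcq (om y) ((homn y).le.trans_lt (hyq.trans_lt hρ₁b))).2
    rw [homq] at this
    exact (this hy).le
  -- The modulus of `G` has upper limits at most `1` on the boundary of `Ω ∩ B(q, ρ₁)`. On `∂Ω` the
  -- barrier is nonnegative and `‖F‖` tends to `1`; on the circle the exponential is at most `m ≤
  -- ‖F‖`. So `‖F‖ ≥ exp (-lam b) ≥ 1 - lam b`, where the barrier `b` is at most `(1 + A)` times the
  -- distance to `q`.
  set G : ℂ → ℂ := fun y => Complex.exp (-(lam * (om y - A * cuspPow β (om y)))) / F y with hG
  have hGn : ∀ y, ‖G y‖ = Real.exp (-(lam * (om y - A * cuspPow β (om y)).re)) / ‖F y‖ := fun y => by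
    simp only [hG]
    rw [norm_div, Complex.norm_exp, Complex.neg_re, Complex.re_ofReal_mul]
  have hbardiff : ∀ y ∈ Ω, dist y q ≤ ρ₁ → DifferentiableAt ℂ G y := fun y hy hyq => by
    have h1 : DifferentiableAt ℂ om y := by fun_prop
    have h2 : DifferentiableAt ℂ (fun y => cuspPow β (om y)) y :=
      h1.cpow_const (hbar y hy hyq).1
    have h3 : F y ≠ 0 := norm_pos_iff.1 (hm.trans_le (hFm y hy hyq))
    exact (((h1.sub (h2.const_mul _)).const_mul _).neg.cexp).div (h.symm.differentiableAt hy) h3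
  have hUo : IsOpen (Ω ∩ Metric.ball q ρ₁) := h.isOpen_right.inter Metric.isOpen_ball
  have key := norm_le_one_of_eventually_frontier hUo (hb.subset inter_subset_left) (G := G)
    (fun y hy => (hbardiff y hy.1 (le_of_lt hy.2)).differentiableWithinAt) ?_ (z := z) ⟨hz, hzq⟩
  · rw [hGn, div_le_one (hm.trans_le (hFm z hz hzq.le))] at key
    have hre : (om z - A * cuspPow β (om z)).re ≤ (1 + A) * dist z q := by
      have h1 := Complex.re_le_norm (om z)
      have h2 := abs_le.1 (abs_cuspPow_re_le β (om z))
      have h3 : ‖om z‖ ^ (1 + β) ≤ ‖om z‖ := by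
        have : ‖om z‖ ≤ 1 := (homn z).le.trans (hzq.le.trans (hρ₁a.trans hρ₀1))
        calc ‖om z‖ ^ (1 + β) ≤ ‖om z‖ ^ (1 : ℝ) :=
              Real.rpow_le_rpow_of_exponent_ge' (norm_nonneg _) this (by norm_num) (by linarith)
          _ = ‖om z‖ := Real.rpow_one _
      rw [Complex.sub_re, Complex.re_ofReal_mul, ← homn]
      nlinarith
    have h5 := Real.add_one_le_exp (-(lam * (om z - A * cuspPow β (om z)).re))
    have h6 : lam * (om z - A * cuspPow β (om z)).re ≤ lam * ((1 + A) * dist z q) := by gcongr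
    have h7 : 0 ≤ dist z q := dist_nonneg
    nlinarith
  · intro p hp M hM
    have hpc : p ∈ closure Ω := closure_mono inter_subset_left (frontier_subset_closure hp)
    have hpd : dist p q ≤ ρ₁ := by
      have := closure_mono (inter_subset_right (s := Ω)) (frontier_subset_closure hp)
      exact Metric.closure_ball_subset_closedBall this
    by_cases hpΩ : p ∈ Ω
    · have hpe : dist p q = ρ₁ := by
        refine hpd.antisymm ?_
        by_contra! hlt
        rw [hUo.frontier_eq] at hp
        exact hp.2 ⟨hpΩ, hlt⟩
      have hval : ‖G p‖ ≤ 1 := by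
        rw [hGn, div_le_one (hm.trans_le (hFm p hpΩ hpd))]
        refine le_trans ?_ (hFm p hpΩ hpd)
        rw [← Real.exp_log hm, Real.exp_le_exp]
        have h1 := (hbar p hpΩ hpd).2
        rw [homn, hpe, ← hR] at h1
        have h2 : lam * R ≤ lam * (om p - A * cuspPow β (om p)).re := by gcongr
        have h3 : lam * R = |Real.log m| := by rw [hlam]; field_simp
        rw [h3] at h2
        linarith [neg_abs_le (Real.log m)]
      have hc := (hbardiff p hpΩ hpd).continuousAt.norm
      exact nhdsWithin_le_nhds ((hc.eventually_lt_const (hval.trans_lt hM)).mono fun _ h => h.le)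
    · have hpf : p ∈ frontier Ω := by rw [h.isOpen_right.frontier_eq]; exact ⟨hpc, hpΩ⟩
      have h1 := h.tendsto_norm_frontier hpf
      have h2 : ∀ᶠ y in 𝓝[Ω] p, M⁻¹ < ‖F y‖ := h1.eventually_const_lt (inv_lt_one_of_one_lt₀ hM)
      have h3 := nhdsWithin_mono p (inter_subset_left (s := Ω) (t := Metric.ball q ρ₁)) h2
      filter_upwards [h3, self_mem_nhdsWithin] with y hy hyU
      have hy1 := (hbar y hyU.1 (le_of_lt hyU.2)).2
      have hFy : 0 < ‖F y‖ := hm.trans_le (hFm y hyU.1 (le_of_lt hyU.2))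
      rw [hGn, div_le_iff₀ hFy]
      have h4 : Real.exp (-(lam * (om y - A * cuspPow β (om y)).re)) ≤ 1 := by
        rw [Real.exp_le_one_iff]
        have : 0 ≤ (om y - A * cuspPow β (om y)).re := le_trans (by positivity) hy1
        nlinarith
      refine h4.trans ?_
      have hM0 : 0 < M := by linarith
      have := (inv_lt_iff_one_lt_mul₀ hM0).1 hy
      linarith

/-- The inverse map is uniformly interior away from the boundary. -/
lemma IsBiholomorphicPair.exists_norm_le_of_le_infDist
    (hb : Bornology.IsBounded Ω) (h : IsBiholomorphicPair (Metric.ball 0 1) Ω f F)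
    {δ : ℝ} (hδ : 0 < δ) :
    ∃ μ : ℝ, 0 < μ ∧ μ < 1 ∧ ∀ z ∈ Ω, δ ≤ Metric.infDist z Ωᶜ → ‖F z‖ ≤ μ := by
  set S := {z ∈ closure Ω | δ ≤ Metric.infDist z Ωᶜ} with hS
  have hSΩ : S ⊆ Ω := by
    intro z hz
    by_contra hcon
    have : Metric.infDist z Ωᶜ = 0 := Metric.infDist_zero_of_mem hcon
    have := hz.2
    linarith
  have hScl : IsClosed S :=
    isClosed_closure.inter (isClosed_le continuous_const (Metric.continuous_infDist_pt _))
  have hcpt : IsCompact S := Metric.isCompact_of_isClosed_isBounded hScl (hb.subset hSΩ)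
  rcases S.eq_empty_or_nonempty with he | hne
  · refine ⟨1 / 2, by norm_num, by norm_num, fun z hz hzd => ?_⟩
    have : z ∈ S := ⟨subset_closure hz, hzd⟩
    simp [he] at this
  · obtain ⟨y, hy, hmax⟩ := hcpt.exists_isMaxOn hne
      (h.holomorphic_right.continuousOn.mono hSΩ).norm
    have hy1 : ‖F y‖ < 1 := by simpa using h.mapsTo_right (hSΩ hy)
    refine ⟨max ‖F y‖ (1 / 2), by positivity, max_lt hy1 (by norm_num), fun z hz hzd => ?_⟩
    exact (hmax ⟨subset_closure hz, hzd⟩).trans (le_max_left _ _)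

lemma exists_frontier_dist_eq_infDist {z : ℂ} (hb : Bornology.IsBounded Ω) (hΩ : IsOpen Ω)
    (hz : z ∈ Ω) : 0 < Metric.infDist z Ωᶜ ∧
      ∃ q ∈ frontier Ω, dist z q = Metric.infDist z Ωᶜ := by
  have hne : (Ωᶜ).Nonempty := by
    rw [nonempty_compl]
    rintro rfl
    exact NormedSpace.unbounded_univ ℝ ℂ hb
  have hcl : IsClosed Ωᶜ := hΩ.isClosed_compl
  have hpos : 0 < Metric.infDist z Ωᶜ := (hcl.notMem_iff_infDist_pos hne).1 (by simpa using hz)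
  obtain ⟨q, hq, hqd⟩ := hcl.exists_infDist_eq_dist hne z
  refine ⟨hpos, q, ?_, hqd.symm⟩
  rw [hΩ.frontier_eq]
  refine ⟨closure_mono (Metric.ball_infDist_compl_subset (x := z)) ?_, hq⟩
  rw [closure_ball _ hpos.ne', Metric.mem_closedBall, hqd, dist_comm]

set_option maxHeartbeats 1000000 in
/-- Lower barrier (Hopf lemma): `1 - |F|` is at least proportional to the distance to the
boundary. -/
lemma IsBiholomorphicPair.exists_le_one_sub_norm (hβ0 : 0 < β) (hβ1 : β < 1)
    (hb : Bornology.IsBounded Ω) (h : IsBiholomorphicPair (Metric.ball 0 1) Ω f F)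
    (hC : 0 < C) (hρ : 0 < ρ) (hcusp : ∀ q ∈ frontier Ω, IsBetweenCusps β Ω C ρ q) :
    ∃ κ ρ₁ : ℝ, 0 < κ ∧ 0 < ρ₁ ∧ ∀ z ∈ Ω, Metric.infDist z Ωᶜ < ρ₁ →
      κ * Metric.infDist z Ωᶜ ≤ 1 - ‖F z‖ := by
  obtain ⟨A, ρ₀, hA, hρ₀, hρ₀1, -, hlow⟩ := exists_barriers hβ0 hβ1 hC
  set ρ₁ := min ρ₀ (ρ / 2) with hρ₁
  have hρ₁0 : 0 < ρ₁ := by positivity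
  have hρ₁a : ρ₁ ≤ ρ₀ := min_le_left _ _
  have hρ₁b : ρ₁ ≤ ρ / 2 := min_le_right _ _
  have hρ₁c : ρ₁ < ρ := by linarith
  -- This inequality makes the ball of radius `c` about any point of the arc `dist p q = ρ₁` with
  -- inward coordinate at least `2C ρ₁^{1+β}` satisfy the inner cusp condition. On that arc the
  -- distance to `Ωᶜ` is thus at least `c`, and `‖F‖ ≤ μ < 1`.
  obtain ⟨c, hc, hcρ, hcC⟩ : ∃ c : ℝ, 0 < c ∧ ρ₁ + c < ρ ∧
      C * (ρ₁ + c) ^ (1 + β) + c < 2 * C * ρ₁ ^ (1 + β) := by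
    have hcont : ContinuousAt (fun c : ℝ => C * (ρ₁ + c) ^ (1 + β) + c) 0 := by
      refine ContinuousAt.add (ContinuousAt.mul continuousAt_const ?_) continuousAt_id
      exact ContinuousAt.rpow_const (by fun_prop) (Or.inl (by simpa using hρ₁0.ne'))
    have hcont2 : ContinuousAt (fun c : ℝ => ρ₁ + c) 0 := by fun_prop
    have h1 : ∀ᶠ c in 𝓝[>] (0 : ℝ), C * (ρ₁ + c) ^ (1 + β) + c < 2 * C * ρ₁ ^ (1 + β) :=
      nhdsWithin_le_nhds (hcont.eventually_lt_const (by
        have : 0 < C * ρ₁ ^ (1 + β) := by positivity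
        simp only [add_zero]; linarith))
    have h2 : ∀ᶠ c in 𝓝[>] (0 : ℝ), ρ₁ + c < ρ :=
      nhdsWithin_le_nhds (hcont2.eventually_lt_const (by simpa using hρ₁c))
    obtain ⟨c, ⟨hc1, hc2⟩, hc3⟩ := ((h1.and h2).and self_mem_nhdsWithin).exists
    exact ⟨c, hc3, hc2, hc1⟩
  obtain ⟨μ, hμ0, hμ1, hμ⟩ := h.exists_norm_le_of_le_infDist hb hc
  -- Calibrated so that on the arc the exponential factor is at most `exp (-log μ) = μ⁻¹`, which
  -- compensates `‖F‖ ≤ μ`.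
  set lam := -Real.log μ / ((1 + A) * ρ₁) with hlam
  have hlogμ : Real.log μ < 0 := Real.log_neg hμ0 hμ1
  have hlam0 : 0 < lam := div_pos (by linarith) (by positivity)
  obtain ⟨ρ₂, hρ₂, -, hpow⟩ := exists_rpow_le hβ0
    (η := min (1 / (8 * C * 2)) (1 / (4 * A))) (by positivity)
  set ρ₃ := min (min (ρ₂ / 2) (1 / lam)) (ρ₁ / 2) with hρ₃
  have hρ₃a : ρ₃ ≤ ρ₂ / 2 := (min_le_left _ _).trans (min_le_left _ _)
  have hρ₃b : ρ₃ ≤ 1 / lam := (min_le_left _ _).trans (min_le_right _ _)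
  have hρ₃c : ρ₃ ≤ ρ₁ / 2 := min_le_right _ _
  refine ⟨lam / 8, ρ₃, by positivity, by positivity, fun z hz hzd => ?_⟩
  obtain ⟨hδ, q, hq, hqd⟩ := exists_frontier_dist_eq_infDist hb h.isOpen_right hz
  set δ := Metric.infDist z Ωᶜ with hδdef
  obtain ⟨n, hn, hcq⟩ := hcusp q hq
  have hn0 : n ≠ 0 := by rintro rfl; simp at hn
  set om : ℂ → ℂ := fun y => (y - q) / n with hom
  have homn : ∀ y, ‖om y‖ = dist y q := fun y => by
    simp only [hom]; rw [norm_div, hn, div_one, dist_eq_norm]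
  have homq : ∀ y, q + n * om y = y := fun y => by
    simp only [hom]; rw [mul_div_cancel₀ _ hn0]; ring
  have homc : Continuous om := by fun_prop
  -- the real part of the point in the frame
  have hpow1 := hpow (2 * δ) (by positivity) (by linarith)
  have hpow1' : C * (2 * δ) ^ (1 + β) ≤ δ / 8 := by
    calc C * (2 * δ) ^ (1 + β) ≤ C * (1 / (8 * C * 2) * (2 * δ)) := by
          gcongr; exact hpow1.trans (by gcongr; exact min_le_left _ _)
      _ = δ / 8 := by field_simp
  have hmono : ‖om z‖ ^ (1 + β) ≤ (2 * δ) ^ (1 + β) := by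
    rw [homn, hqd]; gcongr; linarith
  have hpow2 : A * ‖om z‖ ^ (1 + β) ≤ δ / 4 := by
    rw [homn, hqd]
    calc A * δ ^ (1 + β) ≤ A * (1 / (4 * A) * δ) := by
          gcongr; exact (hpow δ hδ.le (by linarith)).trans (by gcongr; exact min_le_right _ _)
      _ = δ / 4 := by field_simp
  -- The point `z - (3δ/4) n` is still in `Ω`, since the ball of radius `δ` about `z` is. Its inward
  -- coordinate therefore exceeds `-δ / 8`, and that of `z` exceeds `5δ / 8`.
  have hre : δ / 2 ≤ (om z).re := by
    have hmem : z - n * ((3 * δ / 4 : ℝ) : ℂ) ∈ Ω := by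
      refine Metric.ball_infDist_compl_subset (x := z) ?_
      rw [Metric.mem_ball, dist_eq_norm, ← hδdef]
      have : z - n * ((3 * δ / 4 : ℝ) : ℂ) - z = -(n * ((3 * δ / 4 : ℝ) : ℂ)) := by ring
      rw [this, norm_neg, norm_mul, hn, Complex.norm_real, Real.norm_eq_abs,
        abs_of_pos (by positivity)]
      linarith
    have hle : ‖om z - ((3 * δ / 4 : ℝ) : ℂ)‖ ≤ 2 * δ := by
      refine (norm_sub_le _ _).trans ?_
      rw [homn, hqd, Complex.norm_real, Real.norm_eq_abs, abs_of_pos (by positivity)]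
      linarith
    have := (hcq (om z - ((3 * δ / 4 : ℝ) : ℂ)) (by linarith)).2 (by
      rw [mul_sub, ← add_sub_assoc, homq]; exact hmem)
    rw [Complex.sub_re, Complex.ofReal_re] at this
    have h2 : C * ‖om z - ((3 * δ / 4 : ℝ) : ℂ)‖ ^ (1 + β) ≤ C * (2 * δ) ^ (1 + β) := by gcongr
    linarith
  -- A cusp of constant `2C`, twice that of `Ω`. Its closure meets the complement of `Ω` at most at
  -- `q`, and on its lateral boundary the second barrier is nonpositive.
  set V := {y : ℂ | y ∈ Metric.ball q ρ₁ ∧ 2 * C * ‖om y‖ ^ (1 + β) < (om y).re} with hV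
  have hcr : Continuous fun y => 2 * C * ‖om y‖ ^ (1 + β) :=
    continuous_const.mul (homc.norm.rpow_const fun _ => Or.inr (by linarith))
  have hcre : Continuous fun y => (om y).re := Complex.continuous_re.comp homc
  have hVo : IsOpen V := Metric.isOpen_ball.inter (isOpen_lt hcr hcre)
  have hVcl : closure V ⊆ {y | dist y q ≤ ρ₁ ∧ 2 * C * ‖om y‖ ^ (1 + β) ≤ (om y).re} := by
    refine closure_minimal (fun y hy => ⟨le_of_lt hy.1, hy.2.le⟩) ?_
    exact (isClosed_le (f := fun y : ℂ => dist y q) (by fun_prop) continuous_const).inter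
      (isClosed_le hcr hcre)
  have hclΩ : ∀ y ∈ closure V, om y ≠ 0 → y ∈ Ω ∧ om y ∈ Complex.slitPlane := by
    intro y hy h0
    obtain ⟨h1, h2⟩ := hVcl hy
    have hpos : 0 < C * ‖om y‖ ^ (1 + β) := by
      have := norm_pos_iff.2 h0; positivity
    have := (hcq (om y) (by rw [homn]; linarith)).1 (by linarith)
    rw [homq] at this
    exact ⟨this, Or.inl (by linarith)⟩
  have hV0 : ∀ y ∈ V, om y ≠ 0 := by
    intro y hy h0
    have := hy.2
    simp [h0, Real.zero_rpow (by linarith : (1 + β) ≠ 0)] at this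
  -- The maximum principle for `G` on `V` gives `‖F z‖ ≤ exp (-lam b)`, where the barrier satisfies
  -- `b ≥ δ / 4` at `z`. This is a quantitative Hopf lemma.
  set G : ℂ → ℂ := fun y => F y * Complex.exp (lam * (om y + A * cuspPow β (om y))) with hG
  have hGn : ∀ y, ‖G y‖ = ‖F y‖ * Real.exp (lam * (om y + A * cuspPow β (om y)).re) := fun y => by
    simp only [hG]
    rw [norm_mul, Complex.norm_exp, Complex.re_ofReal_mul]
  have hGd : ∀ y ∈ closure V, om y ≠ 0 → DifferentiableAt ℂ G y := fun y hy h0 => by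
    obtain ⟨h1, h2⟩ := hclΩ y hy h0
    have h3 : DifferentiableAt ℂ om y := by fun_prop
    have h4 : DifferentiableAt ℂ (fun y => cuspPow β (om y)) y := h3.cpow_const h2
    exact (h.symm.differentiableAt h1).mul (((h3.add (h4.const_mul _)).const_mul _).cexp)
  have hF1 : ∀ y ∈ Ω, ‖F y‖ ≤ 1 := fun y hy => by
    have : ‖F y‖ < 1 := by simpa using h.mapsTo_right hy
    exact this.le
  have hbup : ∀ y, dist y q ≤ ρ₁ →
      (om y + A * cuspPow β (om y)).re ≤ (1 + A) * dist y q := by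
    intro y hy
    have h1 := Complex.re_le_norm (om y)
    have h2 := abs_le.1 (abs_cuspPow_re_le β (om y))
    have h3 : ‖om y‖ ^ (1 + β) ≤ ‖om y‖ := by
      have : ‖om y‖ ≤ 1 := (homn y).le.trans (hy.trans (hρ₁a.trans hρ₀1))
      calc ‖om y‖ ^ (1 + β) ≤ ‖om y‖ ^ (1 : ℝ) :=
            Real.rpow_le_rpow_of_exponent_ge' (norm_nonneg _) this (by norm_num) (by linarith)
        _ = ‖om y‖ := Real.rpow_one _
    rw [Complex.add_re, Complex.re_ofReal_mul, ← homn]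
    nlinarith
  have hzV : z ∈ V := by
    refine ⟨by rw [Metric.mem_ball, hqd]; linarith, ?_⟩
    have : C * ‖om z‖ ^ (1 + β) ≤ C * (2 * δ) ^ (1 + β) := by gcongr
    linarith
  have key := norm_le_one_of_eventually_frontier hVo
    (Metric.isBounded_ball.subset fun y (hy : y ∈ V) => hy.1) (G := G)
    (fun y hy => (hGd y (subset_closure hy) (hV0 y hy)).differentiableWithinAt) ?_ hzV
  · rw [hGn] at key
    have hb1 : δ / 4 ≤ (om z + A * cuspPow β (om z)).re := by
      rw [Complex.add_re, Complex.re_ofReal_mul]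
      have h2 := abs_le.1 (abs_cuspPow_re_le β (om z))
      nlinarith
    set x := lam * (δ / 4) with hx
    have hx0 : 0 < x := by positivity
    have hx1 : x ≤ 1 := by
      have : δ ≤ 1 / lam := hzd.le.trans hρ₃b
      rw [le_div_iff₀ hlam0] at this
      rw [hx]; nlinarith
    have h3 : 1 + x ≤ Real.exp (lam * (om z + A * cuspPow β (om z)).re) := by
      have : lam * (δ / 4) ≤ lam * (om z + A * cuspPow β (om z)).re := by gcongr
      linarith [Real.add_one_le_exp (lam * (om z + A * cuspPow β (om z)).re)]
    have h4 : ‖F z‖ * (1 + x) ≤ 1 := le_trans (by gcongr) key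
    have h5 : lam / 8 * δ = x / 2 := by rw [hx]; ring
    rw [h5]
    -- From `‖F z‖ (1 + x) ≤ 1` with `x ≤ 1`: either `‖F z‖ ≤ 1/2` and `1 - ‖F z‖ ≥ 1/2 ≥ x / 2`, or
    -- `1 - ‖F z‖ ≥ ‖F z‖ x ≥ x / 2`.
    rcases le_total ‖F z‖ (1 / 2) with hF2 | hF2
    · linarith
    · have := mul_le_mul_of_nonneg_right hF2 hx0.le
      linarith
  · intro p hp M hM
    have hpcl := frontier_subset_closure hp
    obtain ⟨hpd, hpre⟩ := hVcl hpcl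
    have hpV : p ∉ V := by rw [hVo.frontier_eq] at hp; exact hp.2
    by_cases h0 : om p = 0
    · have hpq : p = q := by simpa [h0] using (homq p).symm
      have hc2 : ContinuousAt (fun y => Real.exp (lam * ((1 + A) * dist y q))) p := by fun_prop
      have hev := hc2.eventually_lt_const (u := M) (by simpa [hpq] using hM)
      filter_upwards [nhdsWithin_le_nhds hev, self_mem_nhdsWithin] with y hy hyV
      rw [hGn]
      have h1 := hF1 y (hclΩ y (subset_closure hyV) (hV0 y hyV)).1
      have h2 : Real.exp (lam * (om y + A * cuspPow β (om y)).re)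
          ≤ Real.exp (lam * ((1 + A) * dist y q)) := by
        gcongr; exact hbup y (le_of_lt hyV.1)
      calc _ ≤ 1 * Real.exp (lam * ((1 + A) * dist y q)) := by gcongr
        _ ≤ M := by rw [one_mul]; exact hy.le
    · have hpΩ := (hclΩ p hpcl h0).1
      have hval : ‖G p‖ ≤ 1 := by
        rw [hGn]
        rcases hpd.lt_or_eq with hlt | heq
        · have he : (om p).re = 2 * C * ‖om p‖ ^ (1 + β) := by
            refine le_antisymm ?_ hpre
            by_contra! hcon
            exact hpV ⟨hlt, hcon⟩
          have h1 := hlow (om p) h0 (by rw [homn]; linarith) he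
          have h2 : Real.exp (lam * (om p + A * cuspPow β (om p)).re) ≤ 1 := by
            rw [Real.exp_le_one_iff]; nlinarith
          exact mul_le_one₀ (hF1 p hpΩ) (Real.exp_pos _).le h2
        · have hinf : c ≤ Metric.infDist p Ωᶜ := by
            have hne : (Ωᶜ).Nonempty := by
              rw [nonempty_compl]
              rintro rfl
              exact NormedSpace.unbounded_univ ℝ ℂ hb
            rw [Metric.le_infDist hne]
            intro y hy
            by_contra! hcon
            refine hy ?_
            have hyp : ‖om y - om p‖ < c := by
              have : om y - om p = (y - p) / n := by simp only [hom]; ring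
              rw [this, norm_div, hn, div_one, ← dist_eq_norm, dist_comm]; exact hcon
            have hyn : ‖om y‖ ≤ ρ₁ + c := by
              have := norm_le_insert' (om y) (om p)
              rw [homn p, heq] at this
              linarith
            have := (hcq (om y) (by linarith)).1 (by
              have h1 : |(om y - om p).re| < c := (Complex.abs_re_le_norm _).trans_lt hyp
              rw [Complex.sub_re] at h1
              have h2 : C * ‖om y‖ ^ (1 + β) ≤ C * (ρ₁ + c) ^ (1 + β) := by gcongr
              rw [homn p, heq] at hpre
              linarith [(abs_lt.1 h1).1])
            rwa [homq] at this
          have h1 := hμ p hpΩ hinf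
          have h2 : Real.exp (lam * (om p + A * cuspPow β (om p)).re) ≤ Real.exp (-Real.log μ) := by
            rw [Real.exp_le_exp]
            calc lam * (om p + A * cuspPow β (om p)).re ≤ lam * ((1 + A) * dist p q) := by
                  gcongr; exact hbup p hpd
              _ = -Real.log μ := by rw [heq, hlam]; field_simp
          rw [Real.exp_neg, Real.exp_log hμ0] at h2
          calc _ ≤ μ * μ⁻¹ := by gcongr
            _ = 1 := mul_inv_cancel₀ hμ0.ne'
      have hc := (hGd p hpcl h0).continuousAt.norm
      exact nhdsWithin_le_nhds ((hc.eventually_lt_const (hval.trans_lt hM)).mono fun _ h => h.le)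

end GreenBounds

/-! ### Bilipschitz bounds for conformal representations -/

section

variable {β : ℝ} {Ω : Set ℂ} {f F : ℂ → ℂ} {C ρ : ℝ}

/-- The inverse of a conformal representation has bounded derivative. -/
lemma IsBiholomorphicPair.exists_norm_deriv_symm_le (hβ0 : 0 < β) (hβ1 : β < 1)
    (hΩ : IsHolderDomain β Ω) (h : IsBiholomorphicPair (Metric.ball 0 1) Ω f F) :
    ∃ M : ℝ, 0 < M ∧ ∀ z ∈ Ω, ‖deriv F z‖ ≤ M := by
  obtain ⟨C, ρ, hC, hρ, hcusp⟩ := hΩ.exists_isBetweenCusps hβ0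
  obtain ⟨K, ρ₁, hK, hρ₁, H⟩ := h.exists_one_sub_norm_le hβ0 hβ1 hΩ.isBounded hC hρ hcusp
  refine ⟨2 * K + 2 / ρ₁, by positivity, fun z hz => ?_⟩
  obtain ⟨hδ, q, hq, hqd⟩ := exists_frontier_dist_eq_infDist hΩ.isBounded h.isOpen_right hz
  set δ := Metric.infDist z Ωᶜ with hδdef
  have hsub : Metric.ball z δ ⊆ Ω := Metric.ball_infDist_compl_subset
  -- Schwarz–Pick on the largest disc about `z` inside `Ω`. Near the boundary the upper barrier
  -- bounds the quotient `(1 - ‖F z‖) / δ`; elsewhere `δ ≥ ρ₁` suffices.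
  have hSP := norm_deriv_le_of_mapsTo_unit_ball hδ (h.holomorphic_right.mono hsub)
    (h.mapsTo_right.mono hsub Subset.rfl)
  refine hSP.trans ?_
  rcases lt_or_ge δ ρ₁ with hlt | hge
  · have := H q hq z hz (hqd ▸ hlt)
    rw [hqd] at this
    have h1 : 2 * (1 - ‖F z‖) / δ ≤ 2 * K := by rw [div_le_iff₀ hδ]; linarith
    have : 0 < 2 / ρ₁ := by positivity
    linarith
  · have h1 : 2 * (1 - ‖F z‖) / δ ≤ 2 / ρ₁ := by
      have := norm_nonneg (F z)
      gcongr
      linarith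
    linarith

/-- A conformal representation of a `C^{1,β}` domain has bounded derivative. -/
lemma IsBiholomorphicPair.exists_norm_deriv_le (hβ0 : 0 < β) (hβ1 : β < 1)
    (hΩ : IsHolderDomain β Ω) (h : IsBiholomorphicPair (Metric.ball 0 1) Ω f F) :
    ∃ M : ℝ, 0 < M ∧ ∀ z ∈ Metric.ball (0 : ℂ) 1, ‖deriv f z‖ ≤ M := by
  obtain ⟨C, ρ, hC, hρ, hcusp⟩ := hΩ.exists_isBetweenCusps hβ0
  obtain ⟨κ, ρ₁, hκ, hρ₁, H⟩ := h.exists_le_one_sub_norm hβ0 hβ1 hΩ.isBounded hC hρ hcusp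
  obtain ⟨ρ₂, hρ₂, -, hpow⟩ := exists_rpow_le hβ0 (η := 1 / (8 * C)) (by positivity)
  obtain ⟨B, hB⟩ := hΩ.isBounded.exists_norm_le
  have hB0 : 0 ≤ B := (norm_nonneg _).trans (hB (f 0) (h.mapsTo_left (by simp)))
  set ρ₃ := min (min ρ₁ (ρ₂ / 2)) (ρ / 2) with hρ₃
  have hρ₃0 : 0 < ρ₃ := by positivity
  have hρ₃a : ρ₃ ≤ ρ₁ := (min_le_left _ _).trans (min_le_left _ _)
  have hρ₃b : ρ₃ ≤ ρ₂ / 2 := (min_le_left _ _).trans (min_le_right _ _)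
  have hρ₃c : ρ₃ ≤ ρ / 2 := min_le_right _ _
  obtain ⟨μ, hμ0, hμ1, hμ⟩ := h.exists_norm_le_of_le_infDist hΩ.isBounded hρ₃0
  have hμ' : 0 < 1 - μ := by linarith
  refine ⟨16 / κ + (2 * B) / (1 - μ), by positivity, fun z hz => ?_⟩
  have hz1 : ‖z‖ < 1 := by simpa using hz
  have hfz := h.mapsTo_left hz
  have hsub : Metric.ball z (1 - ‖z‖) ⊆ Metric.ball 0 1 := by
    refine Metric.ball_subset_ball' ?_
    rw [dist_zero_right]; linarith
  have hr : 0 < 1 - ‖z‖ := by linarith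
  obtain ⟨hδ, q, hq, hqd⟩ := exists_frontier_dist_eq_infDist hΩ.isBounded h.isOpen_right hfz
  set δ := Metric.infDist (f z) Ωᶜ with hδdef
  rcases lt_or_ge δ ρ₃ with hlt | hge
  · obtain ⟨n, hn, hcq⟩ := hcusp q hq
    have hn0 : n ≠ 0 := by rintro rfl; simp at hn
    have h1 := H _ hfz (hlt.trans_le hρ₃a)
    rw [h.left_inv z hz, ← hδdef] at h1
    have hpow1 := hpow (2 * δ) (by positivity) (by linarith)
    have hpow1' : C * (2 * δ) ^ (1 + β) ≤ δ / 4 := by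
      calc C * (2 * δ) ^ (1 + β) ≤ C * (1 / (8 * C) * (2 * δ)) := by gcongr
        _ = δ / 4 := by field_simp; norm_num
    -- An exterior point at distance comparable to `δ`: the outer cusp condition keeps `Ω` at
    -- distance at least `δ / 2` from `p`. So `(f - p)⁻¹` is bounded by `2 / δ`, and a Cauchy
    -- estimate on the disc of radius `1 - ‖z‖` bounds `‖f'(z)‖ (1 - ‖z‖)` by `16 δ`.
    set p := q - n * (δ : ℂ) with hp
    have hext : ∀ y ∈ Ω, δ / 2 ≤ ‖y - p‖ := by
      intro y hy
      by_contra! hcon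
      set w := (y - q) / n with hw
      have hwy : q + n * w = y := by rw [hw, mul_div_cancel₀ _ hn0]; ring
      have hwp : ‖w + (δ : ℂ)‖ < δ / 2 := by
        have : w + (δ : ℂ) = (y - p) / n := by rw [hw, hp]; field_simp; ring
        rw [this, norm_div, hn, div_one]; exact hcon
      have hwn : ‖w‖ ≤ 2 * δ := by
        have := norm_sub_le (w + (δ : ℂ)) (δ : ℂ)
        rw [add_sub_cancel_right, Complex.norm_real, Real.norm_eq_abs, abs_of_pos hδ] at this
        linarith
      have h2 := (hcq w (by linarith)).2 (by rwa [hwy])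
      have h3 : C * ‖w‖ ^ (1 + β) ≤ C * (2 * δ) ^ (1 + β) := by gcongr
      have h4 := (abs_lt.1 ((Complex.abs_re_le_norm _).trans_lt hwp)).2
      rw [Complex.add_re, Complex.ofReal_re] at h4
      linarith
    have hdist : ‖f z - p‖ ≤ 2 * δ := by
      have : f z - p = (f z - q) + n * (δ : ℂ) := by rw [hp]; ring
      rw [this]
      refine (norm_add_le _ _).trans ?_
      rw [← dist_eq_norm, hqd, norm_mul, hn, Complex.norm_real, Real.norm_eq_abs, abs_of_pos hδ]
      linarith
    have hne : ∀ y ∈ Ω, y - p ≠ 0 := fun y hy => norm_pos_iff.1 (by linarith [hext y hy])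
    have hinv : ∀ y ∈ Ω, ‖(y - p)⁻¹‖ ≤ 2 / δ := fun y hy => by
      rw [norm_inv, inv_le_comm₀ (norm_pos_iff.2 (hne y hy)) (by positivity), inv_div]
      exact hext y hy
    have key := Complex.norm_deriv_le_div_of_mapsTo_ball (f := fun y => (f y - p)⁻¹) (c := z)
      (R₁ := 1 - ‖z‖) (R₂ := 4 / δ)
      (((h.holomorphic_left.mono hsub).sub_const p).inv
        fun y hy => hne _ (h.mapsTo_left (hsub hy)))
      (fun y hy => by
        rw [Metric.mem_closedBall, dist_eq_norm]
        refine (norm_sub_le _ _).trans ?_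
        have e1 := hinv _ (h.mapsTo_left (hsub hy))
        have e2 := hinv _ hfz
        have : 4 / δ = 2 / δ + 2 / δ := by ring
        linarith) hr
    have hd := (((h.differentiableAt hz).hasDerivAt.sub_const p).fun_inv (hne _ hfz)).deriv
    rw [hd, norm_div, norm_neg, norm_pow,
      div_le_div_iff₀ (by have := norm_pos_iff.2 (hne _ hfz); positivity) hr] at key
    have h5 : ‖f z - p‖ ^ 2 ≤ (2 * δ) ^ 2 := by gcongr
    have h6 : ‖deriv f z‖ * (1 - ‖z‖) ≤ 16 * δ := by
      calc _ ≤ 4 / δ * ‖f z - p‖ ^ 2 := key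
        _ ≤ 4 / δ * (2 * δ) ^ 2 := by gcongr
        _ = 16 * δ := by field_simp; ring
    -- The Hopf bound `κ δ ≤ 1 - ‖z‖` cancels `δ`.
    have h7 : ‖deriv f z‖ ≤ 16 / κ := by
      rw [le_div_iff₀ hκ]
      have h8 : ‖deriv f z‖ * (κ * δ) ≤ ‖deriv f z‖ * (1 - ‖z‖) := by gcongr
      have h9 : ‖deriv f z‖ * κ * δ ≤ 16 * δ := by nlinarith
      exact le_of_mul_le_mul_right h9 hδ
    have : 0 ≤ 2 * B / (1 - μ) := by positivity
    linarith
  · have h1 := hμ _ hfz hge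
    rw [h.left_inv z hz] at h1
    have key := Complex.norm_deriv_le_div_of_mapsTo_ball (f := f) (c := z)
      (R₁ := 1 - ‖z‖) (R₂ := 2 * B) (h.holomorphic_left.mono hsub)
      (fun y hy => by
        rw [Metric.mem_closedBall, dist_eq_norm]
        refine (norm_sub_le _ _).trans ?_
        have e1 := hB _ (h.mapsTo_left (hsub hy))
        have e2 := hB _ hfz
        linarith) hr
    have : 2 * B / (1 - ‖z‖) ≤ 2 * B / (1 - μ) := by gcongr
    have : 0 < 16 / κ := by positivity
    linarith

/-- Bounded derivative implies Lipschitz on a bounded `C^{1,β}` domain. -/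
lemma IsHolderDomain.exists_lipschitz (hΩ : IsHolderDomain β Ω) {G : ℂ → ℂ} {M : ℝ} (hM : 0 ≤ M)
    (hG : DifferentiableOn ℂ G Ω) (hG' : ∀ z ∈ Ω, ‖deriv G z‖ ≤ M) {B : ℝ}
    (hB : ∀ z ∈ Ω, ‖G z‖ ≤ B) :
    ∃ K : ℝ, 0 < K ∧ ∀ z₁ ∈ Ω, ∀ z₂ ∈ Ω, ‖G z₁ - G z₂‖ ≤ K * ‖z₁ - z₂‖ := by
  have hcpt : IsCompact (closure Ω) :=
    Metric.isCompact_of_isClosed_isBounded isClosed_closure hΩ.isBounded.closure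
  -- Compactness of the closure yields one scale `ρ` and one constant for all close pairs. Pairs at
  -- distance at least `ρ` are handled by the bound on `G`.
  obtain ⟨K, ρ, hK, hρ, H⟩ : ∃ K ρ : ℝ, 0 < K ∧ 0 < ρ ∧ ∀ p ∈ closure Ω, ∀ z₁ ∈ Ω, ∀ z₂ ∈ Ω,
      dist z₁ p < ρ → dist z₂ p < ρ → ‖G z₁ - G z₂‖ ≤ K * ‖z₁ - z₂‖ := by
    refine hcpt.induction_on
      (p := fun S => ∃ K ρ : ℝ, 0 < K ∧ 0 < ρ ∧ ∀ p ∈ S, ∀ z₁ ∈ Ω, ∀ z₂ ∈ Ω,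
      dist z₁ p < ρ → dist z₂ p < ρ → ‖G z₁ - G z₂‖ ≤ K * ‖z₁ - z₂‖) ?_ ?_ ?_ ?_
    · exact ⟨1, 1, one_pos, one_pos, by simp⟩
    · rintro S T hST ⟨C, ρ, hC, hρ, H⟩
      exact ⟨C, ρ, hC, hρ, fun q hq => H q (hST hq)⟩
    · rintro S T ⟨C, ρ, hC, hρ, H⟩ ⟨C', ρ', hC', hρ', H'⟩
      refine ⟨max C C', min ρ ρ', by positivity, by positivity, ?_⟩
      rintro q (hq | hq) z₁ h₁ z₂ h₂ hd₁ hd₂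
      · refine (H q hq z₁ h₁ z₂ h₂ (hd₁.trans_le (min_le_left _ _))
          (hd₂.trans_le (min_le_left _ _))).trans ?_
        gcongr; exact le_max_left _ _
      · refine (H' q hq z₁ h₁ z₂ h₂ (hd₁.trans_le (min_le_right _ _))
          (hd₂.trans_le (min_le_right _ _))).trans ?_
        gcongr; exact le_max_right _ _
    · intro p hp
      suffices ∃ ρ K : ℝ, 0 < ρ ∧ 0 < K ∧ ∀ z₁ ∈ Ω, ∀ z₂ ∈ Ω, dist z₁ p < ρ → dist z₂ p < ρ →
          ‖G z₁ - G z₂‖ ≤ K * ‖z₁ - z₂‖ by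
        obtain ⟨ρ, K, hρ, hK, H⟩ := this
        refine ⟨Metric.ball p (ρ / 2), mem_nhdsWithin_of_mem_nhds
          (Metric.ball_mem_nhds p (by positivity)), K, ρ / 2, hK, by positivity,
          fun q hq z₁ h₁ z₂ h₂ hd₁ hd₂ => H z₁ h₁ z₂ h₂ ?_ ?_⟩
        · exact (dist_triangle _ q _).trans_lt (by rw [Metric.mem_ball] at hq; linarith)
        · exact (dist_triangle _ q _).trans_lt (by rw [Metric.mem_ball] at hq; linarith)
      by_cases hpΩ : p ∈ Ω
      · obtain ⟨ρ, hρ, hsub⟩ := Metric.isOpen_iff.1 hΩ.isOpen p hpΩ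
        refine ⟨ρ, M + 1, hρ, by positivity, fun z₁ h₁ z₂ h₂ hd₁ hd₂ => ?_⟩
        have := (convex_ball p ρ).norm_image_sub_le_of_norm_deriv_le
          (fun x hx => (hG x (hsub hx)).differentiableAt (hΩ.isOpen.mem_nhds (hsub hx)))
          (fun x hx => hG' x (hsub hx)) hd₂ hd₁
        refine this.trans ?_
        gcongr; linarith
      · exact (hΩ.boundary p (by rw [hΩ.isOpen.frontier_eq]; exact ⟨hp, hpΩ⟩)).exists_lipschitz
          hΩ.isOpen hM hG hG'
  have hB0 : 0 ≤ |B| := abs_nonneg _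
  refine ⟨max K (2 * |B| / ρ), by positivity, fun z₁ h₁ z₂ h₂ => ?_⟩
  rcases lt_or_ge (dist z₂ z₁) ρ with hlt | hge
  · refine (H z₁ (subset_closure h₁) z₁ h₁ z₂ h₂ (by simpa using hρ) hlt).trans ?_
    gcongr; exact le_max_left _ _
  · have h1 : ‖G z₁ - G z₂‖ ≤ 2 * |B| := by
      refine (norm_sub_le _ _).trans ?_
      have := le_abs_self B
      linarith [hB z₁ h₁, hB z₂ h₂]
    rw [dist_comm, dist_eq_norm] at hge
    calc _ ≤ 2 * |B| := h1
      _ = 2 * |B| / ρ * ρ := by field_simp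
      _ ≤ max K (2 * |B| / ρ) * ‖z₁ - z₂‖ := by gcongr; exact le_max_right _ _

end

/-- A biholomorphic pair of Lipschitz maps. -/
structure IsBilipschitzPair (U V : Set ℂ) (f F : ℂ → ℂ) (K : NNReal) : Prop extends
    IsBiholomorphicPair U V f F where
  lipschitz_left : LipschitzOnWith K f U
  lipschitz_right : LipschitzOnWith K F V

/-- Bounded derivatives integrate to Lipschitz bounds: for `f` because the disc is convex, for the
inverse because nearby points of a `C^{1,β}` domain are joined by paths of comparable length. -/
lemma IsConformalRep.exists_isBilipschitzPair {β : ℝ} (hβ0 : 0 < β) (hβ1 : β < 1) {Ω : Set ℂ}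
    (hΩ : IsHolderDomain β Ω) {f : ℂ → ℂ} (hf : IsConformalRep f Ω) :
    ∃ F K, IsBilipschitzPair (Metric.ball 0 1) Ω f F K := by
  obtain ⟨F, h⟩ := exists_isBiholomorphicPair Metric.isOpen_ball hf.holomorphic hf.injective
  rw [hf.image_eq] at h
  obtain ⟨M, hM, h1⟩ := h.exists_norm_deriv_symm_le hβ0 hβ1 hΩ
  obtain ⟨M', hM', h2⟩ := h.exists_norm_deriv_le hβ0 hβ1 hΩ
  obtain ⟨K, hK, h3⟩ := hΩ.exists_lipschitz hM.le h.holomorphic_right h1 (B := 1)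
    (fun z hz => by
      have : ‖F z‖ < 1 := by simpa using h.mapsTo_right hz
      exact this.le)
  refine ⟨F, max K.toNNReal M'.toNNReal, { h with lipschitz_left := ?_, lipschitz_right := ?_ }⟩
  · refine LipschitzOnWith.weaken (K := M'.toNNReal) ?_ (le_max_right _ _)
    refine LipschitzOnWith.of_dist_le_mul fun x hx y hy => ?_
    rw [Real.coe_toNNReal _ hM'.le, dist_eq_norm, dist_eq_norm]
    exact (convex_ball (0 : ℂ) 1).norm_image_sub_le_of_norm_deriv_le
      (fun x hx => h.differentiableAt hx) h2 hy hx
  · refine LipschitzOnWith.weaken (K := K.toNNReal) ?_ (le_max_left _ _)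
    refine LipschitzOnWith.of_dist_le_mul fun x hx y hy => ?_
    rw [Real.coe_toNNReal _ hK.le, dist_eq_norm, dist_eq_norm]
    exact h3 x hx y hy

namespace IsBilipschitzPair

variable {U V : Set ℂ} {f F : ℂ → ℂ} {K : NNReal}

lemma symm (h : IsBilipschitzPair U V f F K) : IsBilipschitzPair V U F f K :=
  { h.toIsBiholomorphicPair.symm with
    lipschitz_left := h.lipschitz_right
    lipschitz_right := h.lipschitz_left }

/-- A Lipschitz extension to the plane supplies the limit at every point of the closure, so that the
extension by continuity has genuine limits there. -/
lemma exists_extension (h : IsBilipschitzPair U V f F K) :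
    ∃ g : ℂ → ℂ, Continuous g ∧ EqOn f g U ∧ EqOn (extendFrom U f) g (closure U) := by
  obtain ⟨g, hg, hfg⟩ := h.lipschitz_left.extend_finite_dimension
  refine ⟨g, hg.continuous, hfg, fun x hx => ?_⟩
  refine extendFrom_eq hx ?_
  refine (hg.continuous.continuousAt.tendsto.mono_left nhdsWithin_le_nhds).congr' ?_
  filter_upwards [self_mem_nhdsWithin] with y hy using (hfg hy).symm

lemma extend_eqOn (h : IsBilipschitzPair U V f F K) : EqOn (extendFrom U f) f U := by
  obtain ⟨g, -, h1, h2⟩ := h.exists_extension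
  exact fun x hx => (h2 (subset_closure hx)).trans (h1 hx).symm

lemma continuousOn_extend (h : IsBilipschitzPair U V f F K) :
    ContinuousOn (extendFrom U f) (closure U) := by
  obtain ⟨g, hg, -, h2⟩ := h.exists_extension
  exact hg.continuousOn.congr h2

lemma lipschitz_extend (h : IsBilipschitzPair U V f F K) :
    LipschitzOnWith K (extendFrom U f) (closure U) := by
  refine LipschitzOnWith.closure h.continuousOn_extend fun x hx y hy => ?_
  rw [h.extend_eqOn hx, h.extend_eqOn hy]
  exact h.lipschitz_left hx hy

lemma mapsTo_extend_closure (h : IsBilipschitzPair U V f F K) :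
    MapsTo (extendFrom U f) (closure U) (closure V) :=
  (h.mapsTo_left.congr h.extend_eqOn.symm).closure_of_continuousOn h.continuousOn_extend

lemma extend_left_inv (h : IsBilipschitzPair U V f F K) {x : ℂ} (hx : x ∈ closure U) :
    extendFrom V F (extendFrom U f x) = x := by
  have hc : ContinuousOn (fun x => extendFrom V F (extendFrom U f x)) (closure U) :=
    h.symm.continuousOn_extend.comp h.continuousOn_extend h.mapsTo_extend_closure
  have heq : EqOn (fun x => extendFrom V F (extendFrom U f x)) id U := fun y hy => by
    simp only [h.extend_eqOn hy, h.symm.extend_eqOn (h.mapsTo_left hy), h.left_inv y hy, id]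
  exact heq.of_subset_closure hc continuousOn_id subset_closure Subset.rfl hx

lemma mapsTo_extend_frontier (h : IsBilipschitzPair U V f F K) :
    MapsTo (extendFrom U f) (frontier U) (frontier V) := by
  intro x hx
  have hxc := frontier_subset_closure hx
  rw [h.isOpen_right.frontier_eq]
  refine ⟨h.mapsTo_extend_closure hxc, fun hV => ?_⟩
  rw [h.isOpen_left.frontier_eq] at hx
  refine hx.2 ?_
  have := h.extend_left_inv hxc
  rw [h.symm.extend_eqOn hV] at this
  rw [← this]
  exact h.mapsTo_right hV

lemma tendsto_extend (h : IsBilipschitzPair U V f F K) {p : ℂ} (hp : p ∈ closure U) :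
    Tendsto f (𝓝[U] p) (𝓝[V] (extendFrom U f p)) := by
  obtain ⟨g, hg, h1, h2⟩ := h.exists_extension
  rw [h2 hp]
  refine tendsto_nhdsWithin_iff.2 ⟨?_, ?_⟩
  · refine (hg.continuousAt.tendsto.mono_left nhdsWithin_le_nhds).congr' ?_
    filter_upwards [self_mem_nhdsWithin] with y hy using (h1 hy).symm
  · filter_upwards [self_mem_nhdsWithin] with y hy using h.mapsTo_left hy

lemma norm_deriv_le (h : IsBilipschitzPair U V f F K) {z : ℂ} (hz : z ∈ U) : ‖deriv f z‖ ≤ K :=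
  norm_deriv_le_of_lipschitzOn (h.isOpen_left.mem_nhds hz) h.lipschitz_left

end IsBilipschitzPair

/-! ### Change of variables by conformal maps -/

lemma det_smul_one_complex (c : ℂ) : (c • (1 : ℂ →L[ℝ] ℂ)).det = ‖c‖ ^ 2 := by
  have h : ((c • (1 : ℂ →L[ℝ] ℂ) : ℂ →L[ℝ] ℂ) : ℂ →ₗ[ℝ] ℂ) = Algebra.lmul ℝ ℂ c := by
    ext
    simp
  rw [ContinuousLinearMap.det, h, ← Algebra.norm_apply, Algebra.norm_complex_apply,
    Complex.normSq_eq_norm_sq]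

lemma fderiv_apply_complex {E : Type*} [NormedAddCommGroup E] [NormedSpace ℝ E]
    (u : ℂ → E) (z c : ℂ) : fderiv ℝ u z c = c.re • partialX u z + c.im • partialY u z := by
  have : c = c.re • (1 : ℂ) + c.im • Complex.I := by
    simp [Complex.re_add_im]
  conv_lhs => rw [this]
  rw [map_add, map_smul, map_smul]
  rfl

lemma norm_partialX_le {E : Type*} [NormedAddCommGroup E] [NormedSpace ℝ E]
    (u : ℂ → E) (z : ℂ) : ‖partialX u z‖ ≤ ‖fderiv ℝ u z‖ := by
  simpa [partialX] using (fderiv ℝ u z).le_opNorm 1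

lemma norm_partialY_le {E : Type*} [NormedAddCommGroup E] [NormedSpace ℝ E]
    (u : ℂ → E) (z : ℂ) : ‖partialY u z‖ ≤ ‖fderiv ℝ u z‖ := by
  simpa [partialY] using (fderiv ℝ u z).le_opNorm Complex.I

lemma norm_fderiv_le_add {E : Type*} [NormedAddCommGroup E] [NormedSpace ℝ E]
    (u : ℂ → E) (z : ℂ) : ‖fderiv ℝ u z‖ ≤ ‖partialX u z‖ + ‖partialY u z‖ := by
  refine ContinuousLinearMap.opNorm_le_bound _ (by positivity) fun c => ?_
  rw [fderiv_apply_complex]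
  refine (norm_add_le _ _).trans ?_
  rw [norm_smul, norm_smul, Real.norm_eq_abs, Real.norm_eq_abs, add_mul]
  have h1 := Complex.abs_re_le_norm c
  have h2 := Complex.abs_im_le_norm c
  rw [mul_comm ‖partialX u z‖, mul_comm ‖partialY u z‖]
  gcongr

/-- The integrand `∇^⊥ψ · (v ∧ ∇v)` of the angular pairing. -/
noncomputable def curlDot (ψ : ℂ → ℝ) (v : ℂ → ℂ) (z : ℂ) : ℝ :=
  partialX ψ z * wedge (v z) (partialY v z) - partialY ψ z * wedge (v z) (partialX v z)

lemma curlDot_eq_zero_of_eventually {ψ : ℂ → ℝ} (v : ℂ → ℂ) {z : ℂ} (h : ∀ᶠ y in 𝓝 z, ψ y = 0) :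
    curlDot ψ v z = 0 := by
  have : fderiv ℝ ψ z = 0 := by
    rw [Filter.EventuallyEq.fderiv_eq (f := fun _ => (0 : ℝ)) h]; simp
  simp [curlDot, partialX, partialY, this]

lemma isSmoothFiniteEnergy_iff {E : Type*} [NormedAddCommGroup E] [NormedSpace ℝ E]
    {U : Set ℂ} (hU : IsOpen U) {u : ℂ → E} :
    IsSmoothFiniteEnergy U u ↔
      ContDiffOn ℝ ∞ u U ∧ ∫⁻ z in U, ‖fderiv ℝ u z‖ₑ ^ (2 : ℝ) < ⊤ := by
  have key : ContDiffOn ℝ ∞ u U → (MemLp (fderiv ℝ u) 2 (volume.restrict U) ↔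
      ∫⁻ z in U, ‖fderiv ℝ u z‖ₑ ^ (2 : ℝ) < ⊤) := fun hu => by
    have hm : AEStronglyMeasurable (fderiv ℝ u) (volume.restrict U) :=
      (hu.continuousOn_fderiv_of_isOpen hU (by simp)).aestronglyMeasurable hU.measurableSet
    rw [MemLp, eLpNorm_lt_top_iff_lintegral_rpow_enorm_lt_top (by norm_num) (by norm_num)]
    simp [hm]
  exact ⟨fun h => ⟨h.1, (key h.1).1 h.2⟩, fun h => ⟨h.1, (key h.1).2 h.2⟩⟩

lemma IsSmoothFiniteEnergy.mono {E : Type*} [NormedAddCommGroup E] [NormedSpace ℝ E]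
    {U W : Set ℂ} {u : ℂ → E} (h : IsSmoothFiniteEnergy U u) (hW : W ⊆ U) :
    IsSmoothFiniteEnergy W u :=
  ⟨h.1.mono hW, h.2.mono_measure (Measure.restrict_mono hW le_rfl)⟩

lemma IsSmoothFiniteEnergy.differentiableAt {E : Type*} [NormedAddCommGroup E] [NormedSpace ℝ E]
    {U : Set ℂ} {u : ℂ → E} (h : IsSmoothFiniteEnergy U u) (hU : IsOpen U) {z : ℂ} (hz : z ∈ U) :
    DifferentiableAt ℝ u z :=
  (h.1.differentiableOn (by simp)).differentiableAt (hU.mem_nhds hz)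

namespace IsBiholomorphicPair

variable {U V : Set ℂ} {f F : ℂ → ℂ}

lemma hasFDerivAt (h : IsBiholomorphicPair U V f F) {z : ℂ} (hz : z ∈ U) :
    HasFDerivAt f (deriv f z • (1 : ℂ →L[ℝ] ℂ)) z :=
  (h.differentiableAt hz).hasDerivAt.complexToReal_fderiv

lemma contDiffOn (h : IsBiholomorphicPair U V f F) : ContDiffOn ℝ ∞ f U :=
  (h.holomorphic_left.contDiffOn h.isOpen_left).restrict_scalars ℝ

lemma restrict (h : IsBiholomorphicPair U V f F) {W : Set ℂ} (hW : IsOpen W) (hWV : W ⊆ V) :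
    IsBiholomorphicPair (F '' W) W f F where
  isOpen_left := by
    have : F '' W = U ∩ f ⁻¹' W := by
      ext z
      constructor
      · rintro ⟨w, hw, rfl⟩
        exact ⟨h.mapsTo_right (hWV hw), by simpa [h.right_inv w (hWV hw)] using hw⟩
      · rintro ⟨hz, hw⟩
        exact ⟨f z, hw, h.left_inv z hz⟩
    rw [this]
    exact h.holomorphic_left.continuousOn.isOpen_inter_preimage h.isOpen_left hW
  isOpen_right := hW
  holomorphic_left := h.holomorphic_left.mono (by
    rintro _ ⟨w, hw, rfl⟩; exact h.mapsTo_right (hWV hw))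
  holomorphic_right := h.holomorphic_right.mono hWV
  mapsTo_left := by rintro _ ⟨w, hw, rfl⟩; simpa [h.right_inv w (hWV hw)] using hw
  mapsTo_right := mapsTo_image F W
  left_inv := by rintro _ ⟨w, hw, rfl⟩; rw [h.right_inv w (hWV hw)]
  right_inv := fun w hw => h.right_inv w (hWV hw)

lemma lintegral_image (h : IsBiholomorphicPair U V f F) {s : Set ℂ} (hs : MeasurableSet s)
    (hsU : s ⊆ U) (g : ℂ → ENNReal) :
    ∫⁻ w in f '' s, g w = ∫⁻ z in s, ‖deriv f z‖ₑ ^ (2 : ℝ) * g (f z) := by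
  rw [lintegral_image_eq_lintegral_abs_det_fderiv_mul volume hs
    (fun x hx => (h.hasFDerivAt (hsU hx)).hasFDerivWithinAt) (h.injOn.mono hsU)]
  congr 1
  ext z
  rw [det_smul_one_complex, abs_of_nonneg (by positivity), ENNReal.ofReal_pow (norm_nonneg _),
    ofReal_norm]
  norm_cast

lemma integral_image (h : IsBiholomorphicPair U V f F) (g : ℂ → ℝ) :
    ∫ w in V, g w = ∫ z in U, ‖deriv f z‖ ^ 2 * g (f z) := by
  rw [← h.image_eq, integral_image_eq_integral_abs_det_fderiv_smul volume
    h.isOpen_left.measurableSet (fun x hx => (h.hasFDerivAt hx).hasFDerivWithinAt) h.injOn]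
  simp only [det_smul_one_complex, abs_pow, abs_norm, smul_eq_mul]

section Calculus

variable {E : Type*} [NormedAddCommGroup E] [NormedSpace ℝ E]

lemma fderiv_comp_eq (h : IsBiholomorphicPair U V f F) {z : ℂ} (hz : z ∈ U) {u : ℂ → E}
    (hu : DifferentiableAt ℝ u (f z)) (c : ℂ) :
    fderiv ℝ (u ∘ f) z c = fderiv ℝ u (f z) (deriv f z * c) := by
  rw [(hu.hasFDerivAt.comp z (h.hasFDerivAt hz)).fderiv]
  simp

lemma partialX_comp (h : IsBiholomorphicPair U V f F) {z : ℂ} (hz : z ∈ U) {u : ℂ → E}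
    (hu : DifferentiableAt ℝ u (f z)) :
    partialX (u ∘ f) z
      = (deriv f z).re • partialX u (f z) + (deriv f z).im • partialY u (f z) := by
  rw [partialX, h.fderiv_comp_eq hz hu, mul_one, fderiv_apply_complex]

lemma partialY_comp (h : IsBiholomorphicPair U V f F) {z : ℂ} (hz : z ∈ U) {u : ℂ → E}
    (hu : DifferentiableAt ℝ u (f z)) :
    partialY (u ∘ f) z
      = -(deriv f z).im • partialX u (f z) + (deriv f z).re • partialY u (f z) := by
  rw [partialY, h.fderiv_comp_eq hz hu, fderiv_apply_complex]
  simp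

lemma enorm_fderiv_comp_le (h : IsBiholomorphicPair U V f F) {z : ℂ} (hz : z ∈ U) {u : ℂ → E}
    (hu : DifferentiableAt ℝ u (f z)) :
    ‖fderiv ℝ (u ∘ f) z‖ₑ ≤ ‖deriv f z‖ₑ * ‖fderiv ℝ u (f z)‖ₑ := by
  rw [← ofReal_norm, ← ofReal_norm, ← ofReal_norm,
    ← ENNReal.ofReal_mul (norm_nonneg _)]
  refine ENNReal.ofReal_le_ofReal (ContinuousLinearMap.opNorm_le_bound _ (by positivity)
    fun c => ?_)
  rw [h.fderiv_comp_eq hz hu]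
  refine ((fderiv ℝ u (f z)).le_opNorm _).trans ?_
  rw [norm_mul]
  nlinarith

lemma isSmoothFiniteEnergy_comp (h : IsBiholomorphicPair U V f F) {u : ℂ → E}
    (hu : IsSmoothFiniteEnergy V u) : IsSmoothFiniteEnergy U (u ∘ f) := by
  rw [isSmoothFiniteEnergy_iff h.isOpen_left]
  refine ⟨hu.1.comp h.contDiffOn h.mapsTo_left, ?_⟩
  refine lt_of_le_of_lt ?_ ((isSmoothFiniteEnergy_iff h.isOpen_right).1 hu).2
  rw [← h.image_eq, h.lintegral_image h.isOpen_left.measurableSet Subset.rfl]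
  refine setLIntegral_mono' h.isOpen_left.measurableSet fun z hz => ?_
  rw [← ENNReal.mul_rpow_of_nonneg _ _ (by norm_num)]
  gcongr
  exact h.enorm_fderiv_comp_le hz (hu.differentiableAt h.isOpen_right (h.mapsTo_left hz))

/-- By the Cauchy–Riemann equations the Jacobian matrix is `|f'|` times a rotation, and rotations
preserve scalar products. The factor is the Jacobian determinant, so integrals are invariant. -/
lemma gradDot_comp (h : IsBiholomorphicPair U V f F) {z : ℂ} (hz : z ∈ U) {u v : ℂ → ℝ}
    (hu : DifferentiableAt ℝ u (f z)) (hv : DifferentiableAt ℝ v (f z)) :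
    gradDot (u ∘ f) (v ∘ f) z = ‖deriv f z‖ ^ 2 * gradDot u v (f z) := by
  rw [← Complex.normSq_eq_norm_sq, Complex.normSq_apply]
  simp only [gradDot, h.partialX_comp hz hu, h.partialX_comp hz hv, h.partialY_comp hz hu,
    h.partialY_comp hz hv, smul_eq_mul]
  ring

/-- The integrand is a determinant in the two partial derivatives, so it is multiplied by the
determinant of the differential of `f`. -/
lemma curlDot_comp (h : IsBiholomorphicPair U V f F) {z : ℂ} (hz : z ∈ U) {ψ : ℂ → ℝ} {v : ℂ → ℂ}
    (hψ : DifferentiableAt ℝ ψ (f z)) (hv : DifferentiableAt ℝ v (f z)) :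
    curlDot (ψ ∘ f) (v ∘ f) z = ‖deriv f z‖ ^ 2 * curlDot ψ v (f z) := by
  rw [← Complex.normSq_eq_norm_sq, Complex.normSq_apply]
  simp only [curlDot, h.partialX_comp hz hψ, h.partialX_comp hz hv, h.partialY_comp hz hψ,
    h.partialY_comp hz hv, smul_eq_mul, wedge, Function.comp_apply, Complex.add_re, Complex.add_im,
    Complex.smul_re, Complex.smul_im]
  ring

end Calculus

end IsBiholomorphicPair

/-! ### Traces -/

/-- The domain has positive lower density at its boundary points. -/
def HasBoundaryDensity (U : Set ℂ) : Prop :=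
  ∃ c : ℝ, 0 < c ∧ ∀ x ∈ frontier U, ∀ r : ℝ, 0 < r → r ≤ 1 →
    ENNReal.ofReal (c * r ^ 2) ≤ volume (Metric.ball x r ∩ U)

lemma measurableSet_frontier' {U : Set ℂ} : MeasurableSet (frontier U) :=
  isClosed_frontier.measurableSet

lemma ae_boundaryMeasure_iff {U : Set ℂ} {P : ℂ → Prop} :
    (∀ᵐ x ∂(boundaryMeasure U), P x) ↔ (μH[1] : Measure ℂ) {x ∈ frontier U | ¬ P x} = 0 := by
  rw [boundaryMeasure, ae_restrict_iff' measurableSet_frontier', ae_iff]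
  congr! 2
  ext x
  simp

lemma HasTrace.congr {E : Type*} [NormedAddCommGroup E] {U L : Set ℂ} (hU : IsOpen U)
    (hL : IsCompact L) (hLU : L ⊆ U) {u u' t : ℂ → E} (h : HasTrace U u t)
    (hu : EqOn u u' (U \ L)) : HasTrace U u' t := by
  rw [HasTrace, boundaryMeasure, ae_restrict_iff' measurableSet_frontier'] at h ⊢
  filter_upwards [h] with x hx hxU
  refine (hx hxU).congr' ?_
  have hxL : x ∉ L := fun h => by rw [hU.frontier_eq] at hxU; exact hxU.2 (hLU h)
  obtain ⟨ε, hε, hball⟩ := Metric.isOpen_iff.1 hL.isClosed.isOpen_compl x hxL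
  filter_upwards [nhdsWithin_le_nhds (Iio_mem_nhds hε)] with r hr
  rw [setLAverage_eq, setLAverage_eq]
  congr 1
  refine setLIntegral_congr_fun (Metric.isOpen_ball.inter hU).measurableSet fun y hy => ?_
  rw [hu ⟨hy.2, hball (Metric.ball_subset_ball (le_of_lt hr) hy.1)⟩]

lemma HasTrace.add {E : Type*} [NormedAddCommGroup E] {U : Set ℂ}
    {u u' t t' : ℂ → E} (h : HasTrace U u t) (h' : HasTrace U u' t')
    (hm : AEStronglyMeasurable u (volume.restrict U)) :
    HasTrace U (fun z => u z + u' z) (fun z => t z + t' z) := by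
  filter_upwards [h, h'] with x hx hx'
  have := hx.add hx'
  rw [add_zero] at this
  refine tendsto_of_tendsto_of_tendsto_of_le_of_le tendsto_const_nhds this (fun _ => zero_le)
    fun r => ?_
  simp only [setLAverage_eq]
  rw [← ENNReal.add_div, ← lintegral_add_left']
  · gcongr with y
    have : u y + u' y - (t x + t' x) = (u y - t x) + (u' y - t' x) := by abel
    rw [this]
    exact enorm_add_le _ _
  · exact ((hm.mono_measure (Measure.restrict_mono inter_subset_right le_rfl)).sub
      aestronglyMeasurable_const).enorm

namespace IsBilipschitzPair

variable {U V : Set ℂ} {f F : ℂ → ℂ} {K : NNReal}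

/-- The factor `K + 1` instead of `K` gives strict inequality, hence an open ball, also when `K =
0`. -/
lemma image_ball_inter_subset (h : IsBilipschitzPair U V f F K) {x : ℂ} (hx : x ∈ closure U)
    {r : ℝ} (hr : 0 < r) :
    f '' (Metric.ball x r ∩ U) ⊆ Metric.ball (extendFrom U f x) ((K + 1) * r) ∩ V := by
  rintro _ ⟨z, ⟨hz, hzU⟩, rfl⟩
  refine ⟨?_, h.mapsTo_left hzU⟩
  have := h.lipschitz_extend.dist_le_mul z (subset_closure hzU) x hx
  rw [h.extend_eqOn hzU] at this
  refine this.trans_lt ?_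
  rw [Metric.mem_ball] at hz
  have : 0 ≤ dist z x := dist_nonneg
  have hK : (0 : ℝ) ≤ K := K.2
  nlinarith

lemma enorm_deriv_rpow_le (h : IsBilipschitzPair U V f F K) {z : ℂ} (hz : z ∈ U) :
    ‖deriv f z‖ₑ ^ (2 : ℝ) ≤ (K : ENNReal) ^ (2 : ℝ) := by
  gcongr
  rw [enorm_le_coe]
  exact_mod_cast h.norm_deriv_le hz

lemma lintegral_comp_le (h : IsBilipschitzPair U V f F K) {s : Set ℂ} (hs : IsOpen s)
    (hsU : s ⊆ U) (g : ℂ → ENNReal) :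
    ∫⁻ z in s, g (f z) ≤ (K : ENNReal) ^ (2 : ℝ) * ∫⁻ w in f '' s, g w := by
  have him : F '' (f '' s) = s := by
    rw [image_image]
    exact (image_congr fun z hz => h.left_inv z (hsU hz)).trans (image_id' s)
  have ho : IsOpen (f '' s) := (h.toIsBiholomorphicPair.symm.restrict hs hsU).isOpen_left
  have hsV : f '' s ⊆ V := by rintro _ ⟨z, hz, rfl⟩; exact h.mapsTo_left (hsU hz)
  conv_lhs => rw [← him]
  rw [h.toIsBiholomorphicPair.symm.lintegral_image ho.measurableSet hsV,
    ← lintegral_const_mul' _ _ (by simp)]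
  refine setLIntegral_mono' ho.measurableSet fun w hw => ?_
  rw [h.right_inv w (hsV hw)]
  exact mul_le_mul' (h.symm.enorm_deriv_rpow_le (hsV hw)) le_rfl

lemma hausdorffMeasure_image_le (h : IsBilipschitzPair U V f F K) (s : Set ℂ)
    (hs : s ⊆ frontier U) : (μH[1] : Measure ℂ) (extendFrom U f '' s) ≤ K * μH[1] s := by
  have := (h.lipschitz_extend.mono (hs.trans frontier_subset_closure)).hausdorffMeasure_image_le
    (d := 1) zero_le_one
  simpa using this

lemma ae_boundaryMeasure (h : IsBilipschitzPair U V f F K) {P : ℂ → Prop}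
    (hP : ∀ᵐ y ∂(boundaryMeasure V), P y) :
    ∀ᵐ x ∂(boundaryMeasure U), P (extendFrom U f x) := by
  rw [ae_boundaryMeasure_iff] at hP ⊢
  have hle := h.symm.hausdorffMeasure_image_le _ (sep_subset (frontier V) fun y => ¬ P y)
  rw [hP, mul_zero] at hle
  refine measure_mono_null (fun x hx => ?_) (le_zero_iff.1 hle)
  exact ⟨extendFrom U f x, ⟨h.mapsTo_extend_frontier hx.1, hx.2⟩,
    h.extend_left_inv (frontier_subset_closure hx.1)⟩

lemma hasBoundaryDensity (h : IsBilipschitzPair U V f F K) (hU : HasBoundaryDensity U) :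
    HasBoundaryDensity V := by
  obtain ⟨c, hc, H⟩ := hU
  have hK : (0 : ℝ) ≤ K := K.2
  refine ⟨c / (K + 1) ^ 2 / (K + 1) ^ 2, by positivity, fun y hy r hr hr1 => ?_⟩
  have hx := h.symm.mapsTo_extend_frontier hy
  set x := extendFrom V F y with hxdef
  have hyx : extendFrom U f x = y := h.symm.extend_left_inv (frontier_subset_closure hy)
  have hr' : 0 < r / (K + 1) := by positivity
  have hr'1 : r / (K + 1) ≤ 1 := by rw [div_le_one (by positivity)]; linarith
  have h1 := H x hx _ hr' hr'1
  have hsub := h.image_ball_inter_subset (frontier_subset_closure hx) hr'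
  rw [hyx, mul_div_cancel₀ _ (by positivity)] at hsub
  have h2 := h.lintegral_comp_le (Metric.isOpen_ball.inter h.isOpen_left)
    (inter_subset_right (s := Metric.ball x (r / (K + 1))) (t := U)) (fun _ => 1)
  simp only [lintegral_const, one_mul, Measure.restrict_apply_univ] at h2
  have h3 : (K : ENNReal) ^ (2 : ℝ) ≤ ENNReal.ofReal ((K + 1) ^ 2) := by
    rw [ENNReal.ofReal_pow (by positivity), ← ENNReal.rpow_natCast, Nat.cast_ofNat]
    gcongr
    rw [ENNReal.ofReal_add hK zero_le_one]
    simp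
  have h4 : ENNReal.ofReal (c * (r / (K + 1)) ^ 2)
      ≤ ENNReal.ofReal ((K + 1) ^ 2) * volume (Metric.ball y r ∩ V) :=
    h1.trans (h2.trans (mul_le_mul' h3 (measure_mono hsub)))
  have h5 : c / (K + 1) ^ 2 / (K + 1) ^ 2 * r ^ 2 = c * (r / (K + 1)) ^ 2 / (K + 1) ^ 2 := by
    field_simp
  rw [h5, ENNReal.ofReal_div_of_pos (by positivity)]
  exact ENNReal.div_le_of_le_mul' h4

/-- A half-ball of radius `r` is mapped into one of radius `(K + 1) r`, and the change of variables
costs at most `K²`. The two volumes are compared through the trivial upper bound in `V` and the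
density lower bound in `U`. Exceptional sets stay null because the extension of the inverse is
Lipschitz for the one-dimensional Hausdorff measure. -/
theorem hasTrace_comp {E : Type*} [NormedAddCommGroup E] (h : IsBilipschitzPair U V f F K)
    (hU : HasBoundaryDensity U) {u t : ℂ → E} (ht : HasTrace V u t) :
    HasTrace U (u ∘ f) (t ∘ extendFrom U f) := by
  obtain ⟨c, hc, H⟩ := hU
  have hK : (0 : ℝ) ≤ K := K.2
  have h' := h.ae_boundaryMeasure ht
  rw [HasTrace, boundaryMeasure, ae_restrict_iff' measurableSet_frontier'] at *
  filter_upwards [h'] with x hx hxU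
  have hx := hx hxU
  set y := extendFrom U f x with hy
  set a : ℝ → ENNReal := fun r => ⨍⁻ w in Metric.ball y r ∩ V, ‖u w - t y‖ₑ ∂volume with ha
  have hscale : Tendsto (fun r : ℝ => ((K : ℝ) + 1) * r) (𝓝[>] 0) (𝓝[>] 0) := by
    refine tendsto_nhdsWithin_iff.2 ⟨?_, ?_⟩
    · have : Tendsto (fun r : ℝ => ((K : ℝ) + 1) * r) (𝓝 0) (𝓝 (((K : ℝ) + 1) * 0)) :=
        tendsto_id.const_mul _
      rw [mul_zero] at this
      exact this.mono_left nhdsWithin_le_nhds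
    · filter_upwards [self_mem_nhdsWithin] with r hr
      have hr : 0 < r := hr
      exact mul_pos (by positivity : 0 < (K : ℝ) + 1) hr
  set X : ENNReal := (K : ENNReal) ^ (2 : ℝ) * ENNReal.ofReal (((K : ℝ) + 1) ^ 2 / c) * NNReal.pi
    with hX
  have hlim : Tendsto (fun r => X * a ((K + 1) * r)) (𝓝[>] 0) (𝓝 0) := by
    have := ENNReal.Tendsto.const_mul (a := X) (hx.comp hscale) (Or.inr (by
      simp [hX, ENNReal.mul_eq_top]))
    rwa [mul_zero] at this
  refine tendsto_of_tendsto_of_tendsto_of_le_of_le' tendsto_const_nhds hlim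
    (Eventually.of_forall fun _ => zero_le) ?_
  filter_upwards [self_mem_nhdsWithin, nhdsWithin_le_nhds (Iio_mem_nhds (zero_lt_one (α := ℝ)))]
    with r hr hr1
  have hr : 0 < r := hr
  rw [setLAverage_eq]
  have hI : ∫⁻ z in Metric.ball x r ∩ U, ‖(u ∘ f) z - (t ∘ extendFrom U f) x‖ₑ
      ≤ (K : ENNReal) ^ (2 : ℝ) * (volume (Metric.ball y ((K + 1) * r) ∩ V) * a ((K + 1) * r)) := by
    rw [ha, measure_mul_setLAverage _ (ne_top_of_le_ne_top
      (measure_ball_lt_top (x := y) (r := (K + 1) * r)).ne (measure_mono inter_subset_left))]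
    refine (h.lintegral_comp_le (Metric.isOpen_ball.inter h.isOpen_left) inter_subset_right
      (fun w => ‖u w - t y‖ₑ)).trans ?_
    gcongr
    exact h.image_ball_inter_subset (frontier_subset_closure hxU) hr
  have hvol : volume (Metric.ball y ((K + 1) * r) ∩ V)
      ≤ ENNReal.ofReal (((K : ℝ) + 1) ^ 2 / c) * ENNReal.ofReal (c * r ^ 2) * NNReal.pi := by
    refine (measure_mono inter_subset_left).trans ?_
    rw [Complex.volume_ball, ← ENNReal.ofReal_pow (by positivity),
      ← ENNReal.ofReal_mul (by positivity)]
    refine le_of_eq ?_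
    congr 2
    field_simp
  calc _ ≤ ((K : ENNReal) ^ (2 : ℝ) * (volume (Metric.ball y ((K + 1) * r) ∩ V)
        * a ((K + 1) * r))) / ENNReal.ofReal (c * r ^ 2) := ENNReal.div_le_div hI (H x hxU r hr hr1.le)
    _ ≤ X * a ((K + 1) * r) := by
      refine ENNReal.div_le_of_le_mul ?_
      calc _ ≤ (K : ENNReal) ^ (2 : ℝ) * ((ENNReal.ofReal (((K : ℝ) + 1) ^ 2 / c)
            * ENNReal.ofReal (c * r ^ 2) * NNReal.pi) * a ((K + 1) * r)) := by gcongr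
        _ = _ := by rw [hX]; ring

lemma aemeasurable_extend (h : IsBilipschitzPair U V f F K) :
    AEMeasurable (extendFrom U f) (boundaryMeasure U) :=
  (h.continuousOn_extend.mono frontier_subset_closure).aemeasurable measurableSet_frontier'

lemma map_boundaryMeasure_le (h : IsBilipschitzPair U V f F K) :
    (boundaryMeasure U).map (extendFrom U f) ≤ (K : ENNReal) • boundaryMeasure V := by
  refine Measure.le_iff.2 fun s hs => ?_
  rw [Measure.map_apply_of_aemeasurable h.aemeasurable_extend hs, Measure.smul_apply, smul_eq_mul,
    boundaryMeasure, boundaryMeasure, Measure.restrict_apply' measurableSet_frontier',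
    Measure.restrict_apply hs]
  refine le_trans (measure_mono fun x hx => ?_)
    (h.symm.hausdorffMeasure_image_le _ (inter_subset_right (s := s)))
  exact ⟨extendFrom U f x, ⟨hx.1, h.mapsTo_extend_frontier hx.2⟩,
    h.extend_left_inv (frontier_subset_closure hx.2)⟩

lemma integrable_comp_extend (h : IsBilipschitzPair U V f F K) {t : ℂ → ℝ}
    (ht : Integrable t (boundaryMeasure V)) :
    Integrable (t ∘ extendFrom U f) (boundaryMeasure U) :=
  (Integrable.of_measure_le_smul (by simp) h.map_boundaryMeasure_le ht).comp_aemeasurable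
    h.aemeasurable_extend

lemma boundaryMeasure_univ_lt_top (h : IsBilipschitzPair U V f F K)
    (hV : boundaryMeasure V univ < ⊤) : boundaryMeasure U univ < ⊤ := by
  have := h.map_boundaryMeasure_le univ
  rw [Measure.map_apply_of_aemeasurable h.aemeasurable_extend MeasurableSet.univ] at this
  refine this.trans_lt ?_
  simpa using ENNReal.mul_lt_top (by simp) hV

end IsBilipschitzPair

/-! ### Smooth functions: extension by zero, logarithms -/

lemma contDiff_indicator_of_eqOn_zero {E : Type*} [NormedAddCommGroup E] [NormedSpace ℝ E]
    {U S : Set ℂ} (hU : IsOpen U) (hS : IsCompact S) (hSU : S ⊆ U) {χ : ℂ → E}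
    (hχ : ContDiffOn ℝ ∞ χ U) (h0 : ∀ z ∈ U, z ∉ S → χ z = 0) :
    ContDiff ℝ ∞ (U.indicator χ) ∧ tsupport (U.indicator χ) ⊆ S ∧
      HasCompactSupport (U.indicator χ) := by
  have hts : tsupport (U.indicator χ) ⊆ S := by
    refine closure_minimal (fun z hz => ?_) hS.isClosed
    by_contra hcon
    refine hz ?_
    by_cases hzU : z ∈ U
    · rw [indicator_of_mem hzU, h0 z hzU hcon]
    · exact indicator_of_notMem hzU _
  refine ⟨?_, hts, hS.of_isClosed_subset (isClosed_tsupport _) hts⟩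
  rw [contDiff_iff_contDiffAt]
  intro z
  by_cases hzU : z ∈ U
  · refine (hχ.contDiffAt (hU.mem_nhds hzU)).congr_of_eventuallyEq ?_
    filter_upwards [hU.mem_nhds hzU] with y hy using indicator_of_mem hy _
  · have : z ∉ tsupport (U.indicator χ) := fun h => hzU (hSU (hts h))
    exact contDiffAt_const.congr_of_eventuallyEq (notMem_tsupport_iff_eventuallyEq.1 this)

/-- Locally `log |D|` is a constant plus the real part of `log (D / D(z))`. Normalizing by the value
at `z` puts the argument near `1`, away from the branch cut. -/
lemma hasFDerivAt_log_norm {D : ℂ → ℂ} {D' z : ℂ} (hD : HasDerivAt D D' z) (h0 : D z ≠ 0) :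
    HasFDerivAt (fun y => Real.log ‖D y‖)
      (Complex.reCLM ∘L ((D' / D z) • (1 : ℂ →L[ℝ] ℂ))) z := by
  have h1 : HasDerivAt (fun y => Complex.log (D y / D z)) (D' / D z) z := by
    have := (hD.div_const (D z)).clog (by rw [div_self h0]; exact Complex.one_mem_slitPlane)
    simpa [div_self h0] using this
  have h2 := (Complex.reCLM.hasFDerivAt (x := Complex.log (D z / D z))).comp z
    h1.complexToReal_fderiv
  refine (h2.add_const (Real.log ‖D z‖)).congr_of_eventuallyEq ?_
  filter_upwards [hD.continuousAt.eventually_ne h0] with y hy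
  simp only [Function.comp_apply, Complex.reCLM_apply, Complex.log_re, norm_div]
  rw [Real.log_div (norm_ne_zero_iff.2 hy) (norm_ne_zero_iff.2 h0)]
  ring

lemma partialX_log_norm {D : ℂ → ℂ} {D' z : ℂ} (hD : HasDerivAt D D' z) (h0 : D z ≠ 0) :
    partialX (fun y => Real.log ‖D y‖) z = (D' / D z).re := by
  rw [partialX, (hasFDerivAt_log_norm hD h0).fderiv]
  simp

lemma partialY_log_norm {D : ℂ → ℂ} {D' z : ℂ} (hD : HasDerivAt D D' z) (h0 : D z ≠ 0) :
    partialY (fun y => Real.log ‖D y‖) z = -(D' / D z).im := by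
  rw [partialY, (hasFDerivAt_log_norm hD h0).fderiv]
  simp

lemma norm_fderiv_log_norm_le {D : ℂ → ℂ} {D' z : ℂ} (hD : HasDerivAt D D' z) (h0 : D z ≠ 0) :
    ‖fderiv ℝ (fun y => Real.log ‖D y‖) z‖ ≤ ‖D' / D z‖ := by
  rw [(hasFDerivAt_log_norm hD h0).fderiv]
  refine ContinuousLinearMap.opNorm_le_bound _ (norm_nonneg _) fun c => ?_
  simp only [ContinuousLinearMap.comp_apply, Complex.reCLM_apply]
  refine (Complex.abs_re_le_norm _).trans ?_
  simp

lemma contDiffOn_log_norm {U : Set ℂ} (hU : IsOpen U) {D : ℂ → ℂ} (hD : DifferentiableOn ℂ D U)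
    (h0 : ∀ z ∈ U, D z ≠ 0) : ContDiffOn ℝ ∞ (fun y => Real.log ‖D y‖) U :=
  (((hD.contDiffOn hU).restrict_scalars ℝ).norm ℝ h0).log fun z hz => norm_ne_zero_iff.2 (h0 z hz)

lemma isSmoothFiniteEnergy_of_bounded {E : Type*} [NormedAddCommGroup E] [NormedSpace ℝ E]
    {U : Set ℂ} (hU : IsOpen U) (hb : Bornology.IsBounded U) {u : ℂ → E}
    (hu : ContDiffOn ℝ ∞ u U) {M : ℝ} (hM : ∀ z ∈ U, ‖fderiv ℝ u z‖ ≤ M) :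
    IsSmoothFiniteEnergy U u := by
  refine ⟨hu, ?_⟩
  have : IsFiniteMeasure (volume.restrict U) := ⟨by simpa using hb.measure_lt_top⟩
  exact MemLp.of_bound ((hu.continuousOn_fderiv_of_isOpen hU (by simp)).aestronglyMeasurable
    hU.measurableSet) M (ae_restrict_of_forall_mem hU.measurableSet hM)

lemma memLp_add {G α : Type*} [NormedAddCommGroup G] [MeasurableSpace α] {μ : Measure α}
    {u v : α → G} (hu : MemLp u 2 μ) (hv : MemLp v 2 μ) : MemLp (u + v) 2 μ := hu.add hv

lemma IsSmoothFiniteEnergy.add {E : Type*} [NormedAddCommGroup E] [NormedSpace ℝ E]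
    {U : Set ℂ} (hU : IsOpen U) {u v : ℂ → E} (hu : IsSmoothFiniteEnergy U u)
    (hv : IsSmoothFiniteEnergy U v) : IsSmoothFiniteEnergy U (fun z => u z + v z) := by
  have h2 : MemLp (fderiv ℝ u + fderiv ℝ v) 2 (volume.restrict U) :=
    memLp_add hu.2 hv.2
  refine ⟨hu.1.add hv.1, (memLp_congr_ae ?_).1 h2⟩
  refine (ae_restrict_iff' hU.measurableSet).2 (Eventually.of_forall fun z hz => ?_)
  exact (fderiv_add (hu.differentiableAt hU hz) (hv.differentiableAt hU hz)).symm

lemma IsSmoothFiniteEnergy.const_smul {E : Type*} [NormedAddCommGroup E] [NormedSpace ℝ E]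
    {U : Set ℂ} (hU : IsOpen U) {u : ℂ → E} (hu : IsSmoothFiniteEnergy U u) (c : ℝ) :
    IsSmoothFiniteEnergy U (fun z => c • u z) := by
  have h2 : MemLp (c • fderiv ℝ u) 2 (volume.restrict U) := hu.2.const_smul c
  refine ⟨hu.1.const_smul c, (memLp_congr_ae ?_).1 h2⟩
  refine (ae_restrict_iff' hU.measurableSet).2 (Eventually.of_forall fun z hz => ?_)
  exact (fderiv_const_smul (hu.differentiableAt hU hz) c).symm

lemma IsSmoothFiniteEnergy.const {E : Type*} [NormedAddCommGroup E] [NormedSpace ℝ E]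
    {U : Set ℂ} (c : E) : IsSmoothFiniteEnergy U (fun _ => c) := by
  refine ⟨contDiffOn_const, ?_⟩
  have : fderiv ℝ (fun _ : ℂ => c) = 0 := by ext; simp
  rw [this]
  exact MemLp.zero (ε := ℂ →L[ℝ] E)

lemma IsSmoothFiniteEnergy.sum {U : Set ℂ} (hU : IsOpen U) {k : ℕ} {u : Fin k → ℂ → ℝ}
    (hu : ∀ j, IsSmoothFiniteEnergy U (u j)) (s : Finset (Fin k)) :
    IsSmoothFiniteEnergy U (fun z => ∑ j ∈ s, u j z) := by
  classical
  induction s using Finset.induction_on with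
  | empty => simpa using IsSmoothFiniteEnergy.const (U := U) (0 : ℝ)
  | insert a s ha ih =>
    simp only [Finset.sum_insert ha]
    exact (hu a).add hU ih

lemma IsSmoothFiniteEnergy.congr {E : Type*} [NormedAddCommGroup E] [NormedSpace ℝ E]
    {U : Set ℂ} (hU : IsOpen U) {u v : ℂ → E} (hu : IsSmoothFiniteEnergy U u)
    (huv : EqOn u v U) : IsSmoothFiniteEnergy U v := by
  refine ⟨hu.1.congr huv.symm, (memLp_congr_ae ?_).1 hu.2⟩
  refine (ae_restrict_iff' hU.measurableSet).2 (Eventually.of_forall fun z hz => ?_)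
  exact (huv.eventuallyEq_of_mem (hU.mem_nhds hz)).fderiv_eq

/-- Functions which are smooth with finite energy outside a compact subset of `U`. -/
def IsFiniteEnergyNearBoundary (U : Set ℂ) (φ : ℂ → ℝ) : Prop :=
  ∃ M : Set ℂ, IsCompact M ∧ M ⊆ U ∧ IsSmoothFiniteEnergy (U \ M) φ

lemma isSmoothFiniteEnergy_log_sub {U : Set ℂ} (hU : IsOpen U) (hb : Bornology.IsBounded U)
    {M : Set ℂ} (hM : IsClosed M) {a : ℂ} (ha : M ∈ 𝓝 a) :
    IsSmoothFiniteEnergy (U \ M) (fun z => Real.log ‖z - a‖) := by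
  obtain ⟨ε, hε, hball⟩ := Metric.mem_nhds_iff.1 ha
  have hfar : ∀ z ∈ U \ M, ε ≤ ‖z - a‖ := fun z hz => by
    by_contra! h
    exact hz.2 (hball (by rwa [Metric.mem_ball, dist_eq_norm]))
  have h0 : ∀ z ∈ U \ M, z - a ≠ 0 := fun z hz => norm_pos_iff.1 (hε.trans_le (hfar z hz))
  have ho : IsOpen (U \ M) := hU.sdiff hM
  refine isSmoothFiniteEnergy_of_bounded ho (hb.subset sdiff_subset)
    (contDiffOn_log_norm (D := fun z => z - a) ho (by fun_prop) h0) (M := 1 / ε) fun z hz => ?_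
  refine (norm_fderiv_log_norm_le ((hasDerivAt_id z).sub_const a) (h0 z hz)).trans ?_
  rw [norm_div, norm_one]
  have := hfar z hz
  simp only [id]
  gcongr

lemma exists_compact_mem_nhds_range {U : Set ℂ} (hU : IsOpen U) {k : ℕ} {a : Fin k → ℂ}
    (ha : ∀ j, a j ∈ U) : ∃ M : Set ℂ, IsCompact M ∧ M ⊆ U ∧ ∀ j, M ∈ 𝓝 (a j) := by
  obtain ⟨M, hM, h1, h2⟩ := exists_compact_between (finite_range a).isCompact hU
    (range_subset_iff.2 ha)
  exact ⟨M, hM, h2, fun j => mem_interior_iff_mem_nhds.1 (h1 (mem_range_self j))⟩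

lemma isFiniteEnergyNearBoundary_withLogs {U : Set ℂ} (hU : IsOpen U)
    (hb : Bornology.IsBounded U) {k : ℕ} (d : Fin k → ℤ) {a : Fin k → ℂ} (ha : ∀ j, a j ∈ U)
    {R : ℂ → ℝ} (hR : IsSmoothFiniteEnergy U R) :
    IsFiniteEnergyNearBoundary U (withLogs d a R) := by
  obtain ⟨M, hM, hMU, hMa⟩ := exists_compact_mem_nhds_range hU ha
  have ho : IsOpen (U \ M) := hU.sdiff hM.isClosed
  exact ⟨M, hM, hMU, (hR.mono sdiff_subset).add ho (IsSmoothFiniteEnergy.sum ho (fun j =>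
    (isSmoothFiniteEnergy_log_sub hU hb hM.isClosed (hMa j)).const_smul ho (d j : ℝ)) _)⟩

/-! ### Angular pairings -/

lemma IsAngularPairing.congr {U : Set ℂ} {g : ℂ → ℂ} {φ φ' : ℂ → ℝ} {t : ℝ}
    (h : IsAngularPairing U g φ t) {M : Set ℂ} (hM : IsCompact M) (hMU : M ⊆ U)
    (hφ : EqOn φ φ' (U \ M)) : IsAngularPairing U g φ' t := by
  obtain ⟨K, L, v, ψ, hv, hL, hLU, hψ, hs, hd, ht⟩ := h
  refine ⟨K, L ∪ M, v, ψ, hv, hL.union hM, union_subset hLU hMU, fun z hz => ?_, hs, hd, ht⟩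
  rw [hψ ⟨hz.1, fun h => hz.2 (Or.inl h)⟩, hφ ⟨hz.1, fun h => hz.2 (Or.inr h)⟩]

lemma IsAngularPairing.congr_boundary {U : Set ℂ} {g g' : ℂ → ℂ} {φ : ℂ → ℝ} {t : ℝ}
    (h : IsAngularPairing U g φ t) (hg : EqOn g g' (frontier U)) : IsAngularPairing U g' φ t := by
  obtain ⟨K, L, v, ψ, hv, hrest⟩ := h
  refine ⟨K, L, v, ψ, { hv with trace := ?_ }, hrest⟩
  have := hv.trace
  rw [HasTrace, boundaryMeasure, ae_restrict_iff' measurableSet_frontier'] at this ⊢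
  filter_upwards [this] with x hx hxU
  rw [← hg hxU]
  exact hx hxU

/-- Adding a constant `c` to the test function adds `c s` to the pairing. -/
def PairingAddConst (U : Set ℂ) (g : ℂ → ℂ) (s : ℝ) : Prop :=
  ∀ (φ : ℂ → ℝ) (t c : ℝ), IsFiniteEnergyNearBoundary U φ → IsAngularPairing U g φ t →
    IsAngularPairing U g (fun z => φ z + c) (t + c * s)

namespace IsBilipschitzPair

variable {U V : Set ℂ} {f F : ℂ → ℂ} {K : NNReal}

lemma image_sdiff (h : IsBilipschitzPair U V f F K) {M : Set ℂ} (hM : M ⊆ V) :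
    F '' (V \ M) = U \ F '' M := by
  rw [(h.toIsBiholomorphicPair.symm.injOn).image_sdiff_subset hM,
    h.toIsBiholomorphicPair.symm.image_eq]

lemma isCompact_image (h : IsBilipschitzPair U V f F K) {M : Set ℂ} (hM : IsCompact M)
    (hMV : M ⊆ V) : IsCompact (F '' M) :=
  hM.image_of_continuousOn (h.holomorphic_right.continuousOn.mono hMV)

lemma image_subset (h : IsBilipschitzPair U V f F K) {M : Set ℂ} (hMV : M ⊆ V) : F '' M ⊆ U :=
  (h.mapsTo_right.mono hMV Subset.rfl).image_subset

lemma mem_of_notMem_image (h : IsBilipschitzPair U V f F K) {M : Set ℂ} {z : ℂ}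
    (hz : z ∈ U \ F '' M) : f z ∈ V \ M :=
  ⟨h.mapsTo_left hz.1, fun hm => hz.2 ⟨f z, hm, h.left_inv z hz.1⟩⟩

lemma isSmoothFiniteEnergy_comp_sdiff {E : Type*} [NormedAddCommGroup E] [NormedSpace ℝ E]
    (h : IsBilipschitzPair U V f F K) {M : Set ℂ} (hM : IsCompact M) (hMV : M ⊆ V) {u : ℂ → E}
    (hu : IsSmoothFiniteEnergy (V \ M) u) : IsSmoothFiniteEnergy (U \ F '' M) (u ∘ f) := by
  rw [← h.image_sdiff hMV]
  exact (h.toIsBiholomorphicPair.restrict (h.isOpen_right.sdiff hM.isClosed)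
    sdiff_subset).isSmoothFiniteEnergy_comp hu

lemma isFiniteEnergyNearBoundary_comp (h : IsBilipschitzPair U V f F K) {φ : ℂ → ℝ}
    (hφ : IsFiniteEnergyNearBoundary V φ) : IsFiniteEnergyNearBoundary U (φ ∘ f) := by
  obtain ⟨M, hM, hMV, hφ⟩ := hφ
  exact ⟨F '' M, h.isCompact_image hM hMV, h.image_subset hMV,
    h.isSmoothFiniteEnergy_comp_sdiff hM hMV hφ⟩

lemma isCircleExtension_comp (h : IsBilipschitzPair U V f F K) (hU : HasBoundaryDensity U)
    {g v : ℂ → ℂ} {M : Set ℂ} (hv : IsCircleExtension V g M v) :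
    IsCircleExtension U (g ∘ extendFrom U f) (F '' M) (v ∘ f) where
  isCompact := h.isCompact_image hv.isCompact hv.subset
  subset := h.image_subset hv.subset
  norm_eq_one _ hz := hv.norm_eq_one _ (h.mem_of_notMem_image hz)
  energy := h.isSmoothFiniteEnergy_comp_sdiff hv.isCompact hv.subset hv.energy
  trace := h.hasTrace_comp hU hv.trace

/-- Every ingredient of the bracket pulls back: the compact sets through `F`, the extension and the
test function by composition with `f`. The integrands correspond on the support of `ψ`, where `v` is
smooth, and both vanish off it. -/
lemma isAngularPairing_comp (h : IsBilipschitzPair U V f F K) (hU : HasBoundaryDensity U)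
    {g : ℂ → ℂ} {φ : ℂ → ℝ} {t : ℝ} (hp : IsAngularPairing V g φ t) :
    IsAngularPairing U (g ∘ extendFrom U f) (φ ∘ f) t := by
  obtain ⟨M, L, v, ψ, hv, hL, hLV, hψ, hs, hd, ht⟩ := hp
  refine ⟨F '' M, F '' L, v ∘ f, ψ ∘ f, h.isCircleExtension_comp hU hv, h.isCompact_image hL hLV,
    h.image_subset hLV, fun z hz => hψ (h.mem_of_notMem_image hz),
    hs.comp h.contDiffOn h.mapsTo_left, ?_, ?_⟩
  · rw [Set.disjoint_right]
    rintro _ ⟨w, hw, rfl⟩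
    have hwV := hv.subset hw
    have h0 := notMem_tsupport_iff_eventuallyEq.1 (Set.disjoint_right.1 hd hw)
    refine notMem_tsupport_iff_eventuallyEq.2 ?_
    have hc : ContinuousAt f (F w) := (h.differentiableAt (h.mapsTo_right hwV)).continuousAt
    rw [ContinuousAt, h.right_inv w hwV] at hc
    exact hc.eventually h0
  · rw [ht]
    refine (h.integral_image (curlDot ψ v)).trans ?_
    refine setIntegral_congr_fun h.isOpen_left.measurableSet fun z hz => ?_
    change _ = curlDot (ψ ∘ f) (v ∘ f) z
    by_cases hfz : f z ∈ tsupport ψ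
    · have hfV : f z ∈ V \ M := ⟨h.mapsTo_left hz, Set.disjoint_left.1 hd hfz⟩
      exact (h.curlDot_comp hz ((hs.differentiableOn (by simp)).differentiableAt
        (h.isOpen_right.mem_nhds hfV.1)) (hv.energy.differentiableAt
          (h.isOpen_right.sdiff hv.isCompact.isClosed) hfV)).symm
    · have h0 := notMem_tsupport_iff_eventuallyEq.1 hfz
      rw [curlDot_eq_zero_of_eventually v h0, mul_zero, curlDot_eq_zero_of_eventually]
      exact (h.differentiableAt hz).continuousAt.eventually h0

lemma comp_extend_comp_extend (h : IsBilipschitzPair U V f F K) (g : ℂ → ℂ) :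
    EqOn ((g ∘ extendFrom U f) ∘ extendFrom V F) g (frontier V) := fun y hy => by
  simp only [Function.comp_apply]
  rw [h.symm.extend_left_inv (frontier_subset_closure hy)]

lemma pairingAddConst (h : IsBilipschitzPair U V f F K) (hU : HasBoundaryDensity U)
    (hV : HasBoundaryDensity V) {g : ℂ → ℂ} {s : ℝ}
    (hs : PairingAddConst U (g ∘ extendFrom U f) s) : PairingAddConst V g s := by
  intro φ t c hφ hp
  have h1 := hs _ t c (h.isFiniteEnergyNearBoundary_comp hφ) (h.isAngularPairing_comp hU hp)
  have h2 := (h.symm.isAngularPairing_comp hV h1).congr_boundary (h.comp_extend_comp_extend g)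
  refine h2.congr isCompact_empty (empty_subset _) fun w hw => ?_
  simp [h.right_inv w hw.1]

end IsBilipschitzPair

/-! ### Transport of the regular parts and of the energies -/

lemma isSmoothFiniteEnergy_of_sdiff {E : Type*} [NormedAddCommGroup E] [NormedSpace ℝ E]
    {U M : Set ℂ} (hU : IsOpen U) (hM : IsCompact M) (hMU : M ⊆ U) {u : ℂ → E}
    (hu : ContDiffOn ℝ ∞ u U) (h : IsSmoothFiniteEnergy (U \ M) u) : IsSmoothFiniteEnergy U u := by
  rw [isSmoothFiniteEnergy_iff hU]
  rw [isSmoothFiniteEnergy_iff (hU.sdiff hM.isClosed)] at h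
  refine ⟨hu, ?_⟩
  obtain ⟨C, hC⟩ := hM.exists_bound_of_continuousOn
    ((hu.continuousOn_fderiv_of_isOpen hU (by simp)).mono hMU)
  have hun : U = (U \ M) ∪ M := by rw [sdiff_union_of_subset hMU]
  rw [hun]
  refine (lintegral_union_le _ _ _).trans_lt (ENNReal.add_lt_top.2 ⟨h.2, ?_⟩)
  have hle : ∫⁻ z in M, ‖fderiv ℝ u z‖ₑ ^ (2 : ℝ) ≤ ∫⁻ _ in M, ENNReal.ofReal C ^ (2 : ℝ) := by
    refine setLIntegral_mono' hM.measurableSet fun z hz => ?_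
    gcongr
    rw [← ofReal_norm]
    exact ENNReal.ofReal_le_ofReal (hC z hz)
  refine hle.trans_lt ?_
  rw [setLIntegral_const]
  exact ENNReal.mul_lt_top (by finiteness) hM.measure_lt_top

lemma gradDot_congr {u u' v v' : ℂ → ℝ} {z : ℂ} (hu : u =ᶠ[𝓝 z] u') (hv : v =ᶠ[𝓝 z] v') :
    gradDot u v z = gradDot u' v' z := by
  simp only [gradDot, partialX, partialY, hu.fderiv_eq, hv.fderiv_eq]

lemma gradDot_add_const (u v : ℂ → ℝ) (c : ℝ) (z : ℂ) :
    gradDot (fun y => u y + c) v z = gradDot u v z := by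
  simp only [gradDot, partialX, partialY, fderiv_add_const]

lemma differentiableAt_withLogs {k : ℕ} (d : Fin k → ℤ) {a : Fin k → ℂ} {R : ℂ → ℝ} {z : ℂ}
    (hR : DifferentiableAt ℝ R z) (hz : ∀ j, z ≠ a j) : DifferentiableAt ℝ (withLogs d a R) z := by
  refine hR.add (DifferentiableAt.fun_sum fun j _ => DifferentiableAt.const_mul ?_ _)
  exact (hasFDerivAt_log_norm ((hasDerivAt_id z).sub_const (a j))
    (sub_ne_zero.2 (hz j))).differentiableAt

lemma HasTrace.add_const {E : Type*} [NormedAddCommGroup E] {U : Set ℂ} {u t : ℂ → E}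
    (h : HasTrace U u t) (c : E) : HasTrace U (fun z => u z + c) (fun z => t z + c) := by
  filter_upwards [h] with x hx
  simpa only [add_sub_add_right_eq_sub] using hx

lemma exists_integral_add_const_eq_zero {U : Set ℂ} (hU : boundaryMeasure U univ < ⊤) {t : ℂ → ℝ}
    (ht : Integrable t (boundaryMeasure U)) : ∃ c : ℝ,
      Integrable (fun x => t x + c) (boundaryMeasure U) ∧
        ∫ x, (t x + c) ∂(boundaryMeasure U) = 0 := by
  have : IsFiniteMeasure (boundaryMeasure U) := ⟨hU⟩
  refine ⟨-(∫ x, t x ∂(boundaryMeasure U)) / (boundaryMeasure U).real univ,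
    ht.add (integrable_const _), ?_⟩
  rw [integral_add ht (integrable_const _), integral_const, smul_eq_mul]
  -- If the total mass is zero, the division returns `0` and the integral vanishes with the measure.
  by_cases h0 : (boundaryMeasure U).real univ = 0
  · have : boundaryMeasure U = 0 := by
      rw [← Measure.measure_univ_eq_zero]
      exact (measureReal_eq_zero_iff).1 h0
    simp [this]
  · field_simp
    ring

namespace IsBilipschitzPair

variable {U V : Set ℂ} {f F : ℂ → ℂ} {K : NNReal}

lemma differentiableOn_dslope (h : IsBilipschitzPair U V f F K) {α : ℂ} (hα : α ∈ U) :
    DifferentiableOn ℂ (dslope f α) U :=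
  (Complex.differentiableOn_dslope (h.isOpen_left.mem_nhds hα)).2 h.holomorphic_left

lemma dslope_ne_zero (h : IsBilipschitzPair U V f F K) {α z : ℂ} (hα : α ∈ U) (hz : z ∈ U) :
    dslope f α z ≠ 0 := by
  rcases eq_or_ne z α with rfl | hne
  · rw [dslope_same]
    exact h.deriv_ne_zero hz
  · rw [dslope_of_ne _ hne, slope_def_field]
    exact div_ne_zero (sub_ne_zero.2 fun he => hne (h.injOn hz hα he)) (sub_ne_zero.2 hne)

lemma log_norm_dslope (h : IsBilipschitzPair U V f F K) {α z : ℂ} (hα : α ∈ U) (hz : z ∈ U)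
    (hne : z ≠ α) :
    Real.log ‖dslope f α z‖ = Real.log ‖f z - f α‖ - Real.log ‖z - α‖ := by
  rw [dslope_of_ne _ hne, slope_def_field, norm_div, Real.log_div]
  · exact norm_ne_zero_iff.2 (sub_ne_zero.2 fun he => hne (h.injOn hz hα he))
  · exact norm_ne_zero_iff.2 (sub_ne_zero.2 hne)

/-- On compact subsets smoothness suffices, the slope having no zero. Near the boundary the function
is `log |f - f(α)| - log |· - α|`: the second term has bounded gradient there, and the first is the
pullback by `f` of such a function, so its energy is preserved. -/
lemma isSmoothFiniteEnergy_log_dslope (h : IsBilipschitzPair U V f F K)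
    (hbU : Bornology.IsBounded U) (hbV : Bornology.IsBounded V) {α : ℂ} (hα : α ∈ U) :
    IsSmoothFiniteEnergy U (fun z => Real.log ‖dslope f α z‖) := by
  have hfα := h.mapsTo_left hα
  obtain ⟨M, hM, hMV, hMa⟩ := exists_compact_mem_nhds_range (k := 1) (a := fun _ => f α)
    h.isOpen_right fun _ => hfα
  have hMa := hMa 0
  have hN := h.isCompact_image hM hMV
  have hNα : F '' M ∈ 𝓝 α := by
    have h1 : f ⁻¹' M ∈ 𝓝 α := (h.differentiableAt hα).continuousAt hMa
    refine mem_of_superset (inter_mem h1 (h.isOpen_left.mem_nhds hα)) fun z hz => ?_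
    exact ⟨f z, hz.1, h.left_inv z hz.2⟩
  have hs := contDiffOn_log_norm h.isOpen_left (h.differentiableOn_dslope hα)
    fun z hz => h.dslope_ne_zero hα hz
  have ho : IsOpen (U \ F '' M) := h.isOpen_left.sdiff hN.isClosed
  refine isSmoothFiniteEnergy_of_sdiff h.isOpen_left hN (h.image_subset hMV) hs ?_
  have h1 := h.isSmoothFiniteEnergy_comp_sdiff hM hMV
    (isSmoothFiniteEnergy_log_sub h.isOpen_right hbV hM.isClosed hMa)
  have h2 := (isSmoothFiniteEnergy_log_sub h.isOpen_left hbU hN.isClosed hNα).const_smul ho (-1)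
  refine (h1.add ho h2).congr ho fun z hz => ?_
  have hne : z ≠ α := by rintro rfl; exact hz.2 (mem_of_mem_nhds hNα)
  simp only [Function.comp_apply, h.log_norm_dslope hα hz.1 hne, smul_eq_mul]
  ring

section

variable {k : ℕ} (d : Fin k → ℤ) {α a : Fin k → ℂ} {R : ℂ → ℝ}

/-- The regular part transported by a conformal map. -/
noncomputable def _root_.transportRegularPart (f : ℂ → ℂ) (d : Fin k → ℤ) (α : Fin k → ℂ)
    (R : ℂ → ℝ) (c : ℝ) (z : ℂ) : ℝ :=
  R (f z) + ∑ j, (d j : ℝ) * Real.log ‖dslope f (α j) z‖ + c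

lemma contDiffOn_transport (h : IsBilipschitzPair U V f F K) (hα : ∀ j, α j ∈ U)
    (hR : ContDiffOn ℝ ∞ R V) (c : ℝ) : ContDiffOn ℝ ∞ (transportRegularPart f d α R c) U := by
  refine ((hR.comp h.contDiffOn h.mapsTo_left).add (ContDiffOn.sum fun j _ => ?_)).add
    contDiffOn_const
  exact contDiffOn_const.mul (contDiffOn_log_norm h.isOpen_left (h.differentiableOn_dslope (hα j))
    fun z hz => h.dslope_ne_zero (hα j) hz)

lemma isSmoothFiniteEnergy_transport (h : IsBilipschitzPair U V f F K)
    (hbU : Bornology.IsBounded U) (hbV : Bornology.IsBounded V) (hα : ∀ j, α j ∈ U)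
    (hR : IsSmoothFiniteEnergy V R) (c : ℝ) :
    IsSmoothFiniteEnergy U (transportRegularPart f d α R c) :=
  ((h.isSmoothFiniteEnergy_comp hR).add h.isOpen_left (IsSmoothFiniteEnergy.sum h.isOpen_left
    (fun j => (h.isSmoothFiniteEnergy_log_dslope hbU hbV (hα j)).const_smul h.isOpen_left
      (d j : ℝ)) _)).add h.isOpen_left (IsSmoothFiniteEnergy.const c)

lemma withLogs_transport (h : IsBilipschitzPair U V f F K) (hα : ∀ j, α j ∈ U)
    (haf : ∀ j, f (α j) = a j) (R : ℂ → ℝ) (c : ℝ) {z : ℂ} (hz : z ∈ U \ range α) :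
    withLogs d α (transportRegularPart f d α R c) z = withLogs d a R (f z) + c := by
  have : ∀ j, Real.log ‖dslope f (α j) z‖ = Real.log ‖f z - a j‖ - Real.log ‖z - α j‖ := fun j => by
    rw [h.log_norm_dslope (hα j) hz.1 (fun he => hz.2 ⟨j, he.symm⟩), haf]
  simp only [withLogs, transportRegularPart, this, mul_sub, Finset.sum_sub_distrib]
  ring

/-- On the diagonal the divided difference is `f'(α_j)`; this is the only source of the derivative
term. Off the diagonal it is an ordinary quotient, which splits into two logarithms. -/
lemma transport_apply (h : IsBilipschitzPair U V f F K) (hα : ∀ j, α j ∈ U)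
    (hinj : Function.Injective α) (haf : ∀ j, f (α j) = a j) (R : ℂ → ℝ) (c : ℝ) (j : Fin k) :
    transportRegularPart f d α R c (α j) = R (a j) + ((d j : ℝ) * Real.log ‖deriv f (α j)‖ +
      ∑ l ∈ Finset.univ.erase j, (d l : ℝ) *
        (Real.log ‖a j - a l‖ - Real.log ‖α j - α l‖)) + c := by
  rw [transportRegularPart, haf, ← Finset.add_sum_erase _ _ (Finset.mem_univ j), dslope_same]
  congr 3
  refine Finset.sum_congr rfl fun l hl => ?_
  have hne : α j ≠ α l := fun he => (Finset.mem_erase.1 hl).1 (hinj he).symm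
  rw [h.log_norm_dslope (hα l) (hα j) hne, haf, haf]

/-- The off-diagonal quotients, weighted by `d_j d_l` and summed over ordered pairs, are the
difference of the two interaction sums. What remains is the diagonal term and the contribution of
the constant. -/
lemma sum_transport (h : IsBilipschitzPair U V f F K) (hα : ∀ j, α j ∈ U)
    (hinj : Function.Injective α) (haf : ∀ j, f (α j) = a j) (R : ℂ → ℝ) (c : ℝ) :
    interaction d α + ∑ j, (d j : ℝ) * transportRegularPart f d α R c (α j)
      = interaction d a + ∑ j, (d j : ℝ) * R (a j)
        + ∑ j, (d j : ℝ) ^ 2 * Real.log ‖deriv f (α j)‖ + c * ∑ j, (d j : ℝ) := by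
  simp only [interaction, h.transport_apply d hα hinj haf, Finset.mul_sum,
    ← Finset.sum_add_distrib, mul_add, mul_sub, Finset.sum_sub_distrib]
  refine Finset.sum_congr rfl fun j _ => ?_
  have e1 : ∀ l, (d j : ℝ) * ((d l : ℝ) * Real.log ‖a j - a l‖)
      = (d j : ℝ) * d l * Real.log ‖a j - a l‖ := fun l => by ring
  have e2 : ∀ l, (d j : ℝ) * ((d l : ℝ) * Real.log ‖α j - α l‖)
      = (d j : ℝ) * d l * Real.log ‖α j - α l‖ := fun l => by ring
  simp only [e1, e2]
  ring

lemma integral_gradDot_transport (h : IsBilipschitzPair U V f F K) (hα : ∀ j, α j ∈ U)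
    (haf : ∀ j, f (α j) = a j) (hR : ContDiffOn ℝ ∞ R V) (c : ℝ) {φ ψ : ℂ → ℝ}
    (hψ : ContDiffOn ℝ ∞ ψ V) (hφ : ∀ z ∈ U, φ z = ψ (f z)) :
    ∫ z in U, gradDot (withLogs d α (transportRegularPart f d α R c)) φ z
      = ∫ w in V, gradDot (withLogs d a R) ψ w := by
  rw [h.integral_image]
  refine setIntegral_congr_ae₀ h.isOpen_left.measurableSet.nullMeasurableSet ?_
  have h0 : ∀ᵐ z ∂(volume : Measure ℂ), z ∉ range α :=
    measure_eq_zero_iff_ae_notMem.1 ((finite_range α).measure_zero _)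
  filter_upwards [h0] with z hz hzU
  have ho : IsOpen (U \ range α) := h.isOpen_left.sdiff (finite_range α).isClosed
  have hz' : z ∈ U \ range α := ⟨hzU, hz⟩
  have hfz := h.mapsTo_left hzU
  rw [← h.gradDot_comp hzU]
  · rw [← gradDot_add_const (withLogs d a R ∘ f) _ c]
    refine gradDot_congr ?_ ?_
    · filter_upwards [ho.mem_nhds hz'] with y hy
      rw [h.withLogs_transport d hα haf R c hy, Function.comp_apply]
    · filter_upwards [h.isOpen_left.mem_nhds hzU] with y hy using hφ y hy
  · refine differentiableAt_withLogs d ((hR.differentiableOn (by simp)).differentiableAt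
      (h.isOpen_right.mem_nhds hfz)) fun j he => hz ⟨j, ?_⟩
    rw [← haf] at he
    exact (h.injOn hzU (hα j) he).symm
  · exact (hψ.differentiableOn (by simp)).differentiableAt (h.isOpen_right.mem_nhds hfz)

/-- Test functions on `U` are carried to `V` by the inverse, and the weak equation comes back by
conformal invariance of both of its sides. The constant restores the zero mean for the arclength of
`∂U`. -/
theorem isNeumannRegularPart_transport (h : IsBilipschitzPair U V f F K)
    (hdU : HasBoundaryDensity U) (hbU : Bornology.IsBounded U) (hbV : Bornology.IsBounded V)
    (hfin : boundaryMeasure U univ < ⊤)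
    (hα : ∀ j, α j ∈ U) (haf : ∀ j, f (α j) = a j) {g : ℂ → ℂ}
    (hR : IsNeumannRegularPart V d a g R) :
    ∃ c, IsNeumannRegularPart U d α (g ∘ extendFrom U f) (transportRegularPart f d α R c) := by
  obtain ⟨t, ht, hti, -⟩ := hR.normalized
  obtain ⟨c, hc1, hc2⟩ := exists_integral_add_const_eq_zero hfin (h.integrable_comp_extend hti)
  refine ⟨c, h.isSmoothFiniteEnergy_transport d hbU hbV hα hR.energy c, fun φ hφ => ?_, _,
    ?_, hc1, hc2⟩
  · have hψ := h.symm.isSmoothFiniteEnergy_comp hφ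
    have h1 := h.isAngularPairing_comp hdU (hR.weak_equation _ hψ)
    have h2 := h1.congr (φ' := φ) isCompact_empty (empty_subset _) fun z hz => by
      simp [h.left_inv z hz.1]
    have h3 : ∀ j, (φ ∘ F) (a j) = φ (α j) := fun j => by
      rw [← haf, Function.comp_apply, h.left_inv _ (hα j)]
    simp only [h3] at h2
    rwa [h.integral_gradDot_transport d hα haf hR.energy.smooth c hψ.smooth
      fun z hz => by simp [h.left_inv z hz]]
  · refine HasTrace.congr h.isOpen_left (finite_range α).isCompact (range_subset_iff.2 hα)
      ((h.hasTrace_comp hdU ht).add_const c) fun z hz => ?_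
    rw [h.withLogs_transport d hα haf R c hz, Function.comp_apply]

/-- The constant `c` adds `2π c ∑ d_j` to the bracket and `c ∑ d_j` to `∑ d_j R(α_j)`. With the
weights `1/2` and `-π` the two contributions cancel. -/
theorem isRenormalizedEnergy_transport (h : IsBilipschitzPair U V f F K)
    (hdU : HasBoundaryDensity U) (hbU : Bornology.IsBounded U) (hbV : Bornology.IsBounded V)
    (hfin : boundaryMeasure U univ < ⊤)
    (hα : ∀ j, α j ∈ U) (hinj : Function.Injective α) (haf : ∀ j, f (α j) = a j) {g : ℂ → ℂ}
    (hadd : PairingAddConst U (g ∘ extendFrom U f) (2 * Real.pi * ∑ j, (d j : ℝ))) {w : ℝ}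
    (hw : IsRenormalizedEnergy V d a g w) :
    IsRenormalizedEnergy U d α (g ∘ extendFrom U f)
      (w - Real.pi * ∑ j, (d j : ℝ) ^ 2 * Real.log ‖deriv f (α j)‖) := by
  obtain ⟨R, t, hR, ht, hw⟩ := hw
  obtain ⟨c, hc⟩ := h.isNeumannRegularPart_transport d hdU hbU hbV hfin hα haf hR
  have haV : ∀ j, a j ∈ V := fun j => haf j ▸ h.mapsTo_left (hα j)
  have h1 := hadd _ t c (h.isFiniteEnergyNearBoundary_comp
    (isFiniteEnergyNearBoundary_withLogs h.isOpen_right hbV d haV hR.energy))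
    (h.isAngularPairing_comp hdU ht)
  refine ⟨_, _, hc, h1.congr (finite_range α).isCompact (range_subset_iff.2 hα) fun z hz =>
    (h.withLogs_transport d hα haf R c hz).symm, ?_⟩
  · have := h.sum_transport d hα hinj haf R c
    rw [hw]
    linear_combination Real.pi * this

theorem isDirichletRegularPart_transport (h : IsBilipschitzPair U V f F K)
    (hα : ∀ j, α j ∈ U) (haf : ∀ j, f (α j) = a j) (hR : IsDirichletRegularPart V d a R) :
    IsDirichletRegularPart U d α (transportRegularPart f d α R 0) := by
  refine ⟨h.contDiffOn_transport d hα hR.smooth 0, fun φ hφ hφc hφU => ?_, fun p hp => ?_⟩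
  · have hzero : ∀ w ∈ V, w ∉ f '' tsupport φ → (φ ∘ F) w = 0 := fun w hw hws => by
      by_contra hne
      exact hws ⟨F w, subset_tsupport φ hne, h.right_inv w hw⟩
    have hcont : ContDiffOn ℝ ∞ (φ ∘ F) V := hφ.comp_contDiffOn h.symm.contDiffOn
    have hSV : f '' tsupport φ ⊆ V := h.symm.image_subset hφU
    -- `φ ∘ F` is meaningful only on `V`. It vanishes off the compact image of the support of `φ`,
    -- so its extension by zero is an admissible test function.
    obtain ⟨h1, h2, h3⟩ := contDiff_indicator_of_eqOn_zero h.isOpen_right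
      (h.symm.isCompact_image hφc hφU) hSV hcont hzero
    have h4 := hR.distribution_equation _ h1 h3 (h2.trans hSV)
    rw [h.integral_gradDot_transport d hα haf hR.smooth 0 h1.contDiffOn fun z hz => ?_, h4]
    · have : ∀ j, V.indicator (φ ∘ F) (a j) = φ (α j) := fun j => by
        rw [← haf, indicator_of_mem (h.mapsTo_left (hα j)), Function.comp_apply,
          h.left_inv _ (hα j)]
      simp only [this]
    · rw [indicator_of_mem (h.mapsTo_left hz), Function.comp_apply, h.left_inv _ hz]
  · have h1 := (hR.boundary_value _ (h.mapsTo_extend_frontier hp)).comp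
      (h.tendsto_extend (frontier_subset_closure hp))
    refine h1.congr' ?_
    have hpr : p ∉ range α := by
      rintro ⟨j, rfl⟩
      rw [h.isOpen_left.frontier_eq] at hp
      exact hp.2 (hα j)
    filter_upwards [self_mem_nhdsWithin,
      nhdsWithin_le_nhds ((finite_range α).isClosed.isOpen_compl.mem_nhds hpr)] with z hz hzr
    rw [h.withLogs_transport d hα haf R 0 ⟨hz, hzr⟩, add_zero, Function.comp_apply]

theorem isRenormalizedEnergyHat_transport (h : IsBilipschitzPair U V f F K)
    (hα : ∀ j, α j ∈ U) (hinj : Function.Injective α) (haf : ∀ j, f (α j) = a j) {w : ℝ}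
    (hw : IsRenormalizedEnergyHat V d a w) :
    IsRenormalizedEnergyHat U d α
      (w - Real.pi * ∑ j, (d j : ℝ) ^ 2 * Real.log ‖deriv f (α j)‖) := by
  obtain ⟨R, hR, hw⟩ := hw
  refine ⟨_, h.isDirichletRegularPart_transport d hα haf hR, ?_⟩
  have := h.sum_transport d hα hinj haf R 0
  rw [hw]
  linear_combination Real.pi * this

end

end IsBilipschitzPair

/-! ### Integration by parts and closed fields -/

lemma integral_fderiv_apply_eq_zero {u : ℂ → ℝ} (hu : ContDiff ℝ ∞ u) (hc : HasCompactSupport u)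
    (v : ℂ) : ∫ z, fderiv ℝ u z v = 0 := by
  have hcont : Continuous fun z => fderiv ℝ u z v :=
    (hu.continuous_fderiv (by simp)).clm_apply continuous_const
  have := integral_mul_fderiv_eq_neg_fderiv_mul_of_integrable (μ := (volume : Measure ℂ))
    (f := fun _ : ℂ => (1 : ℝ)) (g := u) (v := v) (by simp)
    (by simpa using hcont.integrable_of_hasCompactSupport (hc.fderiv_apply (𝕜 := ℝ) v))
    (by simpa using hu.continuous.integrable_of_hasCompactSupport hc)
    (by fun_prop) (fun x _ => hu.differentiable (by simp) x)
  simpa using this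

lemma partialX_contDiffOn {E : Type*} [NormedAddCommGroup E] [NormedSpace ℝ E] {W : Set ℂ}
    (hW : IsOpen W) {u : ℂ → E} (hu : ContDiffOn ℝ ∞ u W) : ContDiffOn ℝ ∞ (partialX u) W :=
  (hu.fderiv_of_isOpen hW (m := ∞) (by simp)).clm_apply contDiffOn_const

lemma partialY_contDiffOn {E : Type*} [NormedAddCommGroup E] [NormedSpace ℝ E] {W : Set ℂ}
    (hW : IsOpen W) {u : ℂ → E} (hu : ContDiffOn ℝ ∞ u W) : ContDiffOn ℝ ∞ (partialY u) W :=
  (hu.fderiv_of_isOpen hW (m := ∞) (by simp)).clm_apply contDiffOn_const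

lemma partialX_partialY_comm {E : Type*} [NormedAddCommGroup E] [NormedSpace ℝ E] {W : Set ℂ}
    (hW : IsOpen W) {u : ℂ → E} (hu : ContDiffOn ℝ ∞ u W) {z : ℂ} (hz : z ∈ W) :
    partialX (partialY u) z = partialY (partialX u) z := by
  have hat := hu.contDiffAt (hW.mem_nhds hz)
  have hd : DifferentiableAt ℝ (fderiv ℝ u) z :=
    (hat.fderiv_right (m := ∞) (by simp)).differentiableAt (by simp)
  have hs : IsSymmSndFDerivAt ℝ u z := hat.isSymmSndFDerivAt
    (by simpa using WithTop.coe_le_coe.2 (le_top : (2 : ℕ∞) ≤ ⊤))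
  have key : ∀ a b : ℂ, fderiv ℝ (fun y => fderiv ℝ u y a) z b = fderiv ℝ (fderiv ℝ u) z b a := by
    intro a b
    rw [fderiv_clm_apply hd (by fun_prop)]
    simp
  exact (key _ _).trans ((hs.eq _ _).trans (key _ _).symm)

lemma contDiff_mul_of_tsupport_subset {W : Set ℂ} (hW : IsOpen W) {χ P : ℂ → ℝ}
    (hχ : ContDiff ℝ ∞ χ) (hχW : tsupport χ ⊆ W) (hP : ContDiffOn ℝ ∞ P W) :
    ContDiff ℝ ∞ (fun z => χ z * P z) := by
  refine contDiff_iff_contDiffAt.2 fun z => ?_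
  by_cases hz : z ∈ W
  · exact hχ.contDiffAt.mul (hP.contDiffAt (hW.mem_nhds hz))
  · have : (fun z => χ z * P z) =ᶠ[𝓝 z] fun _ => 0 := by
      filter_upwards [notMem_tsupport_iff_eventuallyEq.1 fun h => hz (hχW h)] with y hy
      simp [hy]
    exact contDiffAt_const.congr_of_eventuallyEq this

/-- A compactly supported cutoff integrates to zero against a closed field. -/
lemma integral_closed_field_eq_zero {W : Set ℂ} (hW : IsOpen W) {χ P Q : ℂ → ℝ}
    (hχ : ContDiff ℝ ∞ χ) (hc : HasCompactSupport χ) (hχW : tsupport χ ⊆ W)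
    (hP : ContDiffOn ℝ ∞ P W) (hQ : ContDiffOn ℝ ∞ Q W)
    (hPQ : ∀ z ∈ W, partialX Q z = partialY P z) :
    ∫ z, (partialX χ z * Q z - partialY χ z * P z) = 0 := by
  have hQ' := contDiff_mul_of_tsupport_subset hW hχ hχW hQ
  have hP' := contDiff_mul_of_tsupport_subset hW hχ hχW hP
  have hint : ∀ {u : ℂ → ℝ}, ContDiff ℝ ∞ u → HasCompactSupport u → ∀ v : ℂ,
      Integrable fun z => fderiv ℝ u z v := fun {u} hu huc v =>
    Continuous.integrable_of_hasCompactSupport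
      ((hu.continuous_fderiv (by simp)).clm_apply continuous_const) (huc.fderiv_apply (𝕜 := ℝ) v)
  have h1 := integral_fderiv_apply_eq_zero hQ' hc.mul_right 1
  have h2 := integral_fderiv_apply_eq_zero hP' hc.mul_right Complex.I
  have h3 := integral_sub (hint hQ' hc.mul_right 1) (hint hP' hc.mul_right Complex.I)
  rw [h1, h2, sub_zero] at h3
  rw [← h3]
  refine integral_congr_ae (Eventually.of_forall fun z => ?_)
  dsimp only
  by_cases hz : z ∈ W
  · have hdχ : DifferentiableAt ℝ χ z := hχ.differentiable (by simp) z
    rw [fderiv_fun_mul hdχ ((hQ.contDiffAt (hW.mem_nhds hz)).differentiableAt (by simp)),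
      fderiv_fun_mul hdχ ((hP.contDiffAt (hW.mem_nhds hz)).differentiableAt (by simp))]
    have := hPQ z hz
    simp only [partialX, partialY, add_apply, smul_apply,
      smul_eq_mul] at this ⊢
    rw [this]
    ring
  · have h0 := notMem_tsupport_iff_eventuallyEq.1 fun h => hz (hχW h)
    have hQ0 : (fun z => χ z * Q z) =ᶠ[𝓝 z] fun _ => 0 := by
      filter_upwards [h0] with y hy
      simp [hy]
    have hP0 : (fun z => χ z * P z) =ᶠ[𝓝 z] fun _ => 0 := by
      filter_upwards [h0] with y hy
      simp [hy]
    simp only [partialX, partialY, h0.fderiv_eq, hQ0.fderiv_eq, hP0.fderiv_eq]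
    simp [Pi.zero_def]

lemma setIntegral_eq_integral_of_tsupport {U : Set ℂ} {χ : ℂ → ℝ} (hχU : tsupport χ ⊆ U)
    {G : ℂ → ℝ} (hG : ∀ z, χ =ᶠ[𝓝 z] 0 → G z = 0) : ∫ z in U, G z = ∫ z, G z :=
  setIntegral_eq_integral_of_forall_compl_eq_zero fun z hz =>
    hG z (notMem_tsupport_iff_eventuallyEq.1 fun h => hz (hχU h))

/-- Two gradients are orthogonal after rotation. -/
lemma integral_rot_gradient_eq_zero {W : Set ℂ} (hW : IsOpen W) {χ η : ℂ → ℝ}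
    (hχ : ContDiff ℝ ∞ χ) (hc : HasCompactSupport χ) (hχW : tsupport χ ⊆ W)
    (hη : ContDiffOn ℝ ∞ η W) :
    ∫ z, (partialX χ z * partialY η z - partialY χ z * partialX η z) = 0 :=
  integral_closed_field_eq_zero hW hχ hc hχW (partialX_contDiffOn hW hη)
    (partialY_contDiffOn hW hη) fun _ hz => partialX_partialY_comm hW hη hz

lemma contDiffOn_wedge {W : Set ℂ} {u v : ℂ → ℂ} (hu : ContDiffOn ℝ ∞ u W)
    (hv : ContDiffOn ℝ ∞ v W) : ContDiffOn ℝ ∞ (fun z => wedge (u z) (v z)) W := by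
  have hre : ∀ {w : ℂ → ℂ}, ContDiffOn ℝ ∞ w W → ContDiffOn ℝ ∞ (fun z => (w z).re) W :=
    fun hw => Complex.reCLM.contDiff.comp_contDiffOn hw
  have him : ∀ {w : ℂ → ℂ}, ContDiffOn ℝ ∞ w W → ContDiffOn ℝ ∞ (fun z => (w z).im) W :=
    fun hw => Complex.imCLM.contDiff.comp_contDiffOn hw
  exact ((hre hu).mul (him hv)).sub ((him hu).mul (hre hv))

lemma fderiv_wedge {u v : ℂ → ℂ} {z : ℂ} (hu : DifferentiableAt ℝ u z)
    (hv : DifferentiableAt ℝ v z) (b : ℂ) :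
    fderiv ℝ (fun y => wedge (u y) (v y)) z b =
      wedge (fderiv ℝ u z b) (v z) + wedge (u z) (fderiv ℝ v z b) := by
  have hre : ∀ {w : ℂ → ℂ}, DifferentiableAt ℝ w z →
      HasFDerivAt (fun y => (w y).re) (Complex.reCLM ∘L fderiv ℝ w z) z :=
    fun hw => Complex.reCLM.hasFDerivAt.comp z hw.hasFDerivAt
  have him : ∀ {w : ℂ → ℂ}, DifferentiableAt ℝ w z →
      HasFDerivAt (fun y => (w y).im) (Complex.imCLM ∘L fderiv ℝ w z) z :=
    fun hw => Complex.imCLM.hasFDerivAt.comp z hw.hasFDerivAt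
  have := ((hre hu).mul (him hv)).sub ((him hu).mul (hre hv))
  have h2 : fderiv ℝ (fun y => wedge (u y) (v y)) z = _ := this.fderiv
  rw [h2]
  simp [wedge]
  ring

/-- The derivative of a map of constant norm is orthogonal to it. -/
lemma inner_fderiv_eq_zero_of_norm_eq_one {v : ℂ → ℂ} {z : ℂ} (hv : DifferentiableAt ℝ v z)
    (h1 : ∀ᶠ y in 𝓝 z, ‖v y‖ = 1) (b : ℂ) :
    (v z).re * (fderiv ℝ v z b).re + (v z).im * (fderiv ℝ v z b).im = 0 := by
  have hre : HasFDerivAt (fun y => (v y).re) (Complex.reCLM ∘L fderiv ℝ v z) z :=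
    Complex.reCLM.hasFDerivAt.comp z hv.hasFDerivAt
  have him : HasFDerivAt (fun y => (v y).im) (Complex.imCLM ∘L fderiv ℝ v z) z :=
    Complex.imCLM.hasFDerivAt.comp z hv.hasFDerivAt
  have h2 := (hre.mul hre).add (him.mul him)
  have h3 : (fun y => (v y).re * (v y).re + (v y).im * (v y).im) =ᶠ[𝓝 z] fun _ => 1 := by
    filter_upwards [h1] with y hy
    rw [← Complex.normSq_apply, Complex.normSq_eq_norm_sq, hy, one_pow]
  have h4 := h2.fderiv.symm.trans (h3.fderiv_eq.trans (by simp : fderiv ℝ (fun _ : ℂ => (1:ℝ)) z = 0))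
  have h5 := DFunLike.congr_fun h4 b
  simp at h5
  linarith

/-- Both partial derivatives are orthogonal to `v`, hence parallel in the plane. Algebraically, the
determinant is multiplied by `|v|² = 1` and reduced with the two orthogonality relations. -/
lemma wedge_fderiv_eq_zero_of_norm_eq_one {v : ℂ → ℂ} {z : ℂ} (hv : DifferentiableAt ℝ v z)
    (h1 : ∀ᶠ y in 𝓝 z, ‖v y‖ = 1) : wedge (partialX v z) (partialY v z) = 0 := by
  have hx := inner_fderiv_eq_zero_of_norm_eq_one hv h1 1
  have hy := inner_fderiv_eq_zero_of_norm_eq_one hv h1 Complex.I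
  have hn : (v z).re ^ 2 + (v z).im ^ 2 = 1 := by
    have := h1.self_of_nhds
    rw [pow_two, pow_two, ← Complex.normSq_apply, Complex.normSq_eq_norm_sq, this, one_pow]
  simp only [wedge, partialX, partialY]
  set p := fderiv ℝ v z 1
  set q := fderiv ℝ v z Complex.I
  linear_combination (-(p.re * q.im - p.im * q.re)) * hn
    + (v z).re * (q.im * hx - p.im * hy) + (v z).im * (-q.re * hx + p.re * hy)

/-- The field `v ∧ ∇v` of a circle valued map is closed. -/
lemma closed_wedge {W : Set ℂ} (hW : IsOpen W) {v : ℂ → ℂ} (hv : ContDiffOn ℝ ∞ v W)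
    (h1 : ∀ z ∈ W, ‖v z‖ = 1) {z : ℂ} (hz : z ∈ W) :
    partialX (fun y => wedge (v y) (partialY v y)) z =
      partialY (fun y => wedge (v y) (partialX v y)) z := by
  have hd : ∀ {E : Type} [NormedAddCommGroup E] [NormedSpace ℝ E] {u : ℂ → E},
      ContDiffOn ℝ ∞ u W → DifferentiableAt ℝ u z := fun hu =>
    (hu.contDiffAt (hW.mem_nhds hz)).differentiableAt (by simp)
  have hw := wedge_fderiv_eq_zero_of_norm_eq_one (hd hv)
    (Filter.eventually_of_mem (hW.mem_nhds hz) h1)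
  have hcomm := partialX_partialY_comm hW hv hz
  refine (fderiv_wedge (hd hv) (hd (partialY_contDiffOn hW hv)) 1).trans
    (Eq.trans ?_ (fderiv_wedge (hd hv) (hd (partialX_contDiffOn hW hv)) Complex.I).symm)
  change wedge (partialX v z) (partialY v z) + wedge (v z) (partialX (partialY v) z) =
    wedge (partialY v z) (partialX v z) + wedge (v z) (partialY (partialX v) z)
  rw [hcomm]
  simp only [wedge] at hw ⊢
  linarith

lemma integral_curlDot_eq_zero {W : Set ℂ} (hW : IsOpen W) {χ : ℂ → ℝ} {v : ℂ → ℂ}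
    (hχ : ContDiff ℝ ∞ χ) (hc : HasCompactSupport χ) (hχW : tsupport χ ⊆ W)
    (hv : ContDiffOn ℝ ∞ v W) (h1 : ∀ z ∈ W, ‖v z‖ = 1) :
    ∫ z, curlDot χ v z = 0 :=
  integral_closed_field_eq_zero hW hχ hc hχW (contDiffOn_wedge hv (partialX_contDiffOn hW hv))
    (contDiffOn_wedge hv (partialY_contDiffOn hW hv)) fun _ hz => closed_wedge hW hv h1 hz

/-! ### The fundamental solution -/

lemma polarCoord_symm_eq_circleMap (p : ℝ × ℝ) :
    Complex.polarCoord.symm p = circleMap 0 p.1 p.2 := by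
  rw [Complex.polarCoord_symm_apply, circleMap_zero, Complex.exp_mul_I]
  push_cast
  rfl

/-- In polar coordinates about `a` the Jacobian cancels the singularity, leaving at most the area of
a rectangle. -/
lemma lintegral_inv_ball_lt_top (a : ℂ) (r : ℝ) :
    ∫⁻ z in Metric.ball a r, ‖(z - a)⁻¹‖ₑ < ⊤ := by
  have hshift : ∫⁻ z in Metric.ball a r, ‖(z - a)⁻¹‖ₑ =
      ∫⁻ z, (Metric.ball (0 : ℂ) r).indicator (fun z => ‖z⁻¹‖ₑ) z := by
    rw [← lintegral_indicator measurableSet_ball,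
      ← lintegral_sub_right_eq_self ((Metric.ball (0 : ℂ) r).indicator (fun z => ‖z⁻¹‖ₑ)) a]
    refine lintegral_congr fun z => ?_
    simp only [indicator, Metric.mem_ball, dist_eq_norm, sub_zero]
  rw [hshift, ← Complex.lintegral_comp_polarCoord_symm]
  have hle : ∀ p ∈ polarCoord.target, ENNReal.ofReal p.1 •
      (Metric.ball (0 : ℂ) r).indicator (fun z => ‖z⁻¹‖ₑ) (Complex.polarCoord.symm p) ≤
      (Ioo 0 r ×ˢ Ioo (-Real.pi) Real.pi).indicator 1 p := by
    rintro ⟨ρ, θ⟩ hp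
    rw [polarCoord_target] at hp
    obtain ⟨hρ, hθ⟩ := hp
    simp only [mem_Ioi] at hρ hθ
    by_cases h : ρ < r
    · rw [indicator_of_mem (show (ρ, θ) ∈ Ioo 0 r ×ˢ Ioo (-Real.pi) Real.pi from ⟨⟨hρ, h⟩, hθ⟩),
        indicator_of_mem (by simpa [polarCoord_symm_eq_circleMap, abs_of_pos hρ] using h)]
      rw [← ofReal_norm, polarCoord_symm_eq_circleMap, norm_inv, norm_circleMap_zero,
        abs_of_pos hρ, smul_eq_mul, ← ENNReal.ofReal_mul hρ.le, mul_inv_cancel₀ hρ.ne']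
      simp
    · rw [indicator_of_notMem (s := Metric.ball (0 : ℂ) r)
        (by simpa [polarCoord_symm_eq_circleMap, abs_of_pos hρ] using h)]
      simp
  refine (setLIntegral_mono' (by rw [polarCoord_target]; measurability) hle).trans_lt ?_
  refine (setLIntegral_le_lintegral _ _).trans_lt ?_
  rw [lintegral_indicator_one (measurableSet_Ioo.prod measurableSet_Ioo), Measure.volume_eq_prod,
    Measure.prod_prod]
  exact ENNReal.mul_lt_top (by simp) (by simp)

lemma locallyIntegrable_inv_sub (a : ℂ) : LocallyIntegrable (fun z : ℂ => (z - a)⁻¹) := by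
  rw [locallyIntegrable_iff]
  intro K hK
  obtain ⟨r, hr⟩ := hK.isBounded.subset_ball a
  refine IntegrableOn.mono_set ⟨?_, ?_⟩ hr
  · exact ((measurable_id.sub_const a).inv).aestronglyMeasurable
  · exact lintegral_inv_ball_lt_top a r

lemma integrable_mul_inv_sub {χ : ℂ → ℂ} (hχ : Continuous χ) (hc : HasCompactSupport χ) (a : ℂ) :
    Integrable fun z => χ z * (z - a)⁻¹ :=
  (locallyIntegrable_inv_sub a).integrable_smul_left_of_hasCompactSupport hχ hc

lemma hasDerivAt_circleMap_radius (r θ : ℝ) :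
    HasDerivAt (fun s : ℝ => circleMap 0 s θ) (circleMap 0 1 θ) r := by
  have : HasDerivAt (fun s : ℝ => (s : ℂ) * Complex.exp (θ * Complex.I))
      (1 * Complex.exp (θ * Complex.I)) r := (Complex.ofRealCLM.hasDerivAt).mul_const _
  simpa [circleMap_zero] using this

lemma continuous_circleMap_uncurry : Continuous fun p : ℝ × ℝ => circleMap 0 p.1 p.2 := by
  simp only [circleMap_zero]
  fun_prop

/-- Integration of a compactly supported gradient in polar coordinates. -/
lemma integral_dbar_div_self {φ : ℂ → ℂ} (hφ : ContDiff ℝ ∞ φ) (hc : HasCompactSupport φ) :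
    ∫ z, (partialX φ z + Complex.I * partialY φ z) * z⁻¹ = -(2 * Real.pi * φ 0) := by
  obtain ⟨r, hr0, hr⟩ : ∃ r, 0 < r ∧ tsupport φ ⊆ Metric.closedBall 0 r := by
    obtain ⟨r, hr⟩ := hc.isCompact.isBounded.subset_closedBall 0
    exact ⟨max r 1, by positivity, hr.trans (Metric.closedBall_subset_closedBall (le_max_left _ _))⟩
  have hzero : ∀ s θ : ℝ, r < s → fderiv ℝ φ (circleMap 0 s θ) = 0 := fun s θ hs => by
    have : circleMap 0 s θ ∉ tsupport φ := fun h => by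
      have := hr h
      rw [mem_closedBall_zero_iff, norm_circleMap_zero, abs_of_pos (hr0.trans hs)] at this
      linarith
    rw [(notMem_tsupport_iff_eventuallyEq.1 this).fderiv_eq]
    simp [Pi.zero_def]
  have hφ0 : ∀ s θ : ℝ, r < s → φ (circleMap 0 s θ) = 0 := fun s θ hs => by
    refine image_eq_zero_of_notMem_tsupport fun h => ?_
    have := hr h
    rw [mem_closedBall_zero_iff, norm_circleMap_zero, abs_of_pos (hr0.trans hs)] at this
    linarith
  -- `A` is the radial derivative and `B` the tangential one, that is the angular derivative divided
  -- by the radius. With the Jacobian included, the integrand is `A + i B`: on each ray `A`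
  -- integrates to `-φ(0)`, and on each circle `B` integrates to zero by periodicity.
  set A : ℝ × ℝ → ℂ := fun p => fderiv ℝ φ (circleMap 0 p.1 p.2) (circleMap 0 1 p.2) with hA
  set B : ℝ × ℝ → ℂ := fun p => fderiv ℝ φ (circleMap 0 p.1 p.2) (circleMap 0 1 p.2 * Complex.I)
    with hB
  have hfd : Continuous fun p : ℝ × ℝ => fderiv ℝ φ (circleMap 0 p.1 p.2) :=
    (hφ.continuous_fderiv (by simp)).comp continuous_circleMap_uncurry
  have h1c : Continuous fun p : ℝ × ℝ => circleMap 0 1 p.2 :=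
    (continuous_circleMap 0 1).comp continuous_snd
  have hAc : Continuous A := hfd.clm_apply h1c
  have hBc : Continuous B := hfd.clm_apply (h1c.mul continuous_const)
  have hint : ∀ C : ℝ × ℝ → ℂ, Continuous C → (∀ s θ : ℝ, r < s → C (s, θ) = 0) →
      IntegrableOn C (Ioi 0 ×ˢ Ioo (-Real.pi) Real.pi) := by
    intro C hC h0
    refine IntegrableOn.of_forall_sdiff_eq_zero (s := Icc 0 r ×ˢ Icc (-Real.pi) Real.pi)
      (hC.continuousOn.integrableOn_compact (isCompact_Icc.prod isCompact_Icc))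
      (measurableSet_Ioi.prod measurableSet_Ioo) ?_
    rintro ⟨s, θ⟩ ⟨⟨hs, hθ⟩, hn⟩
    refine h0 s θ ?_
    by_contra! hle
    exact hn ⟨⟨le_of_lt hs, hle⟩, Ioo_subset_Icc_self hθ⟩
  have hAi := hint A hAc fun s θ hs => by simp [hA, hzero s θ hs]
  have hBi := hint B hBc fun s θ hs => by simp [hB, hzero s θ hs]
  rw [← Complex.integral_comp_polarCoord_symm, polarCoord_target]
  have hcongr : ∀ p ∈ Ioi (0 : ℝ) ×ˢ Ioo (-Real.pi) Real.pi,
      p.1 • ((partialX φ (Complex.polarCoord.symm p) +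
        Complex.I * partialY φ (Complex.polarCoord.symm p)) * (Complex.polarCoord.symm p)⁻¹) =
      A p + Complex.I * B p := by
    rintro ⟨s, θ⟩ ⟨hs, -⟩
    have hs : (0 : ℝ) < s := hs
    have hs' : (s : ℂ) ≠ 0 := by exact_mod_cast hs.ne'
    have he : circleMap 0 1 θ = (Real.cos θ : ℂ) + Real.sin θ * Complex.I := by
      simp [circleMap_zero, Complex.exp_mul_I]
    have hsc : (Real.cos θ : ℂ) ^ 2 + (Real.sin θ : ℂ) ^ 2 = 1 := by
      exact_mod_cast Real.cos_sq_add_sin_sq θ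
    have hse : circleMap 0 s θ = s * circleMap 0 1 θ := by simp [circleMap_zero]
    have hinv : (circleMap 0 1 θ)⁻¹ = (Real.cos θ : ℂ) - Real.sin θ * Complex.I := by
      rw [he]
      refine inv_eq_of_mul_eq_one_left ?_
      linear_combination hsc - (Real.sin θ : ℂ) ^ 2 * Complex.I_sq
    rw [polarCoord_symm_eq_circleMap, hA, hB]
    dsimp only
    rw [fderiv_apply_complex, fderiv_apply_complex _ _ (_ * Complex.I)]
    rw [show (circleMap 0 s θ)⁻¹ = (s : ℂ)⁻¹ * (circleMap 0 1 θ)⁻¹ by rw [hse, mul_inv], hinv]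
    have hre : (circleMap 0 1 θ).re = Real.cos θ := by rw [he]; simp [-Complex.ofReal_cos, -Complex.ofReal_sin]
    have him : (circleMap 0 1 θ).im = Real.sin θ := by rw [he]; simp [-Complex.ofReal_cos, -Complex.ofReal_sin]
    rw [Complex.mul_I_re, Complex.mul_I_im, hre, him]
    simp only [Complex.real_smul]
    generalize Real.sin θ = sn
    generalize Real.cos θ = cs
    field_simp
    push_cast
    linear_combination (-(sn : ℂ) * partialY φ (circleMap 0 s θ)) * Complex.I_sq
  rw [setIntegral_congr_fun (measurableSet_Ioi.prod measurableSet_Ioo) hcongr,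
    integral_add hAi (hBi.const_mul _), integral_const_mul]
  have hA2 : ∫ p in Ioi 0 ×ˢ Ioo (-Real.pi) Real.pi, A p = -(2 * Real.pi * φ 0) := by
    rw [IntegrableOn, Measure.volume_eq_prod, ← Measure.prod_restrict] at hAi
    rw [Measure.volume_eq_prod, ← Measure.prod_restrict, integral_prod_symm _ hAi]
    have : ∀ θ : ℝ, ∫ s in Ioi 0, A (s, θ) = -φ 0 := fun θ => by
      have hd : ∀ s : ℝ, HasDerivAt (fun s : ℝ => φ (circleMap 0 s θ)) (A (s, θ)) s := fun s =>
        ((hφ.differentiable (by simp) _).hasFDerivAt).comp_hasDerivAt s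
          (hasDerivAt_circleMap_radius s θ)
      have := integral_Ioi_of_hasDerivAt_of_tendsto (m := 0) (a := 0)
        (hd 0).continuousAt.continuousWithinAt (fun s _ => hd s) ?_ ?_
      · rw [this]
        simp [circleMap_zero]
      · refine IntegrableOn.of_forall_sdiff_eq_zero (s := Icc 0 r)
          (((hAc.comp (Continuous.prodMk_left θ)).continuousOn).integrableOn_compact isCompact_Icc)
          measurableSet_Ioi fun s hs => ?_
        have : r < s := by
          by_contra! hle
          exact hs.2 ⟨le_of_lt hs.1, hle⟩
        simp [hA, hzero s θ this]
      · refine tendsto_const_nhds.congr' ?_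
        filter_upwards [eventually_gt_atTop r] with s hs
        exact (hφ0 s θ hs).symm
    simp only [this]
    rw [integral_const]
    simp only [MeasurableSet.univ, measureReal_restrict_apply, univ_inter, Real.volume_real_Ioo]
    rw [max_eq_left (by linarith [Real.pi_pos])]
    simp only [Complex.real_smul]
    push_cast
    ring
  have hB2 : ∫ p in Ioi 0 ×ˢ Ioo (-Real.pi) Real.pi, B p = 0 := by
    rw [IntegrableOn, Measure.volume_eq_prod, ← Measure.prod_restrict] at hBi
    rw [Measure.volume_eq_prod, ← Measure.prod_restrict, integral_prod _ hBi]
    have : ∀ s ∈ Ioi (0 : ℝ), ∫ θ in Ioo (-Real.pi) Real.pi, B (s, θ) = 0 := fun s hs => by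
      have hs' : (s : ℂ) ≠ 0 := by exact_mod_cast (ne_of_gt hs)
      have hd : ∀ θ : ℝ, HasDerivAt (fun θ : ℝ => φ (circleMap 0 s θ)) (s * B (s, θ)) θ := fun θ => by
        have h := ((hφ.differentiable (by simp) (circleMap 0 s θ)).hasFDerivAt).comp_hasDerivAt θ
          (hasDerivAt_circleMap 0 s θ)
        rw [show circleMap 0 s θ * Complex.I = s • (circleMap 0 1 θ * Complex.I) by
          simp [circleMap_zero, mul_assoc], map_smul, Complex.real_smul] at h
        exact h
      have h := intervalIntegral.integral_eq_sub_of_hasDerivAt (a := -Real.pi) (b := Real.pi)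
        (fun θ _ => hd θ) ((continuous_const.mul (hBc.comp
          (Continuous.prodMk_right s))).intervalIntegrable _ _)
      rw [intervalIntegral.integral_const_mul] at h
      have hper : circleMap 0 s Real.pi = circleMap 0 s (-Real.pi) := by
        simp [circleMap_zero, Complex.exp_neg]
      rw [hper, sub_self, mul_eq_zero, or_iff_right hs', intervalIntegral.integral_of_le
        (by linarith [Real.pi_pos]), integral_Ioc_eq_integral_Ioo] at h
      exact h
    rw [setIntegral_congr_fun measurableSet_Ioi this]
    simp
  rw [hA2, hB2]
  simp

/-- The Cauchy–Pompeiu formula for compactly supported functions. -/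
theorem integral_dbar_mul_inv_sub {ψ : ℂ → ℂ} (hψ : ContDiff ℝ ∞ ψ) (hc : HasCompactSupport ψ)
    (a : ℂ) :
    ∫ z, (partialX ψ z + Complex.I * partialY ψ z) * (z - a)⁻¹ = -(2 * Real.pi * ψ a) := by
  have h := integral_dbar_div_self (φ := fun z => ψ (z + a)) (hψ.comp (contDiff_id.add contDiff_const))
    (hc.comp_homeomorph (Homeomorph.addRight a))
  rw [← integral_add_right_eq_self _ a]
  simp only [zero_add] at h
  rw [← h]
  refine integral_congr_ae (Eventually.of_forall fun z => ?_)
  simp only [partialX, partialY, fderiv_comp_add_right, add_sub_cancel_right]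

lemma hasCompactSupport_ofReal_comp {φ : ℂ → ℝ} (hc : HasCompactSupport φ) :
    HasCompactSupport fun z => (φ z : ℂ) :=
  hc.comp_left Complex.ofReal_zero

lemma fderiv_ofReal_comp {φ : ℂ → ℝ} {z : ℂ} (hφ : DifferentiableAt ℝ φ z) (c : ℂ) :
    fderiv ℝ (fun y => (φ y : ℂ)) z c = (fderiv ℝ φ z c : ℂ) := by
  have := (Complex.ofRealCLM.hasFDerivAt.comp z hφ.hasFDerivAt).fderiv
  exact DFunLike.congr_fun this c

lemma gradDot_log_eq {φ : ℂ → ℝ} (hφ : Differentiable ℝ φ) {a z : ℂ} (hz : z ≠ a) :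
    gradDot (fun y => Real.log ‖y - a‖) φ z =
      ((partialX (fun y => (φ y : ℂ)) z + Complex.I * partialY (fun y => (φ y : ℂ)) z) *
        (z - a)⁻¹).re := by
  have hD : HasDerivAt (fun y : ℂ => y - a) 1 z := (hasDerivAt_id z).sub_const a
  rw [gradDot, partialX_log_norm hD (sub_ne_zero.2 hz), partialY_log_norm hD (sub_ne_zero.2 hz)]
  simp only [partialX, partialY, fderiv_ofReal_comp (hφ z), one_div]
  simp
  ring

lemma continuous_dbar {ψ : ℂ → ℂ} (hψ : ContDiff ℝ ∞ ψ) :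
    Continuous fun z => partialX ψ z + Complex.I * partialY ψ z :=
  ((hψ.continuous_fderiv (by simp)).clm_apply continuous_const).add
    (continuous_const.mul ((hψ.continuous_fderiv (by simp)).clm_apply continuous_const))

lemma hasCompactSupport_dbar {ψ : ℂ → ℂ} (hc : HasCompactSupport ψ) :
    HasCompactSupport fun z => partialX ψ z + Complex.I * partialY ψ z :=
  (hc.fderiv_apply (𝕜 := ℝ) 1).add (HasCompactSupport.mul_left (hc.fderiv_apply (𝕜 := ℝ) Complex.I))

lemma gradDot_log_ae {φ : ℂ → ℝ} (hφ : Differentiable ℝ φ) (a : ℂ) :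
    (fun z => ((partialX (fun y => (φ y : ℂ)) z + Complex.I * partialY (fun y => (φ y : ℂ)) z) *
        (z - a)⁻¹).re) =ᵐ[volume] gradDot (fun y => Real.log ‖y - a‖) φ := by
  filter_upwards [measure_eq_zero_iff_ae_notMem.1 (measure_singleton a (μ := volume))] with z hz
  exact (gradDot_log_eq hφ hz).symm

lemma integrable_gradDot_log {φ : ℂ → ℝ} (hφ : ContDiff ℝ ∞ φ) (hc : HasCompactSupport φ) (a : ℂ) :
    Integrable (gradDot (fun y => Real.log ‖y - a‖) φ) :=
  (integrable_mul_inv_sub (continuous_dbar (Complex.ofRealCLM.contDiff.comp hφ))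
    (hasCompactSupport_dbar (hasCompactSupport_ofReal_comp hc)) a).re.congr
    (gradDot_log_ae (hφ.differentiable (by simp)) a)

/-- `log` is the fundamental solution of the Laplacian. -/
theorem integral_gradDot_log {φ : ℂ → ℝ} (hφ : ContDiff ℝ ∞ φ) (hc : HasCompactSupport φ) (a : ℂ) :
    ∫ z, gradDot (fun y => Real.log ‖y - a‖) φ z = -(2 * Real.pi * φ a) := by
  have hψ : ContDiff ℝ ∞ fun z => (φ z : ℂ) := Complex.ofRealCLM.contDiff.comp hφ
  have hψc := hasCompactSupport_ofReal_comp hc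
  rw [← integral_congr_ae (gradDot_log_ae (hφ.differentiable (by simp)) a)]
  have h := integral_re (𝕜 := ℂ) (integrable_mul_inv_sub (continuous_dbar hψ) (hasCompactSupport_dbar hψc) a)
  refine h.trans ?_
  rw [integral_dbar_mul_inv_sub hψ hψc a]
  simp

/-! ### Potentials with logarithmic singularities, and the Dirichlet problem on the disc -/

section Logs

variable {k : ℕ} (d : Fin k → ℤ) {a : Fin k → ℂ}

lemma gradDot_withLogs {R φ : ℂ → ℝ} {z : ℂ} (hR : DifferentiableAt ℝ R z) (hz : z ∉ range a) :
    gradDot (withLogs d a R) φ z = gradDot R φ z +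
      ∑ j, (d j : ℝ) * gradDot (fun y => Real.log ‖y - a j‖) φ z := by
  have hl : ∀ j, DifferentiableAt ℝ (fun y => Real.log ‖y - a j‖) z := fun j =>
    (hasFDerivAt_log_norm ((hasDerivAt_id z).sub_const (a j))
      (sub_ne_zero.2 fun h => hz ⟨j, h.symm⟩)).differentiableAt
  have h : fderiv ℝ (withLogs d a R) z = fderiv ℝ R z +
      ∑ j, (d j : ℝ) • fderiv ℝ (fun y => Real.log ‖y - a j‖) z := by
    have h1 : HasFDerivAt (withLogs d a R) (fderiv ℝ R z +
        ∑ j, (d j : ℝ) • fderiv ℝ (fun y => Real.log ‖y - a j‖) z) z :=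
      hR.hasFDerivAt.add (HasFDerivAt.fun_sum fun j _ => (hl j).hasFDerivAt.const_mul _)
    exact h1.fderiv
  simp only [gradDot, partialX, partialY, h]
  simp only [add_apply, FunLike.coe_sum, Finset.sum_apply, smul_apply, smul_eq_mul, mul_add,
    Finset.sum_add_distrib, add_mul, Finset.sum_mul, mul_assoc]
  ring

lemma ae_notMem_range_fin (a : Fin k → ℂ) : ∀ᵐ z ∂(volume : Measure ℂ), z ∉ range a :=
  measure_eq_zero_iff_ae_notMem.1 ((finite_range a).measure_zero _)

lemma integrable_gradDot_test {U : Set ℂ} (hU : IsOpen U) {R φ : ℂ → ℝ} (hR : ContDiffOn ℝ ∞ R U)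
    (hφ : ContDiff ℝ ∞ φ) (hc : HasCompactSupport φ) (hφU : tsupport φ ⊆ U) :
    Integrable (gradDot R φ) := by
  have key : ∀ c : ℂ, Integrable fun z => fderiv ℝ φ z c * fderiv ℝ R z c := fun c => by
    have hs : ContDiff ℝ ∞ fun z => fderiv ℝ φ z c :=
      (hφ.fderiv_right (m := ∞) (by simp)).clm_apply contDiff_const
    have hRc : ContDiffOn ℝ ∞ (fun z => fderiv ℝ R z c) U :=
      (hR.fderiv_of_isOpen hU (m := ∞) (by simp)).clm_apply contDiffOn_const
    have hsc := hc.fderiv_apply (𝕜 := ℝ) c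
    exact (contDiff_mul_of_tsupport_subset hU hs ((tsupport_fderiv_apply_subset ℝ c).trans hφU)
      hRc).continuous.integrable_of_hasCompactSupport hsc.mul_right
  refine ((key 1).add (key Complex.I)).congr (Eventually.of_forall fun z => ?_)
  simp only [gradDot, partialX, partialY, Pi.add_apply]
  ring

lemma gradDot_eq_zero_of_eventually {R φ : ℂ → ℝ} {z : ℂ} (h : φ =ᶠ[𝓝 z] 0) :
    gradDot R φ z = 0 := by
  simp only [gradDot, partialX, partialY, h.fderiv_eq]
  simp

lemma integral_gradDot_withLogs {U : Set ℂ} (hU : IsOpen U) {R φ : ℂ → ℝ}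
    (hR : ContDiffOn ℝ ∞ R U) (hφ : ContDiff ℝ ∞ φ) (hc : HasCompactSupport φ)
    (hφU : tsupport φ ⊆ U) :
    ∫ z in U, gradDot (withLogs d a R) φ z =
      (∫ z in U, gradDot R φ z) - 2 * Real.pi * ∑ j, (d j : ℝ) * φ (a j) := by
  have h1 : ∫ z in U, gradDot (withLogs d a R) φ z = ∫ z in U, (gradDot R φ z +
      ∑ j, (d j : ℝ) * gradDot (fun y => Real.log ‖y - a j‖) φ z) := by
    refine setIntegral_congr_ae₀ hU.measurableSet.nullMeasurableSet ?_
    filter_upwards [ae_notMem_range_fin a] with z hz hzU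
    exact gradDot_withLogs d ((hR.contDiffAt (hU.mem_nhds hzU)).differentiableAt (by simp)) hz
  have hlog : ∀ j, Integrable fun z => (d j : ℝ) * gradDot (fun y => Real.log ‖y - a j‖) φ z :=
    fun j => (integrable_gradDot_log hφ hc (a j)).const_mul _
  rw [h1, integral_add (integrable_gradDot_test hU hR hφ hc hφU).integrableOn
    (integrable_finsetSum _ fun j _ => (hlog j).integrableOn),
    integral_finsetSum _ fun j _ => (hlog j).integrableOn]
  have h2 : ∀ j, ∫ z in U, (d j : ℝ) * gradDot (fun y => Real.log ‖y - a j‖) φ z =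
      -(2 * Real.pi * ((d j : ℝ) * φ (a j))) := fun j => by
    rw [setIntegral_eq_integral_of_tsupport hφU fun z hz => by
      rw [gradDot_eq_zero_of_eventually hz, mul_zero], integral_const_mul,
      integral_gradDot_log hφ hc]
    ring
  simp only [h2, Finset.sum_neg_distrib, Finset.mul_sum]
  ring

end Logs

lemma integral_holomorphic_field_eq_zero {W : Set ℂ} (hW : IsOpen W) {φ : ℂ → ℝ} {h : ℂ → ℂ}
    (hφ : ContDiff ℝ ∞ φ) (hc : HasCompactSupport φ) (hφW : tsupport φ ⊆ W)
    (hh : DifferentiableOn ℂ h W) :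
    ∫ z, (partialX φ z * (h z).re - partialY φ z * (h z).im) = 0 := by
  have hs : ContDiffOn ℝ ∞ h W := (hh.contDiffOn hW).restrict_scalars ℝ
  refine integral_closed_field_eq_zero hW hφ hc hφW (P := fun z => (h z).im)
    (Q := fun z => (h z).re) (Complex.imCLM.contDiff.comp_contDiffOn hs)
    (Complex.reCLM.contDiff.comp_contDiffOn hs) fun z hz => ?_
  have hd := (hh.differentiableAt (hW.mem_nhds hz)).hasDerivAt.complexToReal_fderiv
  have h1 := (Complex.reCLM.hasFDerivAt.comp z hd).fderiv
  have h2 := (Complex.imCLM.hasFDerivAt.comp z hd).fderiv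
  refine (DFunLike.congr_fun h1 1).trans (Eq.trans ?_ (DFunLike.congr_fun h2 Complex.I).symm)
  simp

/-- `log |D|` is harmonic for a nonvanishing holomorphic function `D`. -/
lemma integral_gradDot_log_norm_eq_zero {W : Set ℂ} (hW : IsOpen W) {φ : ℂ → ℝ} {D : ℂ → ℂ}
    (hφ : ContDiff ℝ ∞ φ) (hc : HasCompactSupport φ) (hφW : tsupport φ ⊆ W)
    (hD : DifferentiableOn ℂ D W) (h0 : ∀ z ∈ W, D z ≠ 0) :
    ∫ z, gradDot (fun y => Real.log ‖D y‖) φ z = 0 := by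
  rw [← integral_holomorphic_field_eq_zero hW hφ hc hφW
    (h := fun z => deriv D z / D z) ((hD.deriv hW).div hD h0)]
  refine integral_congr_ae (Eventually.of_forall fun z => ?_)
  dsimp only
  by_cases hz : z ∈ W
  · have hd := (hD.differentiableAt (hW.mem_nhds hz)).hasDerivAt
    rw [gradDot, partialX_log_norm hd (h0 z hz), partialY_log_norm hd (h0 z hz)]
    ring
  · have h := notMem_tsupport_iff_eventuallyEq.1 fun h => hz (hφW h)
    rw [gradDot_eq_zero_of_eventually h]
    simp only [partialX, partialY, h.fderiv_eq]
    simp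

/-! ### The Dirichlet problem on the disc -/

section Dirichlet

variable {k : ℕ} (d : Fin k → ℤ) {α : Fin k → ℂ}

lemma one_sub_conj_mul_ne_zero {a z : ℂ} (ha : ‖a‖ < 1) (hz : ‖z‖ ≤ 1) :
    1 - (starRingEnd ℂ) a * z ≠ 0 := by
  intro h
  have h1 : ‖(starRingEnd ℂ) a * z‖ = 1 := by rw [← sub_eq_zero.1 h]; simp
  rw [norm_mul, RCLike.norm_conj] at h1
  nlinarith [norm_nonneg a, norm_nonneg z]

/-- On the unit circle `1 - ā p = p · conj (p - a)`. This is why the explicit Green function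
vanishes on the boundary. -/
lemma norm_sub_eq_of_norm_eq_one {a p : ℂ} (hp : ‖p‖ = 1) :
    ‖p - a‖ = ‖1 - (starRingEnd ℂ) a * p‖ := by
  have h : 1 - (starRingEnd ℂ) a * p = p * (starRingEnd ℂ) (p - a) := by
    rw [map_sub, mul_sub, Complex.mul_conj, Complex.normSq_eq_norm_sq, hp]
    push_cast
    ring
  rw [h, norm_mul, hp, RCLike.norm_conj, one_mul]

/-- Existence for the Dirichlet problem on the disc: the Green function is explicit. -/
theorem isDirichletRegularPart_disc (hα : ∀ j, α j ∈ Metric.ball (0 : ℂ) 1) :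
    IsDirichletRegularPart (Metric.ball 0 1) d α
      (fun z => ∑ j, -(d j : ℝ) * Real.log ‖1 - (starRingEnd ℂ) (α j) * z‖) := by
  have hα' : ∀ j, ‖α j‖ < 1 := fun j => by simpa using hα j
  have hD : ∀ j, Differentiable ℂ fun z => 1 - (starRingEnd ℂ) (α j) * z := fun j => by fun_prop
  have h0 : ∀ j, ∀ z ∈ Metric.ball (0 : ℂ) 1, 1 - (starRingEnd ℂ) (α j) * z ≠ 0 := fun j z hz =>
    one_sub_conj_mul_ne_zero (hα' j) (le_of_lt (by simpa using hz))
  have hsm : ∀ j, ContDiffOn ℝ ∞ (fun z => Real.log ‖1 - (starRingEnd ℂ) (α j) * z‖)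
      (Metric.ball 0 1) := fun j =>
    contDiffOn_log_norm Metric.isOpen_ball (hD j).differentiableOn (h0 j)
  have hsmooth : ContDiffOn ℝ ∞
      (fun z => ∑ j, -(d j : ℝ) * Real.log ‖1 - (starRingEnd ℂ) (α j) * z‖) (Metric.ball 0 1) :=
    ContDiffOn.sum fun j _ => contDiffOn_const.mul (hsm j)
  refine ⟨hsmooth, fun φ hφ hc hφU => ?_, fun p hp => ?_⟩
  · rw [integral_gradDot_withLogs d Metric.isOpen_ball hsmooth hφ hc hφU]
    have : ∫ z in Metric.ball (0 : ℂ) 1, gradDot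
        (fun z => ∑ j, -(d j : ℝ) * Real.log ‖1 - (starRingEnd ℂ) (α j) * z‖) φ z = 0 := by
      have hpt : ∀ z ∈ Metric.ball (0 : ℂ) 1, gradDot
          (fun z => ∑ j, -(d j : ℝ) * Real.log ‖1 - (starRingEnd ℂ) (α j) * z‖) φ z =
          ∑ j, -(d j : ℝ) * gradDot (fun z => Real.log ‖1 - (starRingEnd ℂ) (α j) * z‖) φ z := by
        intro z hz
        have hd : ∀ j, DifferentiableAt ℝ (fun z => Real.log ‖1 - (starRingEnd ℂ) (α j) * z‖) z :=
          fun j => ((hsm j).contDiffAt (Metric.isOpen_ball.mem_nhds hz)).differentiableAt (by simp)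
        have h : fderiv ℝ (fun z => ∑ j, -(d j : ℝ) * Real.log ‖1 - (starRingEnd ℂ) (α j) * z‖) z =
            ∑ j, (-(d j : ℝ)) •
              fderiv ℝ (fun z => Real.log ‖1 - (starRingEnd ℂ) (α j) * z‖) z :=
          (HasFDerivAt.fun_sum fun j _ => (hd j).hasFDerivAt.const_mul _).fderiv
        simp only [gradDot, partialX, partialY, h]
        simp only [FunLike.coe_sum, Finset.sum_apply, smul_apply, smul_eq_mul,
          mul_add, Finset.sum_add_distrib, Finset.sum_mul, mul_assoc]
      rw [setIntegral_congr_fun measurableSet_ball hpt, integral_finsetSum]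
      · refine Finset.sum_eq_zero fun j _ => ?_
        rw [integral_const_mul, setIntegral_eq_integral_of_tsupport hφU fun z hz =>
          gradDot_eq_zero_of_eventually hz, integral_gradDot_log_norm_eq_zero Metric.isOpen_ball hφ
            hc hφU (hD j).differentiableOn (h0 j), mul_zero]
      · exact fun j _ => ((integrable_gradDot_test Metric.isOpen_ball (hsm j) hφ hc
          hφU).integrableOn).const_mul _
    rw [this, zero_sub]
  · have hp1 : ‖p‖ = 1 := by
      rw [frontier_ball _ one_ne_zero] at hp
      simpa using hp
    have hne : ∀ j, p - α j ≠ 0 := fun j h => by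
      have := hα' j
      rw [← sub_eq_zero.1 h, hp1] at this
      exact lt_irrefl _ this
    have hval : withLogs d α
        (fun z => ∑ j, -(d j : ℝ) * Real.log ‖1 - (starRingEnd ℂ) (α j) * z‖) p = 0 := by
      rw [withLogs, ← Finset.sum_add_distrib]
      refine Finset.sum_eq_zero fun j _ => ?_
      rw [norm_sub_eq_of_norm_eq_one hp1]
      ring
    rw [← hval]
    refine ContinuousAt.continuousWithinAt ?_
    refine ContinuousAt.add (tendsto_finsetSum _ fun j _ => ContinuousAt.mul continuousAt_const ?_)
      (tendsto_finsetSum _ fun j _ => ContinuousAt.mul continuousAt_const ?_)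
    · exact ContinuousAt.log (by fun_prop) (norm_ne_zero_iff.2
        (one_sub_conj_mul_ne_zero (hα' j) hp1.le))
    · exact ContinuousAt.log (by fun_prop) (norm_ne_zero_iff.2 (hne j))

/-! ### Uniqueness for the Dirichlet problem -/

/-- A smooth monotone function vanishing exactly on `[-ε, ε]`. -/
noncomputable def softThreshold (ε s : ℝ) : ℝ := expNegInvGlue (s - ε) - expNegInvGlue (-s - ε)

lemma contDiff_softThreshold (ε : ℝ) : ContDiff ℝ ∞ (softThreshold ε) :=
  (expNegInvGlue.contDiff.comp (contDiff_id.sub contDiff_const)).sub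
    (expNegInvGlue.contDiff.comp (contDiff_neg.sub contDiff_const))

lemma monotone_softThreshold (ε : ℝ) : Monotone (softThreshold ε) := fun s t hst =>
  sub_le_sub (expNegInvGlue.monotone (by linarith)) (expNegInvGlue.monotone (by linarith))

lemma softThreshold_eq_zero_iff {ε : ℝ} (hε : 0 < ε) {s : ℝ} : softThreshold ε s = 0 ↔ |s| ≤ ε := by
  rw [abs_le]
  constructor
  · intro h
    by_contra hcon
    rw [not_and_or, not_le, not_le] at hcon
    rcases hcon with h1 | h1
    · have e1 := expNegInvGlue.zero_of_nonpos (x := s - ε) (by linarith)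
      have e2 := expNegInvGlue.pos_of_pos (x := -s - ε) (by linarith)
      rw [softThreshold] at h
      linarith
    · have e1 := expNegInvGlue.zero_of_nonpos (x := -s - ε) (by linarith)
      have e2 := expNegInvGlue.pos_of_pos (x := s - ε) (by linarith)
      rw [softThreshold] at h
      linarith
  · rintro ⟨h1, h2⟩
    rw [softThreshold, expNegInvGlue.zero_of_nonpos (by linarith),
      expNegInvGlue.zero_of_nonpos (by linarith), sub_zero]

/-- A weakly harmonic function on a bounded open set which tends to zero at the boundary vanishes. -/
lemma eq_zero_of_weakly_harmonic {U : Set ℂ} (hU : IsOpen U) (hb : Bornology.IsBounded U)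
    {u : ℂ → ℝ} (hu : ContDiffOn ℝ ∞ u U)
    (hw : ∀ φ : ℂ → ℝ, ContDiff ℝ ∞ φ → HasCompactSupport φ → tsupport φ ⊆ U →
      ∫ z in U, gradDot u φ z = 0)
    (h0 : ∀ p ∈ frontier U, Tendsto u (𝓝[U] p) (𝓝 0)) {z : ℂ} (hz : z ∈ U) : u z = 0 := by
  suffices H : ∀ ε > 0, |u z| ≤ ε from
    abs_nonpos_iff.1 (le_of_forall_pos_le_add fun ε hε => by simpa using H ε hε)
  intro ε hε
  set S : Set ℂ := {z ∈ U | ε ≤ |u z|} with hSdef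
  have hSc : IsClosed S := by
    rw [← isSeqClosed_iff_isClosed]
    intro x p hx hxp
    have hpc : p ∈ closure U := mem_closure_of_tendsto hxp (Eventually.of_forall fun n => (hx n).1)
    have hxU : Tendsto x atTop (𝓝[U] p) :=
      tendsto_nhdsWithin_iff.2 ⟨hxp, Eventually.of_forall fun n => (hx n).1⟩
    by_cases hpU : p ∈ U
    · refine ⟨hpU, ?_⟩
      have := ((hu.continuousOn p hpU).tendsto.comp hxU).abs
      exact ge_of_tendsto this (Eventually.of_forall fun n => (hx n).2)
    · have hf : p ∈ frontier U := ⟨hpc, by rwa [hU.interior_eq]⟩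
      have := ((h0 p hf).comp hxU).abs
      rw [abs_zero] at this
      have := ge_of_tendsto this (Eventually.of_forall fun n => (hx n).2)
      linarith
  have hSK : IsCompact S := Metric.isCompact_of_isClosed_isBounded hSc (hb.subset fun _ h => h.1)
  have hχ : ContDiffOn ℝ ∞ (softThreshold ε ∘ u) U := (contDiff_softThreshold ε).comp_contDiffOn hu
  obtain ⟨hφ, hφS, hφc⟩ := contDiff_indicator_of_eqOn_zero hU hSK (fun _ h => h.1) hχ
    fun z hz hzS => (softThreshold_eq_zero_iff hε).2 (le_of_not_ge fun h => hzS ⟨hz, h⟩)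
  set φ := U.indicator (softThreshold ε ∘ u) with hφdef
  have hφU : tsupport φ ⊆ U := hφS.trans fun _ h => h.1
  have hfd : ∀ z ∈ U, fderiv ℝ φ z = deriv (softThreshold ε) (u z) • fderiv ℝ u z := by
    intro z hz
    have hev : φ =ᶠ[𝓝 z] softThreshold ε ∘ u := by
      filter_upwards [hU.mem_nhds hz] with y hy
      exact indicator_of_mem hy _
    rw [hev.fderiv_eq]
    have h1 : HasDerivAt (softThreshold ε) (deriv (softThreshold ε) (u z)) (u z) :=
      ((contDiff_softThreshold ε).differentiable (by simp) (u z)).hasDerivAt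
    exact (h1.comp_hasFDerivAt z
      ((hu.contDiffAt (hU.mem_nhds hz)).differentiableAt (by simp)).hasFDerivAt).fderiv
  -- By monotonicity of the truncation, the tested integrand `η'(u) |∇u|²` is nonnegative. Its
  -- integral is zero, so the gradient of the truncated function vanishes; that function is constant
  -- and equals zero off `U`.
  have hη : ∀ s, 0 ≤ deriv (softThreshold ε) s := fun s => (monotone_softThreshold ε).deriv_nonneg
  have hg : ∀ z ∈ U, gradDot u φ z =
      deriv (softThreshold ε) (u z) * (partialX u z ^ 2 + partialY u z ^ 2) := fun z hz => by
    simp only [gradDot, partialX, partialY, hfd z hz, smul_apply, smul_eq_mul]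
    ring
  have hnn : ∀ z ∈ U, 0 ≤ gradDot u φ z := fun z hz => by
    rw [hg z hz]
    exact mul_nonneg (hη _) (by positivity)
  have hint := integrable_gradDot_test hU hu hφ hφc hφU
  have hcont : ContinuousOn (gradDot u φ) U := by
    have hc1 := hu.continuousOn_fderiv_of_isOpen hU (by simp)
    have hc2 := (hφ.continuous_fderiv (by simp)).continuousOn (s := U)
    exact ((hc1.clm_apply continuousOn_const).mul (hc2.clm_apply continuousOn_const)).add
      ((hc1.clm_apply continuousOn_const).mul (hc2.clm_apply continuousOn_const))
  have hae : gradDot u φ =ᵐ[volume.restrict U] 0 :=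
    (setIntegral_eq_zero_iff_of_nonneg_ae (ae_restrict_of_forall_mem hU.measurableSet hnn)
      hint.integrableOn).1 (hw φ hφ hφc hφU)
  have hzero : EqOn (gradDot u φ) 0 U := Measure.eqOn_open_of_ae_eq hae hU hcont continuousOn_const
  have hfd0 : ∀ z, fderiv ℝ φ z = 0 := by
    intro z
    by_cases hz : z ∈ U
    · have h1 := hzero hz
      rw [hg z hz, Pi.zero_apply, mul_eq_zero] at h1
      rw [hfd z hz]
      rcases h1 with h1 | h1
      · rw [h1, zero_smul]
      · have hx : partialX u z = 0 := by nlinarith [sq_nonneg (partialX u z), sq_nonneg (partialY u z)]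
        have hy : partialY u z = 0 := by nlinarith [sq_nonneg (partialX u z), sq_nonneg (partialY u z)]
        have : fderiv ℝ u z = 0 := by
          ext c
          rw [fderiv_apply_complex, hx, hy]
          simp
        rw [this, smul_zero]
    · rw [(notMem_tsupport_iff_eventuallyEq.1 fun h => hz (hφU h)).fderiv_eq]
      simp [Pi.zero_def]
  obtain ⟨q, hq⟩ : ∃ q, q ∉ U := by
    by_contra! h
    exact NormedSpace.unbounded_univ ℝ ℂ (by rwa [← eq_univ_of_forall h])
  have hconst := is_const_of_fderiv_eq_zero (hφ.differentiable (by simp)) hfd0 z q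
  rw [hφdef, indicator_of_mem hz, indicator_of_notMem hq] at hconst
  exact (softThreshold_eq_zero_iff hε).1 hconst

theorem IsDirichletRegularPart.eqOn {U : Set ℂ} (hU : IsOpen U) (hb : Bornology.IsBounded U)
    {R R' : ℂ → ℝ} (h : IsDirichletRegularPart U d α R)
    (h' : IsDirichletRegularPart U d α R') : EqOn R R' U := by
  intro z hz
  refine sub_eq_zero.1 (eq_zero_of_weakly_harmonic hU hb (h.smooth.sub h'.smooth)
    (fun φ hφ hc hφU => ?_) (fun p hp => ?_) hz)
  · have e1 := h.distribution_equation φ hφ hc hφU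
    have e2 := h'.distribution_equation φ hφ hc hφU
    rw [integral_gradDot_withLogs d hU h.smooth hφ hc hφU] at e1
    rw [integral_gradDot_withLogs d hU h'.smooth hφ hc hφU] at e2
    have hpt : ∀ z ∈ U, gradDot (fun z => R z - R' z) φ z = gradDot R φ z - gradDot R' φ z := by
      intro z hz
      have hd := (h.smooth.contDiffAt (hU.mem_nhds hz)).differentiableAt (by simp)
      have hd' := (h'.smooth.contDiffAt (hU.mem_nhds hz)).differentiableAt (by simp)
      simp only [gradDot, partialX, partialY, fderiv_fun_sub hd hd', sub_apply]
      ring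
    rw [setIntegral_congr_fun hU.measurableSet hpt, integral_sub
      (integrable_gradDot_test hU h.smooth hφ hc hφU).integrableOn
      (integrable_gradDot_test hU h'.smooth hφ hc hφU).integrableOn]
    linarith
  · have := (h.boundary_value p hp).sub (h'.boundary_value p hp)
    simpa [withLogs] using this

theorem existsUnique_isRenormalizedEnergyHat_disc (hα : ∀ j, α j ∈ Metric.ball (0 : ℂ) 1) :
    ∃! w, IsRenormalizedEnergyHat (Metric.ball 0 1) d α w := by
  refine ⟨_, ⟨_, isDirichletRegularPart_disc d hα, rfl⟩, ?_⟩
  rintro w ⟨R, hR, rfl⟩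
  have := hR.eqOn d Metric.isOpen_ball Metric.isBounded_ball (isDirichletRegularPart_disc d hα)
  congr 2
  exact Finset.sum_congr rfl fun j _ => by rw [this (hα j)]

end Dirichlet

/-! ### The unit disc: boundary measure and polar coordinates -/

lemma mem_frontier_disc {x : ℂ} : x ∈ frontier (Metric.ball (0 : ℂ) 1) ↔ ‖x‖ = 1 := by
  rw [frontier_ball _ one_ne_zero]
  simp

lemma hasBoundaryDensity_disc : HasBoundaryDensity (Metric.ball (0 : ℂ) 1) := by
  refine ⟨Real.pi / 4, by positivity, fun x hx r hr hr1 => ?_⟩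
  rw [mem_frontier_disc] at hx
  -- A ball of radius `r / 2`, tangent to the circle from inside at `x`, lies in the intersection;
  -- its area is `π r² / 4`.
  have hsub : Metric.ball (((1 - r / 2 : ℝ) : ℂ) * x) (r / 2) ⊆
      Metric.ball x r ∩ Metric.ball 0 1 := by
    intro z hz
    rw [Metric.mem_ball, dist_eq_norm] at hz
    constructor
    · rw [Metric.mem_ball, dist_eq_norm]
      calc ‖z - x‖ = ‖(z - ((1 - r / 2 : ℝ) : ℂ) * x) + ((-(r / 2) : ℝ) : ℂ) * x‖ := by
            congr 1; push_cast; ring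
        _ ≤ _ := norm_add_le _ _
        _ < r / 2 + r / 2 := by
            rw [norm_mul, hx, Complex.norm_real, Real.norm_eq_abs, abs_neg, abs_of_pos (by linarith)]
            linarith
        _ = r := by ring
    · rw [mem_ball_zero_iff]
      calc ‖z‖ = ‖(z - ((1 - r / 2 : ℝ) : ℂ) * x) + ((1 - r / 2 : ℝ) : ℂ) * x‖ := by
            congr 1; ring
        _ ≤ _ := norm_add_le _ _
        _ < r / 2 + (1 - r / 2) := by
            rw [norm_mul, hx, Complex.norm_real, Real.norm_eq_abs, abs_of_pos (by linarith)]
            linarith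
        _ = 1 := by ring
  refine le_trans (le_of_eq ?_) (measure_mono hsub)
  rw [Complex.volume_ball, ← ENNReal.ofReal_pow (by positivity), ← ENNReal.ofReal_coe_nnreal,
    ← ENNReal.ofReal_mul (by positivity)]
  congr 1
  simp only [NNReal.coe_real_pi]
  ring

/-- The interval of angles. -/
noncomputable def angleMeasure : Measure ℝ := volume.restrict (Ioo (-Real.pi) Real.pi)

instance : IsFiniteMeasure angleMeasure := by
  unfold angleMeasure
  infer_instance

lemma measurable_circleMap_one : Measurable (circleMap 0 1) := (continuous_circleMap 0 1).measurable

lemma circleMap_one_arg {x : ℂ} (hx : ‖x‖ = 1) : circleMap 0 1 x.arg = x := by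
  have := Complex.norm_mul_exp_arg_mul_I x
  rw [hx] at this
  simpa [circleMap_zero] using this

lemma boundaryMeasure_disc_le :
    boundaryMeasure (Metric.ball (0 : ℂ) 1) ≤ angleMeasure.map (circleMap 0 1) := by
  refine Measure.le_iff.2 fun A hA => ?_
  rw [Measure.map_apply measurable_circleMap_one hA, angleMeasure,
    Measure.restrict_congr_set Ioo_ae_eq_Ioc,
    Measure.restrict_apply (measurable_circleMap_one hA), boundaryMeasure, Measure.restrict_apply hA]
  have hsub : A ∩ frontier (Metric.ball (0 : ℂ) 1) ⊆
      circleMap 0 1 '' (circleMap 0 1 ⁻¹' A ∩ Ioc (-Real.pi) Real.pi) := fun x hx => by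
    have h1 := circleMap_one_arg (mem_frontier_disc.1 hx.2)
    exact ⟨x.arg, ⟨by rw [mem_preimage, h1]; exact hx.1, Complex.arg_mem_Ioc x⟩, h1⟩
  refine (measure_mono hsub).trans
    (((lipschitzWith_circleMap 0 1).hausdorffMeasure_image_le zero_le_one _).trans ?_)
  rw [hausdorffMeasure_real]
  simp

lemma boundaryMeasure_disc_univ_lt_top : boundaryMeasure (Metric.ball (0 : ℂ) 1) univ < ⊤ :=
  (boundaryMeasure_disc_le univ).trans_lt (measure_lt_top _ _)

/-- The chord has length `2 |sin ((s - t) / 2)|`, and Jordan's inequality bounds the sine from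
below. -/
lemma abs_sub_le_norm_circleMap_sub {s t : ℝ} (h : |s - t| ≤ Real.pi) :
    |s - t| ≤ Real.pi / 2 * ‖circleMap 0 1 s - circleMap 0 1 t‖ := by
  have h1 : ‖circleMap 0 1 s - circleMap 0 1 t‖ = 2 * |Real.sin ((s - t) / 2)| := by
    have : circleMap 0 1 s - circleMap 0 1 t =
        (Complex.exp (Complex.I * ((s - t : ℝ) : ℂ)) - 1) * circleMap 0 1 t := by
      simp only [circleMap_zero, Complex.ofReal_one, one_mul, sub_mul, ← Complex.exp_add]
      push_cast
      ring_nf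
    rw [this, norm_mul, norm_circleMap_zero, Complex.norm_exp_I_mul_ofReal_sub_one, norm_mul]
    simp
  have h2 := Real.mul_abs_le_abs_sin (x := (s - t) / 2)
    (by rw [abs_div, abs_two]; linarith)
  rw [h1]
  rw [abs_div, abs_two] at h2
  have hpi := Real.pi_pos
  rw [div_mul_div_comm, div_le_iff₀ (by positivity)] at h2
  linarith

/-- On each closed half-circle the inverse of the parametrization is `π/2`-Lipschitz, so it carries
null sets of the Hausdorff measure to null sets of angles. Together with the upper bound for the
boundary measure, this replaces an exact computation of arclength. -/
lemma map_circleMap_absolutelyContinuous :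
    angleMeasure.map (circleMap 0 1) ≪ boundaryMeasure (Metric.ball (0 : ℂ) 1) := by
  refine Measure.AbsolutelyContinuous.mk fun A hA h0 => ?_
  rw [boundaryMeasure, Measure.restrict_apply hA] at h0
  rw [Measure.map_apply measurable_circleMap_one hA, angleMeasure,
    Measure.restrict_apply (measurable_circleMap_one hA)]
  have key : ∀ I : Set ℝ, (∀ s ∈ I, ∀ t ∈ I, |s - t| ≤ Real.pi) →
      volume (circleMap 0 1 ⁻¹' A ∩ I) = 0 := by
    intro I hI
    have hinj : InjOn (circleMap 0 1) I := fun s hs t ht hst => by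
      have := abs_sub_le_norm_circleMap_sub (hI s hs t ht)
      rw [hst, sub_self, norm_zero, mul_zero] at this
      exact sub_eq_zero.1 (abs_nonpos_iff.1 this)
    set g := Function.invFunOn (circleMap 0 1) I with hg
    have hgi : ∀ s ∈ I, g (circleMap 0 1 s) = s := fun s hs => hinj.leftInvOn_invFunOn hs
    set S := circleMap 0 1 '' (circleMap 0 1 ⁻¹' A ∩ I) with hS
    have hlip : LipschitzOnWith (Real.toNNReal (Real.pi / 2)) g S := by
      refine LipschitzOnWith.of_dist_le_mul ?_
      rintro _ ⟨s, hs, rfl⟩ _ ⟨t, ht, rfl⟩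
      rw [hgi s hs.2, hgi t ht.2, Real.dist_eq, dist_eq_norm, Real.coe_toNNReal _ (by positivity)]
      exact abs_sub_le_norm_circleMap_sub (hI s hs.2 t ht.2)
    have hsub : circleMap 0 1 ⁻¹' A ∩ I ⊆ g '' S := fun s hs =>
      ⟨_, ⟨s, hs, rfl⟩, hgi s hs.2⟩
    have hSA : S ⊆ A ∩ frontier (Metric.ball (0 : ℂ) 1) := by
      rintro _ ⟨s, hs, rfl⟩
      exact ⟨hs.1, mem_frontier_disc.2 (by simp)⟩
    refine measure_mono_null hsub ?_
    rw [← hausdorffMeasure_real]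
    refine le_antisymm ((hlip.hausdorffMeasure_image_le zero_le_one).trans ?_) bot_le
    rw [measure_mono_null hSA h0, mul_zero]
  have h1 := key (Icc (-Real.pi) 0) fun s hs t ht => abs_le.2 ⟨by linarith [hs.1, hs.2, ht.1, ht.2],
    by linarith [hs.1, hs.2, ht.1, ht.2]⟩
  have h2 := key (Icc 0 Real.pi) fun s hs t ht => abs_le.2 ⟨by linarith [hs.1, hs.2, ht.1, ht.2],
    by linarith [hs.1, hs.2, ht.1, ht.2]⟩
  refine measure_mono_null (fun s hs => ?_) (measure_union_null h1 h2)
  rcases le_total s 0 with h | h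
  · exact Or.inl ⟨hs.1, hs.2.1.le, h⟩
  · exact Or.inr ⟨hs.1, h, hs.2.2.le⟩

/-- Open annuli centred at the origin. -/
def annulus (a b : ℝ) : Set ℂ := {z | a < ‖z‖ ∧ ‖z‖ < b}

lemma isOpen_annulus (a b : ℝ) : IsOpen (annulus a b) :=
  (isOpen_lt continuous_const continuous_norm).inter (isOpen_lt continuous_norm continuous_const)

lemma annulus_mono {a a' b b' : ℝ} (ha : a' ≤ a) (hb : b ≤ b') : annulus a b ⊆ annulus a' b' :=
  fun _ hz => ⟨ha.trans_lt hz.1, hz.2.trans_le hb⟩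

lemma annulus_subset_ball (a : ℝ) : annulus a 1 ⊆ Metric.ball 0 1 := fun z hz => by
  simpa using hz.2

lemma circleMap_mem_annulus {a b r θ : ℝ} (ha : 0 ≤ a) : r ∈ Ioo a b →
    circleMap 0 r θ ∈ annulus a b := fun h => by
  change a < ‖circleMap 0 r θ‖ ∧ ‖circleMap 0 r θ‖ < b
  rw [norm_circleMap_zero, abs_of_pos (ha.trans_lt h.1)]
  exact h

lemma measurable_indicator_of_continuousOn {U : Set ℂ} (hU : MeasurableSet U) {F : ℂ → ENNReal}
    (hF : ContinuousOn F U) : Measurable (U.indicator F) := by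
  classical
  rw [← piecewise_eq_indicator]
  exact hF.measurable_piecewise continuousOn_const hU

lemma lintegral_annulus {a b : ℝ} (ha : 0 ≤ a) {F : ℂ → ENNReal}
    (hm : Measurable ((annulus a b).indicator F)) :
    ∫⁻ z in annulus a b, F z =
      ∫⁻ θ, (∫⁻ r in Ioo a b, ENNReal.ofReal r * F (circleMap 0 r θ)) ∂angleMeasure := by
  rw [← lintegral_indicator (isOpen_annulus a b).measurableSet,
    ← Complex.lintegral_comp_polarCoord_symm, polarCoord_target, Measure.volume_eq_prod,
    ← Measure.prod_restrict, lintegral_prod_symm]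
  · rw [angleMeasure]
    refine lintegral_congr fun θ => ?_
    rw [← lintegral_indicator measurableSet_Ioi, ← lintegral_indicator measurableSet_Ioo]
    refine lintegral_congr fun r => ?_
    by_cases hr : 0 < r
    · rw [indicator_of_mem (show r ∈ Ioi 0 from hr), polarCoord_symm_eq_circleMap]
      have hiff : circleMap 0 r θ ∈ annulus a b ↔ r ∈ Ioo a b := by
        change a < ‖circleMap 0 r θ‖ ∧ ‖circleMap 0 r θ‖ < b ↔ _
        rw [norm_circleMap_zero, abs_of_pos hr]
        rfl
      by_cases h : r ∈ Ioo a b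
      · rw [indicator_of_mem h, indicator_of_mem (hiff.2 h), smul_eq_mul]
      · rw [indicator_of_notMem h, indicator_of_notMem (fun h' => h (hiff.1 h')), smul_zero]
    · rw [indicator_of_notMem (show r ∉ Ioi 0 from hr), indicator_of_notMem fun h =>
        hr (ha.trans_lt h.1)]
  · simp only [polarCoord_symm_eq_circleMap, smul_eq_mul]
    exact ((measurable_fst.ennreal_ofReal).mul
      (hm.comp continuous_circleMap_uncurry.measurable)).aemeasurable

lemma lintegral_annulus_le {a b : ℝ} (ha : 0 ≤ a) (hb : b ≤ 1) {F : ℂ → ENNReal}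
    (hF : Measurable ((annulus a b).indicator F)) :
    ∫⁻ z in annulus a b, F z ≤ ∫⁻ θ, (∫⁻ r in Ioo a b, F (circleMap 0 r θ)) ∂angleMeasure := by
  rw [lintegral_annulus ha hF]
  refine lintegral_mono fun θ => setLIntegral_mono' measurableSet_Ioo fun r hr => ?_
  exact mul_le_of_le_one_left bot_le (by simpa using hr.2.le.trans hb)

lemma lintegral_polar_le {a b : ℝ} (ha : 1 / 2 ≤ a) {F : ℂ → ENNReal}
    (hF : ContinuousOn F (annulus a b)) :
    ∫⁻ θ, (∫⁻ r in Ioo a b, F (circleMap 0 r θ)) ∂angleMeasure ≤ 2 * ∫⁻ z in annulus a b, F z := by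
  rw [lintegral_annulus (by linarith) (measurable_indicator_of_continuousOn
    (isOpen_annulus a b).measurableSet hF), ← lintegral_const_mul' _ _ (by simp)]
  refine lintegral_mono fun θ => ?_
  dsimp only
  rw [← lintegral_const_mul' _ _ (by simp)]
  refine setLIntegral_mono' measurableSet_Ioo fun r hr => ?_
  rw [← mul_assoc]
  refine le_mul_of_one_le_left bot_le ?_
  rw [← ENNReal.ofReal_ofNat 2, ← ENNReal.ofReal_mul (by simp)]
  rw [ENNReal.one_le_ofReal]
  linarith [hr.1]

/-- Joint measurability in polar coordinates. -/
lemma measurable_indicator_polar {a b : ℝ} (ha : 0 ≤ a) {F : ℂ → ENNReal}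
    (hF : ContinuousOn F (annulus a b)) :
    Measurable fun p : ℝ × ℝ => (Ioo a b).indicator (fun r => F (circleMap 0 r p.1)) p.2 := by
  have hm := measurable_indicator_of_continuousOn (isOpen_annulus a b).measurableSet hF
  -- The indicator of positive radii is needed because a negative radius also lands in the annulus,
  -- at the opposite angle.
  have h2 : Measurable fun p : ℝ × ℝ =>
      (annulus a b).indicator F (circleMap 0 p.2 p.1) * (Ioi (0 : ℝ)).indicator 1 p.2 :=
    (hm.comp (continuous_circleMap_uncurry.measurable.comp measurable_swap)).mul
      ((measurable_const.indicator measurableSet_Ioi).comp measurable_snd)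
  convert h2 using 1
  funext ⟨θ, r⟩
  dsimp only
  by_cases hr : 0 < r
  · have hiff : circleMap 0 r θ ∈ annulus a b ↔ r ∈ Ioo a b := by
      change a < ‖circleMap 0 r θ‖ ∧ ‖circleMap 0 r θ‖ < b ↔ _
      rw [norm_circleMap_zero, abs_of_pos hr]
      rfl
    rw [indicator_of_mem (show r ∈ Ioi 0 from hr), Pi.one_apply, mul_one]
    by_cases h : r ∈ Ioo a b
    · rw [indicator_of_mem h, indicator_of_mem (hiff.2 h)]
    · rw [indicator_of_notMem h, indicator_of_notMem (fun h' => h (hiff.1 h'))]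
  · rw [indicator_of_notMem (show r ∉ Ioi 0 from hr), mul_zero, indicator_of_notMem fun h =>
        hr (ha.trans_lt h.1)]

lemma measurable_lintegral_radial {a b : ℝ} (ha : 0 ≤ a) {F : ℂ → ENNReal}
    (hF : ContinuousOn F (annulus a b)) :
    Measurable fun θ : ℝ => ∫⁻ r in Ioo a b, F (circleMap 0 r θ) := by
  simp only [← lintegral_indicator measurableSet_Ioo]
  exact (measurable_indicator_polar ha hF).lintegral_prod_right'

/-! ### One-dimensional estimates -/

lemma sq_lintegral_le {X : Type*} [MeasurableSpace X] {μ : Measure X} {F : X → ENNReal}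
    (hF : AEMeasurable F μ) : (∫⁻ x, F x ∂μ) ^ 2 ≤ μ univ * ∫⁻ x, F x ^ 2 ∂μ := by
  have h := ENNReal.lintegral_mul_le_Lp_mul_Lq μ Real.HolderConjugate.two_two
    (f := fun _ => 1) (g := F) aemeasurable_const hF
  simp only [Pi.mul_apply, one_mul, ENNReal.one_rpow, lintegral_const] at h
  calc (∫⁻ x, F x ∂μ) ^ 2
      ≤ (μ univ ^ (1 / 2 : ℝ) * (∫⁻ x, F x ^ (2 : ℝ) ∂μ) ^ (1 / 2 : ℝ)) ^ 2 := by gcongr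
    _ = μ univ * ∫⁻ x, F x ^ 2 ∂μ := by
        rw [mul_pow, ← ENNReal.rpow_natCast, ← ENNReal.rpow_natCast, ← ENNReal.rpow_mul,
          ← ENNReal.rpow_mul]
        norm_num

lemma enorm_sub_le_lintegral_deriv {E : Type*} [NormedAddCommGroup E] [NormedSpace ℝ E]
    [CompleteSpace E] {γ γ' : ℝ → E} {a b : ℝ} (hγ : ∀ t ∈ Ioo a b, HasDerivAt γ (γ' t) t)
    (hc : ContinuousOn γ' (Ioo a b)) {r s : ℝ} (hr : r ∈ Ioo a b) (hs : s ∈ Ioo a b) :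
    ‖γ r - γ s‖ₑ ≤ ∫⁻ t in Ioo a b, ‖γ' t‖ₑ := by
  wlog hrs : r ≤ s generalizing r s
  · rw [← enorm_neg, neg_sub]
    exact this hs hr (le_of_not_ge hrs)
  have hsub : uIcc r s ⊆ Ioo a b := by
    rw [uIcc_of_le hrs]
    exact fun t ht => ⟨hr.1.trans_le ht.1, ht.2.trans_lt hs.2⟩
  have h := intervalIntegral.integral_eq_sub_of_hasDerivAt (fun t ht => hγ t (hsub ht))
    (hc.mono hsub).intervalIntegrable
  rw [← enorm_neg, neg_sub, ← h, intervalIntegral.integral_of_le hrs]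
  refine (enorm_integral_le_lintegral_enorm _).trans (lintegral_mono_set fun t ht => ?_)
  exact ⟨hr.1.trans ht.1, ht.2.trans_lt hs.2⟩

lemma enorm_circleMap_one (θ : ℝ) : ‖circleMap 0 1 θ‖ₑ = 1 := by
  rw [← ofReal_norm, norm_circleMap_zero]
  simp

lemma enorm_sub_le_lintegral_radial {E : Type*} [NormedAddCommGroup E] [NormedSpace ℝ E]
    [CompleteSpace E] {y : ℂ → E} {a b : ℝ} (ha : 0 ≤ a) (hy : ContDiffOn ℝ ∞ y (annulus a b))
    (θ : ℝ) {r s : ℝ} (hr : r ∈ Ioo a b) (hs : s ∈ Ioo a b) :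
    ‖y (circleMap 0 r θ) - y (circleMap 0 s θ)‖ₑ ≤
      ∫⁻ t in Ioo a b, ‖fderiv ℝ y (circleMap 0 t θ)‖ₑ := by
  have ho := isOpen_annulus a b
  refine (enorm_sub_le_lintegral_deriv (γ := fun t => y (circleMap 0 t θ))
    (γ' := fun t => fderiv ℝ y (circleMap 0 t θ) (circleMap 0 1 θ)) (fun t ht => ?_) ?_
    hr hs).trans (lintegral_mono fun t => ?_)
  · exact (((hy.contDiffAt (ho.mem_nhds (circleMap_mem_annulus ha ht))).differentiableAt
      (by simp)).hasFDerivAt).comp_hasDerivAt (f := fun s => circleMap 0 s θ) t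
      (hasDerivAt_circleMap_radius t θ)
  · refine ContinuousOn.clm_apply ?_ continuousOn_const
    exact (hy.continuousOn_fderiv_of_isOpen ho (by simp)).comp
      ((continuous_circleMap_uncurry.comp (Continuous.prodMk_left θ)).continuousOn)
      fun t ht => circleMap_mem_annulus ha ht
  · refine ((fderiv ℝ y (circleMap 0 t θ)).le_opENorm _).trans ?_
    rw [enorm_circleMap_one, mul_one]

lemma enorm_sub_le_lintegral_angular {E : Type*} [NormedAddCommGroup E] [NormedSpace ℝ E]
    [CompleteSpace E] {y : ℂ → E} {a b : ℝ} (ha : 0 ≤ a) (hb : b ≤ 1)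
    (hy : ContDiffOn ℝ ∞ y (annulus a b))
    {r θ θ' : ℝ} (hr : r ∈ Ioo a b) (hθ : θ ∈ Ioo (-Real.pi) Real.pi)
    (hθ' : θ' ∈ Ioo (-Real.pi) Real.pi) :
    ‖y (circleMap 0 r θ) - y (circleMap 0 r θ')‖ₑ ≤
      ∫⁻ t, ‖fderiv ℝ y (circleMap 0 r t)‖ₑ ∂angleMeasure := by
  have ho := isOpen_annulus a b
  refine (enorm_sub_le_lintegral_deriv (γ := fun t => y (circleMap 0 r t))
    (γ' := fun t => fderiv ℝ y (circleMap 0 r t) (circleMap 0 r t * Complex.I)) (fun t _ => ?_) ?_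
    hθ hθ').trans (lintegral_mono fun t => ?_)
  · exact (((hy.contDiffAt (ho.mem_nhds (circleMap_mem_annulus ha hr))).differentiableAt
      (by simp)).hasFDerivAt).comp_hasDerivAt t (hasDerivAt_circleMap 0 r t)
  · refine ContinuousOn.clm_apply ?_ ((continuous_circleMap 0 r).mul continuous_const).continuousOn
    exact (hy.continuousOn_fderiv_of_isOpen ho (by simp)).comp (continuous_circleMap 0 r).continuousOn
      fun t _ => circleMap_mem_annulus ha hr
  · refine ((fderiv ℝ y (circleMap 0 r t)).le_opENorm _).trans (mul_le_of_le_one_right bot_le ?_)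
    rw [enorm_mul, ← ofReal_norm, norm_circleMap_zero, abs_of_pos (ha.trans_lt hr.1),
      ← ofReal_norm, Complex.norm_I]
    simpa using hr.2.le.trans hb

/-! ### Functions with vanishing trace on the circle -/

/-- The point `z` is within `2δ` of its radial projection, and an angular change below `δ` moves
that projection by less than `δ`. The interval of length `δ` is taken on the side of `arg z`
pointing towards `0`, so that it does not cross `±π`. -/
lemma ofReal_le_angleMeasure {z : ℂ} {δ : ℝ} (h0 : 0 < δ) (h1 : δ < 1)
    (hz : z ∈ annulus (1 - 2 * δ) (1 - δ)) :
    ENNReal.ofReal δ ≤ angleMeasure {θ | z - circleMap 0 1 θ ∈ Metric.ball 0 (3 * δ)} := by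
  have hpi := Real.pi_gt_three
  have hclose : ∀ θ : ℝ, |θ - z.arg| < δ → z - circleMap 0 1 θ ∈ Metric.ball 0 (3 * δ) := by
    intro θ hθ
    have e1 : ‖z - circleMap 0 1 z.arg‖ = 1 - ‖z‖ := by
      have : z - circleMap 0 1 z.arg = ((‖z‖ - 1 : ℝ) : ℂ) * circleMap 0 1 z.arg := by
        have h := Complex.norm_mul_exp_arg_mul_I z
        simp only [circleMap_zero, Complex.ofReal_one, one_mul]
        push_cast
        linear_combination -h
      rw [this, norm_mul, norm_circleMap_zero, Complex.norm_real, Real.norm_eq_abs,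
        abs_of_neg (by linarith [hz.2])]
      simp
    have e2 : ‖circleMap 0 1 z.arg - circleMap 0 1 θ‖ ≤ |θ - z.arg| := by
      have := (lipschitzWith_circleMap 0 1).dist_le_mul θ z.arg
      rw [dist_comm, dist_eq_norm, Real.dist_eq] at this
      simpa using this
    rw [mem_ball_zero_iff, ← sub_add_sub_cancel z (circleMap 0 1 z.arg)]
    refine (norm_add_le _ _).trans_lt ?_
    linarith [hz.1]
  obtain ⟨I, hI, hI1, hI2⟩ : ∃ c, (∀ θ ∈ Ioo c (c + δ), |θ - z.arg| < δ) ∧ -Real.pi ≤ c ∧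
      c + δ ≤ Real.pi := by
    have h := Complex.arg_mem_Ioc z
    rcases le_total z.arg 0 with hs | hs
    · exact ⟨z.arg, fun θ hθ => abs_lt.2 ⟨by linarith [hθ.1], by linarith [hθ.2]⟩, h.1.le,
        by linarith⟩
    · exact ⟨z.arg - δ, fun θ hθ => abs_lt.2 ⟨by linarith [hθ.1], by linarith [hθ.2]⟩,
        by linarith, by linarith [h.2]⟩
  calc ENNReal.ofReal δ = volume (Ioo I (I + δ)) := by rw [Real.volume_Ioo]; congr 1; ring
    _ = angleMeasure (Ioo I (I + δ)) := by
        rw [angleMeasure, Measure.restrict_apply measurableSet_Ioo, inter_eq_left.2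
          (Ioo_subset_Ioo hI1 hI2)]
    _ ≤ _ := measure_mono fun θ hθ => hclose θ (hI θ hθ)

/-- A bounded function with vanishing trace is small in mean on thin annuli. -/
lemma tendsto_lintegral_thin_annulus {E : Type*} [NormedAddCommGroup E] {y : ℂ → E} {ρ M : ℝ}
    (hρ : ρ < 1) (hy : ContinuousOn y (annulus ρ 1)) (hM : ∀ z ∈ annulus ρ 1, ‖y z‖ ≤ M)
    (ht : HasTrace (Metric.ball 0 1) y (fun _ => 0)) :
    Tendsto (fun δ : ℝ => ENNReal.ofReal δ⁻¹ * ∫⁻ z in annulus (1 - 2 * δ) (1 - δ), ‖y z‖ₑ)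
      (𝓝[>] 0) (𝓝 0) := by
  -- Integrating first in `z` gives integrals over `B(e^{iθ}, 3δ)` within the disc; after division
  -- by `δ²` they are bounded and tend to zero for almost every `θ` by the trace hypothesis.
  -- Integrating first in `θ`, each point of the thin annulus is counted for angles of measure at
  -- least `δ`. Fubini and dominated convergence then give the claim.
  set f : ℝ → ℝ → ℂ → ENNReal := fun δ θ z =>
    (annulus (1 - 2 * δ) (1 - δ)).indicator (fun z => ‖y z‖ₑ) z *
      (Metric.ball (0 : ℂ) (3 * δ)).indicator 1 (z - circleMap 0 1 θ) with hf
  have hsmall : ∀ᶠ δ : ℝ in 𝓝[>] 0, 0 < δ ∧ δ < 1 ∧ 2 * δ < 1 - ρ := by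
    have h1 : ∀ᶠ δ : ℝ in 𝓝[>] 0, δ < min 1 ((1 - ρ) / 2) :=
      nhdsWithin_le_nhds (eventually_lt_nhds (lt_min one_pos (by linarith)))
    filter_upwards [self_mem_nhdsWithin, h1] with δ h0 h1
    exact ⟨h0, h1.trans_le (min_le_left _ _), by linarith [h1.trans_le (min_le_right _ _)]⟩
  have hsub : ∀ {δ : ℝ}, 0 < δ → 2 * δ < 1 - ρ → annulus (1 - 2 * δ) (1 - δ) ⊆ annulus ρ 1 :=
    fun h0 h2 => annulus_mono (by linarith) (by linarith)
  have hmeas : ∀ {δ : ℝ}, 0 < δ → 2 * δ < 1 - ρ → Measurable (Function.uncurry (f δ)) := by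
    intro δ h0 h2
    refine ((measurable_indicator_of_continuousOn (isOpen_annulus _ _).measurableSet
      (hy.enorm.mono (hsub h0 h2))).comp measurable_snd).mul ?_
    exact (measurable_const.indicator measurableSet_ball).comp
      (measurable_snd.sub (measurable_circleMap_one.comp measurable_fst))
  have hle : ∀ {δ : ℝ}, 0 < δ → ∀ θ, ∫⁻ z, f δ θ z ≤
      ∫⁻ z in Metric.ball (circleMap 0 1 θ) (3 * δ) ∩ Metric.ball 0 1,
        (annulus (1 - 2 * δ) (1 - δ)).indicator (fun z => ‖y z‖ₑ) z := by
    intro δ h0 θ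
    rw [← lintegral_indicator (measurableSet_ball.inter measurableSet_ball)]
    refine lintegral_mono fun z => ?_
    by_cases hz : z ∈ annulus (1 - 2 * δ) (1 - δ)
    · by_cases hz2 : z - circleMap 0 1 θ ∈ Metric.ball (0 : ℂ) (3 * δ)
      · have hm : z ∈ Metric.ball (circleMap 0 1 θ) (3 * δ) ∩ Metric.ball 0 1 := by
          refine ⟨by rwa [Metric.mem_ball, dist_eq_norm, ← mem_ball_zero_iff], ?_⟩
          rw [mem_ball_zero_iff]
          linarith [hz.2]
        simp only [hf, indicator_of_mem hz, indicator_of_mem hz2, indicator_of_mem hm]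
        simp
      · simp only [hf, indicator_of_notMem hz2, mul_zero]
        exact bot_le
    · simp only [hf, indicator_of_notMem hz, zero_mul]
      exact bot_le
  have hvol : ∀ {δ : ℝ}, 0 < δ → ∀ θ, volume (Metric.ball (circleMap 0 1 θ) (3 * δ) ∩
      Metric.ball 0 1) ≤ ENNReal.ofReal δ ^ 2 * ENNReal.ofReal (9 * Real.pi) := by
    intro δ h0 θ
    refine (measure_mono inter_subset_left).trans (le_of_eq ?_)
    rw [Complex.volume_ball, ← ENNReal.ofReal_pow (by positivity), ← ENNReal.ofReal_coe_nnreal,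
      ← ENNReal.ofReal_mul (by positivity), ← ENNReal.ofReal_pow h0.le,
      ← ENNReal.ofReal_mul (by positivity)]
    congr 1
    simp only [NNReal.coe_real_pi]
    ring
  have hcancel : ∀ {δ : ℝ}, 0 < δ → ENNReal.ofReal δ⁻¹ ^ 2 * ENNReal.ofReal δ ^ 2 = 1 := by
    intro δ h0
    rw [← mul_pow, ← ENNReal.ofReal_mul (by positivity), inv_mul_cancel₀ h0.ne']
    simp
  have hlim : Tendsto (fun δ : ℝ => ∫⁻ θ, ENNReal.ofReal δ⁻¹ ^ 2 * ∫⁻ z, f δ θ z ∂volume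
      ∂angleMeasure) (𝓝[>] 0) (𝓝 (∫⁻ _θ, 0 ∂angleMeasure)) := by
    refine tendsto_lintegral_filter_of_dominated_convergence
      (fun _ => ENNReal.ofReal (9 * Real.pi) * ENNReal.ofReal M) ?_ ?_ ?_ ?_
    · filter_upwards [hsmall] with δ hδ
      exact ((hmeas hδ.1 hδ.2.2).lintegral_prod_right').const_mul _
    · filter_upwards [hsmall] with δ hδ
      refine Eventually.of_forall fun θ => ?_
      calc ENNReal.ofReal δ⁻¹ ^ 2 * ∫⁻ z, f δ θ z
          ≤ ENNReal.ofReal δ⁻¹ ^ 2 * ∫⁻ _z in Metric.ball (circleMap 0 1 θ) (3 * δ) ∩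
              Metric.ball 0 1, ENNReal.ofReal M := by
            refine mul_le_mul' le_rfl ((hle hδ.1 θ).trans (lintegral_mono fun z => ?_))
            by_cases hz : z ∈ annulus (1 - 2 * δ) (1 - δ)
            swap
            · exact (indicator_of_notMem hz _).trans_le bot_le
            rw [indicator_of_mem hz, ← ofReal_norm]
            exact ENNReal.ofReal_le_ofReal (hM z (hsub hδ.1 hδ.2.2 hz))
        _ ≤ ENNReal.ofReal δ⁻¹ ^ 2 * (ENNReal.ofReal M *
              (ENNReal.ofReal δ ^ 2 * ENNReal.ofReal (9 * Real.pi))) := by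
            rw [setLIntegral_const]
            gcongr
            exact hvol hδ.1 θ
        _ = (ENNReal.ofReal δ⁻¹ ^ 2 * ENNReal.ofReal δ ^ 2) *
              (ENNReal.ofReal (9 * Real.pi) * ENNReal.ofReal M) := by ring
        _ = _ := by rw [hcancel hδ.1, one_mul]
    · rw [lintegral_const]
      exact ENNReal.mul_ne_top (ENNReal.mul_ne_top ENNReal.ofReal_ne_top ENNReal.ofReal_ne_top)
        (measure_ne_top _ _)
    · have hae := ae_of_ae_map measurable_circleMap_one.aemeasurable
        (map_circleMap_absolutelyContinuous.ae_le ht)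
      filter_upwards [hae] with θ hθ
      have h3 : Tendsto (fun δ : ℝ => 3 * δ) (𝓝[>] 0) (𝓝[>] 0) := by
        refine tendsto_nhdsWithin_iff.2 ⟨?_, ?_⟩
        · have : Tendsto (fun δ : ℝ => 3 * δ) (𝓝 0) (𝓝 (3 * 0)) := tendsto_id.const_mul 3
          rw [mul_zero] at this
          exact this.mono_left nhdsWithin_le_nhds
        · filter_upwards [self_mem_nhdsWithin] with δ hδ
          have hδ : 0 < δ := hδ
          exact mul_pos three_pos hδ
      have h4 := ENNReal.Tendsto.const_mul (a := ENNReal.ofReal (9 * Real.pi)) (hθ.comp h3)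
        (Or.inr ENNReal.ofReal_ne_top)
      rw [mul_zero] at h4
      refine tendsto_of_tendsto_of_tendsto_of_le_of_le' tendsto_const_nhds h4
        (Eventually.of_forall fun _ => bot_le) ?_
      filter_upwards [hsmall] with δ hδ
      set S := Metric.ball (circleMap 0 1 θ) (3 * δ) ∩ Metric.ball 0 1 with hS
      have hSt : volume S ≠ ⊤ :=
        ((measure_mono inter_subset_left).trans_lt measure_ball_lt_top).ne
      calc ENNReal.ofReal δ⁻¹ ^ 2 * ∫⁻ z, f δ θ z
          ≤ ENNReal.ofReal δ⁻¹ ^ 2 * (volume S * ⨍⁻ z in S, ‖y z - 0‖ₑ ∂volume) := by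
            rw [measure_mul_setLAverage _ hSt]
            refine mul_le_mul' le_rfl ((hle hδ.1 θ).trans (lintegral_mono fun z => ?_))
            rw [sub_zero]
            exact indicator_le_self' (fun _ _ => bot_le) z
        _ ≤ ENNReal.ofReal δ⁻¹ ^ 2 * ((ENNReal.ofReal δ ^ 2 * ENNReal.ofReal (9 * Real.pi)) *
              ⨍⁻ z in S, ‖y z - 0‖ₑ ∂volume) := by
            gcongr
            exact hvol hδ.1 θ
        _ = (ENNReal.ofReal δ⁻¹ ^ 2 * ENNReal.ofReal δ ^ 2) *
              (ENNReal.ofReal (9 * Real.pi) * ⨍⁻ z in S, ‖y z - 0‖ₑ ∂volume) := by ring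
        _ = _ := by rw [hcancel hδ.1, one_mul]; rfl
  rw [lintegral_zero] at hlim
  refine tendsto_of_tendsto_of_tendsto_of_le_of_le' tendsto_const_nhds hlim
    (Eventually.of_forall fun _ => bot_le) ?_
  filter_upwards [hsmall] with δ hδ
  have hm := hmeas hδ.1 hδ.2.2
  rw [lintegral_const_mul' _ _ (ENNReal.pow_ne_top ENNReal.ofReal_ne_top), lintegral_lintegral_swap hm.aemeasurable,
    pow_two, mul_assoc]
  gcongr
  have hone : ENNReal.ofReal δ⁻¹ * ENNReal.ofReal δ = 1 := by
    rw [← ENNReal.ofReal_mul (by have := hδ.1; positivity), inv_mul_cancel₀ hδ.1.ne']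
    simp
  calc ∫⁻ z in annulus (1 - 2 * δ) (1 - δ), ‖y z‖ₑ
      = ENNReal.ofReal δ⁻¹ * (ENNReal.ofReal δ * ∫⁻ z,
          (annulus (1 - 2 * δ) (1 - δ)).indicator (fun z => ‖y z‖ₑ) z) := by
        rw [← mul_assoc, hone, one_mul, lintegral_indicator (isOpen_annulus _ _).measurableSet]
    _ ≤ _ := by
        gcongr
        rw [← lintegral_const_mul' _ _ ENNReal.ofReal_ne_top]
        refine lintegral_mono fun z => ?_
        by_cases hz : z ∈ annulus (1 - 2 * δ) (1 - δ)
        · simp only [hf, indicator_of_mem hz]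
          rw [lintegral_const_mul' _ _ (by simp), mul_comm]
          gcongr
          refine (ofReal_le_angleMeasure hδ.1 hδ.2.1 hz).trans (le_of_eq ?_)
          rw [← lintegral_indicator_one]
          · rfl
          · exact (measurable_const.sub measurable_circleMap_one) measurableSet_ball
        · simp [hf, indicator_of_notMem hz]

/-- Hardy's inequality near the circle, for functions with vanishing trace. -/
lemma lintegral_sq_annulus_le {E : Type*} [NormedAddCommGroup E] [NormedSpace ℝ E]
    [CompleteSpace E] {y : ℂ → E} {ρ M : ℝ} (hy : ContDiffOn ℝ ∞ y (annulus ρ 1))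
    (hM : ∀ z ∈ annulus ρ 1, ‖y z‖ ≤ M) (ht : HasTrace (Metric.ball 0 1) y (fun _ => 0))
    {ε : ℝ} (hε : 0 < ε) (hρ : ρ ≤ 1 - 2 * ε) (hε4 : ε ≤ 1 / 4) :
    ∫⁻ z in annulus (1 - 2 * ε) (1 - ε), ‖y z‖ₑ ^ 2 ≤
      ENNReal.ofReal (8 * ε ^ 2) * ∫⁻ z in annulus (1 - 2 * ε) 1, ‖fderiv ℝ y z‖ₑ ^ 2 := by
  have hsub : annulus (1 - 2 * ε) 1 ⊆ annulus ρ 1 := annulus_mono hρ le_rfl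
  have hy' := hy.mono hsub
  have ha0 : 0 ≤ 1 - 2 * ε := by linarith
  have hyc : ContinuousOn (fun z => ‖y z‖ₑ ^ 2) (annulus (1 - 2 * ε) 1) :=
    (ENNReal.continuous_pow 2).comp_continuousOn hy'.continuousOn.enorm
  have hfc : ContinuousOn (fun z => ‖fderiv ℝ y z‖ₑ) (annulus (1 - 2 * ε) 1) :=
    (hy'.continuousOn_fderiv_of_isOpen (isOpen_annulus _ _) (by simp)).enorm
  have hfc2 : ContinuousOn (fun z => ‖fderiv ℝ y z‖ₑ ^ 2) (annulus (1 - 2 * ε) 1) :=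
    (ENNReal.continuous_pow 2).comp_continuousOn hfc
  set G : ℝ → ENNReal := fun θ => ∫⁻ r in Ioo (1 - 2 * ε) 1, ‖fderiv ℝ y (circleMap 0 r θ)‖ₑ ^ 2
    with hG
  set X : ENNReal := ∫⁻ θ, (∫⁻ r in Ioo (1 - 2 * ε) (1 - ε), ‖y (circleMap 0 r θ)‖ₑ ^ 2)
    ∂angleMeasure with hX
  have hXle : ∫⁻ z in annulus (1 - 2 * ε) (1 - ε), ‖y z‖ₑ ^ 2 ≤ X :=
    lintegral_annulus_le ha0 (by linarith) (measurable_indicator_of_continuousOn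
      (isOpen_annulus _ _).measurableSet (hyc.mono (annulus_mono le_rfl (by linarith))))
  have hGm : Measurable G := measurable_lintegral_radial ha0 hfc2
  have hGle : ∫⁻ θ, G θ ∂angleMeasure ≤ 2 * ∫⁻ z in annulus (1 - 2 * ε) 1, ‖fderiv ℝ y z‖ₑ ^ 2 :=
    lintegral_polar_le (by linarith) hfc2
  -- The fundamental theorem of calculus along a radius of length `2ε`, Cauchy–Schwarz, and `(a +
  -- b)² ≤ 2a² + 2b²`.
  have hpt : ∀ θ : ℝ, ∀ r ∈ Ioo (1 - 2 * ε) 1, ∀ s ∈ Ioo (1 - 2 * ε) 1,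
      ‖y (circleMap 0 r θ)‖ₑ ^ 2 ≤
        2 * ‖y (circleMap 0 s θ)‖ₑ ^ 2 + ENNReal.ofReal (4 * ε) * G θ := by
    intro θ r hr s hs
    have h1 := enorm_sub_le_lintegral_radial ha0 hy' θ hr hs
    have hcm : ContinuousOn (fun t : ℝ => ‖fderiv ℝ y (circleMap 0 t θ)‖ₑ) (Ioo (1 - 2 * ε) 1) :=
      hfc.comp ((continuous_circleMap_uncurry.comp (Continuous.prodMk_left θ)).continuousOn)
        fun t ht => circleMap_mem_annulus ha0 ht
    have h2 := sq_lintegral_le (μ := volume.restrict (Ioo (1 - 2 * ε) 1))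
      (hcm.aemeasurable measurableSet_Ioo)
    rw [Measure.restrict_apply_univ, Real.volume_Ioo, sub_sub_cancel] at h2
    have h3 : ‖y (circleMap 0 r θ)‖ₑ ≤
        ‖y (circleMap 0 s θ)‖ₑ + ‖y (circleMap 0 r θ) - y (circleMap 0 s θ)‖ₑ := by
      calc _ = ‖y (circleMap 0 s θ) + (y (circleMap 0 r θ) - y (circleMap 0 s θ))‖ₑ := by
            rw [add_sub_cancel]
        _ ≤ _ := enorm_add_le _ _
    have h4 : ∀ a b : ENNReal, (a + b) ^ 2 ≤ 2 * a ^ 2 + 2 * b ^ 2 := by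
      intro a b
      have := ENNReal.rpow_add_le_mul_rpow_add_rpow a b (p := 2) (by norm_num)
      norm_num at this
      rwa [mul_add] at this
    calc ‖y (circleMap 0 r θ)‖ₑ ^ 2
        ≤ (‖y (circleMap 0 s θ)‖ₑ + ‖y (circleMap 0 r θ) - y (circleMap 0 s θ)‖ₑ) ^ 2 := by gcongr
      _ ≤ _ := h4 _ _
      _ ≤ 2 * ‖y (circleMap 0 s θ)‖ₑ ^ 2 + 2 * (ENNReal.ofReal (2 * ε) * G θ) := by
          gcongr
          refine le_trans ?_ h2
          gcongr
      _ = _ := by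
          rw [← mul_assoc 2, ← ENNReal.ofReal_ofNat 2, ← ENNReal.ofReal_mul (by simp)]
          congr 3
          ring
  -- The reference radius `s` is averaged over `(1 - 2δ, 1 - δ)`. The bound `M` replaces `|y|²` by
  -- `M |y|`, and the resulting thin annulus term tends to zero with `δ`.
  have hδ : ∀ δ : ℝ, 0 < δ → δ ≤ ε → X ≤ ENNReal.ofReal (4 * ε) * ENNReal.ofReal M *
      (ENNReal.ofReal δ⁻¹ * ∫⁻ z in annulus (1 - 2 * δ) (1 - δ), ‖y z‖ₑ) +
        ENNReal.ofReal (4 * ε ^ 2) * ∫⁻ θ, G θ ∂angleMeasure := by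
    intro δ h0 hδε
    have hAδ : annulus (1 - 2 * δ) (1 - δ) ⊆ annulus (1 - 2 * ε) 1 :=
      annulus_mono (by linarith) (by linarith)
    have hYm : Measurable fun θ : ℝ =>
        ∫⁻ s in Ioo (1 - 2 * δ) (1 - δ), ‖y (circleMap 0 s θ)‖ₑ ^ 2 :=
      measurable_lintegral_radial (by linarith) (hyc.mono hAδ)
    have hθ : ∀ θ : ℝ, ENNReal.ofReal δ *
        ∫⁻ r in Ioo (1 - 2 * ε) (1 - ε), ‖y (circleMap 0 r θ)‖ₑ ^ 2 ≤
        ENNReal.ofReal (2 * ε) * (∫⁻ s in Ioo (1 - 2 * δ) (1 - δ), ‖y (circleMap 0 s θ)‖ₑ ^ 2) +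
          ENNReal.ofReal δ * (ENNReal.ofReal (4 * ε ^ 2) * G θ) := by
      intro θ
      have hs : ∀ s ∈ Ioo (1 - 2 * δ) (1 - δ),
          ∫⁻ r in Ioo (1 - 2 * ε) (1 - ε), ‖y (circleMap 0 r θ)‖ₑ ^ 2 ≤
          ENNReal.ofReal (2 * ε) * ‖y (circleMap 0 s θ)‖ₑ ^ 2 +
            ENNReal.ofReal (4 * ε ^ 2) * G θ := by
        intro s hs
        calc _ ≤ ∫⁻ _r in Ioo (1 - 2 * ε) (1 - ε), (2 * ‖y (circleMap 0 s θ)‖ₑ ^ 2 +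
                ENNReal.ofReal (4 * ε) * G θ) :=
              setLIntegral_mono' measurableSet_Ioo fun r hr => hpt θ r
                ⟨hr.1, by linarith [hr.2]⟩ s ⟨by linarith [hs.1], by linarith [hs.2]⟩
          _ = _ := by
              rw [setLIntegral_const, Real.volume_Ioo,
                show 1 - ε - (1 - 2 * ε) = ε by ring, add_mul, mul_right_comm, mul_right_comm
                (ENNReal.ofReal (4 * ε)), ← ENNReal.ofReal_mul (by positivity),
                ← ENNReal.ofReal_ofNat 2, ← ENNReal.ofReal_mul (by simp)]
              congr 3
              ring_nf
      have hmsq : AEMeasurable (fun s : ℝ => ‖y (circleMap 0 s θ)‖ₑ ^ 2)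
          (volume.restrict (Ioo (1 - 2 * δ) (1 - δ))) := by
        refine ContinuousOn.aemeasurable ?_ measurableSet_Ioo
        exact (hyc.mono hAδ).comp
          ((continuous_circleMap_uncurry.comp (Continuous.prodMk_left θ)).continuousOn)
          fun t ht => circleMap_mem_annulus (by linarith) ht
      have := setLIntegral_mono' (μ := volume) measurableSet_Ioo hs
      rw [setLIntegral_const, Real.volume_Ioo, show 1 - δ - (1 - 2 * δ) = δ by ring,
        lintegral_add_right' _ aemeasurable_const, lintegral_const_mul' _ _ ENNReal.ofReal_ne_top,
        setLIntegral_const, Real.volume_Ioo, show 1 - δ - (1 - 2 * δ) = δ by ring] at this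
      rw [mul_comm (ENNReal.ofReal δ), mul_comm (ENNReal.ofReal δ)]
      exact this
    have hint := lintegral_mono (μ := angleMeasure) hθ
    rw [lintegral_const_mul' _ _ ENNReal.ofReal_ne_top, lintegral_add_left (hYm.const_mul _),
      lintegral_const_mul' _ _ ENNReal.ofReal_ne_top, lintegral_const_mul' _ _ ENNReal.ofReal_ne_top,
      lintegral_const_mul' _ _ ENNReal.ofReal_ne_top] at hint
    have hY : ∫⁻ θ, (∫⁻ s in Ioo (1 - 2 * δ) (1 - δ), ‖y (circleMap 0 s θ)‖ₑ ^ 2) ∂angleMeasure ≤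
        2 * (ENNReal.ofReal M * ∫⁻ z in annulus (1 - 2 * δ) (1 - δ), ‖y z‖ₑ) := by
      refine (lintegral_polar_le (by linarith) (hyc.mono hAδ)).trans ?_
      gcongr
      rw [← lintegral_const_mul' _ _ ENNReal.ofReal_ne_top]
      refine setLIntegral_mono' (isOpen_annulus _ _).measurableSet fun z hz => ?_
      rw [pow_two]
      gcongr
      rw [← ofReal_norm]
      exact ENNReal.ofReal_le_ofReal (hM z (hsub (hAδ hz)))
    have hone : ENNReal.ofReal δ⁻¹ * ENNReal.ofReal δ = 1 := by
      rw [← ENNReal.ofReal_mul (by positivity), inv_mul_cancel₀ h0.ne']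
      simp
    calc X = ENNReal.ofReal δ⁻¹ * (ENNReal.ofReal δ * X) := by rw [← mul_assoc, hone, one_mul]
      _ ≤ ENNReal.ofReal δ⁻¹ * (ENNReal.ofReal (2 * ε) * (2 * (ENNReal.ofReal M *
            ∫⁻ z in annulus (1 - 2 * δ) (1 - δ), ‖y z‖ₑ)) +
          ENNReal.ofReal δ * (ENNReal.ofReal (4 * ε ^ 2) * ∫⁻ θ, G θ ∂angleMeasure)) := by
            gcongr
            refine hint.trans ?_
            gcongr
      _ = (ENNReal.ofReal (2 * ε) * 2) * ENNReal.ofReal M *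
            (ENNReal.ofReal δ⁻¹ * ∫⁻ z in annulus (1 - 2 * δ) (1 - δ), ‖y z‖ₑ) +
          (ENNReal.ofReal δ⁻¹ * ENNReal.ofReal δ) *
            (ENNReal.ofReal (4 * ε ^ 2) * ∫⁻ θ, G θ ∂angleMeasure) := by ring
      _ = _ := by
          rw [hone, one_mul, ← ENNReal.ofReal_ofNat 2, ← ENNReal.ofReal_mul (by positivity)]
          congr 4
          ring
  have hlim := tendsto_lintegral_thin_annulus (by linarith) hy.continuousOn hM ht
  have hlim2 := (ENNReal.Tendsto.const_mul (a := ENNReal.ofReal (4 * ε) * ENNReal.ofReal M) hlim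
    (Or.inr (ENNReal.mul_ne_top ENNReal.ofReal_ne_top ENNReal.ofReal_ne_top))).add_const
      (ENNReal.ofReal (4 * ε ^ 2) * ∫⁻ θ, G θ ∂angleMeasure)
  rw [mul_zero, zero_add] at hlim2
  have hfin : X ≤ ENNReal.ofReal (4 * ε ^ 2) * ∫⁻ θ, G θ ∂angleMeasure := by
    refine ge_of_tendsto hlim2 ?_
    have h1 : ∀ᶠ δ : ℝ in 𝓝[>] 0, δ < ε := nhdsWithin_le_nhds (eventually_lt_nhds hε)
    filter_upwards [self_mem_nhdsWithin, h1] with δ h0 h1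
    exact hδ δ h0 h1.le
  refine hXle.trans (hfin.trans ?_)
  calc _ ≤ ENNReal.ofReal (4 * ε ^ 2) *
        (2 * ∫⁻ z in annulus (1 - 2 * ε) 1, ‖fderiv ℝ y z‖ₑ ^ 2) := by gcongr
    _ = _ := by
        rw [← mul_assoc, ← ENNReal.ofReal_ofNat 2, ← ENNReal.ofReal_mul (by positivity)]
        congr 2
        ring

/-! ### Traces of functions of finite energy on the disc -/

lemma ae_boundaryMeasure_disc {P : ℂ → Prop} (h : ∀ᵐ θ ∂angleMeasure, P (circleMap 0 1 θ)) :
    ∀ᵐ x ∂(boundaryMeasure (Metric.ball 0 1)), P x := by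
  rw [ae_boundaryMeasure_iff]
  have h' : ∀ᵐ θ ∂(volume.restrict (Ioc (-Real.pi) Real.pi)), P (circleMap 0 1 θ) := by
    rwa [angleMeasure, Measure.restrict_congr_set Ioo_ae_eq_Ioc] at h
  rw [ae_restrict_iff' measurableSet_Ioc, ae_iff] at h'
  have hsub : {x | x ∈ frontier (Metric.ball (0 : ℂ) 1) ∧ ¬P x} ⊆
      circleMap 0 1 '' {θ | ¬(θ ∈ Ioc (-Real.pi) Real.pi → P (circleMap 0 1 θ))} := by
    rintro x ⟨hx, hP⟩
    have h1 := circleMap_one_arg (mem_frontier_disc.1 hx)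
    exact ⟨x.arg, fun hcon => hP (h1 ▸ hcon (Complex.arg_mem_Ioc x)), h1⟩
  refine measure_mono_null hsub (le_antisymm
    (((lipschitzWith_circleMap 0 1).hausdorffMeasure_image_le zero_le_one _).trans ?_) bot_le)
  rw [hausdorffMeasure_real, h', mul_zero]

/-- The radii along which radial limits are taken. -/
noncomputable def radiusSeq (n : ℕ) : ℝ := 1 - 1 / ((n : ℝ) + 3)

lemma radiusSeq_mem {n N : ℕ} (h : N ≤ n) : radiusSeq n ∈ Ioo (1 - 1 / ((N : ℝ) + 2)) 1 := by
  have hN : (N : ℝ) ≤ n := by exact_mod_cast h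
  have h0 : (0 : ℝ) ≤ N := Nat.cast_nonneg N
  refine ⟨sub_lt_sub_left ?_ _, sub_lt_self _ (by positivity)⟩
  exact one_div_lt_one_div_of_lt (by positivity) (by linarith)

lemma half_le_one_sub (N : ℕ) : (1 : ℝ) / 2 ≤ 1 - 1 / ((N : ℝ) + 2) := by
  have h0 : (0 : ℝ) ≤ N := Nat.cast_nonneg N
  have : 1 / ((N : ℝ) + 2) ≤ 1 / 2 := one_div_le_one_div_of_le two_pos (by linarith)
  linarith

lemma tendsto_one_sub_inv : Tendsto (fun N : ℕ => (1 : ℝ) - 1 / ((N : ℝ) + 2)) atTop (𝓝 1) := by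
  have : Tendsto (fun N : ℕ => 1 / ((N : ℝ) + 2)) atTop (𝓝 0) :=
    tendsto_const_nhds.div_atTop (tendsto_natCast_atTop_atTop.atTop_add tendsto_const_nhds)
  simpa using this.const_sub 1

/-- The radial limit of `S`. -/
noncomputable def radialLimit (S : ℂ → ℝ) (x : ℂ) : ℝ :=
  limUnder atTop fun n : ℕ => S ((radiusSeq n : ℂ) * x)

lemma mul_circleMap_one (r θ : ℝ) : (r : ℂ) * circleMap 0 1 θ = circleMap 0 r θ := by
  simp [circleMap_zero]

section Trace

variable {S : ℂ → ℝ}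

/-- The length of the image of a radius. -/
noncomputable def radialVariation (S : ℂ → ℝ) (a θ : ℝ) : ENNReal :=
  ∫⁻ r in Ioo a 1, ‖fderiv ℝ S (circleMap 0 r θ)‖ₑ

lemma contDiffOn_annulus_of_disc (hS : ContDiffOn ℝ ∞ S (Metric.ball 0 1)) (a : ℝ) :
    ContDiffOn ℝ ∞ S (annulus a 1) := hS.mono (annulus_subset_ball a)

lemma continuousOn_enorm_fderiv {E : Type*} [NormedAddCommGroup E] [NormedSpace ℝ E] {u : ℂ → E}
    {U : Set ℂ} (hU : IsOpen U) (hu : ContDiffOn ℝ ∞ u U) :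
    ContinuousOn (fun z => ‖fderiv ℝ u z‖ₑ) U :=
  (hu.continuousOn_fderiv_of_isOpen hU (by simp)).enorm

lemma measurable_radialVariation (hS : ContDiffOn ℝ ∞ S (Metric.ball 0 1)) {a : ℝ} (ha : 0 ≤ a) :
    Measurable (radialVariation S a) :=
  measurable_lintegral_radial ha (continuousOn_enorm_fderiv (isOpen_annulus a 1)
    (contDiffOn_annulus_of_disc hS a))

lemma radialVariation_anti {a b θ : ℝ} (h : a ≤ b) : radialVariation S b θ ≤ radialVariation S a θ :=
  lintegral_mono_set (Ioo_subset_Ioo_left h)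

lemma tendsto_radialVariation {θ : ℝ} (hθ : radialVariation S (1 / 2) θ ≠ ⊤) :
    Tendsto (fun N : ℕ => radialVariation S (1 - 1 / ((N : ℝ) + 2)) θ) atTop (𝓝 0) := by
  have h := tendsto_setLIntegral_zero hθ (l := atTop)
    (s := fun N : ℕ => Ioo (1 - 1 / ((N : ℝ) + 2)) 1) ?_
  · refine h.congr fun N => ?_
    rw [Measure.restrict_restrict measurableSet_Ioo, inter_eq_left.2
      (Ioo_subset_Ioo_left (half_le_one_sub N))]
    rfl
  · have h1 : Tendsto (fun N : ℕ => ENNReal.ofReal (1 - (1 - 1 / ((N : ℝ) + 2)))) atTop (𝓝 0) := by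
      have := (ENNReal.continuous_ofReal.tendsto _).comp (tendsto_one_sub_inv.const_sub 1)
      rw [sub_self, ENNReal.ofReal_zero] at this
      exact this
    refine tendsto_of_tendsto_of_tendsto_of_le_of_le tendsto_const_nhds h1 (fun _ => bot_le)
      fun N => ?_
    refine (Measure.restrict_apply_le _ _).trans (le_of_eq ?_)
    exact Real.volume_Ioo

/-- The increments of `S` along a radius are dominated by the tail of its variation, which tends to
zero when the variation is finite; the sequence of values is Cauchy. -/
lemma tendsto_radialLimit (hS : ContDiffOn ℝ ∞ S (Metric.ball 0 1)) {θ : ℝ}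
    (hθ : radialVariation S (1 / 2) θ ≠ ⊤) :
    Tendsto (fun n : ℕ => S (circleMap 0 (radiusSeq n) θ)) atTop
      (𝓝 (radialLimit S (circleMap 0 1 θ))) := by
  simp only [radialLimit, mul_circleMap_one]
  refine CauchySeq.tendsto_limUnder (cauchySeq_of_le_tendsto_0
    (fun N : ℕ => (radialVariation S (1 - 1 / ((N : ℝ) + 2)) θ).toReal) (fun n m N hn hm => ?_) ?_)
  · have h := enorm_sub_le_lintegral_radial (by linarith [half_le_one_sub N])
      (contDiffOn_annulus_of_disc hS _) θ (radiusSeq_mem hn) (radiusSeq_mem hm)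
    rw [dist_eq_norm, ← toReal_enorm]
    exact ENNReal.toReal_mono (ne_top_of_le_ne_top hθ (radialVariation_anti (half_le_one_sub N))) h
  · exact (ENNReal.tendsto_toReal ENNReal.zero_ne_top).comp (tendsto_radialVariation hθ)

lemma enorm_sub_radialLimit_le (hS : ContDiffOn ℝ ∞ S (Metric.ball 0 1)) {θ a r : ℝ}
    (hθ : radialVariation S (1 / 2) θ ≠ ⊤) (ha : 0 ≤ a) (hr : r ∈ Ioo a 1) :
    ‖S (circleMap 0 r θ) - radialLimit S (circleMap 0 1 θ)‖ₑ ≤ radialVariation S a θ := by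
  have h := ((tendsto_radialLimit hS hθ).const_sub (S (circleMap 0 r θ))).enorm
  refine le_of_tendsto h ?_
  have ha1 : a < 1 := hr.1.trans hr.2
  filter_upwards [tendsto_one_sub_inv.eventually_const_lt ha1] with n hn
  exact enorm_sub_le_lintegral_radial ha (contDiffOn_annulus_of_disc hS _) θ hr
    ⟨hn.trans (radiusSeq_mem le_rfl).1, (radiusSeq_mem le_rfl).2⟩

/-- The energy in a thin annulus. -/
noncomputable def annulusEnergy (S : ℂ → ℝ) (a : ℝ) : ENNReal :=
  ∫⁻ z in annulus a 1, ‖fderiv ℝ S z‖ₑ ^ 2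

/-- Cauchy–Schwarz on a radius of length `1 - a`; the factor `2` absorbs the Jacobian, which is at
least `1/2`. -/
lemma lintegral_sq_radialVariation_le (hS : ContDiffOn ℝ ∞ S (Metric.ball 0 1)) {a : ℝ}
    (ha : 1 / 2 ≤ a) :
    ∫⁻ θ, radialVariation S a θ ^ 2 ∂angleMeasure ≤
      ENNReal.ofReal (2 * (1 - a)) * annulusEnergy S a := by
  have hc := continuousOn_enorm_fderiv (isOpen_annulus a 1) (contDiffOn_annulus_of_disc hS a)
  have hc2 : ContinuousOn (fun z => ‖fderiv ℝ S z‖ₑ ^ 2) (annulus a 1) :=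
    (ENNReal.continuous_pow 2).comp_continuousOn hc
  calc ∫⁻ θ, radialVariation S a θ ^ 2 ∂angleMeasure
      ≤ ∫⁻ θ, ENNReal.ofReal (1 - a) *
          (∫⁻ r in Ioo a 1, ‖fderiv ℝ S (circleMap 0 r θ)‖ₑ ^ 2) ∂angleMeasure := by
        refine lintegral_mono fun θ => ?_
        have hcm : ContinuousOn (fun t : ℝ => ‖fderiv ℝ S (circleMap 0 t θ)‖ₑ) (Ioo a 1) :=
          hc.comp ((continuous_circleMap_uncurry.comp (Continuous.prodMk_left θ)).continuousOn)
            fun t ht => circleMap_mem_annulus (by linarith) ht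
        have h2 := sq_lintegral_le (μ := volume.restrict (Ioo a 1))
          (hcm.aemeasurable measurableSet_Ioo)
        rwa [Measure.restrict_apply_univ, Real.volume_Ioo] at h2
    _ ≤ ENNReal.ofReal (1 - a) * (2 * annulusEnergy S a) := by
        rw [lintegral_const_mul' _ _ ENNReal.ofReal_ne_top]
        gcongr
        exact lintegral_polar_le ha hc2
    _ = _ := by
        rw [ENNReal.ofReal_mul (by simp), ENNReal.ofReal_ofNat]
        ring

lemma annulusEnergy_le (hS : IsSmoothFiniteEnergy (Metric.ball 0 1) S) (a : ℝ) :
    annulusEnergy S a ≠ ⊤ := by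
  rw [isSmoothFiniteEnergy_iff Metric.isOpen_ball] at hS
  refine ne_top_of_le_ne_top ?_ (lintegral_mono_set (annulus_subset_ball a))
  simpa using hS.2.ne

lemma tendsto_setLIntegral_annulus {F : ℂ → ENNReal} {ρ : ℝ} (hρ : ρ < 1)
    (hF : ∫⁻ z in annulus ρ 1, F z ≠ ⊤) :
    Tendsto (fun r : ℝ => ∫⁻ z in annulus (1 - r) 1, F z) (𝓝[>] 0) (𝓝 0) := by
  have hle : ∀ r : ℝ, r < 1 / 2 → 0 < r →
      (volume.restrict (annulus ρ 1)) (annulus (1 - r) 1) ≤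
        ENNReal.ofReal (2 * Real.pi) * ENNReal.ofReal r := by
    intro r hr h0
    refine (Measure.restrict_apply_le _ _).trans ?_
    rw [← setLIntegral_one]
    refine (lintegral_annulus_le (by linarith) le_rfl (measurable_const.indicator
      (isOpen_annulus _ _).measurableSet)).trans (le_of_eq ?_)
    simp only [Real.volume_Ioo, lintegral_const, angleMeasure,
      Measure.restrict_apply_univ, sub_sub_cancel, sub_neg_eq_add]
    rw [mul_comm, two_mul, one_mul]
  have h := tendsto_setLIntegral_zero hF (l := 𝓝[>] 0)
    (s := fun r : ℝ => annulus (1 - r) 1) ?_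
  · refine h.congr' ?_
    have h1 : ∀ᶠ r : ℝ in 𝓝[>] 0, r < 1 - ρ :=
      nhdsWithin_le_nhds (eventually_lt_nhds (by linarith))
    filter_upwards [h1] with r hr
    rw [Measure.restrict_restrict (isOpen_annulus _ _).measurableSet, inter_eq_left.2
      (annulus_mono (by linarith) le_rfl)]
  · have h2 : Tendsto (fun r : ℝ => ENNReal.ofReal (2 * Real.pi) * ENNReal.ofReal r) (𝓝[>] 0)
        (𝓝 0) := by
      have h3 : Tendsto (fun r : ℝ => ENNReal.ofReal r) (𝓝[>] 0) (𝓝 0) := by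
        have := (ENNReal.continuous_ofReal.tendsto 0).mono_left (nhdsWithin_le_nhds (s := Ioi 0))
        simpa using this
      have := ENNReal.Tendsto.const_mul (a := ENNReal.ofReal (2 * Real.pi)) h3
        (Or.inr ENNReal.ofReal_ne_top)
      rwa [mul_zero] at this
    refine tendsto_of_tendsto_of_tendsto_of_le_of_le' tendsto_const_nhds h2
      (Eventually.of_forall fun _ => bot_le) ?_
    have h1 : ∀ᶠ r : ℝ in 𝓝[>] 0, r < 1 / 2 :=
      nhdsWithin_le_nhds (eventually_lt_nhds (by norm_num))
    filter_upwards [h1, self_mem_nhdsWithin] with r hr h0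
    exact hle r hr h0

lemma tendsto_annulusEnergy (hS : IsSmoothFiniteEnergy (Metric.ball 0 1) S) :
    Tendsto (fun r : ℝ => annulusEnergy S (1 - r)) (𝓝[>] 0) (𝓝 0) :=
  tendsto_setLIntegral_annulus zero_lt_one (annulusEnergy_le hS 0)

lemma lintegral_radialVariation_lt_top (hS : IsSmoothFiniteEnergy (Metric.ball 0 1) S) :
    ∫⁻ θ, radialVariation S (1 / 2) θ ∂angleMeasure < ⊤ := by
  have h1 := sq_lintegral_le (μ := angleMeasure)
    (measurable_radialVariation hS.smooth (a := 1 / 2) (by norm_num)).aemeasurable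
  have h2 := lintegral_sq_radialVariation_le hS.smooth (a := 1 / 2) le_rfl
  by_contra! h
  rw [top_le_iff.1 h] at h1
  have h3 : angleMeasure univ * ∫⁻ θ, radialVariation S (1 / 2) θ ^ 2 ∂angleMeasure < ⊤ :=
    ENNReal.mul_lt_top (measure_lt_top _ _) (h2.trans_lt
      (ENNReal.mul_lt_top ENNReal.ofReal_lt_top (annulusEnergy_le hS _).lt_top))
  rw [ENNReal.top_pow two_ne_zero] at h1
  exact (h1.trans_lt h3).ne rfl

lemma ae_radialVariation_ne_top (hS : IsSmoothFiniteEnergy (Metric.ball 0 1) S) :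
    ∀ᵐ θ ∂angleMeasure, radialVariation S (1 / 2) θ ≠ ⊤ :=
  (ae_lt_top (measurable_radialVariation hS.smooth (by norm_num))
    (lintegral_radialVariation_lt_top hS).ne).mono fun _ h => h.ne

lemma integrable_radialLimit_circleMap (hS : IsSmoothFiniteEnergy (Metric.ball 0 1) S) :
    Integrable (fun θ => radialLimit S (circleMap 0 1 θ)) angleMeasure := by
  have hcont : ∀ r : ℝ, r ∈ Ioo (1 / 2 : ℝ) 1 → Continuous fun θ => S (circleMap 0 r θ) :=
    fun r hr => hS.smooth.continuousOn.comp_continuous (continuous_circleMap 0 r) fun θ =>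
      annulus_subset_ball _ (circleMap_mem_annulus (by norm_num) hr)
  have hmem : ∀ n, radiusSeq n ∈ Ioo (1 / 2 : ℝ) 1 := fun n => by
    have := radiusSeq_mem (n := n) (N := n) le_rfl
    exact ⟨(half_le_one_sub n).trans_lt this.1, this.2⟩
  refine ⟨aestronglyMeasurable_of_tendsto_ae atTop
    (fun n => (hcont _ (hmem n)).aestronglyMeasurable)
    ((ae_radialVariation_ne_top hS).mono fun θ hθ => tendsto_radialLimit hS.smooth hθ), ?_⟩
  set r₀ := radiusSeq 0
  obtain ⟨C, hC⟩ := isCompact_Icc.exists_bound_of_continuousOn (s := Icc (-Real.pi) Real.pi)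
    (hcont r₀ (hmem 0)).continuousOn
  have hbound : ∀ᵐ θ ∂angleMeasure, ‖radialLimit S (circleMap 0 1 θ)‖ₑ ≤
      ENNReal.ofReal C + radialVariation S (1 / 2) θ := by
    have hmemI : ∀ᵐ θ ∂angleMeasure, θ ∈ Ioo (-Real.pi) Real.pi := ae_restrict_mem measurableSet_Ioo
    filter_upwards [ae_radialVariation_ne_top hS, hmemI] with θ hθ hI
    have h1 := enorm_sub_radialLimit_le hS.smooth hθ (by norm_num) (hmem 0)
    calc _ = ‖S (circleMap 0 r₀ θ) - (S (circleMap 0 r₀ θ) -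
          radialLimit S (circleMap 0 1 θ))‖ₑ := by rw [sub_sub_cancel]
      _ ≤ _ := enorm_sub_le
      _ ≤ _ := by
          gcongr
          rw [← ofReal_norm]
          exact ENNReal.ofReal_le_ofReal (hC θ (Ioo_subset_Icc_self hI))
  refine (lintegral_mono_ae hbound).trans_lt ?_
  rw [lintegral_add_left measurable_const, lintegral_const]
  exact ENNReal.add_lt_top.2 ⟨ENNReal.mul_lt_top ENNReal.ofReal_lt_top (measure_lt_top _ _),
    lintegral_radialVariation_lt_top hS⟩

lemma integrable_radialLimit (hS : IsSmoothFiniteEnergy (Metric.ball 0 1) S) :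
    Integrable (radialLimit S) (boundaryMeasure (Metric.ball 0 1)) := by
  have hmeas : AEStronglyMeasurable (radialLimit S) (boundaryMeasure (Metric.ball 0 1)) := by
    refine aestronglyMeasurable_of_tendsto_ae atTop
      (f := fun n x => S ((radiusSeq n : ℂ) * x)) (fun n => ?_) ?_
    · refine ContinuousOn.aestronglyMeasurable ?_ measurableSet_frontier'
      refine hS.smooth.continuousOn.comp (by fun_prop) fun x hx => ?_
      rw [mem_frontier_disc] at hx
      have h1 := radiusSeq_mem (n := n) (N := n) le_rfl
      rw [mem_ball_zero_iff, norm_mul, hx, mul_one, Complex.norm_real, Real.norm_eq_abs,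
        abs_of_pos (by linarith [h1.1, half_le_one_sub n])]
      exact h1.2
    · refine ae_boundaryMeasure_disc ((ae_radialVariation_ne_top hS).mono fun θ hθ => ?_)
      simpa only [mul_circleMap_one] using tendsto_radialLimit hS.smooth hθ
  refine Integrable.mono_measure ?_ boundaryMeasure_disc_le
  rw [integrable_map_measure (hmeas.mono_ac map_circleMap_absolutelyContinuous)
    measurable_circleMap_one.aemeasurable]
  exact integrable_radialLimit_circleMap hS

/-- Closeness on the circle determines the angle only modulo `2π`. The two possible shifts are
excluded because `θ₀` keeps a distance `η` from the cut at `±π`. -/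
lemma abs_sub_le_of_norm_sub_lt {θ₀ θ r s η : ℝ} (hθ₀ : |θ₀| ≤ Real.pi - η)
    (hr : Real.pi * r < η) (hθ : θ ∈ Ioo (-Real.pi) Real.pi) (hs : s ∈ Ioo (1 - r) 1)
    (h : ‖circleMap 0 s θ - circleMap 0 1 θ₀‖ < r) : |θ - θ₀| ≤ Real.pi * r := by
  have hpi := Real.pi_pos
  have h1 : ‖circleMap 0 1 θ - circleMap 0 1 θ₀‖ ≤ 2 * r := by
    have e : ‖circleMap 0 1 θ - circleMap 0 s θ‖ = 1 - s := by
      rw [← mul_circleMap_one s, ← one_sub_mul, norm_mul, norm_circleMap_zero, abs_one, mul_one,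
        ← Complex.ofReal_one, ← Complex.ofReal_sub, Complex.norm_real, Real.norm_eq_abs,
        abs_of_pos (by linarith [hs.2])]
    rw [← sub_add_sub_cancel _ (circleMap 0 s θ)]
    refine (norm_add_le _ _).trans ?_
    linarith [hs.1]
  have hr0 : 0 < Real.pi * r := mul_pos hpi ((norm_nonneg _).trans_lt h)
  have hper : ∀ t : ℝ, circleMap 0 1 (t + 2 * Real.pi) = circleMap 0 1 t := periodic_circleMap 0 1
  rw [abs_le] at hθ₀
  by_contra! hcon
  rcases le_or_gt |θ - θ₀| Real.pi with hle | hgt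
  · have := abs_sub_le_norm_circleMap_sub hle
    nlinarith
  · rcases lt_abs.1 hgt with h2 | h2
    · have h3 : |θ - (θ₀ + 2 * Real.pi)| ≤ Real.pi := abs_le.2 ⟨by linarith, by linarith [hθ.2]⟩
      have h4 := abs_sub_le_norm_circleMap_sub h3
      rw [hper] at h4
      have h5 := (abs_le.1 (h4.trans (mul_le_mul_of_nonneg_left h1 (by positivity)))).1
      linarith [hθ.2]
    · have h3 : |θ + 2 * Real.pi - θ₀| ≤ Real.pi := abs_le.2 ⟨by linarith [hθ.1], by linarith⟩
      have h4 := abs_sub_le_norm_circleMap_sub h3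
      rw [hper] at h4
      have h5 := (abs_le.1 (h4.trans (mul_le_mul_of_nonneg_left h1 (by positivity)))).2
      linarith [hθ.1]

lemma lintegral_radialVariation_closedBall_le (hS : IsSmoothFiniteEnergy (Metric.ball 0 1) S)
    {r : ℝ} (hr : 0 < r) (hr2 : r ≤ 1 / 2) (θ₀ : ℝ) :
    ∫⁻ θ in Metric.closedBall θ₀ (Real.pi * r), radialVariation S (1 - r) θ ∂angleMeasure ≤
      ENNReal.ofReal r * (ENNReal.ofReal (4 * Real.pi) * annulusEnergy S (1 - r)) ^ (1 / 2 : ℝ) := by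
  have h1 := sq_lintegral_le (μ := angleMeasure.restrict (Metric.closedBall θ₀ (Real.pi * r)))
    (measurable_radialVariation hS.smooth (a := 1 - r) (by linarith)).aemeasurable
  have h2 : (∫⁻ θ in Metric.closedBall θ₀ (Real.pi * r), radialVariation S (1 - r) θ
      ∂angleMeasure) ^ 2 ≤
      ENNReal.ofReal (r ^ 2) * (ENNReal.ofReal (4 * Real.pi) * annulusEnergy S (1 - r)) := by
    refine h1.trans ?_
    calc _ ≤ ENNReal.ofReal (2 * (Real.pi * r)) *
          (ENNReal.ofReal (2 * (1 - (1 - r))) * annulusEnergy S (1 - r)) := by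
          gcongr
          · rw [Measure.restrict_apply_univ]
            refine (Measure.restrict_apply_le _ _).trans (le_of_eq ?_)
            rw [Real.volume_closedBall]
          · exact (setLIntegral_le_lintegral _ _).trans
              (lintegral_sq_radialVariation_le hS.smooth (by linarith))
      _ = _ := by
          rw [← mul_assoc, ← ENNReal.ofReal_mul (by positivity),
            ← mul_assoc (ENNReal.ofReal (r ^ 2)), ← ENNReal.ofReal_mul (sq_nonneg r)]
          congr 2
          ring
  have h3 := ENNReal.rpow_le_rpow h2 (z := 1 / 2) (by norm_num)
  rw [ENNReal.mul_rpow_of_nonneg _ _ (by norm_num), ENNReal.ofReal_pow hr.le,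
    ← ENNReal.rpow_natCast, ← ENNReal.rpow_natCast, ← ENNReal.rpow_mul, ← ENNReal.rpow_mul] at h3
  norm_num at h3
  norm_num
  exact h3

/-- Near a boundary point of angle `θ₀`, the deviation of `S` from its radial limit there is at most
the variation along the radius plus the oscillation of the radial limits. Over the half-ball of
radius `r`, the first contributes `O(r²)` times the square root of the energy of a thin annulus, and
the second is `o(r²)` at Lebesgue points. Both are negligible against the volume, which is at least
`c r²`. -/
theorem hasTrace_radialLimit (hS : IsSmoothFiniteEnergy (Metric.ball 0 1) S) :
    HasTrace (Metric.ball 0 1) S (radialLimit S) := by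
  refine ae_boundaryMeasure_disc (P := fun x => Tendsto
    (fun r : ℝ => ⨍⁻ y in Metric.ball x r ∩ Metric.ball 0 1, ‖S y - radialLimit S x‖ₑ ∂volume)
      (𝓝[>] 0) (𝓝 0)) ?_
  set I := Ioo (-Real.pi) Real.pi with hI
  -- The radial limits are extended by zero so that Lebesgue differentiation applies on the whole
  -- line; at an interior angle small intervals do not see the extension.
  set T : ℝ → ℝ := I.indicator fun θ => radialLimit S (circleMap 0 1 θ) with hT
  have hTint : Integrable T :=
    (integrable_indicator_iff measurableSet_Ioo).2 (integrable_radialLimit_circleMap hS)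
  have hleb := VitaliFamily.ae_tendsto_lintegral_enorm_sub_div
    (IsUnifLocDoublingMeasure.vitaliFamily (volume : Measure ℝ) 1) hTint.locallyIntegrable
  have hmemI : ∀ᵐ θ ∂angleMeasure, θ ∈ I := ae_restrict_mem measurableSet_Ioo
  obtain ⟨c, hc0, hc⟩ := hasBoundaryDensity_disc
  filter_upwards [ae_restrict_of_ae hleb, hmemI] with θ₀ hθ₀ hI₀
  have hpi := Real.pi_pos
  obtain ⟨η, hη0, hη⟩ : ∃ η, 0 < η ∧ |θ₀| ≤ Real.pi - η :=
    ⟨Real.pi - |θ₀|, by have := abs_lt.2 hI₀; linarith, by linarith⟩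
  have hscale : Tendsto (fun r : ℝ => Real.pi * r) (𝓝[>] 0) (𝓝[>] 0) := by
    refine tendsto_nhdsWithin_iff.2 ⟨?_, ?_⟩
    · have : Tendsto (fun r : ℝ => Real.pi * r) (𝓝 0) (𝓝 (Real.pi * 0)) :=
        tendsto_id.const_mul _
      rw [mul_zero] at this
      exact this.mono_left nhdsWithin_le_nhds
    · filter_upwards [self_mem_nhdsWithin] with r hr
      have hr : 0 < r := hr
      exact mul_pos hpi hr
  have hleb2 := hθ₀.comp (IsUnifLocDoublingMeasure.tendsto_closedBall_filterAt volume
    (K := 1) (x := θ₀) (fun _ => θ₀) (fun r : ℝ => Real.pi * r) hscale (by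
      filter_upwards [self_mem_nhdsWithin] with r hr
      have hr : 0 < r := hr
      exact Metric.mem_closedBall_self (by positivity)))
  have hen : Tendsto (fun r : ℝ => (ENNReal.ofReal (4 * Real.pi) *
      annulusEnergy S (1 - r)) ^ (1 / 2 : ℝ)) (𝓝[>] 0) (𝓝 0) := by
    have h1 := ENNReal.Tendsto.const_mul (a := ENNReal.ofReal (4 * Real.pi))
      (tendsto_annulusEnergy hS) (Or.inr ENNReal.ofReal_ne_top)
    have h2 := ((ENNReal.continuous_rpow_const (y := 1 / 2)).tendsto _).comp h1
    rw [mul_zero, ENNReal.zero_rpow_of_pos (by norm_num)] at h2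
    exact h2
  have hlim := ENNReal.Tendsto.const_mul (a := ENNReal.ofReal c⁻¹) (hen.add
    (ENNReal.Tendsto.const_mul (a := ENNReal.ofReal (2 * Real.pi)) hleb2
      (Or.inr ENNReal.ofReal_ne_top))) (Or.inr ENNReal.ofReal_ne_top)
  rw [mul_zero, zero_add, mul_zero] at hlim
  refine tendsto_of_tendsto_of_tendsto_of_le_of_le' tendsto_const_nhds hlim
    (Eventually.of_forall fun _ => bot_le) ?_
  have hsm : ∀ᶠ r : ℝ in 𝓝[>] 0, r < min (1 / 2) (η / Real.pi) :=
    nhdsWithin_le_nhds (eventually_lt_nhds (lt_min (by norm_num) (by positivity)))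
  filter_upwards [hsm, self_mem_nhdsWithin] with r hr h0
  have h0 : 0 < r := h0
  have hr1 : r < 1 / 2 := hr.trans_le (min_le_left _ _)
  have hr2 : Real.pi * r < η := by
    have := hr.trans_le (min_le_right _ _)
    rw [lt_div_iff₀ hpi] at this
    linarith
  set x := circleMap 0 1 θ₀ with hx
  set B := Metric.closedBall θ₀ (Real.pi * r) with hB
  have hBI : B ⊆ I := fun θ hθ => by
    rw [hB, Metric.mem_closedBall, Real.dist_eq, abs_le] at hθ
    rw [abs_le] at hη
    exact ⟨by linarith [hθ.1], by linarith [hθ.2]⟩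
  have hmain : ∫⁻ z in Metric.ball x r ∩ Metric.ball 0 1, ‖S z - radialLimit S x‖ₑ ≤
      ENNReal.ofReal (r ^ 2) * ((ENNReal.ofReal (4 * Real.pi) *
        annulusEnergy S (1 - r)) ^ (1 / 2 : ℝ) + ENNReal.ofReal (2 * Real.pi) *
        ((∫⁻ θ in B, ‖T θ - T θ₀‖ₑ) / volume B)) := by
    set F : ℂ → ENNReal := (Metric.ball x r).indicator fun z => ‖S z - radialLimit S x‖ₑ with hF
    have hsub : Metric.ball x r ∩ Metric.ball 0 1 ⊆ annulus (1 - r) 1 := fun z hz => by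
      refine ⟨?_, by simpa using hz.2⟩
      have h1 : ‖x‖ ≤ ‖z‖ + ‖x - z‖ := by
        calc ‖x‖ = ‖z + (x - z)‖ := by rw [add_sub_cancel]
          _ ≤ _ := norm_add_le _ _
      have h2 := hz.1
      rw [Metric.mem_ball', dist_eq_norm] at h2
      have h3 : ‖x‖ = 1 := by rw [hx, norm_circleMap_zero, abs_one]
      linarith
    have hFm : Measurable ((annulus (1 - r) 1).indicator F) := by
      have : (annulus (1 - r) 1).indicator F = (Metric.ball x r).indicator
          ((annulus (1 - r) 1).indicator fun z => ‖S z - radialLimit S x‖ₑ) := by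
        rw [hF, indicator_indicator, indicator_indicator, inter_comm]
      rw [this]
      refine (measurable_indicator_of_continuousOn (isOpen_annulus _ _).measurableSet ?_).indicator
        measurableSet_ball
      exact ((contDiffOn_annulus_of_disc hS.smooth _).continuousOn.sub continuousOn_const).enorm
    have e1 : ∫⁻ z in Metric.ball x r ∩ Metric.ball 0 1, ‖S z - radialLimit S x‖ₑ ≤
        ∫⁻ z in annulus (1 - r) 1, F z := by
      refine (setLIntegral_mono' (measurableSet_ball.inter measurableSet_ball) fun z hz => ?_).trans
        (lintegral_mono_set hsub)
      rw [hF, indicator_of_mem hz.1]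
    refine e1.trans ((lintegral_annulus_le (by linarith) le_rfl hFm).trans ?_)
    have e2 : ∀ᵐ θ ∂angleMeasure, ∫⁻ s in Ioo (1 - r) 1, F (circleMap 0 s θ) ≤
        B.indicator (fun θ => ENNReal.ofReal r * (radialVariation S (1 - r) θ +
          ‖T θ - T θ₀‖ₑ)) θ := by
      filter_upwards [hmemI, ae_radialVariation_ne_top hS] with θ hθ hfin
      by_cases hθB : θ ∈ B
      · rw [indicator_of_mem hθB]
        calc _ ≤ ∫⁻ _s in Ioo (1 - r) 1, (radialVariation S (1 - r) θ + ‖T θ - T θ₀‖ₑ) := by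
              refine setLIntegral_mono' measurableSet_Ioo fun s hs => ?_
              refine (indicator_le_self' (fun _ _ => bot_le) _).trans ?_
              have h1 := enorm_sub_radialLimit_le hS.smooth hfin (by linarith) hs
              rw [hT, indicator_of_mem hθ, indicator_of_mem hI₀]
              calc _ = ‖(S (circleMap 0 s θ) - radialLimit S (circleMap 0 1 θ)) +
                    (radialLimit S (circleMap 0 1 θ) - radialLimit S x)‖ₑ := by
                    rw [sub_add_sub_cancel]
                _ ≤ _ := enorm_add_le _ _
                _ ≤ _ := by gcongr
          _ = _ := by
              rw [setLIntegral_const, Real.volume_Ioo, sub_sub_cancel, mul_comm]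
      · rw [indicator_of_notMem hθB]
        refine le_of_eq ?_
        rw [setLIntegral_congr_fun (g := fun _ => 0) measurableSet_Ioo, lintegral_zero]
        intro s hs
        refine indicator_of_notMem (fun hmem => hθB ?_) _
        rw [Metric.mem_ball, dist_eq_norm] at hmem
        rw [hB, Metric.mem_closedBall, Real.dist_eq]
        exact abs_sub_le_of_norm_sub_lt hη hr2 hθ hs hmem
    refine (lintegral_mono_ae e2).trans ?_
    have hBm : MeasurableSet B := measurableSet_closedBall
    rw [lintegral_indicator hBm, lintegral_const_mul' _ _ ENNReal.ofReal_ne_top,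
      lintegral_add_left (measurable_radialVariation hS.smooth (by linarith))]
    have e3 : ∫⁻ θ in B, ‖T θ - T θ₀‖ₑ ∂angleMeasure = ENNReal.ofReal r *
        (ENNReal.ofReal (2 * Real.pi) * ((∫⁻ θ in B, ‖T θ - T θ₀‖ₑ) / volume B)) := by
      have hvB : volume B = ENNReal.ofReal r * ENNReal.ofReal (2 * Real.pi) := by
        rw [hB, Real.volume_closedBall, ← ENNReal.ofReal_mul h0.le]
        congr 1
        ring
      rw [← mul_assoc, ← hvB, ENNReal.mul_div_cancel, angleMeasure, Measure.restrict_restrict hBm,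
        inter_eq_left.2 hBI]
      · rw [hvB, ← ENNReal.ofReal_mul h0.le]
        exact (ENNReal.ofReal_pos.2 (by positivity)).ne'
      · rw [hvB, ← ENNReal.ofReal_mul h0.le]
        exact ENNReal.ofReal_ne_top
    rw [e3, ENNReal.ofReal_pow h0.le, pow_two, mul_assoc]
    gcongr
    rw [mul_add]
    gcongr
    exact lintegral_radialVariation_closedBall_le hS h0 hr1.le θ₀
  have hvol := hc x (mem_frontier_disc.2 (by rw [hx, norm_circleMap_zero, abs_one])) r h0
    (by linarith)
  rw [setLAverage_eq]
  have hcr : 0 < c * r ^ 2 := by positivity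
  calc _ ≤ (∫⁻ z in Metric.ball x r ∩ Metric.ball 0 1, ‖S z - radialLimit S x‖ₑ) /
        ENNReal.ofReal (c * r ^ 2) := ENNReal.div_le_div_left hvol _
    _ ≤ _ := by
        rw [ENNReal.div_le_iff (ENNReal.ofReal_pos.2 hcr).ne' ENNReal.ofReal_ne_top]
        refine hmain.trans (le_of_eq ?_)
        rw [mul_right_comm, ← ENNReal.ofReal_mul (by positivity), ← mul_assoc,
          inv_mul_cancel₀ hc0.ne', one_mul]
        rfl

end Trace

/-! ### Radial cutoffs -/

/-- A smooth radial function, equal to `0` on `|z| ≤ s` and to `1` on `t ≤ |z|`. -/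
noncomputable def radialCutoff (s t : ℝ) (z : ℂ) : ℝ :=
  Real.smoothTransition ((‖z‖ ^ 2 - s ^ 2) / (t ^ 2 - s ^ 2))

lemma contDiff_radialCutoff (s t : ℝ) : ContDiff ℝ ∞ (radialCutoff s t) :=
  Real.smoothTransition.contDiff.comp (((contDiff_norm_sq ℝ).sub contDiff_const).div_const _)

lemma radialCutoff_nonneg (s t : ℝ) (z : ℂ) : 0 ≤ radialCutoff s t z :=
  Real.smoothTransition.nonneg _

lemma radialCutoff_le_one (s t : ℝ) (z : ℂ) : radialCutoff s t z ≤ 1 :=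
  Real.smoothTransition.le_one _

lemma radialCutoff_arg_nonpos {s t : ℝ} (hs : 0 < s) (hst : s < t) {z : ℂ} (hz : ‖z‖ ≤ s) : (‖z‖ ^ 2 - s ^ 2) / (t ^ 2 - s ^ 2) ≤ 0 :=
  div_nonpos_of_nonpos_of_nonneg (by nlinarith [norm_nonneg z]) (by nlinarith)

lemma radialCutoff_arg_one_le {s t : ℝ} (hs : 0 < s) (hst : s < t) {z : ℂ} (hz : t ≤ ‖z‖) :
    1 ≤ (‖z‖ ^ 2 - s ^ 2) / (t ^ 2 - s ^ 2) := by
  rw [one_le_div (by nlinarith)]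
  nlinarith

lemma radialCutoff_eq_zero {s t : ℝ} (hs : 0 < s) (hst : s < t) {z : ℂ} (hz : ‖z‖ ≤ s) : radialCutoff s t z = 0 :=
  Real.smoothTransition.zero_of_nonpos (radialCutoff_arg_nonpos hs hst hz)

lemma radialCutoff_eq_one {s t : ℝ} (hs : 0 < s) (hst : s < t) {z : ℂ} (hz : t ≤ ‖z‖) : radialCutoff s t z = 1 :=
  Real.smoothTransition.one_of_one_le (radialCutoff_arg_one_le hs hst hz)

/-- The function attains its minimum or its maximum at these points. -/
lemma deriv_smoothTransition_eq_zero {x : ℝ} (hx : x ≤ 0 ∨ 1 ≤ x) :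
    deriv Real.smoothTransition x = 0 := by
  rcases hx with hx | hx
  · refine IsLocalMin.deriv_eq_zero (Eventually.of_forall fun y => ?_)
    rw [Real.smoothTransition.zero_of_nonpos hx]
    exact Real.smoothTransition.nonneg y
  · refine IsLocalMax.deriv_eq_zero (Eventually.of_forall fun y => ?_)
    rw [Real.smoothTransition.one_of_one_le hx]
    exact Real.smoothTransition.le_one y

lemma fderiv_radialCutoff (s t : ℝ) (z : ℂ) : fderiv ℝ (radialCutoff s t) z =
    deriv Real.smoothTransition ((‖z‖ ^ 2 - s ^ 2) / (t ^ 2 - s ^ 2)) •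
      ((t ^ 2 - s ^ 2)⁻¹ • (2 • innerSL ℝ z)) := by
  have h1 : HasFDerivAt (fun z : ℂ => (‖z‖ ^ 2 - s ^ 2) / (t ^ 2 - s ^ 2))
      ((t ^ 2 - s ^ 2)⁻¹ • (2 • innerSL ℝ z)) z := by
    have := (((hasStrictFDerivAt_norm_sq z).hasFDerivAt).sub_const (s ^ 2)).const_mul
      ((t ^ 2 - s ^ 2)⁻¹)
    simpa only [div_eq_inv_mul] using this
  have h2 : HasDerivAt Real.smoothTransition _ ((‖z‖ ^ 2 - s ^ 2) / (t ^ 2 - s ^ 2)) :=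
    ((Real.smoothTransition.contDiff (n := 1)).differentiable (by simp) _).hasDerivAt
  exact (h2.comp_hasFDerivAt z h1).fderiv

lemma fderiv_radialCutoff_eq_zero {s t : ℝ} (hs : 0 < s) (hst : s < t) {z : ℂ}
    (hz : ‖z‖ ≤ s ∨ t ≤ ‖z‖) : fderiv ℝ (radialCutoff s t) z = 0 := by
  rw [fderiv_radialCutoff, deriv_smoothTransition_eq_zero, zero_smul]
  exact hz.imp (radialCutoff_arg_nonpos hs hst) (radialCutoff_arg_one_le hs hst)

/-- The cutoff is written in terms of `‖z‖²`, and `t² - s² ≥ t - s` because `s ≥ 1/2` forces `t + s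
≥ 1`. The constant thus depends only on the transition function. -/
lemma exists_norm_fderiv_radialCutoff_le : ∃ C : ℝ, 0 < C ∧ ∀ (s t : ℝ) (z : ℂ), 1 / 2 ≤ s →
    s < t → t ≤ 1 → ‖fderiv ℝ (radialCutoff s t) z‖ ≤ C / (t - s) := by
  have hc : HasCompactSupport (deriv Real.smoothTransition) := by
    refine HasCompactSupport.of_support_subset_isCompact (isCompact_Icc (a := 0) (b := 1))
      fun x hx => ?_
    by_contra hcon
    rw [mem_Icc, not_and_or, not_le, not_le] at hcon
    exact hx (deriv_smoothTransition_eq_zero (hcon.imp le_of_lt le_of_lt))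
  obtain ⟨C, hC⟩ := ((Real.smoothTransition.contDiff (n := 1)).continuous_deriv
    (by simp)).bounded_above_of_compact_support hc
  have hC0 : 0 ≤ C := (norm_nonneg _).trans (hC 0)
  refine ⟨2 * C + 1, by positivity, fun s t z hs hst ht => ?_⟩
  have hts : 0 < t - s := by linarith
  rcases le_or_gt t ‖z‖ with hz | hz
  · rw [fderiv_radialCutoff_eq_zero (by linarith) hst (Or.inr hz), norm_zero]
    positivity
  rw [fderiv_radialCutoff, norm_smul, norm_smul, Real.norm_eq_abs (t ^ 2 - s ^ 2)⁻¹, abs_inv]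
  have h1 : ‖2 • innerSL ℝ z‖ ≤ 2 := by
    rw [two_nsmul]
    refine (norm_add_le _ _).trans ?_
    rw [innerSL_apply_norm]
    linarith
  have h2 : |t ^ 2 - s ^ 2|⁻¹ ≤ (t - s)⁻¹ := by
    refine inv_anti₀ hts ?_
    rw [abs_of_pos (by nlinarith)]
    nlinarith
  calc _ ≤ C * ((t - s)⁻¹ * 2) := by
        gcongr
        exact hC _
    _ = 2 * C / (t - s) := by ring
    _ ≤ _ := by gcongr; linarith

/-! ### The angular pairing as an integral -/

lemma curlDot_mul {χ Φ : ℂ → ℝ} {v : ℂ → ℂ} {z : ℂ} (hχ : DifferentiableAt ℝ χ z)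
    (hΦ : DifferentiableAt ℝ Φ z) :
    curlDot (fun y => χ y * Φ y) v z = χ z * curlDot Φ v z + Φ z * curlDot χ v z := by
  simp only [curlDot, partialX, partialY, fderiv_fun_mul hχ hΦ, add_apply, smul_apply, smul_eq_mul]
  ring

lemma curlDot_add {χ Φ : ℂ → ℝ} {v : ℂ → ℂ} {z : ℂ} (hχ : DifferentiableAt ℝ χ z)
    (hΦ : DifferentiableAt ℝ Φ z) :
    curlDot (fun y => χ y + Φ y) v z = curlDot χ v z + curlDot Φ v z := by
  simp only [curlDot, partialX, partialY, fderiv_fun_add hχ hΦ, add_apply]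
  ring

lemma curlDot_const_mul {Φ : ℂ → ℝ} (v : ℂ → ℂ) {z : ℂ} (c : ℝ) (hΦ : DifferentiableAt ℝ Φ z) :
    curlDot (fun y => c * Φ y) v z = c * curlDot Φ v z := by
  simp only [curlDot, partialX, partialY, fderiv_const_mul hΦ, smul_apply, smul_eq_mul]
  ring

lemma curlDot_congr {Φ Φ' : ℂ → ℝ} {v v' : ℂ → ℂ} {z : ℂ} (h : Φ =ᶠ[𝓝 z] Φ') (hv : v =ᶠ[𝓝 z] v') :
    curlDot Φ v z = curlDot Φ' v' z := by
  simp only [curlDot, partialX, partialY, h.fderiv_eq, hv.fderiv_eq, hv.eq_of_nhds]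

lemma abs_wedge_le (u v : ℂ) : |wedge u v| ≤ ‖u‖ * ‖v‖ := by
  have h : wedge u v = ((starRingEnd ℂ) u * v).im := by
    simp [wedge]
    ring
  rw [h]
  refine (Complex.abs_im_le_norm _).trans ?_
  rw [norm_mul, RCLike.norm_conj]

lemma abs_curlDot_le (Φ : ℂ → ℝ) (v : ℂ → ℂ) (z : ℂ) :
    |curlDot Φ v z| ≤ 2 * (‖fderiv ℝ Φ z‖ * (‖v z‖ * ‖fderiv ℝ v z‖)) := by
  have key : ∀ a b : ℂ, |fderiv ℝ Φ z a * wedge (v z) (fderiv ℝ v z b)| ≤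
      ‖a‖ * ‖b‖ * (‖fderiv ℝ Φ z‖ * (‖v z‖ * ‖fderiv ℝ v z‖)) := fun a b => by
    rw [abs_mul]
    calc _ ≤ (‖fderiv ℝ Φ z‖ * ‖a‖) * (‖v z‖ * (‖fderiv ℝ v z‖ * ‖b‖)) := by
          gcongr
          · exact (fderiv ℝ Φ z).le_opNorm a
          · exact (abs_wedge_le _ _).trans (by gcongr; exact (fderiv ℝ v z).le_opNorm b)
      _ = _ := by ring
  have h1 := key 1 Complex.I
  have h2 := key Complex.I 1
  simp only [norm_one, Complex.norm_I, one_mul] at h1 h2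
  refine (abs_sub _ _).trans ?_
  unfold partialX partialY
  linarith

lemma continuousOn_curlDot {U : Set ℂ} (hU : IsOpen U) {Φ : ℂ → ℝ} {v : ℂ → ℂ}
    (hΦ : ContDiffOn ℝ ∞ Φ U) (hv : ContDiffOn ℝ ∞ v U) : ContinuousOn (curlDot Φ v) U :=
  (((partialX_contDiffOn hU hΦ).continuousOn).mul
    (contDiffOn_wedge hv (partialY_contDiffOn hU hv)).continuousOn).sub
    (((partialY_contDiffOn hU hΦ).continuousOn).mul
    (contDiffOn_wedge hv (partialX_contDiffOn hU hv)).continuousOn)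

lemma integrableOn_norm_fderiv_mul {E F : Type*} [NormedAddCommGroup E] [NormedSpace ℝ E]
    [NormedAddCommGroup F] [NormedSpace ℝ F] {U : Set ℂ} {u : ℂ → E} {v : ℂ → F}
    (hu : IsSmoothFiniteEnergy U u) (hv : IsSmoothFiniteEnergy U v) :
    IntegrableOn (fun z => ‖fderiv ℝ u z‖ * ‖fderiv ℝ v z‖) U :=
  MemLp.integrable_mul hu.finite_energy.norm hv.finite_energy.norm

lemma integrableOn_curlDot_of_norm_eq_one {U : Set ℂ} (hU : IsOpen U) {Φ : ℂ → ℝ} {v : ℂ → ℂ}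
    (hΦ : IsSmoothFiniteEnergy U Φ) (hv : IsSmoothFiniteEnergy U v) (h1 : ∀ z ∈ U, ‖v z‖ = 1) :
    IntegrableOn (curlDot Φ v) U := by
  refine Integrable.mono' ((integrableOn_norm_fderiv_mul hΦ hv).const_mul 2)
    ((continuousOn_curlDot hU hΦ.smooth hv.smooth).aestronglyMeasurable hU.measurableSet)
    (ae_restrict_of_forall_mem hU.measurableSet fun z hz => ?_)
  have := abs_curlDot_le Φ v z
  rwa [h1 z hz, one_mul] at this

lemma integrableOn_curlDot {U K : Set ℂ} (hU : IsOpen U) (hK : IsCompact K) {Φ : ℂ → ℝ}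
    {v : ℂ → ℂ} (hΦ : IsSmoothFiniteEnergy U Φ) (hv : IsSmoothFiniteEnergy (U \ K) v)
    (h1 : ∀ z ∈ U \ K, ‖v z‖ = 1) (h0 : ∀ z ∈ K, ∀ᶠ y in 𝓝 z, Φ y = 0) :
    IntegrableOn (curlDot Φ v) U := by
  refine (integrableOn_curlDot_of_norm_eq_one (hU.sdiff hK.isClosed) (hΦ.mono sdiff_subset) hv
    h1).of_forall_sdiff_eq_zero hU.measurableSet fun z hz => ?_
  exact curlDot_eq_zero_of_eventually v (h0 z (by
    by_contra h
    exact hz.2 ⟨hz.1, h⟩))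

/-- The integral of `curlDot ψ v` depends only on `ψ` near the boundary. -/
lemma setIntegral_curlDot_congr {U K S : Set ℂ} (hU : IsOpen U) (hK : IsCompact K)
    (hS : IsCompact S) (hSU : S ⊆ U) {Φ Ψ : ℂ → ℝ} {v : ℂ → ℂ}
    (hΦ : IsSmoothFiniteEnergy U Φ) (hΨ : IsSmoothFiniteEnergy U Ψ)
    (hv : IsSmoothFiniteEnergy (U \ K) v) (h1 : ∀ z ∈ U \ K, ‖v z‖ = 1)
    (hΦ0 : ∀ z ∈ K, ∀ᶠ y in 𝓝 z, Φ y = 0) (hΨ0 : ∀ z ∈ K, ∀ᶠ y in 𝓝 z, Ψ y = 0)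
    (heq : EqOn Φ Ψ (U \ S)) :
    ∫ z in U, curlDot Φ v z = ∫ z in U, curlDot Ψ v z := by
  have hWo : IsOpen (U \ K) := hU.sdiff hK.isClosed
  -- The difference of the two test functions, extended by zero, is compactly supported away from
  -- `K`, where the field `v ∧ ∇v` is smooth and closed.
  obtain ⟨hχ, hχS, hχc⟩ := contDiff_indicator_of_eqOn_zero hU hS hSU (χ := fun z => Φ z - Ψ z)
    (hΦ.smooth.sub hΨ.smooth) fun z hz hzS => sub_eq_zero.2 (heq ⟨hz, hzS⟩)
  set χ := U.indicator fun z => Φ z - Ψ z with hχdef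
  have hχK : tsupport χ ⊆ U \ K := fun z hz => by
    refine ⟨hSU (hχS hz), fun hzK => ?_⟩
    refine (notMem_tsupport_iff_eventuallyEq.2 ?_) hz
    filter_upwards [hΦ0 z hzK, hΨ0 z hzK] with y h1 h2
    by_cases hy : y ∈ U
    · rw [hχdef, indicator_of_mem hy, h1, h2, sub_zero, Pi.zero_apply]
    · rw [hχdef, indicator_of_notMem hy, Pi.zero_apply]
  have hzero := integral_curlDot_eq_zero hWo hχ hχc hχK hv.smooth h1
  rw [← setIntegral_eq_integral_of_tsupport (U := U) (χ := χ) (fun z hz => (hχK hz).1)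
    fun z hz => curlDot_eq_zero_of_eventually v hz] at hzero
  rw [← sub_eq_zero, ← integral_sub (integrableOn_curlDot hU hK hΦ hv h1 hΦ0)
    (integrableOn_curlDot hU hK hΨ hv h1 hΨ0), ← hzero]
  refine setIntegral_congr_fun hU.measurableSet fun z hz => ?_
  have hev : χ =ᶠ[𝓝 z] fun y => Φ y + (-1) * Ψ y := by
    filter_upwards [hU.mem_nhds hz] with y hy
    rw [hχdef, indicator_of_mem hy]
    ring
  have hd := hΦ.differentiableAt hU hz
  have hd' := hΨ.differentiableAt hU hz
  rw [curlDot_congr hev EventuallyEq.rfl, curlDot_add hd (hd'.const_mul _),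
    curlDot_const_mul v _ hd']
  ring

/-! ### Uniqueness of the angular pairing on the disc -/

/-- The Jacobian of two real functions. -/
noncomputable def gradWedge (u v : ℂ → ℝ) (z : ℂ) : ℝ :=
  partialX u z * partialY v z - partialY u z * partialX v z

lemma gradWedge_eq_zero_of_eventually {u v : ℂ → ℝ} {z : ℂ} (h : u =ᶠ[𝓝 z] 0) :
    gradWedge u v z = 0 := by
  have : fderiv ℝ u z = 0 := by
    rw [h.fderiv_eq]
    simp [Pi.zero_def]
  simp [gradWedge, partialX, partialY, this]

lemma abs_gradWedge_le (u v : ℂ → ℝ) (z : ℂ) :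
    |gradWedge u v z| ≤ 2 * (‖fderiv ℝ u z‖ * ‖fderiv ℝ v z‖) := by
  refine (abs_sub _ _).trans ?_
  rw [abs_mul, abs_mul, two_mul]
  have h1 := norm_partialX_le u z
  have h2 := norm_partialX_le v z
  have h3 := norm_partialY_le u z
  have h4 := norm_partialY_le v z
  simp only [Real.norm_eq_abs] at h1 h2 h3 h4
  gcongr

lemma fderiv_im_comp {y : ℂ → ℂ} {z : ℂ} (h : DifferentiableAt ℝ y z) (c : ℂ) :
    fderiv ℝ (fun z => (y z).im) z c = (fderiv ℝ y z c).im := by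
  have := (Complex.imCLM.hasFDerivAt.comp z h.hasFDerivAt).fderiv
  exact congrArg (fun L => L c) this

/-- Writing `w = 1 + (w - 1)` isolates an exact term `∇ Im (w - 1)`. That term integrates by parts,
while the remaining one carries the factor `w - 1`, which is small near the boundary. -/
lemma curlDot_eq_sub_one {χ : ℂ → ℝ} {w : ℂ → ℂ} {z : ℂ} (h : DifferentiableAt ℝ w z) :
    curlDot χ w z = curlDot χ (fun y => w y - 1) z + gradWedge χ (fun y => (w y - 1).im) z := by
  have hd : DifferentiableAt ℝ (fun y => w y - 1) z := h.sub_const 1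
  simp only [curlDot, gradWedge, partialX, partialY, fderiv_im_comp hd]
  simp only [fderiv_sub_const, wedge, Complex.sub_re, Complex.sub_im, Complex.one_re,
    Complex.one_im]
  ring

lemma gradWedge_mul_right {χ u v : ℂ → ℝ} {z : ℂ} (hu : DifferentiableAt ℝ u z)
    (hv : DifferentiableAt ℝ v z) :
    gradWedge χ (fun y => u y * v y) z = u z * gradWedge χ v z + v z * gradWedge χ u z := by
  simp only [gradWedge, partialX, partialY, fderiv_fun_mul hu hv, add_apply, smul_apply,
    smul_eq_mul]
  ring

lemma gradWedge_congr_right {χ u v : ℂ → ℝ} {z : ℂ} (h : u =ᶠ[𝓝 z] v) :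
    gradWedge χ u z = gradWedge χ v z := by
  simp only [gradWedge, partialX, partialY, h.fderiv_eq]

lemma integrable_gradWedge {W : Set ℂ} (hW : IsOpen W) {χ η : ℂ → ℝ}
    (hχ : ContDiff ℝ ∞ χ) (hc : HasCompactSupport χ) (hχW : tsupport χ ⊆ W)
    (hη : ContDiffOn ℝ ∞ η W) : Integrable (gradWedge χ η) := by
  have key : ∀ (c : ℂ) (P : ℂ → ℝ), ContDiffOn ℝ ∞ P W →
      Integrable fun z => fderiv ℝ χ z c * P z := fun c P hP => by
    have hs : tsupport (fun z => fderiv ℝ χ z c) ⊆ tsupport χ := tsupport_fderiv_apply_subset ℝ c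
    have h2 : HasCompactSupport fun z => fderiv ℝ χ z c := hc.fderiv_apply (𝕜 := ℝ) c
    exact Continuous.integrable_of_hasCompactSupport
      (contDiff_mul_of_tsupport_subset hW ((hχ.fderiv_right (m := ∞) (by simp)).clm_apply
        contDiff_const) (hs.trans hχW) hP).continuous h2.mul_right
  exact (key 1 _ (partialY_contDiffOn hW hη)).sub (key Complex.I _ (partialX_contDiffOn hW hη))

lemma tsupport_one_sub_radialCutoff_subset {s t : ℝ} (hs : 0 < s) (hst : s < t) :
    tsupport (fun z => 1 - radialCutoff s t z) ⊆ Metric.closedBall 0 t := by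
  refine closure_minimal (fun z hz => ?_) Metric.isClosed_closedBall
  by_contra hcon
  rw [mem_closedBall_zero_iff, not_le] at hcon
  exact hz (by simp only [radialCutoff_eq_one hs hst hcon.le, sub_self])

lemma mul_curlDot_bound {C ε M : ℝ} (hM : 0 ≤ M) (hC : 0 ≤ C) {Φ χ : ℂ → ℝ}
    {y : ℂ → ℂ} {z : ℂ}
    (hΦ : |Φ z| ≤ M) (hχ : ‖fderiv ℝ χ z‖ ≤ C / ε) :
    |Φ z * curlDot χ y z - (y z).im * gradWedge χ Φ z| ≤
      2 * C / ε ^ 2 * ‖y z‖ ^ 2 + C * M ^ 2 * ‖fderiv ℝ y z‖ ^ 2 + C * ‖fderiv ℝ Φ z‖ ^ 2 := by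
  have h1 : |Φ z * curlDot χ y z| ≤ M * (2 * (C / ε * (‖y z‖ * ‖fderiv ℝ y z‖))) := by
    rw [abs_mul]
    gcongr
    exact (abs_curlDot_le χ y z).trans (by gcongr)
  have h2 : |(y z).im * gradWedge χ Φ z| ≤ ‖y z‖ * (2 * (C / ε * ‖fderiv ℝ Φ z‖)) := by
    rw [abs_mul]
    gcongr
    · exact Complex.abs_im_le_norm _
    · exact (abs_gradWedge_le χ Φ z).trans (by gcongr)
  refine (abs_sub _ _).trans ((add_le_add h1 h2).trans ?_)
  have e1 := mul_nonneg hC (sq_nonneg (‖y z‖ / ε - M * ‖fderiv ℝ y z‖))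
  have e2 := mul_nonneg hC (sq_nonneg (‖y z‖ / ε - ‖fderiv ℝ Φ z‖))
  have e3 : 2 * C / ε ^ 2 * ‖y z‖ ^ 2 = 2 * (C * (‖y z‖ / ε) ^ 2) := by ring
  have e4 : M * (2 * (C / ε * (‖y z‖ * ‖fderiv ℝ y z‖))) =
    2 * C * ((‖y z‖ / ε) * (M * ‖fderiv ℝ y z‖)) := by ring
  have e5 : ‖y z‖ * (2 * (C / ε * ‖fderiv ℝ Φ z‖)) =
    2 * C * ((‖y z‖ / ε) * ‖fderiv ℝ Φ z‖) := by ring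
  rw [e3, e4, e5]
  nlinarith

lemma tendsto_two_mul_nhdsGT : Tendsto (fun ε : ℝ => 2 * ε) (𝓝[>] 0) (𝓝[>] 0) := by
  refine tendsto_nhdsWithin_iff.2 ⟨?_, ?_⟩
  · have := (tendsto_id (α := ℝ) (x := 𝓝 0)).const_mul 2
    rw [mul_zero] at this
    exact this.mono_left nhdsWithin_le_nhds
  · filter_upwards [self_mem_nhdsWithin] with ε hε
    have : 0 < ε := hε
    exact mem_Ioi.2 (by positivity)

/-- The boundary term produced by a cutoff of the disc. -/
lemma enorm_integral_cutoff_curlDot_le {ρ ρ' M ε C : ℝ} (hρ : ρ < ρ')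
    (hM0 : 0 ≤ M) {w : ℂ → ℂ} {Φ : ℂ → ℝ} (hw : IsSmoothFiniteEnergy (annulus ρ 1) w)
    (h1 : ∀ z ∈ annulus ρ 1, ‖w z‖ = 1) (ht : HasTrace (Metric.ball 0 1) (fun z => w z - 1) 0)
    (hΦ : IsSmoothFiniteEnergy (Metric.ball 0 1) Φ) (hΦ0 : ∀ z, ‖z‖ < ρ' → Φ z = 0)
    (hM : ∀ z ∈ Metric.ball (0 : ℂ) 1, |Φ z| ≤ M) (hε : 0 < ε) (hε4 : ε ≤ 1 / 4)
    (hρε : ρ' ≤ 1 - 2 * ε) (hC : 0 ≤ C)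
    (hχC : ∀ z, ‖fderiv ℝ (radialCutoff (1 - 2 * ε) (1 - ε)) z‖ ≤ C / ε) :
    ‖∫ z in Metric.ball 0 1, (1 - radialCutoff (1 - 2 * ε) (1 - ε) z) * curlDot Φ w z‖ₑ ≤
      ENNReal.ofReal (16 * C + C * M ^ 2) * (∫⁻ z in annulus (1 - 2 * ε) 1, ‖fderiv ℝ w z‖ₑ ^ 2) +
        ENNReal.ofReal C * ∫⁻ z in annulus (1 - 2 * ε) 1, ‖fderiv ℝ Φ z‖ₑ ^ 2 := by
  set D : Set ℂ := Metric.ball 0 1 with hD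
  have hDo : IsOpen D := Metric.isOpen_ball
  have hAo := isOpen_annulus ρ 1
  have hs : 0 < 1 - 2 * ε := by linarith
  have hst : 1 - 2 * ε < 1 - ε := by linarith
  set χ : ℂ → ℝ := fun z => 1 - radialCutoff (1 - 2 * ε) (1 - ε) z with hχdef
  have hχs : ContDiff ℝ ∞ χ := contDiff_const.sub (contDiff_radialCutoff _ _)
  have hχt : tsupport χ ⊆ Metric.closedBall 0 (1 - ε) := tsupport_one_sub_radialCutoff_subset hs hst
  have hχc : HasCompactSupport χ := (isCompact_closedBall _ _).of_isClosed_subset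
    (isClosed_tsupport _) hχt
  have hχD : tsupport χ ⊆ D := hχt.trans (Metric.closedBall_subset_ball (by linarith))
  have hfχ : ∀ z, fderiv ℝ χ z = -fderiv ℝ (radialCutoff (1 - 2 * ε) (1 - ε)) z := fun z => by
    rw [hχdef, fderiv_const_sub]
  have hχC' : ∀ z, ‖fderiv ℝ χ z‖ ≤ C / ε := fun z => by
    rw [hfχ, norm_neg]
    exact hχC z
  have hfχ0 : ∀ z, z ∉ annulus (1 - 2 * ε) (1 - ε) → fderiv ℝ χ z = 0 := fun z hz => by
    rw [hfχ, fderiv_radialCutoff_eq_zero hs hst, neg_zero]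
    by_contra! h
    exact hz h
  set y : ℂ → ℂ := fun z => w z - 1 with hy
  have hfy : ∀ z, fderiv ℝ y z = fderiv ℝ w z := fun z => by rw [hy, fderiv_sub_const]
  have hyA : ContDiffOn ℝ ∞ y (annulus ρ 1) := hw.smooth.sub contDiffOn_const
  set m : ℂ → ℝ := fun z => (y z).im with hm
  have hmA : ContDiffOn ℝ ∞ m (annulus ρ 1) :=
    Complex.imCLM.contDiff.comp_contDiffOn hyA
  set Q : ℂ → ℝ := (annulus ρ 1).indicator fun z => Φ z * m z with hQ
  have hΦev : ∀ z, z ∈ D \ annulus ρ 1 → ∀ᶠ y in 𝓝 z, Φ y = 0 := fun z hz => by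
    have hzρ : ‖z‖ < ρ' := by
      by_contra! h
      exact hz.2 ⟨hρ.trans_le h, mem_ball_zero_iff.1 hz.1⟩
    filter_upwards [(isOpen_lt continuous_norm continuous_const).mem_nhds hzρ] with y hy
    exact hΦ0 y hy
  have hQev : ∀ z ∈ annulus ρ 1, Q =ᶠ[𝓝 z] fun z => Φ z * m z := fun z hz => by
    filter_upwards [hAo.mem_nhds hz] with y hy
    rw [hQ, indicator_of_mem hy]
  have hQD : ContDiffOn ℝ ∞ Q D := fun z hz => by
    refine ContDiffAt.contDiffWithinAt ?_
    by_cases hzA : z ∈ annulus ρ 1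
    · exact ((hΦ.smooth.contDiffAt (hDo.mem_nhds hz)).mul
        (hmA.contDiffAt (hAo.mem_nhds hzA))).congr_of_eventuallyEq (hQev z hzA)
    · refine (contDiffAt_const (c := (0 : ℝ))).congr_of_eventuallyEq ?_
      filter_upwards [hΦev z ⟨hz, hzA⟩] with y hy
      exact indicator_apply_eq_zero.2 fun _ => by rw [hy, zero_mul]
  -- In the product rule for `χ Φ`, the boundary term `Φ curlDot χ w` is split into `B` and a
  -- rotated gradient product of `χ` with `Q = Φ Im (w - 1)`. The latter integrates to zero, as does
  -- the whole of `curlDot (χ Φ) w`, so the integral to be bounded is `-∫ B`.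
  set B : ℂ → ℝ := fun z => Φ z * curlDot χ y z - m z * gradWedge χ Φ z with hB
  have hpt : ∀ z ∈ D, curlDot (fun y => χ y * Φ y) w z =
      χ z * curlDot Φ w z + (B z + gradWedge χ Q z) := fun z hz => by
    have hdΦ := hΦ.differentiableAt hDo hz
    have hdχ : DifferentiableAt ℝ χ z := hχs.differentiable (by simp) z
    by_cases hzA : z ∈ annulus ρ 1
    · have hdw := hw.differentiableAt hAo hzA
      have hdm : DifferentiableAt ℝ m z :=
        (hmA.differentiableOn (by simp)).differentiableAt (hAo.mem_nhds hzA)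
      rw [curlDot_mul hdχ hdΦ, gradWedge_congr_right (hQev z hzA), gradWedge_mul_right hdΦ hdm,
        curlDot_eq_sub_one (χ := χ) hdw, hB]
      ring
    · have hz0 := hΦev z ⟨hz, hzA⟩
      have hfΦ : fderiv ℝ Φ z = 0 := by
        rw [Filter.EventuallyEq.fderiv_eq (f := fun _ => (0 : ℝ)) hz0]; simp
      have hQ0 : Q =ᶠ[𝓝 z] fun _ => 0 := by
        filter_upwards [hz0] with y hy
        exact indicator_apply_eq_zero.2 fun _ => by rw [hy, zero_mul]
      rw [curlDot_mul hdχ hdΦ, gradWedge_congr_right hQ0, hB]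
      simp [gradWedge, partialX, partialY, hfΦ, hz0.self_of_nhds]
  have hTA : annulus (1 - 2 * ε) 1 ⊆ annulus ρ 1 := annulus_mono (by linarith) le_rfl
  have hT1 : annulus (1 - 2 * ε) (1 - ε) ⊆ annulus (1 - 2 * ε) 1 :=
    annulus_mono le_rfl (by linarith)
  -- integrability
  have hKc : IsCompact (Metric.closedBall (0 : ℂ) ρ) := isCompact_closedBall _ _
  have hAK : annulus ρ 1 = D \ Metric.closedBall 0 ρ := by
    ext z
    simp [annulus, hD, and_comm]
  have hK0 : ∀ z ∈ Metric.closedBall (0 : ℂ) ρ, ∀ᶠ y in 𝓝 z, Φ y = 0 := fun z hz => by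
    have hzρ : ‖z‖ < ρ' := (mem_closedBall_zero_iff.1 hz).trans_lt hρ
    filter_upwards [(isOpen_lt continuous_norm continuous_const).mem_nhds hzρ] with y hy
    exact hΦ0 y hy
  have hI1 : IntegrableOn (curlDot Φ w) D :=
    integrableOn_curlDot hDo hKc hΦ (hAK ▸ hw) (hAK ▸ h1) hK0
  have hI1' : IntegrableOn (fun z => χ z * curlDot Φ w z) D := by
    refine hI1.bdd_mul (c := 1) hχs.continuous.aestronglyMeasurable (Eventually.of_forall fun z => ?_)
    rw [hχdef, Real.norm_eq_abs, abs_le]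
    constructor <;> linarith [radialCutoff_nonneg (1 - 2 * ε) (1 - ε) z,
      radialCutoff_le_one (1 - 2 * ε) (1 - ε) z]
  have hχΦ : ContDiff ℝ ∞ (fun z => χ z * Φ z) :=
    contDiff_mul_of_tsupport_subset hDo hχs hχD hΦ.smooth
  have hχΦt : tsupport (fun z => χ z * Φ z) ⊆ annulus ρ 1 := by
    intro z hz
    refine ⟨?_, mem_ball_zero_iff.1 (hχD (tsupport_mul_subset_left hz))⟩
    by_contra! h
    refine (notMem_tsupport_iff_eventuallyEq.2 ?_) (tsupport_mul_subset_right hz)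
    exact hK0 z (mem_closedBall_zero_iff.2 h)
  have hI2 : ∫ z in D, curlDot (fun y => χ y * Φ y) w z = 0 := by
    rw [setIntegral_eq_integral_of_tsupport (hχΦt.trans (annulus_subset_ball ρ))
      fun z hz => curlDot_eq_zero_of_eventually w hz]
    exact integral_curlDot_eq_zero hAo hχΦ hχc.mul_right hχΦt hw.smooth h1
  have hI3 : ∫ z in D, gradWedge χ Q z = 0 := by
    rw [setIntegral_eq_integral_of_tsupport hχD fun z hz => gradWedge_eq_zero_of_eventually hz]
    exact integral_rot_gradient_eq_zero hDo hχs hχc hχD hQD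
  have hI3' : IntegrableOn (gradWedge χ Q) D := (integrable_gradWedge hDo hχs hχc hχD hQD).integrableOn
  have hI2' : IntegrableOn (curlDot (fun y => χ y * Φ y) w) D := by
    refine integrableOn_curlDot hDo hKc ?_ (hAK ▸ hw) (hAK ▸ h1) fun z hz => ?_
    · refine isSmoothFiniteEnergy_of_sdiff hDo hχc (hχD) hχΦ.contDiffOn ?_
      refine (IsSmoothFiniteEnergy.const (0 : ℝ)).congr (hDo.sdiff (isClosed_tsupport _))
        fun z hz => ?_
      dsimp only
      rw [image_eq_zero_of_notMem_tsupport hz.2, zero_mul]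
    · filter_upwards [hK0 z hz] with y hy
      rw [hy, mul_zero]
  have hBI : IntegrableOn B D := by
    refine ((hI2'.sub hI1').sub hI3').congr_fun (fun z hz => ?_) hDo.measurableSet
    simp only [Pi.sub_apply, hpt z hz]
    ring
  have hmain : ∫ z in D, χ z * curlDot Φ w z = -∫ z in D, B z := by
    have := setIntegral_congr_fun (μ := volume) hDo.measurableSet hpt
    have hsum : IntegrableOn (fun z => B z + gradWedge χ Q z) D := hBI.add hI3'
    rw [hI2, integral_add hI1' hsum, integral_add hBI hI3', hI3] at this
    linarith
  have hB0 : ∀ z, z ∉ annulus (1 - 2 * ε) (1 - ε) → B z = 0 := fun z hz => by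
    simp [hB, curlDot, gradWedge, partialX, partialY, hfχ0 z hz]
  rw [hmain, enorm_neg]
  have hTm : MeasurableSet (annulus (1 - 2 * ε) (1 - ε)) := (isOpen_annulus _ _).measurableSet
  have hBT : ∫ z in D, B z = ∫ z in annulus (1 - 2 * ε) (1 - ε), B z := by
    refine (setIntegral_eq_of_subset_of_forall_sdiff_eq_zero hDo.measurableSet
      (hT1.trans (annulus_subset_ball _)) fun z hz => hB0 z hz.2)
  rw [hBT]
  have hyM : ∀ z ∈ annulus ρ 1, ‖y z‖ ≤ 2 := fun z hz => by
    refine (norm_sub_le _ _).trans ?_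
    rw [h1 z hz, norm_one]
    norm_num
  -- The cutoff gradient costs `1 / ε`, hence a weight `ε⁻²` on `|w - 1|²`. Hardy's inequality pays
  -- for it with `8 ε²` times the energy, which accounts for the coefficient `16 C`.
  have hardy := lintegral_sq_annulus_le hyA hyM ht hε (hρ.le.trans hρε) hε4
  have hcy : AEMeasurable (fun z => ‖fderiv ℝ y z‖ₑ ^ 2)
      (volume.restrict (annulus (1 - 2 * ε) (1 - ε))) :=
    ((ENNReal.continuous_pow 2).comp_continuousOn (continuousOn_enorm_fderiv hAo hyA)
      |>.mono (hT1.trans hTA)).aemeasurable hTm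
  have hcy2 : AEMeasurable (fun z => ‖y z‖ₑ ^ 2)
      (volume.restrict (annulus (1 - 2 * ε) (1 - ε))) :=
    ((ENNReal.continuous_pow 2).comp_continuousOn hyA.continuousOn.enorm
      |>.mono (hT1.trans hTA)).aemeasurable hTm
  have hfin : ∀ z ∈ annulus (1 - 2 * ε) (1 - ε), ‖B z‖ₑ ≤
      ENNReal.ofReal (2 * C / ε ^ 2) * ‖y z‖ₑ ^ 2 +
        (ENNReal.ofReal (C * M ^ 2) * ‖fderiv ℝ y z‖ₑ ^ 2 +
          ENNReal.ofReal C * ‖fderiv ℝ Φ z‖ₑ ^ 2) := fun z hz => by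
    have hb := mul_curlDot_bound (y := y) hM0 hC (hM z (annulus_subset_ball _ (hT1 hz))) (hχC' z)
    rw [add_assoc] at hb
    simp only [← ofReal_norm]
    rw [← ENNReal.ofReal_pow (norm_nonneg _), ← ENNReal.ofReal_pow (norm_nonneg _),
      ← ENNReal.ofReal_pow (norm_nonneg _), ← ENNReal.ofReal_mul (by positivity),
      ← ENNReal.ofReal_mul (by positivity), ← ENNReal.ofReal_mul hC,
      ← ENNReal.ofReal_add (by positivity) (by positivity),
      ← ENNReal.ofReal_add (by positivity) (by positivity)]
    exact ENNReal.ofReal_le_ofReal hb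
  calc ‖∫ z in annulus (1 - 2 * ε) (1 - ε), B z‖ₑ
      ≤ ∫⁻ z in annulus (1 - 2 * ε) (1 - ε), ‖B z‖ₑ := enorm_integral_le_lintegral_enorm _
    _ ≤ ∫⁻ z in annulus (1 - 2 * ε) (1 - ε), (ENNReal.ofReal (2 * C / ε ^ 2) * ‖y z‖ₑ ^ 2 +
        (ENNReal.ofReal (C * M ^ 2) * ‖fderiv ℝ y z‖ₑ ^ 2 +
          ENNReal.ofReal C * ‖fderiv ℝ Φ z‖ₑ ^ 2)) := setLIntegral_mono' hTm hfin
    _ = ENNReal.ofReal (2 * C / ε ^ 2) * (∫⁻ z in annulus (1 - 2 * ε) (1 - ε), ‖y z‖ₑ ^ 2) +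
        (ENNReal.ofReal (C * M ^ 2) * (∫⁻ z in annulus (1 - 2 * ε) (1 - ε), ‖fderiv ℝ y z‖ₑ ^ 2) +
          ENNReal.ofReal C * ∫⁻ z in annulus (1 - 2 * ε) (1 - ε), ‖fderiv ℝ Φ z‖ₑ ^ 2) := by
        rw [lintegral_add_left' (hcy2.const_mul _), lintegral_add_left' (hcy.const_mul _),
          lintegral_const_mul' _ _ ENNReal.ofReal_ne_top,
          lintegral_const_mul' _ _ ENNReal.ofReal_ne_top,
          lintegral_const_mul' _ _ ENNReal.ofReal_ne_top]
    _ ≤ ENNReal.ofReal (2 * C / ε ^ 2) * (ENNReal.ofReal (8 * ε ^ 2) *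
          ∫⁻ z in annulus (1 - 2 * ε) 1, ‖fderiv ℝ y z‖ₑ ^ 2) +
        (ENNReal.ofReal (C * M ^ 2) * (∫⁻ z in annulus (1 - 2 * ε) 1, ‖fderiv ℝ y z‖ₑ ^ 2) +
          ENNReal.ofReal C * ∫⁻ z in annulus (1 - 2 * ε) 1, ‖fderiv ℝ Φ z‖ₑ ^ 2) :=
        add_le_add (mul_le_mul' le_rfl hardy) (add_le_add
          (mul_le_mul' le_rfl (lintegral_mono_set hT1))
          (mul_le_mul' le_rfl (lintegral_mono_set hT1)))
    _ = _ := by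
        simp only [hfy]
        rw [← mul_assoc, ← add_assoc, ← add_mul, ← ENNReal.ofReal_mul (by positivity),
          ← ENNReal.ofReal_add (by positivity) (by positivity)]
        congr 4
        field_simp
        ring

/-- As the cutoff exhausts the disc, the left side converges by domination, and the bound tends to
zero because energies over shrinking annuli do. -/
lemma setIntegral_curlDot_eq_zero_of_bounded {ρ ρ' M : ℝ} (hρ : ρ < ρ') (hρ' : ρ' < 1)
    (hM0 : 0 ≤ M) {w : ℂ → ℂ} {Φ : ℂ → ℝ} (hw : IsSmoothFiniteEnergy (annulus ρ 1) w)
    (h1 : ∀ z ∈ annulus ρ 1, ‖w z‖ = 1) (ht : HasTrace (Metric.ball 0 1) (fun z => w z - 1) 0)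
    (hΦ : IsSmoothFiniteEnergy (Metric.ball 0 1) Φ) (hΦ0 : ∀ z, ‖z‖ < ρ' → Φ z = 0)
    (hM : ∀ z ∈ Metric.ball (0 : ℂ) 1, |Φ z| ≤ M) (hI : IntegrableOn (curlDot Φ w) (Metric.ball 0 1)) :
    ∫ z in Metric.ball 0 1, curlDot Φ w z = 0 := by
  obtain ⟨C, hC0, hC⟩ := exists_norm_fderiv_radialCutoff_le
  have hev : ∀ᶠ ε : ℝ in 𝓝[>] 0, 0 < ε ∧ ε ≤ 1 / 4 ∧ ρ' ≤ 1 - 2 * ε := by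
    have h2 : ∀ᶠ ε : ℝ in 𝓝[>] 0, ε < min (1 / 4) ((1 - ρ') / 2) :=
      nhdsWithin_le_nhds (eventually_lt_nhds (by
        rw [lt_min_iff]
        constructor <;> linarith))
    filter_upwards [h2, self_mem_nhdsWithin] with ε h2 h3
    rw [lt_min_iff] at h2
    exact ⟨h3, h2.1.le, by linarith [h2.2]⟩
  have hlim : Tendsto (fun ε : ℝ => ∫ z in Metric.ball 0 1,
      (1 - radialCutoff (1 - 2 * ε) (1 - ε) z) * curlDot Φ w z) (𝓝[>] 0)
      (𝓝 (∫ z in Metric.ball 0 1, curlDot Φ w z)) := by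
    refine tendsto_integral_filter_of_dominated_convergence (fun z => ‖curlDot Φ w z‖)
      (Eventually.of_forall fun ε => ?_) (Eventually.of_forall fun ε => ae_of_all _ fun z => ?_)
      hI.norm (ae_restrict_of_forall_mem Metric.isOpen_ball.measurableSet fun z hz => ?_)
    · exact ((continuous_const.sub (contDiff_radialCutoff _ _).continuous).aestronglyMeasurable).mul
        hI.aestronglyMeasurable
    · rw [norm_mul]
      refine mul_le_of_le_one_left (norm_nonneg _) ?_
      rw [Real.norm_eq_abs, abs_le]
      constructor <;> linarith [radialCutoff_nonneg (1 - 2 * ε) (1 - ε) z,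
        radialCutoff_le_one (1 - 2 * ε) (1 - ε) z]
    · refine tendsto_const_nhds.congr' ?_
      have h2 : ∀ᶠ ε : ℝ in 𝓝[>] 0, ε < (1 - ‖z‖) / 2 :=
        nhdsWithin_le_nhds (eventually_lt_nhds (by linarith [mem_ball_zero_iff.1 hz]))
      filter_upwards [h2, hev] with ε h2 h3
      rw [radialCutoff_eq_zero (by linarith) (by linarith) (by linarith), sub_zero, one_mul]
  have hEw : Tendsto (fun ε : ℝ => ∫⁻ z in annulus (1 - 2 * ε) 1, ‖fderiv ℝ w z‖ₑ ^ 2) (𝓝[>] 0)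
      (𝓝 0) := by
    have h2 := (isSmoothFiniteEnergy_iff (isOpen_annulus ρ 1)).1 hw
    have h3 := tendsto_setLIntegral_annulus (hρ.trans hρ') (F := fun z => ‖fderiv ℝ w z‖ₑ ^ 2)
      (by simpa using h2.2.ne)
    exact h3.comp tendsto_two_mul_nhdsGT
  have hEΦ : Tendsto (fun ε : ℝ => ∫⁻ z in annulus (1 - 2 * ε) 1, ‖fderiv ℝ Φ z‖ₑ ^ 2) (𝓝[>] 0)
      (𝓝 0) := (tendsto_annulusEnergy hΦ).comp tendsto_two_mul_nhdsGT
  have hz := (ENNReal.Tendsto.const_mul (a := ENNReal.ofReal (16 * C + C * M ^ 2)) hEw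
    (Or.inr ENNReal.ofReal_ne_top)).add
    (ENNReal.Tendsto.const_mul (a := ENNReal.ofReal C) hEΦ (Or.inr ENNReal.ofReal_ne_top))
  rw [mul_zero, mul_zero, add_zero] at hz
  have h0 : ‖∫ z in Metric.ball 0 1, curlDot Φ w z‖ₑ ≤ 0 := by
    refine le_of_tendsto_of_tendsto hlim.enorm hz ?_
    filter_upwards [hev] with ε hε
    refine enorm_integral_cutoff_curlDot_le hρ hM0 hw h1 ht hΦ hΦ0 hM hε.1 hε.2.1 hε.2.2 hC0.le
      fun z => (hC _ _ z (by linarith) (by linarith) (by linarith)).trans_eq (by ring_nf)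
  simpa using h0

lemma fderiv_sin_div {Φ : ℂ → ℝ} {z : ℂ} (h : DifferentiableAt ℝ Φ z) {M : ℝ} (hM : M ≠ 0) :
    fderiv ℝ (fun y => M * Real.sin (Φ y / M)) z = Real.cos (Φ z / M) • fderiv ℝ Φ z := by
  have h1 : HasDerivAt (fun x => M * Real.sin (x / M)) (Real.cos (Φ z / M)) (Φ z) := by
    have := (((hasDerivAt_id (Φ z)).div_const M).sin).const_mul M
    refine this.congr_deriv ?_
    simp only [id]
    field_simp
  exact (h1.comp_hasFDerivAt z h.hasFDerivAt).fderiv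

/-- A circle valued map with trace `1` has no boundary contribution. -/
lemma setIntegral_curlDot_eq_zero {ρ ρ' : ℝ} (hρ : ρ < ρ') (hρ' : ρ' < 1)
    {w : ℂ → ℂ} {Φ : ℂ → ℝ} (hw : IsSmoothFiniteEnergy (annulus ρ 1) w)
    (h1 : ∀ z ∈ annulus ρ 1, ‖w z‖ = 1) (ht : HasTrace (Metric.ball 0 1) (fun z => w z - 1) 0)
    (hΦ : IsSmoothFiniteEnergy (Metric.ball 0 1) Φ) (hΦ0 : ∀ z, ‖z‖ < ρ' → Φ z = 0)
    (hI : IntegrableOn (curlDot Φ w) (Metric.ball 0 1)) :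
    ∫ z in Metric.ball 0 1, curlDot Φ w z = 0 := by
  have hDo : IsOpen (Metric.ball (0 : ℂ) 1) := Metric.isOpen_ball
  -- A smooth truncation of `Φ`: bounded by `n + 1`, vanishing where `Φ` does, with gradient `cos (Φ
  -- / (n + 1)) ∇Φ` dominated by `|∇Φ|` and converging to `∇Φ`.
  set T : ℕ → ℂ → ℝ := fun n z => ((n : ℝ) + 1) * Real.sin (Φ z / ((n : ℝ) + 1)) with hT
  have hn : ∀ n : ℕ, (n : ℝ) + 1 ≠ 0 := fun n => by positivity
  have hfT : ∀ n, ∀ z ∈ Metric.ball (0 : ℂ) 1, fderiv ℝ (T n) z =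
      Real.cos (Φ z / ((n : ℝ) + 1)) • fderiv ℝ Φ z := fun n z hz =>
    fderiv_sin_div (hΦ.differentiableAt hDo hz) (hn n)
  have hcurl : ∀ n, ∀ z ∈ Metric.ball (0 : ℂ) 1, curlDot (T n) w z =
      Real.cos (Φ z / ((n : ℝ) + 1)) * curlDot Φ w z := fun n z hz => by
    simp only [curlDot, partialX, partialY, hfT n z hz, smul_apply, smul_eq_mul]
    ring
  have hcos : ∀ n : ℕ, AEStronglyMeasurable (fun z => Real.cos (Φ z / ((n : ℝ) + 1)))
      (volume.restrict (Metric.ball (0 : ℂ) 1)) := fun n =>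
    (Real.continuous_cos.comp_continuousOn (hΦ.smooth.continuousOn.div_const _)).aestronglyMeasurable
      hDo.measurableSet
  have hIn : ∀ n, IntegrableOn (curlDot (T n) w) (Metric.ball 0 1) := fun n => by
    have : IntegrableOn (fun z => Real.cos (Φ z / ((n : ℝ) + 1)) * curlDot Φ w z)
        (Metric.ball 0 1) :=
      hI.bdd_mul (c := 1) (hcos n) (ae_of_all _ fun z => Real.abs_cos_le_one _)
    exact this.congr_fun (fun z hz => (hcurl n z hz).symm) hDo.measurableSet
  have hzero : ∀ n, ∫ z in Metric.ball 0 1, curlDot (T n) w z = 0 := fun n => by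
    refine setIntegral_curlDot_eq_zero_of_bounded (M := (n : ℝ) + 1) hρ hρ' (by positivity) hw h1 ht
      ⟨contDiffOn_const.mul (Real.contDiff_sin.comp_contDiffOn (hΦ.smooth.div_const _)), ?_⟩
      (fun z hz => by simp [hT, hΦ0 z hz]) (fun z _ => ?_) (hIn n)
    · have hTs : ContDiffOn ℝ ∞ (T n) (Metric.ball 0 1) :=
        contDiffOn_const.mul (Real.contDiff_sin.comp_contDiffOn (hΦ.smooth.div_const _))
      refine MemLp.mono hΦ.finite_energy ((hTs.continuousOn_fderiv_of_isOpen hDo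
        (by simp)).aestronglyMeasurable hDo.measurableSet)
        (ae_restrict_of_forall_mem hDo.measurableSet fun z hz => ?_)
      rw [hfT n z hz, norm_smul]
      exact mul_le_of_le_one_left (norm_nonneg _) (Real.abs_cos_le_one _)
    · rw [abs_mul, abs_of_pos (by positivity : (0 : ℝ) < (n : ℝ) + 1)]
      exact mul_le_of_le_one_right (by positivity) (Real.abs_sin_le_one _)
  have hlim : Tendsto (fun n => ∫ z in Metric.ball 0 1, curlDot (T n) w z) atTop
      (𝓝 (∫ z in Metric.ball 0 1, curlDot Φ w z)) := by
    refine tendsto_integral_of_dominated_convergence (fun z => ‖curlDot Φ w z‖)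
      (fun n => (hIn n).aestronglyMeasurable) hI.norm
      (fun n => ae_restrict_of_forall_mem hDo.measurableSet fun z hz => ?_)
      (ae_restrict_of_forall_mem hDo.measurableSet fun z hz => ?_)
    · rw [hcurl n z hz, norm_mul]
      exact mul_le_of_le_one_left (norm_nonneg _) (Real.abs_cos_le_one _)
    · have h3 : Tendsto (fun n : ℕ => Φ z / ((n : ℝ) + 1)) atTop (𝓝 0) :=
        tendsto_const_nhds.div_atTop (tendsto_natCast_atTop_atTop.atTop_add tendsto_const_nhds)
      have h4 := ((Real.continuous_cos.tendsto 0).comp h3).mul_const (curlDot Φ w z)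
      rw [Real.cos_zero, one_mul] at h4
      exact h4.congr fun n => (hcurl n z hz).symm
  exact tendsto_nhds_unique hlim (by simp [hzero])

lemma HasTrace.neg {E : Type*} [NormedAddCommGroup E] {U : Set ℂ} {u t : ℂ → E}
    (h : HasTrace U u t) : HasTrace U (fun z => -u z) (fun z => -t z) := by
  refine Eventually.mono h fun x hx => ?_
  simpa only [neg_sub_neg, enorm_sub_rev (t x)] using hx

lemma HasTrace.of_norm_eq {E : Type*} [NormedAddCommGroup E] {U L : Set ℂ} (hU : IsOpen U)
    (hL : IsCompact L) (hLU : L ⊆ U) {u u' : ℂ → E} (h : HasTrace U u 0)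
    (he : ∀ z ∈ U \ L, ‖u z‖ = ‖u' z‖) : HasTrace U u' 0 := by
  have h1 : HasTrace U (fun z => ‖u z‖) (fun _ => 0) :=
    Eventually.mono h fun x hx => by simpa using hx
  refine Eventually.mono (h1.congr hU hL hLU (u' := fun z => ‖u' z‖) he) fun x hx => ?_
  simpa using hx

lemma exists_subset_ball_of_isCompact {N : Set ℂ} (hN : IsCompact N)
    (hND : N ⊆ Metric.ball 0 1) : ∃ ρ : ℝ, 0 < ρ ∧ ρ < 1 ∧ N ⊆ Metric.ball 0 ρ := by
  obtain ⟨z, hz, hmax⟩ := (hN.insert (0 : ℂ)).exists_isMaxOn ⟨0, mem_insert _ _⟩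
    continuous_norm.continuousOn
  have hz1 : ‖z‖ < 1 := by
    rcases hz with rfl | hz
    · simp
    · exact mem_ball_zero_iff.1 (hND hz)
  refine ⟨(‖z‖ + 1) / 2, by positivity, by linarith, fun y hy => ?_⟩
  have : ‖y‖ ≤ ‖z‖ := hmax (mem_insert_of_mem _ hy)
  exact mem_ball_zero_iff.2 (by linarith)

/-- For unit complex numbers, multiplication by a conjugate subtracts phases, and so subtracts the
angular derivatives. -/
lemma wedge_mul_conj {u v p q : ℂ} (hu : ‖u‖ = 1) (hv : ‖v‖ = 1) :
    wedge (u * (starRingEnd ℂ) v) (u * (starRingEnd ℂ) q + (starRingEnd ℂ) v * p) =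
      wedge u p - wedge v q := by
  have h1 : u.re * u.re + u.im * u.im = 1 := by
    rw [← Complex.normSq_apply, Complex.normSq_eq_norm_sq, hu, one_pow]
  have h2 : v.re * v.re + v.im * v.im = 1 := by
    rw [← Complex.normSq_apply, Complex.normSq_eq_norm_sq, hv, one_pow]
  simp only [wedge, Complex.mul_re, Complex.mul_im, Complex.add_re, Complex.add_im,
    Complex.conj_re, Complex.conj_im]
  linear_combination (-(v.re * q.im - v.im * q.re)) * h1 + (u.re * p.im - u.im * p.re) * h2

lemma fderiv_mul_conj {u v : ℂ → ℂ} {z : ℂ} (hu : DifferentiableAt ℝ u z)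
    (hv : DifferentiableAt ℝ v z) (c : ℂ) :
    fderiv ℝ (fun y => u y * (starRingEnd ℂ) (v y)) z c =
      u z * (starRingEnd ℂ) (fderiv ℝ v z c) + (starRingEnd ℂ) (v z) * fderiv ℝ u z c := by
  have h1 : HasFDerivAt (fun y => (starRingEnd ℂ) (v y))
      ((Complex.conjCLE : ℂ →L[ℝ] ℂ).comp (fderiv ℝ v z)) z :=
    (Complex.conjCLE : ℂ →L[ℝ] ℂ).hasFDerivAt.comp z hv.hasFDerivAt
  have h2 : HasFDerivAt (fun y => u y * (starRingEnd ℂ) (v y)) _ z := hu.hasFDerivAt.mul h1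
  rw [h2.fderiv]
  simp [smul_eq_mul]

lemma curlDot_mul_conj {Φ : ℂ → ℝ} {u v : ℂ → ℂ} {z : ℂ} (hu : DifferentiableAt ℝ u z)
    (hv : DifferentiableAt ℝ v z) (hu1 : ‖u z‖ = 1) (hv1 : ‖v z‖ = 1) :
    curlDot Φ (fun y => u y * (starRingEnd ℂ) (v y)) z = curlDot Φ u z - curlDot Φ v z := by
  simp only [curlDot, partialX, partialY, fderiv_mul_conj hu hv, wedge_mul_conj hu1 hv1]
  ring

lemma isSmoothFiniteEnergy_mul_conj {U : Set ℂ} (hU : IsOpen U) {u v : ℂ → ℂ}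
    (hu : IsSmoothFiniteEnergy U u) (hv : IsSmoothFiniteEnergy U v) (hu1 : ∀ z ∈ U, ‖u z‖ = 1)
    (hv1 : ∀ z ∈ U, ‖v z‖ = 1) :
    IsSmoothFiniteEnergy U (fun z => u z * (starRingEnd ℂ) (v z)) := by
  have hs : ContDiffOn ℝ ∞ (fun z => u z * (starRingEnd ℂ) (v z)) U :=
    hu.smooth.mul ((Complex.conjCLE : ℂ →L[ℝ] ℂ).contDiff.comp_contDiffOn hv.smooth)
  refine ⟨hs, MemLp.mono (hv.finite_energy.norm.add hu.finite_energy.norm)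
    ((hs.continuousOn_fderiv_of_isOpen hU (by simp)).aestronglyMeasurable hU.measurableSet)
    (ae_restrict_of_forall_mem hU.measurableSet fun z hz => ?_)⟩
  refine (ContinuousLinearMap.opNorm_le_bound _ (add_nonneg (norm_nonneg _) (norm_nonneg _)) fun c => ?_).trans
    (Real.le_norm_self _)
  rw [fderiv_mul_conj (hu.differentiableAt hU hz) (hv.differentiableAt hU hz)]
  refine (norm_add_le _ _).trans ?_
  rw [norm_mul, norm_mul, RCLike.norm_conj, RCLike.norm_conj, hu1 z hz, hv1 z hz, one_mul, one_mul,
    add_mul]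
  exact add_le_add ((fderiv ℝ v z).le_opNorm c) ((fderiv ℝ u z).le_opNorm c)

section Cutoff

variable {φ : ℂ → ℝ} {M : Set ℂ} {s t : ℝ}

lemma cutoff_eventually_eq_zero (φ : ℂ → ℝ) (hs : 0 < s) (hst : s < t) {z : ℂ}
    (hz : z ∈ Metric.ball (0 : ℂ) s) : ∀ᶠ y in 𝓝 z, radialCutoff s t y * φ y = 0 := by
  filter_upwards [Metric.isOpen_ball.mem_nhds hz] with y hy
  rw [radialCutoff_eq_zero hs hst (mem_ball_zero_iff.1 hy).le, zero_mul]

lemma isSmoothFiniteEnergy_cutoff (hM : IsCompact M) (hMs : M ⊆ Metric.ball 0 s)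
    (hφ : IsSmoothFiniteEnergy (Metric.ball 0 1 \ M) φ) (hs : 0 < s) (hst : s < t) (ht : t < 1) :
    IsSmoothFiniteEnergy (Metric.ball 0 1) (fun z => radialCutoff s t z * φ z) := by
  have hDo : IsOpen (Metric.ball (0 : ℂ) 1) := Metric.isOpen_ball
  refine isSmoothFiniteEnergy_of_sdiff hDo (isCompact_closedBall 0 t)
    (Metric.closedBall_subset_ball ht) (fun z hz => ContDiffAt.contDiffWithinAt ?_) ?_
  · by_cases hzs : z ∈ Metric.ball (0 : ℂ) s
    · exact (contDiffAt_const (c := (0 : ℝ))).congr_of_eventuallyEq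
        (cutoff_eventually_eq_zero φ hs hst hzs)
    · exact (contDiff_radialCutoff s t).contDiffAt.mul
        (hφ.smooth.contDiffAt ((hDo.sdiff hM.isClosed).mem_nhds ⟨hz, fun h => hzs (hMs h)⟩))
  · refine (hφ.mono (sdiff_subset_sdiff_right (hMs.trans ((Metric.ball_subset_ball hst.le).trans
      Metric.ball_subset_closedBall)))).congr (hDo.sdiff Metric.isClosed_closedBall) fun z hz => ?_
    have : t ≤ ‖z‖ := by
      by_contra! h
      exact hz.2 (mem_closedBall_zero_iff.2 h.le)
    rw [radialCutoff_eq_one hs hst this, one_mul]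

lemma IsCircleExtension.isAngularPairing_cutoff {g v : ℂ → ℂ} {K : Set ℂ}
    (hv : IsCircleExtension (Metric.ball 0 1) g K v) (hKs : K ⊆ Metric.ball 0 s)
    (hM : IsCompact M) (hMs : M ⊆ Metric.ball 0 s)
    (hφ : IsSmoothFiniteEnergy (Metric.ball 0 1 \ M) φ) (hs : 0 < s) (hst : s < t) (ht : t < 1) :
    IsAngularPairing (Metric.ball 0 1) g φ
      (∫ z in Metric.ball 0 1, curlDot (fun z => radialCutoff s t z * φ z) v z) := by
  refine ⟨K, Metric.closedBall 0 t, v, fun z => radialCutoff s t z * φ z, hv,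
    isCompact_closedBall 0 t, Metric.closedBall_subset_ball ht, fun z hz => ?_,
    (isSmoothFiniteEnergy_cutoff hM hMs hφ hs hst ht).smooth, ?_, rfl⟩
  · have : t ≤ ‖z‖ := by
      by_contra! h
      exact hz.2 (mem_closedBall_zero_iff.2 h.le)
    dsimp only
    rw [radialCutoff_eq_one hs hst this, one_mul]
  · rw [disjoint_left]
    intro z hz hzK
    exact notMem_tsupport_iff_eventuallyEq.2 (cutoff_eventually_eq_zero φ hs hst (hKs hzK)) hz

lemma setIntegral_curlDot_eq_cutoff {g v : ℂ → ℂ} {K L : Set ℂ} {ψ : ℂ → ℝ}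
    (hv : IsCircleExtension (Metric.ball 0 1) g K v) (hKs : K ⊆ Metric.ball 0 s)
    (hLs : L ⊆ Metric.ball 0 s) (hψφ : EqOn ψ φ (Metric.ball 0 1 \ L))
    (hψ : ContDiffOn ℝ ∞ ψ (Metric.ball 0 1)) (hψK : Disjoint (tsupport ψ) K)
    (hM : IsCompact M) (hMs : M ⊆ Metric.ball 0 s)
    (hφ : IsSmoothFiniteEnergy (Metric.ball 0 1 \ M) φ) (hs : 0 < s) (hst : s < t) (ht : t < 1) :
    ∫ z in Metric.ball 0 1, curlDot ψ v z =
      ∫ z in Metric.ball 0 1, curlDot (fun z => radialCutoff s t z * φ z) v z := by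
  have hDo : IsOpen (Metric.ball (0 : ℂ) 1) := Metric.isOpen_ball
  have hst' : Metric.ball (0 : ℂ) s ⊆ Metric.closedBall 0 t :=
    (Metric.ball_subset_ball hst.le).trans Metric.ball_subset_closedBall
  have hcD : Metric.closedBall (0 : ℂ) t ⊆ Metric.ball 0 1 := Metric.closedBall_subset_ball ht
  have hcc : IsCompact (Metric.closedBall (0 : ℂ) t) := isCompact_closedBall 0 t
  have hψE : IsSmoothFiniteEnergy (Metric.ball 0 1) ψ :=
    isSmoothFiniteEnergy_of_sdiff hDo hcc hcD hψ
      ((hφ.mono (sdiff_subset_sdiff_right (hMs.trans hst'))).congr (hDo.sdiff hcc.isClosed)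
        fun z hz => (hψφ ⟨hz.1, fun h => hz.2 (hst' (hLs h))⟩).symm)
  refine setIntegral_curlDot_congr hDo hv.isCompact hcc hcD hψE
    (isSmoothFiniteEnergy_cutoff hM hMs hφ hs hst ht) hv.energy hv.norm_eq_one (fun z hz => ?_)
    (fun z hz => cutoff_eventually_eq_zero φ hs hst (hKs hz)) fun z hz => ?_
  · exact notMem_tsupport_iff_eventuallyEq.1 (disjoint_right.1 hψK hz)
  · have : t ≤ ‖z‖ := by
      by_contra! h
      exact hz.2 (mem_closedBall_zero_iff.2 h.le)
    rw [radialCutoff_eq_one hs hst this, one_mul, hψφ ⟨hz.1, fun h => hz.2 (hst' (hLs h))⟩]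

end Cutoff

/-- The duality bracket does not depend on the extensions. -/
theorem IsAngularPairing.unique {g : ℂ → ℂ} {φ : ℂ → ℝ} {t₁ t₂ : ℝ}
    (hφ : IsFiniteEnergyNearBoundary (Metric.ball 0 1) φ)
    (h₁ : IsAngularPairing (Metric.ball 0 1) g φ t₁)
    (h₂ : IsAngularPairing (Metric.ball 0 1) g φ t₂) : t₁ = t₂ := by
  have hDo : IsOpen (Metric.ball (0 : ℂ) 1) := Metric.isOpen_ball
  obtain ⟨M, hM, hMD, hφM⟩ := hφ
  obtain ⟨K, L, v, ψ, hv, hL, hLD, hψφ, hψ, hψK, rfl⟩ := h₁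
  obtain ⟨K', L', v', ψ', hv', hL', hLD', hψφ', hψ', hψK', rfl⟩ := h₂
  have hN := (((hM.union hv.isCompact).union hL).union hv'.isCompact).union hL'
  obtain ⟨ρ, hρ0, hρ1, hNρ⟩ := exists_subset_ball_of_isCompact hN (union_subset (union_subset
    (union_subset (union_subset hMD hv.subset) hLD) hv'.subset) hLD')
  simp only [union_subset_iff] at hNρ
  obtain ⟨⟨⟨⟨hMρ, hKρ⟩, hLρ⟩, hKρ'⟩, hLρ'⟩ := hNρ
  -- The cutoff rises between two radii `s < t` strictly beyond `ρ`, so it vanishes near all the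
  -- compact sets of both representations and equals `1` near the circle.
  set s := (ρ + 1) / 2 with hs
  set t := (s + 1) / 2 with ht
  have hρs : ρ < s := by linarith
  have hs0 : 0 < s := by linarith
  have hst : s < t := by linarith
  have ht1 : t < 1 := by linarith
  have hb : Metric.ball (0 : ℂ) ρ ⊆ Metric.ball 0 s := Metric.ball_subset_ball hρs.le
  set Φ : ℂ → ℝ := fun z => radialCutoff s t z * φ z with hΦ
  have hΦE : IsSmoothFiniteEnergy (Metric.ball 0 1) Φ :=
    isSmoothFiniteEnergy_cutoff hM (hMρ.trans hb) hφM hs0 hst ht1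
  change ∫ z in Metric.ball 0 1, curlDot ψ v z = ∫ z in Metric.ball 0 1, curlDot ψ' v' z
  rw [setIntegral_curlDot_eq_cutoff hv (hKρ.trans hb) (hLρ.trans hb) hψφ hψ hψK hM (hMρ.trans hb)
    hφM hs0 hst ht1, setIntegral_curlDot_eq_cutoff hv' (hKρ'.trans hb) (hLρ'.trans hb) hψφ' hψ'
    hψK' hM (hMρ.trans hb) hφM hs0 hst ht1, ← sub_eq_zero]
  have hA : annulus ρ 1 ⊆ Metric.ball 0 1 \ K := fun z hz =>
    ⟨annulus_subset_ball ρ hz, fun h => (mem_ball_zero_iff.1 (hKρ h)).not_gt hz.1⟩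
  have hA' : annulus ρ 1 ⊆ Metric.ball 0 1 \ K' := fun z hz =>
    ⟨annulus_subset_ball ρ hz, fun h => (mem_ball_zero_iff.1 (hKρ' h)).not_gt hz.1⟩
  have hAo := isOpen_annulus ρ 1
  -- The quotient of the two extensions. Its phase derivative is the difference of theirs and its
  -- trace is `1`, so the difference of the brackets is the boundary contribution of `w`.
  set w : ℂ → ℂ := fun z => v z * (starRingEnd ℂ) (v' z) with hw
  have hΦK : ∀ z ∈ K, ∀ᶠ y in 𝓝 z, Φ y = 0 := fun z hz =>
    cutoff_eventually_eq_zero φ hs0 hst (hb (hKρ hz))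
  have hΦK' : ∀ z ∈ K', ∀ᶠ y in 𝓝 z, Φ y = 0 := fun z hz =>
    cutoff_eventually_eq_zero φ hs0 hst (hb (hKρ' hz))
  have hI := integrableOn_curlDot hDo hv.isCompact hΦE hv.energy hv.norm_eq_one hΦK
  have hI' := integrableOn_curlDot hDo hv'.isCompact hΦE hv'.energy hv'.norm_eq_one hΦK'
  have hpt : ∀ z ∈ Metric.ball (0 : ℂ) 1, (curlDot Φ v - curlDot Φ v') z = curlDot Φ w z :=
    fun z hz => by
      rw [Pi.sub_apply]
      by_cases hzA : z ∈ annulus ρ 1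
      · exact (curlDot_mul_conj ((hv.energy.mono hA).differentiableAt hAo hzA)
          ((hv'.energy.mono hA').differentiableAt hAo hzA) (hv.norm_eq_one z (hA hzA))
          (hv'.norm_eq_one z (hA' hzA))).symm
      · have hzs : z ∈ Metric.ball (0 : ℂ) s := by
          rw [mem_ball_zero_iff]
          by_contra! h
          exact hzA ⟨hρs.trans_le h, mem_ball_zero_iff.1 hz⟩
        have h0 := cutoff_eventually_eq_zero φ hs0 hst hzs
        rw [curlDot_eq_zero_of_eventually v h0, curlDot_eq_zero_of_eventually v' h0,
          curlDot_eq_zero_of_eventually w h0, sub_zero]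
  have htr : HasTrace (Metric.ball 0 1) (fun z => w z - 1) 0 := by
    have hWm : MeasurableSet (Metric.ball (0 : ℂ) 1 \ K) :=
      (hDo.sdiff hv.isCompact.isClosed).measurableSet
    -- Nothing is known about `v` on `K`; replacing it by zero there makes it measurable, as
    -- additivity of traces requires, without changing the trace.
    have h1 : HasTrace (Metric.ball 0 1) ((Metric.ball (0 : ℂ) 1 \ K).indicator v) g :=
      hv.trace.congr hDo hv.isCompact hv.subset fun z hz => by rw [indicator_of_mem hz]
    have h2 := h1.add hv'.trace.neg (AEStronglyMeasurable.restrict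
      ((aestronglyMeasurable_indicator_iff hWm).2
        (hv.energy.smooth.continuousOn.aestronglyMeasurable hWm)))
    have h3 : HasTrace (Metric.ball 0 1)
        (fun z => (Metric.ball (0 : ℂ) 1 \ K).indicator v z + -v' z) 0 := by
      convert h2 using 1
      ext z
      simp
    refine h3.of_norm_eq hDo (isCompact_closedBall 0 ρ) (Metric.closedBall_subset_ball hρ1)
      fun z hz => ?_
    have hzA : z ∈ annulus ρ 1 := ⟨by simpa using hz.2, mem_ball_zero_iff.1 hz.1⟩
    rw [indicator_of_mem (hA hzA)]
    have hv1 : v' z * (starRingEnd ℂ) (v' z) = 1 := by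
      rw [Complex.mul_conj, Complex.normSq_eq_norm_sq, hv'.norm_eq_one z (hA' hzA)]
      simp
    have h4 : w z - 1 = (v z + -v' z) * (starRingEnd ℂ) (v' z) := by
      rw [add_mul, neg_mul, hv1]
      rfl
    rw [h4, norm_mul, RCLike.norm_conj, hv'.norm_eq_one z (hA' hzA), mul_one]
  have hIw : IntegrableOn (curlDot Φ w) (Metric.ball 0 1) :=
    (hI.sub hI').congr_fun hpt hDo.measurableSet
  rw [← integral_sub hI hI', ← setIntegral_curlDot_eq_zero hρs (hst.trans ht1)
    (isSmoothFiniteEnergy_mul_conj hAo (hv.energy.mono hA) (hv'.energy.mono hA')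
      (fun z hz => hv.norm_eq_one z (hA hz)) fun z hz => hv'.norm_eq_one z (hA' hz))
    (fun z hz => by
      rw [norm_mul, RCLike.norm_conj, hv.norm_eq_one z (hA hz), hv'.norm_eq_one z (hA' hz),
        one_mul]) htr hΦE (fun z hz => by
      rw [hΦ]
      dsimp only
      rw [radialCutoff_eq_zero hs0 hst hz.le, zero_mul]) hIw]
  exact setIntegral_congr_fun hDo.measurableSet hpt

/-- Brackets with constants are given by the degree. -/
theorem pairingAddConst_of_pairing_one {g : ℂ → ℂ} {σ : ℝ}
    (h : IsAngularPairing (Metric.ball 0 1) g (fun _ => 1) σ) :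
    PairingAddConst (Metric.ball 0 1) g σ := by
  intro φ t c hφ ht
  have hDo : IsOpen (Metric.ball (0 : ℂ) 1) := Metric.isOpen_ball
  obtain ⟨M, hM, hMD, hφM⟩ := hφ
  obtain ⟨K, L, v, ψ, hv, hL, hLD, hψφ, hψ, hψK, rfl⟩ := ht
  obtain ⟨s, hs0, hs1, hNs⟩ := exists_subset_ball_of_isCompact ((hM.union hv.isCompact).union hL)
    (union_subset (union_subset hMD hv.subset) hLD)
  simp only [union_subset_iff] at hNs
  obtain ⟨⟨hMs, hKs⟩, hLs⟩ := hNs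
  have hst : s < (s + 1) / 2 := by linarith
  have ht1 : (s + 1) / 2 < 1 := by linarith
  set r := (s + 1) / 2
  have hone : IsSmoothFiniteEnergy (Metric.ball (0 : ℂ) 1 \ ∅) fun _ => (1 : ℝ) :=
    IsSmoothFiniteEnergy.const 1
  have hφc : IsSmoothFiniteEnergy (Metric.ball (0 : ℂ) 1 \ M) fun z => φ z + c :=
    hφM.add (hDo.sdiff hM.isClosed) (IsSmoothFiniteEnergy.const c)
  -- By independence of the extension, the bracket of `1` is computed with the same `v` and the same
  -- cutoff as that of `φ`. The claim then becomes linearity of one integral.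
  have hσ := IsAngularPairing.unique ⟨∅, isCompact_empty, empty_subset _, hone⟩ h
    (hv.isAngularPairing_cutoff hKs isCompact_empty (empty_subset _) hone hs0 hst ht1)
  have h2 := hv.isAngularPairing_cutoff hKs hM hMs hφc hs0 hst ht1
  convert h2 using 1
  have e1 := isSmoothFiniteEnergy_cutoff hM hMs hφM hs0 hst ht1
  have e2 := isSmoothFiniteEnergy_cutoff isCompact_empty (empty_subset _) hone hs0 hst ht1
  have hz : ∀ (φ : ℂ → ℝ), ∀ z ∈ K, ∀ᶠ y in 𝓝 z, radialCutoff s r y * φ y = 0 := fun φ z hz =>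
    cutoff_eventually_eq_zero φ hs0 hst (hKs hz)
  have i1 := integrableOn_curlDot hDo hv.isCompact e1 hv.energy hv.norm_eq_one (hz _)
  have i2 := integrableOn_curlDot hDo hv.isCompact e2 hv.energy hv.norm_eq_one (hz _)
  change (∫ z in Metric.ball 0 1, curlDot ψ v z) + c * σ = _
  rw [setIntegral_curlDot_eq_cutoff hv hKs hLs hψφ hψ hψK hM hMs hφM hs0 hst ht1, hσ,
    ← integral_const_mul, ← integral_add i1 (i2.const_mul c)]
  refine setIntegral_congr_fun hDo.measurableSet fun z hz => ?_
  have hd1 := e1.differentiableAt hDo hz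
  have hd2 := e2.differentiableAt hDo hz
  rw [← curlDot_const_mul v c hd2, ← curlDot_add hd1 (hd2.const_mul c)]
  refine curlDot_congr (Eventually.of_forall fun y => ?_) EventuallyEq.rfl
  dsimp only
  ring

/-! ### Energy integrals with logarithmic singularities on the disc -/

lemma gradDot_add_right {u φ ψ : ℂ → ℝ} {z : ℂ} (hφ : DifferentiableAt ℝ φ z)
    (hψ : DifferentiableAt ℝ ψ z) :
    gradDot u (fun y => φ y + ψ y) z = gradDot u φ z + gradDot u ψ z := by
  simp only [gradDot, partialX, partialY, fderiv_fun_add hφ hψ, add_apply]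
  ring

lemma gradDot_congr_right {u φ ψ : ℂ → ℝ} {z : ℂ} (h : φ =ᶠ[𝓝 z] ψ) :
    gradDot u φ z = gradDot u ψ z := by
  simp only [gradDot, partialX, partialY, h.fderiv_eq]

lemma abs_gradDot_le (u v : ℂ → ℝ) (z : ℂ) :
    |gradDot u v z| ≤ 2 * (‖fderiv ℝ u z‖ * ‖fderiv ℝ v z‖) := by
  refine (abs_add_le _ _).trans ?_
  rw [abs_mul, abs_mul, two_mul]
  have h1 := norm_partialX_le u z
  have h2 := norm_partialX_le v z
  have h3 := norm_partialY_le u z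
  have h4 := norm_partialY_le v z
  simp only [Real.norm_eq_abs] at h1 h2 h3 h4
  gcongr

lemma integrableOn_gradDot {U : Set ℂ} (hU : IsOpen U) {u φ : ℂ → ℝ}
    (hu : IsSmoothFiniteEnergy U u) (hφ : IsSmoothFiniteEnergy U φ) :
    IntegrableOn (gradDot u φ) U := by
  refine Integrable.mono' ((integrableOn_norm_fderiv_mul hu hφ).const_mul 2)
    ((((partialX_contDiffOn hU hu.smooth).continuousOn.mul
      (partialX_contDiffOn hU hφ.smooth).continuousOn).add
      ((partialY_contDiffOn hU hu.smooth).continuousOn.mul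
      (partialY_contDiffOn hU hφ.smooth).continuousOn)).aestronglyMeasurable hU.measurableSet)
    (ae_of_all _ fun z => abs_gradDot_le u φ z)

section Log

variable {φ : ℂ → ℝ} {a : ℂ} {s t : ℝ}

lemma integrableOn_gradDot_log_cutoff (ha : ‖a‖ < s) (hst : s < t) (ht : t < 1)
    (hφ : IsSmoothFiniteEnergy (Metric.ball 0 1) φ) :
    IntegrableOn (gradDot (fun y => Real.log ‖y - a‖) (fun z => radialCutoff s t z * φ z))
      (Metric.ball 0 1) := by
  have hs : 0 < s := (norm_nonneg a).trans_lt ha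
  have hDo : IsOpen (Metric.ball (0 : ℂ) 1) := Metric.isOpen_ball
  obtain ⟨r, har, hrs⟩ := exists_between ha
  have hlog : IsSmoothFiniteEnergy (Metric.ball 0 1 \ Metric.closedBall 0 r)
      (fun z => Real.log ‖z - a‖) :=
    isSmoothFiniteEnergy_log_sub hDo Metric.isBounded_ball Metric.isClosed_closedBall
      (Filter.mem_of_superset (Metric.isOpen_ball.mem_nhds (mem_ball_zero_iff.2 har))
        Metric.ball_subset_closedBall)
  have hcut := isSmoothFiniteEnergy_cutoff isCompact_empty (empty_subset _)
    (hφ.mono sdiff_subset) hs hst ht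
  refine (integrableOn_gradDot (hDo.sdiff Metric.isClosed_closedBall) hlog
    (hcut.mono sdiff_subset)).of_forall_sdiff_eq_zero hDo.measurableSet fun z hz => ?_
  refine gradDot_eq_zero_of_eventually (cutoff_eventually_eq_zero φ hs hst ?_)
  have : z ∈ Metric.closedBall (0 : ℂ) r := by
    by_contra h
    exact hz.2 ⟨hz.1, h⟩
  exact mem_ball_zero_iff.2 ((mem_closedBall_zero_iff.1 this).trans_lt hrs)

lemma inner_cutoff_properties (hs : 0 < s) (hst : s < t) (ht : t < 1)
    (hφ : ContDiffOn ℝ ∞ φ (Metric.ball 0 1)) :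
    ContDiff ℝ ∞ (fun z => (1 - radialCutoff s t z) * φ z) ∧
      HasCompactSupport (fun z => (1 - radialCutoff s t z) * φ z) ∧
      tsupport (fun z => (1 - radialCutoff s t z) * φ z) ⊆ Metric.ball 0 1 := by
  have h1 := tsupport_one_sub_radialCutoff_subset hs hst
  have h2 := h1.trans (Metric.closedBall_subset_ball ht)
  have hc : HasCompactSupport fun z => 1 - radialCutoff s t z :=
    (isCompact_closedBall _ _).of_isClosed_subset (isClosed_tsupport _) h1
  exact ⟨contDiff_mul_of_tsupport_subset Metric.isOpen_ball
    (contDiff_const.sub (contDiff_radialCutoff s t)) h2 hφ, hc.mul_right,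
    tsupport_mul_subset_left.trans h2⟩

lemma gradDot_eq_cutoff_add (u : ℂ → ℝ) (s t : ℝ) {z : ℂ}
    (h : DifferentiableAt ℝ φ z) :
    gradDot u φ z = gradDot u (fun z => radialCutoff s t z * φ z) z +
      gradDot u (fun z => (1 - radialCutoff s t z) * φ z) z := by
  have hd : DifferentiableAt ℝ (radialCutoff s t) z :=
    (contDiff_radialCutoff s t).differentiable (by simp) z
  rw [← gradDot_add_right (hd.fun_mul h) ((hd.const_sub 1).fun_mul h)]
  refine gradDot_congr_right (Eventually.of_forall fun y => ?_)
  dsimp only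
  ring

lemma integrableOn_gradDot_log (ha : a ∈ Metric.ball (0 : ℂ) 1)
    (hφ : IsSmoothFiniteEnergy (Metric.ball 0 1) φ) :
    IntegrableOn (gradDot (fun y => Real.log ‖y - a‖) φ) (Metric.ball 0 1) := by
  obtain ⟨s, has, hs1⟩ := exists_between (mem_ball_zero_iff.1 ha)
  obtain ⟨t, hst, ht⟩ := exists_between hs1
  obtain ⟨h1, h2, -⟩ := inner_cutoff_properties ((norm_nonneg a).trans_lt has) hst ht hφ.smooth
  refine ((integrableOn_gradDot_log_cutoff has hst ht hφ).add
    (integrable_gradDot_log h1 h2 a).integrableOn).congr_fun (fun z hz => ?_)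
    Metric.isOpen_ball.measurableSet
  exact (gradDot_eq_cutoff_add _ s t (hφ.differentiableAt Metric.isOpen_ball hz)).symm

/-- The inner part of `φ` is a compactly supported test function equal to `φ` at `a`, so the
fundamental solution evaluates it. The outer part avoids the singularity. -/
lemma integral_gradDot_log_eq_cutoff (ha : ‖a‖ < s) (hst : s < t) (ht : t < 1)
    (hφ : IsSmoothFiniteEnergy (Metric.ball 0 1) φ) :
    ∫ z in Metric.ball 0 1, gradDot (fun y => Real.log ‖y - a‖) φ z =
      (∫ z in Metric.ball 0 1, gradDot (fun y => Real.log ‖y - a‖)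
        (fun z => radialCutoff s t z * φ z) z) - 2 * Real.pi * φ a := by
  have hs := (norm_nonneg a).trans_lt ha
  obtain ⟨h1, h2, h3⟩ := inner_cutoff_properties hs hst ht hφ.smooth
  have h4 : ∫ z in Metric.ball 0 1, gradDot (fun y => Real.log ‖y - a‖)
      (fun z => (1 - radialCutoff s t z) * φ z) z = -(2 * Real.pi * φ a) := by
    rw [setIntegral_eq_integral_of_tsupport h3 fun z hz => gradDot_eq_zero_of_eventually hz,
      integral_gradDot_log h1 h2 a, radialCutoff_eq_zero hs hst ha.le, sub_zero, one_mul]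
  rw [sub_eq_add_neg, ← h4, ← integral_add (integrableOn_gradDot_log_cutoff ha hst ht hφ)
    (integrable_gradDot_log h1 h2 a).integrableOn]
  exact setIntegral_congr_fun Metric.isOpen_ball.measurableSet fun z hz =>
    gradDot_eq_cutoff_add _ s t (hφ.differentiableAt Metric.isOpen_ball hz)

end Log

/-! ### Uniqueness for the Neumann problem on the disc -/

section Neumann

variable {k : ℕ} {d : Fin k → ℤ} {α : Fin k → ℂ} {g : ℂ → ℂ}

lemma integral_gradDot_withLogs_disc (hα : ∀ j, α j ∈ Metric.ball (0 : ℂ) 1) {R φ : ℂ → ℝ}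
    (hR : IsSmoothFiniteEnergy (Metric.ball 0 1) R)
    (hφ : IsSmoothFiniteEnergy (Metric.ball 0 1) φ) :
    ∫ z in Metric.ball 0 1, gradDot (withLogs d α R) φ z =
      (∫ z in Metric.ball 0 1, gradDot R φ z) +
        ∑ j, (d j : ℝ) * ∫ z in Metric.ball 0 1, gradDot (fun y => Real.log ‖y - α j‖) φ z := by
  have hi : ∀ j ∈ Finset.univ, Integrable (fun z => (d j : ℝ) *
      gradDot (fun y => Real.log ‖y - α j‖) φ z) (volume.restrict (Metric.ball 0 1)) :=
    fun j _ => (integrableOn_gradDot_log (hα j) hφ).const_mul _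
  simp only [← integral_const_mul]
  rw [← integral_finsetSum _ hi, ← integral_add (integrableOn_gradDot Metric.isOpen_ball hR hφ)
    (integrable_finsetSum _ hi)]
  refine integral_congr_ae ?_
  filter_upwards [ae_restrict_of_ae (ae_notMem_range_fin α),
    ae_restrict_mem Metric.isOpen_ball.measurableSet] with z hz hzD
  exact gradDot_withLogs d (hR.differentiableAt Metric.isOpen_ball hzD) hz

lemma eqOn_const_of_integral_gradDot_self_eq_zero {u : ℂ → ℝ}
    (hu : IsSmoothFiniteEnergy (Metric.ball 0 1) u)
    (h : ∫ z in Metric.ball 0 1, gradDot u u z = 0) :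
    ∀ z ∈ Metric.ball (0 : ℂ) 1, u z = u 0 := by
  have hDo : IsOpen (Metric.ball (0 : ℂ) 1) := Metric.isOpen_ball
  have hnn : ∀ z, 0 ≤ gradDot u u z := fun z => add_nonneg (mul_self_nonneg _) (mul_self_nonneg _)
  have hae := (integral_eq_zero_iff_of_nonneg hnn (integrableOn_gradDot hDo hu hu)).1 h
  have hX := (partialX_contDiffOn hDo hu.smooth).continuousOn
  have hY := (partialY_contDiffOn hDo hu.smooth).continuousOn
  have hz := Measure.eqOn_open_of_ae_eq hae hDo ((hX.mul hX).add (hY.mul hY)) continuousOn_const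
  intro z hzD
  refine hDo.is_const_of_fderiv_eq_zero (𝕜 := ℝ) (convex_ball 0 1).isPreconnected
    (hu.smooth.differentiableOn (by simp)) (fun x hx => ?_) hzD (by simp)
  have h0 : partialX u x * partialX u x + partialY u x * partialY u x = 0 := hz hx
  obtain ⟨h1, h2⟩ := (add_eq_zero_iff_of_nonneg (mul_self_nonneg _) (mul_self_nonneg _)).1 h0
  have := norm_fderiv_le_add u x
  rw [mul_self_eq_zero.1 h1, mul_self_eq_zero.1 h2, norm_zero, add_zero] at this
  exact norm_le_zero_iff.1 this

lemma IsSmoothFiniteEnergy.nearBoundary {U : Set ℂ} {φ : ℂ → ℝ} (h : IsSmoothFiniteEnergy U φ) :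
    IsFiniteEnergyNearBoundary U φ :=
  ⟨∅, isCompact_empty, empty_subset _, h.mono sdiff_subset⟩

/-- The Neumann problem in the disc has at most one solution up to constants. -/
lemma IsNeumannRegularPart.eq_add_const (hα : ∀ j, α j ∈ Metric.ball (0 : ℂ) 1) {R R' : ℂ → ℝ}
    (h : IsNeumannRegularPart (Metric.ball 0 1) d α g R)
    (h' : IsNeumannRegularPart (Metric.ball 0 1) d α g R') :
    ∃ c : ℝ, ∀ z ∈ Metric.ball (0 : ℂ) 1, R z = R' z + c := by
  have hDo : IsOpen (Metric.ball (0 : ℂ) 1) := Metric.isOpen_ball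
  -- The difference of the two solutions is an admissible test function. Subtracting the two weak
  -- equations, the logarithmic terms cancel and the Dirichlet energy of the difference is zero.
  have hu : IsSmoothFiniteEnergy (Metric.ball 0 1) (fun z => R z + (-1 : ℝ) • R' z) :=
    h.energy.add hDo (h'.energy.const_smul hDo (-1))
  have e := (h.weak_equation _ hu).unique hu.nearBoundary (h'.weak_equation _ hu)
  rw [integral_gradDot_withLogs_disc hα h.energy hu,
    integral_gradDot_withLogs_disc hα h'.energy hu] at e
  refine ⟨R 0 - R' 0, fun z hz => ?_⟩
  have hc := eqOn_const_of_integral_gradDot_self_eq_zero hu ?_ z hz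
  · simp only [smul_eq_mul] at hc
    linarith
  · have e2 : (∫ z in Metric.ball 0 1, gradDot R (fun z => R z + (-1 : ℝ) • R' z) z) -
        ∫ z in Metric.ball 0 1, gradDot R' (fun z => R z + (-1 : ℝ) • R' z) z = 0 := by
      linarith
    rw [← e2, ← integral_sub (integrableOn_gradDot hDo h.energy hu)
      (integrableOn_gradDot hDo h'.energy hu)]
    refine setIntegral_congr_fun hDo.measurableSet fun x hx => ?_
    have d1 := h.energy.differentiableAt hDo hx
    have d2 := h'.energy.differentiableAt hDo hx
    have hf : fderiv ℝ (fun z => R z + (-1 : ℝ) • R' z) x =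
        fderiv ℝ R x + (-1 : ℝ) • fderiv ℝ R' x := by
      rw [← fderiv_fun_const_smul d2]
      exact fderiv_fun_add d1 (d2.fun_const_smul (-1 : ℝ))
    unfold gradDot partialX partialY
    rw [hf]
    simp only [add_apply, smul_apply, smul_eq_mul]
    ring

/-- Two regular parts differ by a constant, whose effects on the bracket and on the point values
cancel exactly because the degree of `g` is `∑ d_j`. -/
theorem IsRenormalizedEnergy.unique_disc (hα : ∀ j, α j ∈ Metric.ball (0 : ℂ) 1)
    (hg : HasBoundaryDegree (Metric.ball 0 1) g (∑ j, d j)) {w w' : ℝ}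
    (h : IsRenormalizedEnergy (Metric.ball 0 1) d α g w)
    (h' : IsRenormalizedEnergy (Metric.ball 0 1) d α g w') : w = w' := by
  obtain ⟨R, t, hR, ht, rfl⟩ := h
  obtain ⟨R', t', hR', ht', rfl⟩ := h'
  obtain ⟨c, hc⟩ := hR.eq_add_const hα hR'
  have hn := isFiniteEnergyNearBoundary_withLogs Metric.isOpen_ball Metric.isBounded_ball d hα
    hR'.energy
  have h1 := pairingAddConst_of_pairing_one hg _ _ c hn ht'
  have h2 := ht.congr isCompact_empty (empty_subset _)
    (φ' := fun z => withLogs d α R' z + c) fun z hz => by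
      simp only [withLogs, hc z hz.1]
      ring
  obtain ⟨M, hM, hMD, hφM⟩ := hn
  have h3 := h2.unique ⟨M, hM, hMD, hφM.add (Metric.isOpen_ball.sdiff hM.isClosed)
    (IsSmoothFiniteEnergy.const c)⟩ h1
  have h4 : ∑ j, (d j : ℝ) * R (α j) = (∑ j, (d j : ℝ) * R' (α j)) + c * ∑ j, (d j : ℝ) := by
    rw [Finset.mul_sum, ← Finset.sum_add_distrib]
    refine Finset.sum_congr rfl fun j _ => ?_
    rw [hc _ (hα j)]
    ring
  rw [h3, h4]
  push_cast
  ring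

end Neumann

/-! ### Weyl's lemma for the Cauchy-Riemann operator -/

/-- Twice the Wirtinger derivative `∂/∂\bar z`. -/
noncomputable def dbar (ψ : ℂ → ℂ) (z : ℂ) : ℂ := partialX ψ z + Complex.I * partialY ψ z

lemma dbar_mul {θ ψ : ℂ → ℂ} {z : ℂ} (hθ : DifferentiableAt ℝ θ z) (hψ : DifferentiableAt ℝ ψ z) :
    dbar (fun y => θ y * ψ y) z = θ z * dbar ψ z + ψ z * dbar θ z := by
  simp only [dbar, partialX, partialY, fderiv_fun_mul hθ hψ, add_apply, smul_apply, smul_eq_mul]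
  ring

/-- The Cauchy transform of a test function. -/
noncomputable def cauchyTransform (χ : ℂ → ℂ) (z : ℂ) : ℂ := ∫ x, (z - x)⁻¹ * χ x

lemma cauchyTransform_eq_convolution (χ : ℂ → ℂ) :
    cauchyTransform χ = convolution (fun z : ℂ => z⁻¹) χ (ContinuousLinearMap.mul ℝ ℂ) volume := by
  ext z
  rw [convolution_eq_swap]
  rfl

lemma locallyIntegrable_inv : LocallyIntegrable (fun z : ℂ => z⁻¹) volume := by
  simpa using locallyIntegrable_inv_sub 0

lemma contDiff_cauchyTransform {χ : ℂ → ℂ} (hχ : ContDiff ℝ ∞ χ) (hc : HasCompactSupport χ) :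
    ContDiff ℝ ∞ (cauchyTransform χ) := by
  rw [cauchyTransform_eq_convolution]
  exact hc.contDiff_convolution_right _ locallyIntegrable_inv hχ

lemma fderiv_cauchyTransform {χ : ℂ → ℂ} (hχ : ContDiff ℝ ∞ χ) (hc : HasCompactSupport χ)
    (z c : ℂ) : fderiv ℝ (cauchyTransform χ) z c = cauchyTransform (fun x => fderiv ℝ χ x c) z := by
  rw [cauchyTransform_eq_convolution, cauchyTransform_eq_convolution,
    (hc.hasFDerivAt_convolution_right _ locallyIntegrable_inv (hχ.of_le (by simp)) z).fderiv,
    convolution_precompR_apply _ locallyIntegrable_inv (hc.fderiv ℝ)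
      (hχ.continuous_fderiv (by simp))]

lemma integrable_cauchyKernel {χ : ℂ → ℂ} (hχ : Continuous χ) (hc : HasCompactSupport χ) (z : ℂ) :
    Integrable fun x => (z - x)⁻¹ * χ x := by
  refine (integrable_mul_inv_sub hχ hc z).neg.congr (ae_of_all _ fun x => ?_)
  dsimp only
  rw [Pi.neg_apply, ← neg_sub x z, inv_neg]
  ring

/-- Derivatives pass to `χ` under the convolution, and the Cauchy–Pompeiu formula evaluates the
result. -/
lemma dbar_cauchyTransform {χ : ℂ → ℂ} (hχ : ContDiff ℝ ∞ χ) (hc : HasCompactSupport χ) (z : ℂ) :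
    dbar (cauchyTransform χ) z = 2 * Real.pi * χ z := by
  have hi : ∀ c : ℂ, Integrable fun x => (z - x)⁻¹ * fderiv ℝ χ x c := fun c =>
    integrable_cauchyKernel ((hχ.continuous_fderiv (by simp)).clm_apply continuous_const)
      (hc.fderiv_apply (𝕜 := ℝ) c) z
  rw [dbar, partialX, partialY, fderiv_cauchyTransform hχ hc, fderiv_cauchyTransform hχ hc,
    cauchyTransform, cauchyTransform, ← integral_const_mul,
    ← integral_add (hi 1) ((hi Complex.I).const_mul _), ← neg_neg (2 * Real.pi * χ z),
    ← integral_dbar_mul_inv_sub hχ hc z, ← integral_neg]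
  refine integral_congr_ae (ae_of_all _ fun x => ?_)
  dsimp only
  rw [← neg_sub x z, inv_neg, partialX, partialY]
  ring

section Weyl

variable {q : ℂ → ℂ}

/-- The inner radial cutoff, as a complex function. -/
noncomputable def complexCutoff (s t : ℝ) (z : ℂ) : ℂ := ((1 - radialCutoff s t z : ℝ) : ℂ)

/-- The Cauchy integral formula with a smooth cutoff in place of a contour. -/
noncomputable def cutoffCauchyIntegral (q : ℂ → ℂ) (s t : ℝ) (w : ℂ) : ℂ :=
  ∫ z in Metric.ball 0 1, q z * dbar (complexCutoff s t) z * (z - w)⁻¹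

lemma contDiff_complexCutoff (s t : ℝ) :
    ContDiff ℝ ∞ (complexCutoff s t) :=
  Complex.ofRealCLM.contDiff.comp (contDiff_const.sub (contDiff_radialCutoff s t))

lemma dbar_complexCutoff_eq_zero {s t : ℝ} (hs : 0 < s) (hst : s < t) {z : ℂ} (hz : ‖z‖ < s) :
    dbar (complexCutoff s t) z = 0 := by
  have h : complexCutoff s t =ᶠ[𝓝 z] fun _ => 1 := by
    filter_upwards [(isOpen_lt continuous_norm continuous_const).mem_nhds hz] with y hy
    rw [complexCutoff, radialCutoff_eq_zero hs hst (le_of_lt hy)]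
    simp
  simp only [dbar, partialX, partialY, h.fderiv_eq]
  simp

lemma hasCompactSupport_complexCutoff {s t : ℝ} (hs : 0 < s) (hst : s < t) :
    HasCompactSupport (complexCutoff s t) :=
  hasCompactSupport_ofReal_comp ((isCompact_closedBall _ _).of_isClosed_subset
    (isClosed_tsupport _) (tsupport_one_sub_radialCutoff_subset hs hst))

lemma integrableOn_mul_dbar_complexCutoff {s t : ℝ} (hs : 0 < s) (hst : s < t)
    (hq : IntegrableOn q (Metric.ball 0 1)) :
    IntegrableOn (fun z => q z * dbar (complexCutoff s t) z)
      (Metric.ball 0 1) := by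
  have h1 : Continuous (dbar (complexCutoff s t)) :=
    continuous_dbar (contDiff_complexCutoff s t)
  obtain ⟨C, hC⟩ := h1.bounded_above_of_compact_support
    (hasCompactSupport_dbar (hasCompactSupport_complexCutoff hs hst))
  exact Integrable.mul_bdd hq h1.aestronglyMeasurable (ae_of_all _ hC)

lemma norm_mul_dbar_mul_inv_le {ρ s t : ℝ} (hρ : ρ < s) (hs : 0 < s) (hst : s < t) {z w : ℂ}
    (hw : ‖w‖ < ρ) (c : ℂ) (n : ℕ) :
    ‖c * dbar (complexCutoff s t) z * ((z - w) ^ n)⁻¹‖ ≤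
      ‖c * dbar (complexCutoff s t) z‖ * ((s - ρ) ^ n)⁻¹ := by
  rcases lt_or_ge ‖z‖ s with hz | hz
  · simp [dbar_complexCutoff_eq_zero hs hst hz]
  · rw [norm_mul, norm_inv, norm_pow]
    have : s - ρ ≤ ‖z - w‖ := by
      have := norm_sub_norm_le z w
      linarith
    have : 0 < s - ρ := by linarith
    gcongr

/-- The derivative of the cutoff lives in `‖z‖ ≥ s` while `‖w‖ < ρ < s`, so the kernel is bounded
and differentiation under the integral is allowed. -/
lemma differentiableOn_cutoffCauchyIntegral {ρ s t : ℝ} (hρ : ρ < s) (hs : 0 < s) (hst : s < t)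
    (hq : IntegrableOn q (Metric.ball 0 1)) :
    DifferentiableOn ℂ (cutoffCauchyIntegral q s t) (Metric.ball 0 ρ) := by
  intro w hw
  have hi := integrableOn_mul_dbar_complexCutoff hs hst hq
  have hm : ∀ (n : ℕ) (w : ℂ), AEStronglyMeasurable (fun z : ℂ => ((z - w) ^ n)⁻¹)
      (volume.restrict (Metric.ball (0 : ℂ) 1)) := fun n w =>
    (((measurable_id.sub_const w).pow_const n).inv).aestronglyMeasurable
  have hI : Integrable (fun z => q z * dbar (complexCutoff s t) z *
      (z - w)⁻¹) (volume.restrict (Metric.ball (0 : ℂ) 1)) := by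
    refine (hi.norm.mul_const ((s - ρ) ^ 1)⁻¹).mono' (hi.aestronglyMeasurable.mul (by
      simpa using hm 1 w)) (ae_of_all _ fun z => ?_)
    simpa using norm_mul_dbar_mul_inv_le (z := z) hρ hs hst (mem_ball_zero_iff.1 hw) (q z) 1
  have key := (hasDerivAt_integral_of_dominated_loc_of_deriv_le (𝕜 := ℂ) (x₀ := w)
    (μ := volume.restrict (Metric.ball (0 : ℂ) 1))
    (F := fun w z => q z * dbar (complexCutoff s t) z * (z - w)⁻¹)
    (F' := fun w z => q z * dbar (complexCutoff s t) z *
      ((z - w) ^ 2)⁻¹) (Metric.isOpen_ball.mem_nhds hw)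
    (Eventually.of_forall fun w => hi.aestronglyMeasurable.mul (by simpa using hm 1 w)) hI
    (hi.aestronglyMeasurable.mul (hm 2 w))
    (bound := fun z => ‖q z * dbar (complexCutoff s t) z‖ *
      ((s - ρ) ^ 2)⁻¹)
    (ae_of_all _ fun z x hx => norm_mul_dbar_mul_inv_le hρ hs hst (mem_ball_zero_iff.1 hx) _ 2)
    (hi.norm.mul_const _) (ae_of_all _ fun z x hx => ?_)).2
  · exact key.differentiableAt.differentiableWithinAt
  rcases lt_or_ge ‖z‖ s with hz | hz
  · simp only [dbar_complexCutoff_eq_zero hs hst hz, mul_zero, zero_mul]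
    exact hasDerivAt_const _ _
  · have hne : z - x ≠ 0 := sub_ne_zero.2 fun h => by
      have := mem_ball_zero_iff.1 hx
      rw [← h] at this
      linarith
    have h1 := (((hasDerivAt_id x).const_sub z).inv hne).const_mul
      (q z * dbar (complexCutoff s t) z)
    refine h1.congr_deriv ?_
    simp [div_eq_mul_inv]

/-- The weak equation is tested with the cutoff times the Cauchy transform of `χ`. The cutoff is `1`
on the support of `χ`, so the product rule gives `2π χ` plus a term in the derivative of the cutoff,
where the kernel is nonsingular and Fubini applies. -/
lemma integral_test_mul_eq_cutoffCauchyIntegral {ρ s t : ℝ} (hρ : ρ < s) (hs : 0 < s) (hst : s < t)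
    (ht : t < 1) (hq : IntegrableOn q (Metric.ball 0 1))
    (hw : ∀ ψ : ℂ → ℂ, ContDiff ℝ ∞ ψ → HasCompactSupport ψ →
      tsupport ψ ⊆ Metric.ball 0 1 → ∫ z in Metric.ball 0 1, q z * dbar ψ z = 0)
    {χ : ℂ → ℂ} (hχ : ContDiff ℝ ∞ χ) (hc : HasCompactSupport χ)
    (hχρ : tsupport χ ⊆ Metric.ball 0 ρ) :
    2 * Real.pi * (∫ z in Metric.ball 0 1, q z * χ z) +
      ∫ x, χ x * cutoffCauchyIntegral q s t x = 0 := by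
  set θ : ℂ → ℂ := complexCutoff s t with hθ
  have hθs : ContDiff ℝ ∞ θ := contDiff_complexCutoff s t
  have hΨ := contDiff_cauchyTransform hχ hc
  have hθc := hasCompactSupport_complexCutoff hs hst
  have hi := integrableOn_mul_dbar_complexCutoff hs hst hq
  have hθt : tsupport θ ⊆ Metric.ball 0 1 := by
    refine Subset.trans (closure_minimal (fun z hz => ?_) Metric.isClosed_closedBall)
      (Metric.closedBall_subset_ball ht)
    by_contra hcon
    rw [mem_closedBall_zero_iff, not_le] at hcon
    exact hz (by simp [hθ, complexCutoff, radialCutoff_eq_one hs hst hcon.le])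
  have h0 := hw (fun z => θ z * cauchyTransform χ z) (hθs.mul hΨ) hθc.mul_right
    (tsupport_mul_subset_left.trans hθt)
  have hpt : ∀ z, q z * dbar (fun z => θ z * cauchyTransform χ z) z =
      2 * Real.pi * (q z * χ z) + ∫ x, q z * dbar θ z * ((z - x)⁻¹ * χ x) := fun z => by
    rw [dbar_mul (hθs.differentiable (by simp) z) (hΨ.differentiable (by simp) z),
      dbar_cauchyTransform hχ hc, integral_const_mul]
    have : θ z * χ z = χ z := by
      by_cases hz : z ∈ Metric.ball (0 : ℂ) ρ
      · simp [hθ, complexCutoff, radialCutoff_eq_zero hs hst ((mem_ball_zero_iff.1 hz).trans hρ).le]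
      · rw [image_eq_zero_of_notMem_tsupport fun h => hz (hχρ h), mul_zero]
    simp only [cauchyTransform]
    linear_combination (2 * Real.pi * q z : ℂ) * this
  have hprod : Integrable (Function.uncurry fun z x => q z * dbar θ z * ((z - x)⁻¹ * χ x))
      ((volume.restrict (Metric.ball (0 : ℂ) 1)).prod volume) := by
    have hχi : Integrable χ := hχ.continuous.integrable_of_hasCompactSupport hc
    refine (hi.norm.mul_prod (hχi.norm.mul_const ((s - ρ) ^ 1)⁻¹)).mono' ?_ (ae_of_all _ ?_)
    · exact hi.aestronglyMeasurable.comp_fst.mul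
        (((measurable_fst.sub measurable_snd).inv).aestronglyMeasurable.mul
          hχi.aestronglyMeasurable.comp_snd)
    · rintro ⟨z, x⟩
      simp only [Function.uncurry]
      by_cases hx : x ∈ Metric.ball (0 : ℂ) ρ
      · have := norm_mul_dbar_mul_inv_le (z := z) hρ hs hst (mem_ball_zero_iff.1 hx) (q z) 1
        rw [pow_one] at this
        rw [← mul_assoc, norm_mul _ (χ x)]
        calc _ ≤ ‖q z * dbar θ z‖ * ((s - ρ) ^ 1)⁻¹ * ‖χ x‖ := by gcongr
          _ = _ := by ring
      · rw [image_eq_zero_of_notMem_tsupport fun h => hx (hχρ h)]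
        simp
  obtain ⟨C, hC⟩ := hχ.continuous.bounded_above_of_compact_support hc
  have hqχ : IntegrableOn (fun z => q z * χ z) (Metric.ball 0 1) :=
    Integrable.mul_bdd hq hχ.continuous.aestronglyMeasurable (ae_of_all _ hC)
  simp only [hpt] at h0
  have hF : Integrable (fun z => ∫ x, q z * dbar θ z * ((z - x)⁻¹ * χ x))
    (volume.restrict (Metric.ball (0 : ℂ) 1)) := hprod.integral_prod_left
  rw [integral_add (hqχ.const_mul _) hF, integral_const_mul,
    integral_integral_swap hprod] at h0
  refine Eq.trans (congrArg₂ (· + ·) rfl (integral_congr_ae (ae_of_all _ fun x => ?_))) h0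
  dsimp only
  rw [cutoffCauchyIntegral, ← integral_const_mul]
  refine integral_congr_ae (ae_of_all _ fun z => ?_)
  dsimp only
  ring

lemma ae_eq_cutoffCauchyIntegral {ρ s t : ℝ} (hρ : ρ < s) (hs : 0 < s) (hst : s < t)
    (ht : t < 1) (hq : IntegrableOn q (Metric.ball 0 1))
    (hw : ∀ ψ : ℂ → ℂ, ContDiff ℝ ∞ ψ → HasCompactSupport ψ →
      tsupport ψ ⊆ Metric.ball 0 1 → ∫ z in Metric.ball 0 1, q z * dbar ψ z = 0) :
    ∀ᵐ z, z ∈ Metric.ball (0 : ℂ) ρ →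
      q z = -(2 * Real.pi : ℂ)⁻¹ * cutoffCauchyIntegral q s t z := by
  have hsub : Metric.ball (0 : ℂ) ρ ⊆ Metric.ball 0 1 :=
    Metric.ball_subset_ball (by linarith)
  have hcont := (differentiableOn_cutoffCauchyIntegral hρ hs hst hq).continuousOn
  have hloc : LocallyIntegrableOn (cutoffCauchyIntegral q s t) (Metric.ball 0 ρ) :=
    hcont.locallyIntegrableOn Metric.isOpen_ball.measurableSet
  have hqloc : LocallyIntegrableOn q (Metric.ball 0 ρ) := (hq.mono_set hsub).locallyIntegrableOn
  have h2 : LocallyIntegrableOn (fun z => (2 * Real.pi : ℂ) • q z + cutoffCauchyIntegral q s t z)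
      (Metric.ball 0 ρ) := (hqloc.smul (2 * Real.pi : ℂ)).add hloc
  have key := Metric.isOpen_ball.ae_eq_zero_of_integral_contDiff_smul_eq_zero h2
    fun χ hχ hc hχρ => ?_
  · filter_upwards [key] with z hz hzρ
    have hpi : (2 * Real.pi : ℂ) ≠ 0 := by simp [Real.pi_ne_zero]
    have := hz hzρ
    rw [smul_eq_mul] at this
    field_simp
    linear_combination this
  · have hχ' : ContDiff ℝ ∞ fun z => (χ z : ℂ) := Complex.ofRealCLM.contDiff.comp hχ
    have hc' := hasCompactSupport_ofReal_comp hc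
    have hχρ' : tsupport (fun z => (χ z : ℂ)) ⊆ Metric.ball 0 ρ :=
      (closure_mono fun z hz => by simpa using hz : _ ⊆ tsupport χ).trans hχρ
    have h := integral_test_mul_eq_cutoffCauchyIntegral hρ hs hst ht hq hw hχ' hc' hχρ'
    obtain ⟨C, hC⟩ := hχ'.continuous.bounded_above_of_compact_support hc'
    have e1 : ∫ z in Metric.ball 0 1, q z * (χ z : ℂ) = ∫ z in Metric.ball 0 ρ, q z * (χ z : ℂ) :=
      setIntegral_eq_of_subset_of_forall_sdiff_eq_zero Metric.isOpen_ball.measurableSet hsub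
        fun z hz => by
          rw [image_eq_zero_of_notMem_tsupport fun h => hz.2 (hχρ h)]
          simp
    have e2 : ∫ x, (χ x : ℂ) * cutoffCauchyIntegral q s t x =
        ∫ x in Metric.ball 0 ρ, (χ x : ℂ) * cutoffCauchyIntegral q s t x :=
      (setIntegral_eq_integral_of_forall_compl_eq_zero fun z hz => by
        rw [image_eq_zero_of_notMem_tsupport fun h => hz (hχρ h)]
        simp).symm
    have i1 : IntegrableOn (fun z => q z * (χ z : ℂ)) (Metric.ball 0 ρ) :=
      Integrable.mul_bdd (hq.mono_set hsub) hχ'.continuous.aestronglyMeasurable (ae_of_all _ hC)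
    have i2 : IntegrableOn (fun x => (χ x : ℂ) * cutoffCauchyIntegral q s t x)
        (Metric.ball 0 ρ) := by
      refine IntegrableOn.of_forall_sdiff_eq_zero (s := tsupport χ)
        (((hχ'.continuous.continuousOn).mul (hcont.mono hχρ)).integrableOn_compact hc)
        Metric.isOpen_ball.measurableSet fun z hz => ?_
      rw [image_eq_zero_of_notMem_tsupport hz.2, Complex.ofReal_zero, zero_mul]
    have e3 : ∫ x, χ x • ((2 * Real.pi : ℂ) • q x + cutoffCauchyIntegral q s t x) =
        ∫ x in Metric.ball 0 ρ, χ x • ((2 * Real.pi : ℂ) • q x + cutoffCauchyIntegral q s t x) :=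
      (setIntegral_eq_integral_of_forall_compl_eq_zero fun z hz => by
        rw [image_eq_zero_of_notMem_tsupport fun h => hz (hχρ h), zero_smul]).symm
    rw [e1, e2, ← integral_const_mul, ← integral_add (i1.const_mul _) i2] at h
    refine e3.trans (Eq.trans ?_ h)
    refine integral_congr_ae (ae_of_all _ fun z => ?_)
    simp only [Complex.real_smul, smul_eq_mul]
    ring

/-- Weyl's lemma: a weakly holomorphic function on the disc is holomorphic. -/
theorem exists_holomorphic_of_integral_dbar_eq_zero (hq : IntegrableOn q (Metric.ball 0 1))
    (hw : ∀ ψ : ℂ → ℂ, ContDiff ℝ ∞ ψ → HasCompactSupport ψ →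
      tsupport ψ ⊆ Metric.ball 0 1 → ∫ z in Metric.ball 0 1, q z * dbar ψ z = 0) :
    ∃ H : ℂ → ℂ, DifferentiableOn ℂ H (Metric.ball 0 1) ∧
      ∀ᵐ z, z ∈ Metric.ball (0 : ℂ) 1 → q z = H z := by
  have hex : ∀ ρ : ℝ, ∃ h : ℂ → ℂ, 0 < ρ → ρ < 1 → DifferentiableOn ℂ h (Metric.ball 0 ρ) ∧
      ∀ᵐ z, z ∈ Metric.ball (0 : ℂ) ρ → q z = h z := fun ρ => by
    by_cases hρ : 0 < ρ ∧ ρ < 1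
    · obtain ⟨s, h1, h2⟩ := exists_between hρ.2
      obtain ⟨t, h3, h4⟩ := exists_between h2
      have hs : 0 < s := hρ.1.trans h1
      exact ⟨_, fun _ _ => ⟨(differentiableOn_cutoffCauchyIntegral h1 hs h3 hq).const_mul _,
        ae_eq_cutoffCauchyIntegral h1 hs h3 h4 hq hw⟩⟩
    · exact ⟨0, fun h1 h2 => absurd ⟨h1, h2⟩ hρ⟩
  choose h hh using hex
  have hagree : ∀ ρ ρ' : ℝ, 0 < ρ → ρ ≤ ρ' → ρ' < 1 → EqOn (h ρ) (h ρ') (Metric.ball 0 ρ) := by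
    intro ρ ρ' h0 hle h1
    obtain ⟨d1, a1⟩ := hh ρ h0 (hle.trans_lt h1)
    obtain ⟨d2, a2⟩ := hh ρ' (h0.trans_le hle) h1
    have hsub := Metric.ball_subset_ball (x := (0 : ℂ)) hle
    refine Measure.eqOn_open_of_ae_eq (μ := volume) ?_ Metric.isOpen_ball d1.continuousOn
      (d2.continuousOn.mono hsub)
    rw [EventuallyEq, ae_restrict_iff' Metric.isOpen_ball.measurableSet]
    filter_upwards [a1, a2] with z z1 z2 hz
    rw [← z1 hz, ← z2 (hsub hz)]
  -- The local representatives agree on overlaps, so any radius beyond `‖z‖` may be chosen; this one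
  -- depends continuously on `z` and stays below `1`.
  refine ⟨fun z => h ((1 + ‖z‖) / 2) z, fun z hz => ?_, ?_⟩
  · rw [mem_ball_zero_iff] at hz
    have hr0 : 0 < (3 + ‖z‖) / 4 := by positivity
    have hr1 : (3 + ‖z‖) / 4 < 1 := by linarith
    have hd := (hh _ hr0 hr1).1.differentiableAt (x := z)
      (Metric.isOpen_ball.mem_nhds (mem_ball_zero_iff.2 (by linarith)))
    refine (hd.congr_of_eventuallyEq ?_).differentiableWithinAt
    have hlt : ‖z‖ < (1 + ‖z‖) / 2 := by linarith
    filter_upwards [(isOpen_lt continuous_norm continuous_const).mem_nhds hlt] with y hy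
    have hy' : ‖y‖ < (1 + ‖z‖) / 2 := hy
    exact hagree _ _ (by positivity) (by linarith) hr1 (mem_ball_zero_iff.2 (by linarith))
  · have hall : ∀ᵐ z : ℂ, ∀ n : ℕ, z ∈ Metric.ball (0 : ℂ) (1 - 1 / ((n : ℝ) + 2)) →
        q z = h (1 - 1 / ((n : ℝ) + 2)) z := ae_all_iff.2 fun n => by
      have h2 : 1 / ((n : ℝ) + 2) < 1 := by
        rw [div_lt_one (by positivity)]
        linarith [(Nat.cast_nonneg n : (0 : ℝ) ≤ n)]
      exact (hh _ (by linarith) (by linarith [(by positivity : 0 < 1 / ((n : ℝ) + 2))])).2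
    filter_upwards [hall] with z hz hzD
    rw [mem_ball_zero_iff] at hzD
    obtain ⟨n, hn⟩ := exists_nat_one_div_lt (by linarith : 0 < (1 - ‖z‖) / 2)
    have hn2 : 1 / ((n : ℝ) + 2) ≤ 1 / ((n : ℝ) + 1) := by gcongr; norm_num
    have hpos : 0 < 1 / ((n : ℝ) + 2) := by positivity
    rw [hz n (mem_ball_zero_iff.2 (by linarith))]
    exact (hagree _ _ (by positivity) (by linarith) (by linarith)
      (mem_ball_zero_iff.2 (by linarith))).symm

end Weyl

/-! ### A Poincaré inequality on annuli -/

/-- Every point is joined to a fixed base point along its circle and then along one fixed radius, so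
both increments are integrals of the gradient. No convexity of the annulus is needed. -/
lemma exists_const_lintegral_annulus_sub_le {φ : ℂ → ℝ} {s t : ℝ} (hs : 1 / 2 ≤ s) (hst : s < t)
    (ht : t ≤ 1) (hφ : ContDiffOn ℝ ∞ φ (annulus s t)) :
    ∃ c : ℝ, ∫⁻ z in annulus s t, ‖φ z - c‖ₑ ≤
      ENNReal.ofReal (4 * Real.pi + 2) * ∫⁻ z in annulus s t, ‖fderiv ℝ φ z‖ₑ := by
  have hs0 : 0 ≤ s := by linarith
  have hfc := continuousOn_enorm_fderiv (isOpen_annulus s t) hφ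
  set f : ℝ → ℝ → ENNReal := fun θ r => ‖fderiv ℝ φ (circleMap 0 r θ)‖ₑ with hf
  set I := ∫⁻ z in annulus s t, ‖fderiv ℝ φ z‖ₑ with hI
  have hpol : ∫⁻ θ, (∫⁻ r in Ioo s t, f θ r) ∂angleMeasure ≤ 2 * I := lintegral_polar_le hs hfc
  have hvol : volume (Ioo (-Real.pi) Real.pi) = ENNReal.ofReal (2 * Real.pi) := by
    rw [Real.volume_Ioo]
    ring_nf
  have hpi : 0 < 2 * Real.pi := by positivity
  have hpi0 : ENNReal.ofReal (2 * Real.pi) ≠ 0 := by simpa using hpi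
  -- The fixed radius is one on which the gradient integral is at most its average over all angles.
  obtain ⟨θ₀, hθ₀, hle⟩ := exists_le_setLAverage (μ := volume) (s := Ioo (-Real.pi) Real.pi)
    (f := fun θ => ∫⁻ r in Ioo s t, f θ r) (by rwa [hvol])
    (by rw [hvol]; exact ENNReal.ofReal_ne_top) (measurable_lintegral_radial hs0 hfc).aemeasurable
  have hB : ENNReal.ofReal (2 * Real.pi) * ∫⁻ r in Ioo s t, f θ₀ r ≤ 2 * I := by
    rw [setLAverage_eq, hvol] at hle
    calc _ ≤ ENNReal.ofReal (2 * Real.pi) *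
          ((∫⁻ θ in Ioo (-Real.pi) Real.pi, ∫⁻ r in Ioo s t, f θ r) /
            ENNReal.ofReal (2 * Real.pi)) := mul_le_mul' le_rfl hle
      _ = ∫⁻ θ in Ioo (-Real.pi) Real.pi, ∫⁻ r in Ioo s t, f θ r :=
        ENNReal.mul_div_cancel hpi0 ENNReal.ofReal_ne_top
      _ ≤ _ := hpol
  have hr₀ : (s + t) / 2 ∈ Ioo s t := ⟨by linarith, by linarith⟩
  set c := φ (circleMap 0 ((s + t) / 2) θ₀) with hc
  have hswap : ∫⁻ r in Ioo s t, (∫⁻ θ, f θ r ∂angleMeasure) ≤ 2 * I := by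
    refine le_of_eq_of_le ?_ hpol
    have h1 : ∀ θ, ∫⁻ r in Ioo s t, f θ r = ∫⁻ r, (Ioo s t).indicator (fun r => f θ r) r :=
      fun θ => (lintegral_indicator measurableSet_Ioo _).symm
    simp only [h1]
    rw [← lintegral_indicator measurableSet_Ioo, lintegral_lintegral_swap
      (f := fun θ r => (Ioo s t).indicator (fun r => f θ r) r)
      (measurable_indicator_polar hs0 hfc).aemeasurable]
    refine lintegral_congr fun r => ?_
    by_cases hr : r ∈ Ioo s t
    · simp only [indicator_of_mem hr]
    · simp only [indicator_of_notMem hr, lintegral_zero]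
  have hpt : ∀ θ ∈ Ioo (-Real.pi) Real.pi, ∀ r ∈ Ioo s t, ‖φ (circleMap 0 r θ) - c‖ₑ ≤
      (∫⁻ τ, f τ r ∂angleMeasure) + ∫⁻ ρ in Ioo s t, f θ₀ ρ := fun θ hθ r hr => by
    rw [← sub_add_sub_cancel _ (φ (circleMap 0 r θ₀))]
    refine (enorm_add_le _ _).trans (add_le_add ?_ ?_)
    · exact enorm_sub_le_lintegral_angular hs0 ht hφ hr hθ hθ₀
    · exact enorm_sub_le_lintegral_radial hs0 hφ θ₀ hr hr₀
  refine ⟨c, ?_⟩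
  have hsub1 : volume (Ioo s t) ≤ 1 := by
    rw [Real.volume_Ioo, ← ENNReal.ofReal_one]
    exact ENNReal.ofReal_le_ofReal (by linarith)
  calc ∫⁻ z in annulus s t, ‖φ z - c‖ₑ
      ≤ ∫⁻ θ, (∫⁻ r in Ioo s t, ‖φ (circleMap 0 r θ) - c‖ₑ) ∂angleMeasure :=
        lintegral_annulus_le hs0 ht (measurable_indicator_of_continuousOn
          (isOpen_annulus s t).measurableSet (hφ.continuousOn.sub continuousOn_const).enorm)
    _ ≤ ∫⁻ _θ, (2 * I + ∫⁻ ρ in Ioo s t, f θ₀ ρ) ∂angleMeasure := by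
        refine setLIntegral_mono' measurableSet_Ioo fun θ hθ => ?_
        refine (setLIntegral_mono' measurableSet_Ioo (hpt θ hθ)).trans ?_
        rw [lintegral_add_right _ measurable_const, lintegral_const, Measure.restrict_apply_univ]
        exact add_le_add hswap (mul_le_of_le_one_right bot_le hsub1)
    _ = ENNReal.ofReal (2 * Real.pi) * (2 * I) +
          ENNReal.ofReal (2 * Real.pi) * ∫⁻ ρ in Ioo s t, f θ₀ ρ := by
        rw [lintegral_const, angleMeasure, Measure.restrict_apply_univ, hvol]
        ring
    _ ≤ ENNReal.ofReal (2 * Real.pi) * (2 * I) + 2 * I := add_le_add le_rfl hB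
    _ = _ := by
        have h4 : ENNReal.ofReal (4 * Real.pi + 2) = ENNReal.ofReal (2 * Real.pi) * 2 + 2 := by
          rw [ENNReal.ofReal_add (by positivity) (by norm_num), ENNReal.ofReal_ofNat,
            show 4 * Real.pi = 2 * Real.pi * 2 by ring, ENNReal.ofReal_mul hpi.le,
            ENNReal.ofReal_ofNat]
        rw [h4]
        ring

lemma isCompact_closedAnnulus (s t : ℝ) :
    IsCompact (Metric.closedBall (0 : ℂ) t \ Metric.ball 0 s) :=
  (isCompact_closedBall 0 t).diff Metric.isOpen_ball

lemma closedAnnulus_subset {r s t : ℝ} (hrs : r < s) (ht : t < 1) :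
    Metric.closedBall (0 : ℂ) t \ Metric.ball 0 s ⊆ annulus r 1 := fun z hz => by
  have h1 := mem_closedBall_zero_iff.1 hz.1
  have h2 : s ≤ ‖z‖ := by simpa using hz.2
  exact ⟨by linarith, by linarith⟩

lemma annulus_subset_closedAnnulus (s t : ℝ) :
    annulus s t ⊆ Metric.closedBall (0 : ℂ) t \ Metric.ball 0 s := fun z hz =>
  ⟨mem_closedBall_zero_iff.2 hz.2.le, by simpa using hz.1.le⟩

section MeanZero

variable {η : ℂ → ℝ} {r s t : ℝ}

lemma integrableOn_mul_of_annulus (hrs : r < s) (ht : t < 1)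
    (hη : ContinuousOn η (annulus r 1)) (hη0 : ∀ z, z ∉ annulus s t → η z = 0) {φ : ℂ → ℝ}
    (hφ : ContinuousOn φ (Metric.ball 0 1)) :
    IntegrableOn (fun z => φ z * η z) (Metric.ball 0 1) := by
  have hsub := closedAnnulus_subset hrs ht
  refine IntegrableOn.of_forall_sdiff_eq_zero
    (((hφ.mono (hsub.trans (annulus_subset_ball r))).mul (hη.mono hsub)).integrableOn_compact
      (isCompact_closedAnnulus s t)) Metric.isOpen_ball.measurableSet fun z hz => ?_
  rw [hη0 z fun h => hz.2 (annulus_subset_closedAnnulus s t h), mul_zero]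

/-- A density of mean zero supported in an annulus acts continuously on gradients. -/
lemma exists_bound_integral_mul_of_mean_zero (hs : 1 / 2 ≤ s) (hrs : r < s) (hst : s < t)
    (ht : t < 1) (hη : ContinuousOn η (annulus r 1)) (hη0 : ∀ z, z ∉ annulus s t → η z = 0)
    (hmean : ∫ z in Metric.ball 0 1, η z = 0) :
    ∃ C : ℝ, ∀ φ : ℂ → ℝ, IsSmoothFiniteEnergy (Metric.ball 0 1) φ →
      |∫ z in Metric.ball 0 1, φ z * η z| ≤
        C * (eLpNorm (fderiv ℝ φ) 2 (volume.restrict (Metric.ball 0 1))).toReal := by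
  have hsub := closedAnnulus_subset hrs ht
  obtain ⟨m, hm⟩ := (isCompact_closedAnnulus s t).exists_bound_of_continuousOn (hη.mono hsub)
  set C : ENNReal := ENNReal.ofReal m * (ENNReal.ofReal (4 * Real.pi + 2) *
    volume (Metric.ball (0 : ℂ) 1) ^ (1 / 2 : ℝ)) with hC
  have hCtop : C ≠ ⊤ := ENNReal.mul_ne_top ENNReal.ofReal_ne_top (ENNReal.mul_ne_top
    ENNReal.ofReal_ne_top (ENNReal.rpow_ne_top_of_nonneg (by norm_num)
      measure_ball_lt_top.ne))
  refine ⟨C.toReal, fun φ hφ => ?_⟩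
  have hann : annulus s t ⊆ Metric.ball 0 1 :=
    (annulus_mono le_rfl ht.le).trans (annulus_subset_ball s)
  obtain ⟨c, hc⟩ := exists_const_lintegral_annulus_sub_le hs hst ht.le (hφ.smooth.mono hann)
  have i1 := integrableOn_mul_of_annulus hrs ht hη hη0 hφ.smooth.continuousOn
  have i2 := integrableOn_mul_of_annulus hrs ht hη hη0 (φ := fun _ => c) continuousOn_const
  -- Since `η` has mean zero, the constant from the Poincaré inequality may be subtracted from `φ`.
  have e1 : ∫ z in Metric.ball 0 1, φ z * η z = ∫ z in annulus s t, (φ z - c) * η z := by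
    have h2 : ∫ z in Metric.ball 0 1, c * η z = 0 := by rw [integral_const_mul, hmean, mul_zero]
    rw [← sub_zero (∫ z in Metric.ball 0 1, φ z * η z), ← h2, ← integral_sub i1 i2,
      ← setIntegral_eq_of_subset_of_forall_sdiff_eq_zero Metric.isOpen_ball.measurableSet hann
        fun z hz => by rw [hη0 z hz.2, mul_zero]]
    refine integral_congr_ae (ae_of_all _ fun z => ?_)
    dsimp only
    ring
  have e2 : ‖∫ z in Metric.ball 0 1, φ z * η z‖ₑ ≤
      C * eLpNorm (fderiv ℝ φ) 2 (volume.restrict (Metric.ball 0 1)) := by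
    rw [e1]
    have hle := eLpNorm_le_eLpNorm_mul_rpow_measure_univ (p := 1) (q := 2) (by norm_num)
      hφ.finite_energy.aestronglyMeasurable
    rw [eLpNorm_one_eq_lintegral_enorm, Measure.restrict_apply_univ] at hle
    calc _ ≤ ∫⁻ z in annulus s t, ‖(φ z - c) * η z‖ₑ := enorm_integral_le_lintegral_enorm _
      _ ≤ ∫⁻ z in annulus s t, ENNReal.ofReal m * ‖φ z - c‖ₑ := by
          refine setLIntegral_mono' (isOpen_annulus s t).measurableSet fun z hz => ?_
          rw [enorm_mul, mul_comm]
          refine mul_le_mul' ?_ le_rfl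
          rw [← ofReal_norm]
          exact ENNReal.ofReal_le_ofReal (hm z (annulus_subset_closedAnnulus s t hz))
      _ = ENNReal.ofReal m * ∫⁻ z in annulus s t, ‖φ z - c‖ₑ :=
          lintegral_const_mul' _ _ ENNReal.ofReal_ne_top
      _ ≤ ENNReal.ofReal m * (ENNReal.ofReal (4 * Real.pi + 2) *
            ∫⁻ z in Metric.ball 0 1, ‖fderiv ℝ φ z‖ₑ) :=
          mul_le_mul' le_rfl (hc.trans (mul_le_mul' le_rfl (lintegral_mono_set hann)))
      _ ≤ _ := by
          rw [hC, mul_assoc, mul_assoc]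
          refine mul_le_mul' le_rfl (mul_le_mul' le_rfl (hle.trans_eq ?_))
          rw [mul_comm]
          norm_num
  have := ENNReal.toReal_mono (ENNReal.mul_ne_top hCtop hφ.finite_energy.eLpNorm_ne_top) e2
  rwa [ENNReal.toReal_mul, toReal_enorm] at this

end MeanZero

/-! ### Riesz representation on a space of gradients -/

/-- The bound makes `f` factor through `e`; it extends by density to the closed range, a Hilbert
space with its own Riesz theorem. Having the representing vector in that closure matters later,
since it makes the field weakly curl free. -/
lemma exists_inner_eq_of_bound {E H : Type*} [AddCommGroup E] [Module ℝ E]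
    [NormedAddCommGroup H] [InnerProductSpace ℝ H] [CompleteSpace H] (e : E →ₗ[ℝ] H)
    (f : E →ₗ[ℝ] ℝ) {C : ℝ} (hC : ∀ x, ‖f x‖ ≤ C * ‖e x‖) :
    ∃ G ∈ closure (range e), ∀ x, inner ℝ G (e x) = f x := by
  set K := (LinearMap.range e).topologicalClosure with hK
  have : CompleteSpace K := (Submodule.isClosed_topologicalClosure _).completeSpace_coe
  have hmem : ∀ x, e x ∈ K := fun x => Submodule.le_topologicalClosure _ ⟨x, rfl⟩
  set e' : E →ₗ[ℝ] K := e.codRestrict K hmem with he'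
  have hdense : DenseRange e' := by
    intro y
    rw [Topology.IsEmbedding.subtypeVal.closure_eq_preimage_closure_image, mem_preimage]
    have h2 : (Subtype.val '' range e' : Set H) = range e := by
      rw [← range_comp]
      rfl
    rw [h2]
    exact y.2
  set L := f.extendOfNorm e'
  refine ⟨((InnerProductSpace.toDual ℝ K).symm L : K), ?_, fun x => ?_⟩
  · exact ((InnerProductSpace.toDual ℝ K).symm L).2
  · rw [← LinearMap.extendOfNorm_eq hdense ⟨C, hC⟩ x]
    exact InnerProductSpace.toDual_symm_apply (x := e' x) (y := L)

/-! ### Weak solutions of the Neumann problem on the disc -/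

/-- The gradient of a real function, as a complex number. -/
noncomputable def complexGrad (φ : ℂ → ℝ) (z : ℂ) : ℂ := ⟨partialX φ z, partialY φ z⟩

/-- The derivative of `φ` along the vector field `V`. -/
noncomputable def fieldDot (V : ℂ → ℂ) (φ : ℂ → ℝ) (z : ℂ) : ℝ :=
  (V z).re * partialX φ z + (V z).im * partialY φ z

lemma real_inner_complex (w z : ℂ) : inner ℝ w z = w.re * z.re + w.im * z.im := by
  simp [Complex.inner]
  ring

lemma fieldDot_mul {V : ℂ → ℂ} {χ φ : ℂ → ℝ} {z : ℂ} (hχ : DifferentiableAt ℝ χ z)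
    (hφ : DifferentiableAt ℝ φ z) :
    fieldDot V (fun y => χ y * φ y) z = χ z * fieldDot V φ z + φ z * fieldDot V χ z := by
  simp only [fieldDot, partialX, partialY, fderiv_fun_mul hχ hφ, add_apply, smul_apply,
    smul_eq_mul]
  ring

lemma norm_complexGrad_le (φ : ℂ → ℝ) (z : ℂ) : ‖complexGrad φ z‖ ≤ 2 * ‖fderiv ℝ φ z‖ := by
  refine (Complex.norm_le_abs_re_add_abs_im _).trans ?_
  rw [two_mul]
  exact add_le_add (norm_partialX_le φ z) (norm_partialY_le φ z)

lemma norm_fderiv_le_complexGrad (φ : ℂ → ℝ) (z : ℂ) :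
    ‖fderiv ℝ φ z‖ ≤ 2 * ‖complexGrad φ z‖ := by
  refine (norm_fderiv_le_add φ z).trans ?_
  rw [two_mul]
  exact add_le_add (Complex.abs_re_le_norm (complexGrad φ z))
    (Complex.abs_im_le_norm (complexGrad φ z))

lemma continuousOn_complexGrad {U : Set ℂ} (hU : IsOpen U) {φ : ℂ → ℝ} (hφ : ContDiffOn ℝ ∞ φ U) :
    ContinuousOn (complexGrad φ) U :=
  (Complex.equivRealProdCLM.symm.continuous.comp_continuousOn
    ((partialX_contDiffOn hU hφ).continuousOn.prodMk (partialY_contDiffOn hU hφ).continuousOn)).congr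
    fun z _ => by apply Complex.ext <;> simp [complexGrad]

lemma memLp_complexGrad {U : Set ℂ} (hU : IsOpen U) {φ : ℂ → ℝ} (hφ : IsSmoothFiniteEnergy U φ) :
    MemLp (complexGrad φ) 2 (volume.restrict U) :=
  hφ.finite_energy.of_le_mul
    ((continuousOn_complexGrad hU hφ.smooth).aestronglyMeasurable hU.measurableSet)
    (ae_of_all _ (norm_complexGrad_le φ))

/-- Smooth functions of finite energy on the disc. -/
def finiteEnergySpace : Submodule ℝ (ℂ → ℝ) where
  carrier := {φ | IsSmoothFiniteEnergy (Metric.ball 0 1) φ}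
  add_mem' h h' := h.add Metric.isOpen_ball h'
  zero_mem' := IsSmoothFiniteEnergy.const 0
  smul_mem' c _ h := h.const_smul Metric.isOpen_ball c

/-- Square integrable fields on the disc. -/
abbrev DiscField : Type := Lp ℂ 2 (volume.restrict (Metric.ball (0 : ℂ) 1))

/-- The gradient, as a square integrable field. -/
noncomputable def gradLp : finiteEnergySpace →ₗ[ℝ] DiscField where
  toFun φ := (memLp_complexGrad Metric.isOpen_ball φ.2).toLp
  map_add' φ ψ := by
    rw [← MemLp.toLp_add]
    refine MemLp.toLp_congr _ _ (ae_restrict_of_forall_mem Metric.isOpen_ball.measurableSet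
      fun z hz => ?_)
    have h := fderiv_add (φ.2.differentiableAt Metric.isOpen_ball hz)
      (ψ.2.differentiableAt Metric.isOpen_ball hz)
    apply Complex.ext <;> simp [complexGrad, partialX, partialY, h]
  map_smul' c φ := by
    rw [RingHom.id_apply, ← MemLp.toLp_const_smul]
    refine MemLp.toLp_congr _ _ (ae_restrict_of_forall_mem Metric.isOpen_ball.measurableSet
      fun z hz => ?_)
    have h := fderiv_const_smul (φ.2.differentiableAt Metric.isOpen_ball hz) c
    apply Complex.ext <;> simp [complexGrad, partialX, partialY, h]

lemma integrable_fieldDot {V : ℂ → ℂ} {φ : ℂ → ℝ}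
    (hV : MemLp V 2 (volume.restrict (Metric.ball 0 1)))
    (hφ : IsSmoothFiniteEnergy (Metric.ball 0 1) φ) :
    IntegrableOn (fieldDot V φ) (Metric.ball 0 1) := by
  refine (L2.integrable_inner (𝕜 := ℝ) hV.toLp (gradLp ⟨φ, hφ⟩)).congr ?_
  filter_upwards [hV.coeFn_toLp, (memLp_complexGrad Metric.isOpen_ball hφ).coeFn_toLp] with z h1 h2
  rw [h1]
  refine Eq.trans (congrArg _ h2) ?_
  rw [real_inner_complex]
  rfl

lemma inner_toLp_gradLp {V : ℂ → ℂ} {φ : ℂ → ℝ}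
    (hV : MemLp V 2 (volume.restrict (Metric.ball 0 1)))
    (hφ : IsSmoothFiniteEnergy (Metric.ball 0 1) φ) :
    inner ℝ hV.toLp (gradLp ⟨φ, hφ⟩) = ∫ z in Metric.ball 0 1, fieldDot V φ z := by
  rw [L2.inner_def]
  refine integral_congr_ae ?_
  filter_upwards [hV.coeFn_toLp, (memLp_complexGrad Metric.isOpen_ball hφ).coeFn_toLp] with z h1 h2
  rw [h1]
  refine Eq.trans (congrArg _ h2) ?_
  rw [real_inner_complex]
  rfl

lemma inner_gradLp_eq_integral_fieldDot (G : DiscField) {φ : ℂ → ℝ}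
    (hφ : IsSmoothFiniteEnergy (Metric.ball 0 1) φ) :
    inner ℝ G (gradLp ⟨φ, hφ⟩) = ∫ z in Metric.ball 0 1, fieldDot G φ z := by
  rw [← inner_toLp_gradLp (Lp.memLp G) hφ, Lp.toLp_coeFn]

lemma isSmoothFiniteEnergy_test {φ : ℂ → ℝ} (hφ : ContDiff ℝ ∞ φ) (hc : HasCompactSupport φ) :
    IsSmoothFiniteEnergy (Metric.ball 0 1) φ := by
  obtain ⟨C, hC⟩ := (hφ.continuous_fderiv (by simp)).bounded_above_of_compact_support (hc.fderiv ℝ)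
  exact isSmoothFiniteEnergy_of_bounded Metric.isOpen_ball Metric.isBounded_ball hφ.contDiffOn
    fun z _ => hC z

/-- Being weakly curl free is a closed condition in `L²`, and gradients satisfy it. -/
lemma integral_fieldDot_rot_eq_zero {G : DiscField} (hG : G ∈ closure (range gradLp)) {ψ : ℂ → ℝ}
    (hψ : ContDiff ℝ ∞ ψ) (hc : HasCompactSupport ψ) (hψD : tsupport ψ ⊆ Metric.ball 0 1) :
    ∫ z in Metric.ball 0 1, fieldDot (fun z => Complex.I * G z) ψ z = 0 := by
  have hE := isSmoothFiniteEnergy_test hψ hc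
  have hm := memLp_complexGrad Metric.isOpen_ball hE
  have hrot : MemLp (fun z => -Complex.I * complexGrad ψ z) 2
      (volume.restrict (Metric.ball 0 1)) := hm.const_mul _
  have key : ∀ F : DiscField, inner ℝ F hrot.toLp =
      ∫ z in Metric.ball 0 1, fieldDot (fun z => Complex.I * F z) ψ z := fun F => by
    rw [L2.inner_def]
    refine integral_congr_ae ?_
    filter_upwards [hrot.coeFn_toLp] with z h1
    rw [h1, real_inner_complex]
    simp [fieldDot, complexGrad]
    ring
  have hclosed : IsClosed {F : DiscField | inner ℝ F hrot.toLp = 0} :=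
    isClosed_eq (by fun_prop) continuous_const
  rw [← key]
  refine closure_minimal ?_ hclosed hG
  rintro _ ⟨φ, rfl⟩
  change inner ℝ (gradLp φ) hrot.toLp = 0
  have h0 : ∫ z, gradWedge ψ φ z = 0 :=
    integral_rot_gradient_eq_zero Metric.isOpen_ball hψ hc hψD φ.2.smooth
  rw [← setIntegral_eq_integral_of_tsupport hψD fun z hz => gradWedge_eq_zero_of_eventually hz,
    ← neg_eq_zero, ← integral_neg] at h0
  rw [key]
  refine Eq.trans (integral_congr_ae ?_) h0
  filter_upwards [(memLp_complexGrad Metric.isOpen_ball φ.2).coeFn_toLp] with z h1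
  have h2 : gradLp φ z = complexGrad φ z := h1
  simp [fieldDot, h2, complexGrad, gradWedge]
  ring

/-- Fields in the closure of gradients which are weakly divergence free are gradients of smooth
functions. -/
lemma exists_potential {G : DiscField} (hG : G ∈ closure (range gradLp))
    (hdiv : ∀ ψ : ℂ → ℝ, ContDiff ℝ ∞ ψ → HasCompactSupport ψ → tsupport ψ ⊆ Metric.ball 0 1 →
      ∫ z in Metric.ball 0 1, fieldDot G ψ z = 0) :
    ∃ S : ℂ → ℝ, IsSmoothFiniteEnergy (Metric.ball 0 1) S ∧
      ∀ φ : ℂ → ℝ, ∫ z in Metric.ball 0 1, gradDot S φ z =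
        ∫ z in Metric.ball 0 1, fieldDot G φ z := by
  have hDo : IsOpen (Metric.ball (0 : ℂ) 1) := Metric.isOpen_ball
  have : IsFiniteMeasure (volume.restrict (Metric.ball (0 : ℂ) 1)) :=
    ⟨by simp⟩
  have hGm := Lp.memLp G
  have hIm : MemLp (fun z => Complex.I * G z) 2 (volume.restrict (Metric.ball 0 1)) :=
    hGm.const_mul _
  have hGi : IntegrableOn (fun z => (starRingEnd ℂ) (G z)) (Metric.ball 0 1) :=
    (Complex.conjCLE : ℂ →L[ℝ] ℂ).integrable_comp (hGm.integrable (by norm_num))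
  -- Vanishing curl and divergence are the weak Cauchy–Riemann equations for the conjugate of `G`.
  -- They are checked on the real and imaginary parts of a complex test function.
  obtain ⟨H, hH, hqH⟩ := exists_holomorphic_of_integral_dbar_eq_zero hGi fun ψ hψ hc hψD => by
    set a : ℂ → ℝ := fun z => (ψ z).re with ha
    set b : ℂ → ℝ := fun z => (ψ z).im with hb
    have has : ContDiff ℝ ∞ a := Complex.reCLM.contDiff.comp hψ
    have hbs : ContDiff ℝ ∞ b := Complex.imCLM.contDiff.comp hψ
    have hac : HasCompactSupport a := hc.comp_left (g := Complex.re) Complex.zero_re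
    have hbc : HasCompactSupport b := hc.comp_left (g := Complex.im) Complex.zero_im
    have haD : tsupport a ⊆ Metric.ball 0 1 :=
      (tsupport_comp_subset Complex.zero_re ψ).trans hψD
    have hbD : tsupport b ⊆ Metric.ball 0 1 :=
      (tsupport_comp_subset Complex.zero_im ψ).trans hψD
    have ea := isSmoothFiniteEnergy_test has hac
    have eb := isSmoothFiniteEnergy_test hbs hbc
    have i1 := integrable_fieldDot hGm ea
    have i2 := integrable_fieldDot hIm eb
    have i3 := integrable_fieldDot hIm ea
    have i4 := integrable_fieldDot hGm eb
    have hpt : ∀ z, (starRingEnd ℂ) (G z) * dbar ψ z =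
        ((fieldDot G a z - fieldDot (fun z => Complex.I * G z) b z : ℝ) : ℂ) +
          ((fieldDot (fun z => Complex.I * G z) a z + fieldDot G b z : ℝ) : ℂ) * Complex.I :=
      fun z => by
        have hd : DifferentiableAt ℝ ψ z := hψ.differentiable (by simp) z
        have hfb : ∀ c, fderiv ℝ b z c = (fderiv ℝ ψ z c).im := fderiv_im_comp hd
        have hfa : ∀ c, fderiv ℝ a z c = (fderiv ℝ ψ z c).re := fun c =>
          congrArg (fun L => L c) (Complex.reCLM.hasFDerivAt.comp z hd.hasFDerivAt).fderiv
        apply Complex.ext <;> simp [dbar, fieldDot, partialX, partialY, hfa, hfb] <;> ring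
    simp only [hpt]
    have j1 : IntegrableOn (fun z => ((fieldDot G a z - fieldDot (fun z => Complex.I * G z) b z : ℝ)
      : ℂ)) (Metric.ball 0 1) := (i1.sub i2).ofReal
    have j2 : IntegrableOn (fun z => ((fieldDot (fun z => Complex.I * G z) a z + fieldDot G b z : ℝ)
      : ℂ)) (Metric.ball 0 1) := (i3.add i4).ofReal
    rw [integral_add j1 (j2.mul_const _), integral_mul_const, integral_complex_ofReal,
      integral_complex_ofReal, integral_sub i1 i2, integral_add i3 i4, hdiv a has hac haD, hdiv b hbs hbc hbD,
      integral_fieldDot_rot_eq_zero hG has hac haD, integral_fieldDot_rot_eq_zero hG hbs hbc hbD]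
    simp
  -- A primitive of `H` exists on the disc, and the gradient of its real part is the conjugate of
  -- `H`, that is `G` almost everywhere.
  obtain ⟨P, hP⟩ := hH.isExactOn_ball
  have hPd : DifferentiableOn ℂ P (Metric.ball 0 1) := fun z hz =>
    (hP z hz).differentiableAt.differentiableWithinAt
  have hPs : ContDiffOn ℝ ∞ P (Metric.ball 0 1) := (hPd.contDiffOn hDo).restrict_scalars ℝ
  have hSs : ContDiffOn ℝ ∞ (fun z => (P z).re) (Metric.ball 0 1) :=
    Complex.reCLM.contDiff.comp_contDiffOn hPs
  have hfS : ∀ z ∈ Metric.ball (0 : ℂ) 1, ∀ c, fderiv ℝ (fun z => (P z).re) z c = (c * H z).re :=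
    fun z hz c => by
      have h1 := Complex.reCLM.hasFDerivAt.comp z ((hP z hz).hasFDerivAt.restrictScalars ℝ)
      refine (congrArg (fun L => L c) h1.fderiv).trans ?_
      simp
  have hGH : ∀ᵐ z ∂(volume.restrict (Metric.ball (0 : ℂ) 1)), (starRingEnd ℂ) (G z) = H z :=
    (ae_restrict_iff' hDo.measurableSet).2 hqH
  refine ⟨fun z => (P z).re, ⟨hSs, ?_⟩, fun φ => ?_⟩
  · refine MemLp.of_le hGm
      ((hSs.continuousOn_fderiv_of_isOpen hDo (by simp)).aestronglyMeasurable hDo.measurableSet) ?_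
    filter_upwards [hGH, ae_restrict_mem hDo.measurableSet] with z hz hzD
    refine ContinuousLinearMap.opNorm_le_bound _ (norm_nonneg _) fun c => ?_
    rw [hfS z hzD, ← RCLike.norm_conj (G z), hz, mul_comm, ← norm_mul, mul_comm]
    exact Complex.abs_re_le_norm _
  · refine integral_congr_ae ?_
    filter_upwards [hGH, ae_restrict_mem hDo.measurableSet] with z hz hzD
    have h1 : (G z).re = (H z).re := by rw [← hz, Complex.conj_re]
    have h2 : (G z).im = -(H z).im := by rw [← hz, Complex.conj_im, neg_neg]
    simp only [gradDot, fieldDot]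
    rw [partialX, partialY, hfS z hzD, hfS z hzD, h1, h2]
    simp

/-- Weak solutions exist when the flux vanishes. -/
theorem exists_weak_solution {V : ℂ → ℂ} {r s t : ℝ} (hs : 1 / 2 ≤ s) (hrs : r < s) (hst : s < t)
    (ht : t < 1) (hVc : ContinuousOn V (annulus r 1))
    (hV : MemLp V 2 (volume.restrict (annulus r 1)))
    (hflux : ∫ z in Metric.ball 0 1, fieldDot V (radialCutoff s t) z = 0)
    (htest : ∀ ψ : ℂ → ℝ, ContDiff ℝ ∞ ψ → HasCompactSupport ψ → tsupport ψ ⊆ Metric.ball 0 1 →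
      ∫ z in Metric.ball 0 1, fieldDot V (fun z => radialCutoff s t z * ψ z) z = 0) :
    ∃ S : ℂ → ℝ, IsSmoothFiniteEnergy (Metric.ball 0 1) S ∧
      ∀ φ : ℂ → ℝ, IsSmoothFiniteEnergy (Metric.ball 0 1) φ →
        ∫ z in Metric.ball 0 1, gradDot S φ z =
          ∫ z in Metric.ball 0 1, fieldDot V (fun z => radialCutoff s t z * φ z) z := by
  have hs0 : 0 < s := by linarith
  have hDo : IsOpen (Metric.ball (0 : ℂ) 1) := Metric.isOpen_ball
  have hAm : MeasurableSet (annulus r 1) := (isOpen_annulus r 1).measurableSet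
  set ζ := radialCutoff s t with hζ
  have hζs : ContDiff ℝ ∞ ζ := contDiff_radialCutoff s t
  have hζ0 : ∀ z, z ∉ annulus s t → fderiv ℝ ζ z = 0 := fun z hz =>
    fderiv_radialCutoff_eq_zero hs0 hst (by
      by_contra! h
      exact hz h)
  -- The tested flux splits by the product rule. The part `ζ V · ∇φ` is an `L²` pairing with `Y`;
  -- the part `φ V · ∇ζ` is integration against a density of mean zero, bounded by the gradient
  -- through the Poincaré inequality.
  set Y : ℂ → ℂ := (annulus r 1).indicator fun z => (ζ z : ℂ) * V z with hY
  have hYm : MemLp Y 2 (volume.restrict (Metric.ball 0 1)) := by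
    rw [hY, memLp_indicator_iff_restrict hAm, Measure.restrict_restrict hAm,
      inter_eq_left.2 (annulus_subset_ball r)]
    refine hV.of_le ((Complex.continuous_ofReal.comp hζs.continuous).aestronglyMeasurable.mul
      hV.aestronglyMeasurable) (ae_of_all _ fun z => ?_)
    rw [norm_mul, Complex.norm_real, Real.norm_of_nonneg (radialCutoff_nonneg s t z)]
    exact mul_le_of_le_one_left (norm_nonneg _) (radialCutoff_le_one s t z)
  have hη : ContinuousOn (fieldDot V ζ) (annulus r 1) :=
    ((Complex.continuous_re.comp_continuousOn hVc).mul
      ((partialX_contDiffOn isOpen_univ hζs.contDiffOn).continuousOn.mono (subset_univ _))).add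
      ((Complex.continuous_im.comp_continuousOn hVc).mul
      ((partialY_contDiffOn isOpen_univ hζs.contDiffOn).continuousOn.mono (subset_univ _)))
  have hη0 : ∀ z, z ∉ annulus s t → fieldDot V ζ z = 0 := fun z hz => by
    simp [fieldDot, partialX, partialY, hζ0 z hz]
  obtain ⟨C, hC⟩ := exists_bound_integral_mul_of_mean_zero hs hrs hst ht hη hη0 hflux
  have hi : ∀ φ : finiteEnergySpace, IntegrableOn (fun z => (φ : ℂ → ℝ) z * fieldDot V ζ z)
      (Metric.ball 0 1) := fun φ =>
    integrableOn_mul_of_annulus hrs ht hη hη0 φ.2.smooth.continuousOn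
  let f : finiteEnergySpace →ₗ[ℝ] ℝ :=
    { toFun := fun φ => inner ℝ hYm.toLp (gradLp φ) +
        ∫ z in Metric.ball 0 1, (φ : ℂ → ℝ) z * fieldDot V ζ z
      map_add' := fun φ ψ => by
        simp only [map_add, inner_add_right, Submodule.coe_add, Pi.add_apply, add_mul]
        rw [integral_add (hi φ) (hi ψ)]
        ring
      map_smul' := fun c φ => by
        simp only [map_smul, inner_smul_right, Submodule.coe_smul, Pi.smul_apply, smul_eq_mul,
          mul_assoc, integral_const_mul, RingHom.id_apply, mul_add] }
  have hf : ∀ φ : ℂ → ℝ, ∀ hφ : IsSmoothFiniteEnergy (Metric.ball 0 1) φ,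
      f ⟨φ, hφ⟩ = ∫ z in Metric.ball 0 1, fieldDot V (fun z => ζ z * φ z) z := fun φ hφ => by
    change inner ℝ hYm.toLp (gradLp ⟨φ, hφ⟩) + ∫ z in Metric.ball 0 1, φ z * fieldDot V ζ z = _
    rw [inner_toLp_gradLp hYm hφ, ← integral_add (integrable_fieldDot hYm hφ) (hi ⟨φ, hφ⟩)]
    refine setIntegral_congr_fun hDo.measurableSet fun z hz => ?_
    dsimp only
    rw [fieldDot_mul (hζs.differentiable (by simp) z) (hφ.differentiableAt hDo hz)]
    congr 1
    by_cases hzA : z ∈ annulus r 1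
    · simp only [fieldDot, hY, indicator_of_mem hzA, Complex.re_ofReal_mul, Complex.im_ofReal_mul]
      ring
    · have hzr : ‖z‖ ≤ s := by
        by_contra! h
        exact hzA ⟨hrs.trans h, mem_ball_zero_iff.1 hz⟩
      rw [hζ, radialCutoff_eq_zero hs0 hst hzr]
      simp [fieldDot, hY, indicator_of_notMem hzA]
  have hbound : ∀ φ : finiteEnergySpace, ‖f φ‖ ≤ (‖hYm.toLp‖ + max C 0 * 2) * ‖gradLp φ‖ := by
    intro φ
    have h1 : (eLpNorm (fderiv ℝ (φ : ℂ → ℝ)) 2 (volume.restrict (Metric.ball 0 1))).toReal ≤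
        2 * ‖gradLp φ‖ := by
      have h2 := eLpNorm_le_mul_eLpNorm_of_ae_le_mul (μ := volume.restrict (Metric.ball (0 : ℂ) 1))
        (ae_of_all _ (norm_fderiv_le_complexGrad (φ : ℂ → ℝ))) 2
      have h3 := memLp_complexGrad hDo φ.2
      have h4 := ENNReal.toReal_mono (ENNReal.mul_ne_top ENNReal.ofReal_ne_top
        h3.eLpNorm_ne_top) h2
      rw [ENNReal.toReal_mul, ENNReal.toReal_ofReal (by norm_num)] at h4
      exact h4.trans_eq (congrArg _ (Lp.norm_toLp _ h3).symm)
    calc ‖f φ‖ ≤ ‖inner ℝ hYm.toLp (gradLp φ)‖ +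
          ‖∫ z in Metric.ball 0 1, (φ : ℂ → ℝ) z * fieldDot V ζ z‖ := norm_add_le _ _
      _ ≤ ‖hYm.toLp‖ * ‖gradLp φ‖ + max C 0 * (2 * ‖gradLp φ‖) := by
          refine add_le_add (norm_inner_le_norm _ _) ((hC _ φ.2).trans ?_)
          refine mul_le_mul (le_max_left _ _) h1 ENNReal.toReal_nonneg (le_max_right _ _)
      _ = _ := by ring
  obtain ⟨G, hG, hGf⟩ := exists_inner_eq_of_bound gradLp f hbound
  obtain ⟨S, hS, hSG⟩ := exists_potential hG fun ψ hψ hc hψD => by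
    rw [← inner_gradLp_eq_integral_fieldDot G (isSmoothFiniteEnergy_test hψ hc), hGf, hf]
    exact htest ψ hψ hc hψD
  refine ⟨S, hS, fun φ hφ => ?_⟩
  rw [hSG, ← inner_gradLp_eq_integral_fieldDot G hφ, hGf, hf]

/-! ### Existence for the Neumann problem on the disc -/

lemma hasTrace_self {E : Type*} [NormedAddCommGroup E] {U : Set ℂ} {u : ℂ → E}
    (hu : ∀ x ∈ frontier U, ContinuousAt u x) : HasTrace U u u := by
  refine ae_restrict_of_forall_mem measurableSet_frontier' fun x hx => ?_
  refine ENNReal.tendsto_nhds_zero.2 fun ε hε => ?_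
  have h1 : Tendsto (fun y => ‖u y - u x‖ₑ) (𝓝 x) (𝓝 0) := by
    have : Tendsto (fun y => u y - u x) (𝓝 x) (𝓝 0) := by
      simpa using (hu x hx).tendsto.sub_const (u x)
    simpa using this.enorm
  obtain ⟨δ, hδ, hball⟩ := Metric.mem_nhds_iff.1 (ENNReal.tendsto_nhds_zero.1 h1 ε hε)
  filter_upwards [nhdsWithin_le_nhds (Iio_mem_nhds hδ)] with r hr
  rw [setLAverage_eq]
  refine ENNReal.div_le_of_le_mul ?_
  rw [← setLIntegral_const]
  exact lintegral_mono_ae (ae_restrict_of_ae_restrict_of_subset inter_subset_left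
    (ae_restrict_of_forall_mem Metric.isOpen_ball.measurableSet fun y hy =>
      hball (Metric.ball_subset_ball hr.le hy)))

section

variable {k : ℕ} (d : Fin k → ℤ) (α : Fin k → ℂ) (v : ℂ → ℂ)

/-- The field whose tested flux through the boundary is `v ∧ ∂v/∂τ` minus the flux of the
logarithmic potentials. -/
noncomputable def neumannField (z : ℂ) : ℂ :=
  (⟨wedge (v z) (partialY v z), -wedge (v z) (partialX v z)⟩ : ℂ) -
    ∑ j, (d j : ℝ) • complexGrad (fun y => Real.log ‖y - α j‖) z

lemma fieldDot_neumannField (φ : ℂ → ℝ) (z : ℂ) :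
    fieldDot (neumannField d α v) φ z =
      curlDot φ v z - ∑ j, (d j : ℝ) * gradDot (fun y => Real.log ‖y - α j‖) φ z := by
  simp only [fieldDot, neumannField, curlDot, gradDot, complexGrad, Complex.sub_re, Complex.sub_im,
    Complex.re_sum, Complex.im_sum, Complex.smul_re, Complex.smul_im, smul_eq_mul, mul_add,
    Finset.sum_add_distrib, sub_mul, Finset.sum_mul]
  simp only [mul_assoc]
  ring

variable {d α v} {r s t : ℝ} {g : ℂ → ℂ} {K : Set ℂ} {φ : ℂ → ℝ}

lemma annulus_subset_sdiff {M : Set ℂ} (hM : M ⊆ Metric.closedBall 0 r) :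
    annulus r 1 ⊆ Metric.ball 0 1 \ M :=
  fun _ hz => ⟨annulus_subset_ball r hz, fun h =>
    absurd (mem_closedBall_zero_iff.1 (hM h)) (not_le.2 hz.1)⟩

lemma isSmoothFiniteEnergy_log_annulus {a : ℂ} (ha : a ∈ Metric.ball (0 : ℂ) r) :
    IsSmoothFiniteEnergy (annulus r 1) (fun z => Real.log ‖z - a‖) :=
  (isSmoothFiniteEnergy_log_sub Metric.isOpen_ball Metric.isBounded_ball Metric.isClosed_closedBall
    (mem_of_superset (Metric.isOpen_ball.mem_nhds ha) Metric.ball_subset_closedBall)).mono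
    (annulus_subset_sdiff subset_rfl)

lemma continuousOn_neumannField (hα : ∀ j, α j ∈ Metric.ball (0 : ℂ) r)
    (hv : ContDiffOn ℝ ∞ v (annulus r 1)) :
    ContinuousOn (neumannField d α v) (annulus r 1) := by
  have hA := isOpen_annulus r 1
  have h1 := (contDiffOn_wedge hv (partialY_contDiffOn hA hv)).continuousOn
  have h2 := (contDiffOn_wedge hv (partialX_contDiffOn hA hv)).continuousOn
  refine ContinuousOn.sub ((Complex.equivRealProdCLM.symm.continuous.comp_continuousOn
    (h1.prodMk h2.neg)).congr fun z _ => by apply Complex.ext <;> simp) ?_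
  exact continuousOn_finsetSum _ fun j _ => (continuousOn_complexGrad hA
    (isSmoothFiniteEnergy_log_annulus (hα j)).smooth).fun_const_smul (d j : ℝ)

lemma memLp_neumannField (hα : ∀ j, α j ∈ Metric.ball (0 : ℂ) r)
    (hv : IsSmoothFiniteEnergy (annulus r 1) v) (h1 : ∀ z ∈ annulus r 1, ‖v z‖ = 1) :
    MemLp (neumannField d α v) 2 (volume.restrict (annulus r 1)) := by
  have hA := isOpen_annulus r 1
  have hsum : MemLp (fun z => ∑ j, (d j : ℝ) • complexGrad (fun y => Real.log ‖y - α j‖) z) 2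
      (volume.restrict (annulus r 1)) :=
    memLp_finsetSum _ fun j _ =>
      (memLp_complexGrad hA (isSmoothFiniteEnergy_log_annulus (hα j))).const_smul (d j : ℝ)
  have hm := (continuousOn_neumannField (d := d) hα hv.smooth).aestronglyMeasurable
    (μ := volume) hA.measurableSet
  have hfirst : MemLp (fun z => neumannField d α v z +
      ∑ j, (d j : ℝ) • complexGrad (fun y => Real.log ‖y - α j‖) z) 2
      (volume.restrict (annulus r 1)) := by
    refine hv.finite_energy.of_le_mul (c := 2) (hm.add hsum.1)
      (ae_restrict_of_forall_mem hA.measurableSet fun z hz => ?_)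
    rw [neumannField, sub_add_cancel]
    refine (Complex.norm_le_abs_re_add_abs_im _).trans ?_
    rw [two_mul]
    dsimp only
    rw [abs_neg]
    refine add_le_add ((abs_wedge_le _ _).trans ?_) ((abs_wedge_le _ _).trans ?_)
    · rw [h1 z hz, one_mul]
      exact norm_partialY_le v z
    · rw [h1 z hz, one_mul]
      exact norm_partialX_le v z
  refine (hfirst.sub hsum).congr_norm hm (ae_of_all _ fun z => ?_)
  simp

lemma integral_fieldDot_neumannField (hv : IsCircleExtension (Metric.ball 0 1) g K v)
    (hKs : K ⊆ Metric.ball 0 s) (hα : ∀ j, α j ∈ Metric.ball (0 : ℂ) s) (hs : 0 < s) (hst : s < t)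
    (ht : t < 1) (hφ : IsSmoothFiniteEnergy (Metric.ball 0 1) φ) :
    ∫ z in Metric.ball 0 1, fieldDot (neumannField d α v) (fun z => radialCutoff s t z * φ z) z =
      (∫ z in Metric.ball 0 1, curlDot (fun z => radialCutoff s t z * φ z) v z) -
        ∑ j, (d j : ℝ) * ∫ z in Metric.ball 0 1, gradDot (fun y => Real.log ‖y - α j‖)
          (fun z => radialCutoff s t z * φ z) z := by
  have hi : ∀ j ∈ Finset.univ, Integrable (fun z => (d j : ℝ) *
      gradDot (fun y => Real.log ‖y - α j‖) (fun z => radialCutoff s t z * φ z) z)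
      (volume.restrict (Metric.ball 0 1)) := fun j _ =>
    (integrableOn_gradDot_log_cutoff (mem_ball_zero_iff.1 (hα j)) hst ht hφ).const_mul _
  have hc : IsSmoothFiniteEnergy (Metric.ball 0 1) (fun z => radialCutoff s t z * φ z) :=
    isSmoothFiniteEnergy_cutoff isCompact_empty (empty_subset _) (hφ.mono sdiff_subset) hs hst ht
  simp only [fieldDot_neumannField]
  rw [integral_sub (integrableOn_curlDot Metric.isOpen_ball hv.isCompact hc hv.energy hv.norm_eq_one
    fun _ hz => cutoff_eventually_eq_zero φ hs hst (hKs hz)) (integrable_finsetSum _ hi),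
    integral_finsetSum _ hi]
  simp only [integral_const_mul]

end

section

variable {k : ℕ} {d : Fin k → ℤ} {α : Fin k → ℂ} {g : ℂ → ℂ}

/-- A regular part satisfying the two equations of the Neumann problem, without normalization. -/
lemma exists_neumann_weak_solution (hα : ∀ j, α j ∈ Metric.ball (0 : ℂ) 1)
    (hg : HasBoundaryDegree (Metric.ball 0 1) g (∑ j, d j)) :
    ∃ S : ℂ → ℝ, IsSmoothFiniteEnergy (Metric.ball 0 1) S ∧
      ∀ φ : ℂ → ℝ, IsSmoothFiniteEnergy (Metric.ball 0 1) φ →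
        IsAngularPairing (Metric.ball 0 1) g φ
          ((∫ z in Metric.ball 0 1, gradDot (withLogs d α S) φ z) +
            2 * Real.pi * ∑ j, (d j : ℝ) * φ (α j)) := by
  have hDo : IsOpen (Metric.ball (0 : ℂ) 1) := Metric.isOpen_ball
  -- The degree hypothesis carries a circle valued extension of `g`, which serves for all brackets
  -- below.
  obtain ⟨K, -, v, -, hv, -⟩ := id hg
  obtain ⟨ρ, hρ0, hρ1, hKρ⟩ := exists_subset_ball_of_isCompact
    (hv.isCompact.union (finite_range α).isCompact)
    (union_subset hv.subset (range_subset_iff.2 hα))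
  obtain ⟨hKρ, hαρ⟩ := union_subset_iff.1 hKρ
  obtain ⟨s, hρs, hs1⟩ := exists_between (max_lt hρ1 (by norm_num : (1 / 2 : ℝ) < 1))
  obtain ⟨t, hst, ht⟩ := exists_between hs1
  obtain ⟨hρs, hs2⟩ := max_lt_iff.1 hρs
  have hs0 : 0 < s := by linarith
  have hαρ' : ∀ j, α j ∈ Metric.ball (0 : ℂ) ρ := fun j => hαρ ⟨j, rfl⟩
  have hαs : ∀ j, α j ∈ Metric.ball (0 : ℂ) s := fun j =>
    Metric.ball_subset_ball hρs.le (hαρ' j)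
  have hKs : K ⊆ Metric.ball 0 s := hKρ.trans (Metric.ball_subset_ball hρs.le)
  have hsub : annulus ρ 1 ⊆ Metric.ball 0 1 \ K :=
    annulus_subset_sdiff (hKρ.trans Metric.ball_subset_closedBall)
  have hlog : ∀ φ : ℂ → ℝ, IsSmoothFiniteEnergy (Metric.ball 0 1) φ → ∀ j,
      ∫ z in Metric.ball 0 1, gradDot (fun y => Real.log ‖y - α j‖)
        (fun z => radialCutoff s t z * φ z) z =
      (∫ z in Metric.ball 0 1, gradDot (fun y => Real.log ‖y - α j‖) φ z) +
        2 * Real.pi * φ (α j) := fun φ hφ j => by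
    rw [integral_gradDot_log_eq_cutoff (mem_ball_zero_iff.1 (hαs j)) hst ht hφ, sub_add_cancel]
  have hpair : ∀ φ : ℂ → ℝ, IsSmoothFiniteEnergy (Metric.ball 0 1) φ →
      IsAngularPairing (Metric.ball 0 1) g φ
        (∫ z in Metric.ball 0 1, curlDot (fun z => radialCutoff s t z * φ z) v z) := fun φ hφ =>
    hv.isAngularPairing_cutoff hKs isCompact_empty (empty_subset _) (hφ.mono sdiff_subset) hs0 hst ht
  have hone : IsSmoothFiniteEnergy (Metric.ball 0 1) (fun _ : ℂ => (1 : ℝ)) :=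
    IsSmoothFiniteEnergy.const 1
  -- The compatibility condition of the Neumann problem: `g` contributes `2π` times its degree, the
  -- logarithms contribute `2π ∑ d_j`.
  have hflux : ∫ z in Metric.ball 0 1, fieldDot (neumannField d α v) (radialCutoff s t) z = 0 := by
    have h1 := integral_fieldDot_neumannField (d := d) hv hKs hαs hs0 hst ht hone
    simp only [hlog _ hone] at h1
    rw [(hpair _ hone).unique hone.nearBoundary hg] at h1
    simp only [mul_one] at h1
    rw [h1, sub_eq_zero, Int.cast_sum, Finset.mul_sum]
    refine Finset.sum_congr rfl fun j _ => ?_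
    simp [gradDot, partialX, partialY]
    ring
  -- Against interior tests the field has no divergence. The phase part is closed away from `K`, and
  -- each logarithm sees only the value at `α_j`, where the cutoff vanishes.
  have htest : ∀ ψ : ℂ → ℝ, ContDiff ℝ ∞ ψ → HasCompactSupport ψ → tsupport ψ ⊆ Metric.ball 0 1 →
      ∫ z in Metric.ball 0 1, fieldDot (neumannField d α v)
        (fun z => radialCutoff s t z * ψ z) z = 0 := by
    intro ψ hψ hψc hψD
    have hψE := isSmoothFiniteEnergy_test hψ hψc
    rw [integral_fieldDot_neumannField hv hKs hαs hs0 hst ht hψE]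
    have hχ : ContDiff ℝ ∞ (fun z => radialCutoff s t z * ψ z) :=
      (contDiff_radialCutoff s t).mul hψ
    have hχc : HasCompactSupport (fun z => radialCutoff s t z * ψ z) := hψc.mul_left
    have hχD : tsupport (fun z => radialCutoff s t z * ψ z) ⊆ Metric.ball 0 1 :=
      (tsupport_mul_subset_right).trans hψD
    have hout : ∀ z ∉ Metric.ball (0 : ℂ) 1, ∀ᶠ y in 𝓝 z, radialCutoff s t y * ψ y = 0 :=
      fun z hz => notMem_tsupport_iff_eventuallyEq.1 fun h => hz (hχD h)
    rw [setIntegral_eq_integral_of_forall_compl_eq_zero fun z hz =>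
        curlDot_eq_zero_of_eventually v (hout z hz),
      integral_curlDot_eq_zero (hDo.sdiff hv.isCompact.isClosed) hχ hχc (fun z hz => ⟨hχD hz,
        fun hzK => notMem_tsupport_iff_eventuallyEq.2
          (cutoff_eventually_eq_zero ψ hs0 hst (hKs hzK)) hz⟩) hv.energy.smooth hv.norm_eq_one,
      zero_sub, neg_eq_zero]
    refine Finset.sum_eq_zero fun j _ => ?_
    rw [setIntegral_eq_integral_of_forall_compl_eq_zero fun z hz =>
        gradDot_eq_zero_of_eventually (hout z hz), integral_gradDot_log hχ hχc,
      radialCutoff_eq_zero hs0 hst (mem_ball_zero_iff.1 (hαs j)).le]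
    simp
  obtain ⟨S, hS, hSφ⟩ := exists_weak_solution (V := neumannField d α v) hs2.le hρs hst ht
    (continuousOn_neumannField hαρ' (hv.energy.smooth.mono hsub))
    (memLp_neumannField hαρ' (hv.energy.mono hsub) fun z hz => hv.norm_eq_one z (hsub hz)) hflux htest
  refine ⟨S, hS, fun φ hφ => ?_⟩
  convert hpair φ hφ using 1
  rw [integral_gradDot_withLogs_disc hα hS hφ, hSφ φ hφ,
    integral_fieldDot_neumannField hv hKs hαs hs0 hst ht hφ]
  simp only [hlog φ hφ, mul_add, Finset.sum_add_distrib, Finset.mul_sum]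
  simp only [mul_left_comm (2 * Real.pi)]
  abel

/-- The trace of the potential is the sum of the radial limits of `S` and the logarithms, which are
continuous near the circle. Both are integrable on it, and a constant corrects the mean. -/
lemma exists_isNeumannRegularPart_disc (hα : ∀ j, α j ∈ Metric.ball (0 : ℂ) 1)
    (hg : HasBoundaryDegree (Metric.ball 0 1) g (∑ j, d j)) :
    ∃ R, IsNeumannRegularPart (Metric.ball 0 1) d α g R := by
  have hDo : IsOpen (Metric.ball (0 : ℂ) 1) := Metric.isOpen_ball
  obtain ⟨S, hS, hweak⟩ := exists_neumann_weak_solution hα hg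
  have hcont : ∀ x ∈ frontier (Metric.ball (0 : ℂ) 1),
      ContinuousAt (fun x => ∑ j, (d j : ℝ) * Real.log ‖x - α j‖) x := fun x hx => by
    refine tendsto_finsetSum _ fun j _ => ContinuousAt.mul continuousAt_const
      (ContinuousAt.log (by fun_prop) ?_)
    rw [norm_ne_zero_iff, sub_ne_zero]
    rintro rfl
    rw [mem_frontier_disc] at hx
    exact absurd (mem_ball_zero_iff.1 (hα j)) hx.not_lt
  have htr := (hasTrace_radialLimit hS).add (hasTrace_self hcont)
    (hS.smooth.continuousOn.aestronglyMeasurable hDo.measurableSet)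
  have hfr : IsCompact (frontier (Metric.ball (0 : ℂ) 1)) := by
    rw [frontier_ball _ one_ne_zero]
    exact isCompact_sphere _ _
  have : IsFiniteMeasure (boundaryMeasure (Metric.ball (0 : ℂ) 1)) :=
    ⟨boundaryMeasure_disc_univ_lt_top⟩
  have hint : Integrable (fun x => ∑ j, (d j : ℝ) * Real.log ‖x - α j‖)
      (boundaryMeasure (Metric.ball (0 : ℂ) 1)) := by
    have hc : ContinuousOn (fun x => ∑ j, (d j : ℝ) * Real.log ‖x - α j‖)
        (frontier (Metric.ball (0 : ℂ) 1)) := fun x hx => (hcont x hx).continuousWithinAt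
    obtain ⟨C, hC⟩ := hfr.exists_bound_of_continuousOn hc
    exact Integrable.of_bound (hc.aestronglyMeasurable measurableSet_frontier') C
      (ae_restrict_of_forall_mem measurableSet_frontier' hC)
  obtain ⟨c, hc1, hc2⟩ := exists_integral_add_const_eq_zero boundaryMeasure_disc_univ_lt_top
    ((integrable_radialLimit hS).add hint)
  have heq : ∀ z, withLogs d α (fun z => S z + c) z = withLogs d α S z + c := fun z => by
    simp only [withLogs]
    ring
  refine ⟨fun z => S z + c, hS.add hDo (IsSmoothFiniteEnergy.const c), fun φ hφ => ?_, _, ?_,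
    hc1, hc2⟩
  · rw [funext heq]
    simpa only [gradDot_add_const] using hweak φ hφ
  · rw [funext heq]
    exact htr.add_const c

theorem existsUnique_isRenormalizedEnergy_disc (hα : ∀ j, α j ∈ Metric.ball (0 : ℂ) 1)
    (hg : HasBoundaryDegree (Metric.ball 0 1) g (∑ j, d j)) :
    ∃! w, IsRenormalizedEnergy (Metric.ball 0 1) d α g w := by
  obtain ⟨R, hR⟩ := exists_isNeumannRegularPart_disc hα hg
  obtain ⟨K, -, v, -, hv, -⟩ := id hg
  obtain ⟨M, hM, hMD, hRM⟩ := isFiniteEnergyNearBoundary_withLogs Metric.isOpen_ball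
    Metric.isBounded_ball d hα hR.energy
  obtain ⟨s, hs0, hs1, hNs⟩ := exists_subset_ball_of_isCompact (hv.isCompact.union hM)
    (union_subset hv.subset hMD)
  obtain ⟨hKs, hMs⟩ := union_subset_iff.1 hNs
  obtain ⟨t, hst, ht⟩ := exists_between hs1
  exact ⟨_, ⟨R, _, hR, hv.isAngularPairing_cutoff hKs hM hMs hRM hs0 hst ht, rfl⟩,
    fun w hw => hw.unique_disc hα hg ⟨R, _, hR,
      hv.isAngularPairing_cutoff hKs hM hMs hRM hs0 hst ht, rfl⟩⟩

end

/-! ### Transfer of the energies from the disc to `Ω` -/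

lemma eq_add_of_existsUnique {P Q : ℝ → Prop} {c : ℝ} (hQ : ∃! w, Q w)
    (hPQ : ∀ w, P w → Q (w - c)) (hQP : ∀ w, Q w → P (w + c)) :
    (∃! w, P w) ∧ Classical.epsilon P = Classical.epsilon Q + c := by
  obtain ⟨w, hw, hu⟩ := hQ
  have hu' : ∀ y, P y → y = w + c := fun y hy => by
    have := hu _ (hPQ y hy)
    linarith
  refine ⟨⟨w + c, hQP w hw, hu'⟩, ?_⟩
  -- The choice operator returns the only admissible value on each side, so the shift between
  -- predicates becomes a shift between energies.
  rw [hu' _ (Classical.epsilon_spec ⟨_, hQP w hw⟩), hu _ (Classical.epsilon_spec ⟨_, hw⟩)]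

lemma IsRenormalizedEnergy.congr_boundary {U : Set ℂ} {k : ℕ} {d : Fin k → ℤ} {a : Fin k → ℂ}
    {g g' : ℂ → ℂ} {w : ℝ} (h : IsRenormalizedEnergy U d a g w) (hg : EqOn g g' (frontier U)) :
    IsRenormalizedEnergy U d a g' w := by
  obtain ⟨R, t, hR, ht, hw⟩ := h
  exact ⟨R, t, { hR with
    weak_equation := fun φ hφ => (hR.weak_equation φ hφ).congr_boundary hg },
    ht.congr_boundary hg, hw⟩

/-- Transformation of the renormalized energies under a conformal representation `f : 𝔻 → Ω`. The
existence and uniqueness clauses say that the four energies are well defined. -/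
theorem mainTheorem10 (β : ℝ) (hβ0 : 0 < β) (hβ1 : β < 1)
    (Ω : Set ℂ) (hΩ : IsHolderDomain β Ω)
    (f : ℂ → ℂ) (hf : IsConformalRep f Ω)
    (k : ℕ) (d : Fin k → ℤ)
    (α : Fin k → ℂ) (hα : ∀ j, α j ∈ Metric.ball (0 : ℂ) 1) (hα_inj : Function.Injective α) :
    (∀ g : ℂ → ℂ, IsHalfSobolevCircle Ω g → HasBoundaryDegree Ω g (∑ j, d j) →
      (∃! w, IsRenormalizedEnergy Ω d (fun j => f (α j)) g w) ∧
      (∃! w, IsRenormalizedEnergy (Metric.ball 0 1) d α (g ∘ discExtension f) w) ∧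
      renormalizedEnergy Ω d (fun j => f (α j)) g =
        renormalizedEnergy (Metric.ball 0 1) d α (g ∘ discExtension f) +
          Real.pi * ∑ j, (d j : ℝ) ^ 2 * Real.log ‖deriv f (α j)‖) ∧
    ((∃! w, IsRenormalizedEnergyHat Ω d (fun j => f (α j)) w) ∧
      (∃! w, IsRenormalizedEnergyHat (Metric.ball 0 1) d α w) ∧
      renormalizedEnergyHat Ω d (fun j => f (α j)) =
        renormalizedEnergyHat (Metric.ball 0 1) d α +
          Real.pi * ∑ j, (d j : ℝ) ^ 2 * Real.log ‖deriv f (α j)‖) := by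
  obtain ⟨F, K, h⟩ := hf.exists_isBilipschitzPair hβ0 hβ1 hΩ
  have hbD : Bornology.IsBounded (Metric.ball (0 : ℂ) 1) := Metric.isBounded_ball
  have hdD := hasBoundaryDensity_disc
  have hdΩ : HasBoundaryDensity Ω := h.hasBoundaryDensity hdD
  have hfinD := boundaryMeasure_disc_univ_lt_top
  have hfinΩ : boundaryMeasure Ω univ < ⊤ := h.symm.boundaryMeasure_univ_lt_top hfinD
  have haΩ : ∀ j, f (α j) ∈ Ω := fun j => h.mapsTo_left (hα j)
  have haf : ∀ j, F (f (α j)) = α j := fun j => h.left_inv _ (hα j)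
  have ha_inj : Function.Injective fun j => f (α j) := fun i j hij =>
    hα_inj (by rw [← haf i, ← haf j]; exact congrArg F hij)
  -- The derivative of the inverse at the image point is `1 / f'(α_j)`, so transport by the inverse
  -- map undoes the correction term.
  have hlog : ∀ j, Real.log ‖deriv F (f (α j))‖ = -Real.log ‖deriv f (α j)‖ := fun j => by
    rw [eq_inv_of_mul_eq_one_left (h.deriv_mul_deriv (hα j)), norm_inv, Real.log_inv]
  have hsum : Real.pi * ∑ j, (d j : ℝ) ^ 2 * Real.log ‖deriv F (f (α j))‖ =
      -(Real.pi * ∑ j, (d j : ℝ) ^ 2 * Real.log ‖deriv f (α j)‖) := by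
    simp only [hlog, mul_neg, Finset.sum_neg_distrib]
  refine ⟨fun g _ hg => ?_, ?_⟩
  · have hgD : HasBoundaryDegree (Metric.ball 0 1) (g ∘ discExtension f) (∑ j, d j) :=
      h.isAngularPairing_comp hdD hg
    have hadd : PairingAddConst (Metric.ball 0 1) (g ∘ discExtension f)
        (2 * Real.pi * ∑ j, (d j : ℝ)) := by
      have := pairingAddConst_of_pairing_one hgD
      rwa [Int.cast_sum] at this
    have hgg : EqOn ((g ∘ discExtension f) ∘ extendFrom Ω F) g (frontier Ω) :=
      h.comp_extend_comp_extend g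
    -- Additivity of the bracket in constants on `Ω` is pulled back from the disc. The datum `g ∘ f
    -- ∘ F` agrees with `g` only on the boundary of `Ω`, which is all that the bracket sees.
    have haddΩ : PairingAddConst Ω ((g ∘ discExtension f) ∘ extendFrom Ω F)
        (2 * Real.pi * ∑ j, (d j : ℝ)) := fun φ t c hφ ht =>
      (h.pairingAddConst hdD hdΩ hadd φ t c hφ (ht.congr_boundary hgg)).congr_boundary hgg.symm
    have hex := existsUnique_isRenormalizedEnergy_disc hα hgD
    obtain ⟨h1, h2⟩ := eq_add_of_existsUnique hex
      (fun w hw => h.isRenormalizedEnergy_transport d hdD hbD hΩ.isBounded hfinD hα hα_inj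
        (fun _ => rfl) hadd hw)
      (fun w hw => by
        have := h.symm.isRenormalizedEnergy_transport d hdΩ hΩ.isBounded hbD hfinΩ haΩ ha_inj haf
          (g := g ∘ discExtension f) haddΩ hw
        rw [hsum, sub_neg_eq_add] at this
        exact this.congr_boundary hgg)
    exact ⟨h1, hex, h2⟩
  · have hex := existsUnique_isRenormalizedEnergyHat_disc (d := d) hα
    obtain ⟨h1, h2⟩ := eq_add_of_existsUnique hex
      (fun w hw => h.isRenormalizedEnergyHat_transport d hα hα_inj (fun _ => rfl) hw)
      (fun w hw => by
        have := h.symm.isRenormalizedEnergyHat_transport d haΩ ha_inj haf hw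
        rwa [hsum, sub_neg_eq_add] at this)
    exact ⟨h1, hex, h2⟩
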